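/- **Theorem (Global inhomogeneous estimates).** *Setting.* Let $n\in\mathbb N$, $a\ge 1$, $D=(-\Delta)^{1/2}$ on $\mathbb R^n$, and $\sigma=\frac{n-1}{2}$ if $a=1$, $\sigma=\frac n2$ if $a\neq 1$; put $r=\frac{a\sigma-n}{2}$. Fix a smooth, radial, radially decreasing $\psi:\mathbb R^n\to\mathbb R$ with $\psi=1$ for $|x|\le1$ and $\psi=0$ for $|x|\ge2$, let $\chi(x)=\psi(x)-\psi(2x)$, and for $R>0$ let $P_R$ be the Fourier multiplier $(P_Rf)^{\wedge}(\xi)=\chi(\xi/R)\hat f(\xi)$ on $\mathcal S'(\mathbb R^n)$, where $\hat f(\xi)=\int f(x)e^{-ix\xi}dx$. The letter $N$ denotes dyadic numbers $N\in2^{\mathbb Z}$. *Range spaces.* Let $(Z_p)_{p\in[1,\infty]}$ be a family of Banach spaces of tempered distributions on $\mathbb R^n$ with the compatibility property: $Z_p\hookrightarrow\mathcal S'(\mathbb R^n)$ continuously; $\|P_R\|_{Z_p\to Z_p}\le C$ uniformly in $R>0$ and $p\in[1,\infty]$; and there are a separable Hilbert space $H$ and isometric identifications $Z_p=L^p((0,\infty),r^{n-1}dr;H)$,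 which are the same for all $p$ (elements of $Z_p$ and $Z_{\bar p}$ agree in $\mathcal S'$ if and only if the corresponding $H$-valued functions agree a.e.), under which $f(\lambda\,\cdot)$ corresponds to $g(\lambda\,\cdot)$ when $f$ corresponds to $g$ ($\lambda>0$), and such that $Z_2\subset L^2(\mathbb R^n)$ with $\|f\|_{L^2(\mathbb R^n)}=c\,\|f\|_{Z_2}$ for a constant $c>0$. Define $$\|f\|_{Z^s_p}=\Big(\sum_N N^{2s}\|P_Nf\|_{Z_p}^2\Big)^{1/2},\qquad \|F\|_{Z^s_{p,q}}=\Big(\sum_N N^{2s}\|P_NF\|_{L^q_tZ_p}^2\Big)^{1/2}.$$ *Hypotheses on the propagator.* Suppose that $e^{itD^a}$ admits generalized homogeneous Strichartz estimates with range spaces $(Z_p)$ and extended decay parameter $\sigma'$: $1\le\sigma<\sigma'$, and whenever $q,p\ge2$, $\frac1q=\tau(\frac12-\frac1p)$ for some $\tau\in(\sigma,\sigma')$, and $s=-\frac n2+\frac np+\frac aq$, there is $C$ with $$\|P_Ne^{itD^a}u_0\|_{L^q_tZ_p}\le C\,N^{-s}\|u_0\|_{L^2}\qquad\text{for all } N\text{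 and all }u_0\in Z_2 .$$ Call $F$ a *forcing term* if $F\in L^1(\mathbb R;L^2(\mathbb R^n))$ and $F(t)\in Z_2$ for almost every $t$. Suppose moreover that the generalized dispersive estimate holds: for every $\kappa\ge1$ there is $C$ such that for all closed intervals $I,J$ of unit length with $\kappa^{-1}\le\mathrm{dist}(I,J)\le\kappa$, all $N$, and all forcing terms $F$ supported in $I$, $$\Big\|P_N\int_{-\infty}^te^{i(t-\tau)D^a}F(\tau)\,d\tau\Big\|_{L^\infty_t(J;Z_\infty)}\le C\,N^{n-a\sigma}\|F\|_{L^1_t(I;Z_1)} .$$ *Exponents.* Let $1\le q,\tilde q,p,\tilde p\le\infty$ and $s\in\mathbb R$ satisfy the scaling condition $$\frac1q+\frac1{\tilde q}-\frac na\Big(1-\frac1p-\frac1{\tilde p}\Big)-\frac{2s}a=0,$$ let $p',q',\tilde p',\tilde q'$ denote conjugate exponents, and for $\sigma_1,\sigma_2\in\mathbb R$ put $$\mu=\frac{\frac a2\left(\frac{\sigma_1}2+\frac{\sigma_2}2-\sigma\right)}{s-r+\frac12\left(\frac{a\sigma_1-n}{p}+\frac{a\sigma_2-n}{\tilde p}\right)}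 .$$ Consider the estimates, with a constant independent of $F$, for all forcing terms $F$: $$\text{(I)}\quad\Big\|\int_{-\infty}^te^{i(t-\tau)D^a}F(\tau)d\tau\Big\|_{L^q_tZ^s_p}\le C\,\|F\|_{L^{\tilde q'}_tZ^{-s}_{\tilde p'}},\qquad\text{(II)}\quad\Big\|\int_{-\infty}^te^{i(t-\tau)D^a}F(\tau)d\tau\Big\|_{Z^s_{p,q}}\le C\,\|F\|_{Z^{-s}_{\tilde p',\tilde q'}} .$$ *Non-sharp case.* If $\frac1q+\frac1{\tilde q}<1$ and $q,\tilde q<\infty$, then (I) and (II) hold provided that there are $\sigma_1,\sigma_2\in(\sigma,\sigma')$ with $$1\le\mu<\infty,\qquad \frac{\sigma_1-1}{\sigma_1}\frac p2\le\mu\le\frac p2,\qquad\frac{\sigma_2-1}{\sigma_2}\frac{\tilde p}2\le\mu\le\frac{\tilde p}2,\qquad\frac{\sigma_1/2}{\frac1q+\frac{\sigma_1}p}<\mu,\qquad\frac{\sigma_2/2}{\frac1{\tilde q}+\frac{\sigma_2}{\tilde p}}<\mu .$$ *Sharp case.* If $\frac1q+\frac1{\tilde q}=1$ and $2<p,\tilde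 p<\infty$, then (II) holds provided that there are $\sigma_1,\sigma_2\in(\sigma,\sigma')$ with $$1<\mu<\infty,\qquad \frac{\sigma_1-1}{\sigma_1}\frac p2<\mu<\frac p2,\qquad\frac{\sigma_2-1}{\sigma_2}\frac{\tilde p}2<\mu<\frac{\tilde p}2,\qquad\frac{\sigma_1/2}{\frac1q+\frac{\sigma_1}p}<\mu,\qquad\frac{\sigma_2/2}{\frac1{\tilde q}+\frac{\sigma_2}{\tilde p}}<\mu,\qquad\frac1p\le\frac1q,\qquad\frac1{\tilde p}\le\frac1{\tilde q} .$$ -/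

import Mathlib

open MeasureTheory FourierTransform SchwartzMap
open scoped ENNReal NNReal

noncomputable section

/-- Euclidean space `ℝⁿ`. -/
abbrev Sp (n : ℕ) : Type := EuclideanSpace ℝ (Fin n)

/-- The Hilbert space `L²(ℝⁿ; ℂ)`. -/
abbrev L2 (n : ℕ) : Type := Lp (α := Sp n) ℂ 2

/-- The tempered distribution given by an `L²` function. -/
def toDist {n : ℕ} (u : L2 n) : 𝓢'(Sp n, ℂ) := Lp.toTemperedDistribution u

/-- The measure `r ^ (n - 1) dr` on `(0, ∞)`. -/
abbrev radialMeasure (n : ℕ) : Measure (Set.Ioi (0 : ℝ)) := Measure.volumeIoiPow (n - 1)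

/-! ### Frequency localization

Mathlib normalizes the Fourier transform as `∫ f(x) exp(-2πi x·ξ) dx`. The frequency variable of
the convention `∫ f(x) exp(-i x·ξ) dx` is therefore `2π ξ` below. -/

/-- A smooth, radial, radially decreasing function `ψ` on `ℝⁿ` with `ψ = 1` for `|x| ≤ 1` and
`ψ = 0` for `|x| ≥ 2`. Radial symmetry is the case `‖x‖ = ‖y‖` of `radial_anti`. -/
structure Cutoff (n : ℕ) where
  toFun : Sp n → ℝ
  smooth : ContDiff ℝ (⊤ : ℕ∞) toFun
  radial_anti : ∀ x y, ‖x‖ ≤ ‖y‖ → toFun y ≤ toFun x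
  eq_one : ∀ x, ‖x‖ ≤ 1 → toFun x = 1
  eq_zero : ∀ x, 2 ≤ ‖x‖ → toFun x = 0

/-- The bump function `χ(x) = ψ(x) - ψ(2x)`. -/
def Cutoff.bump {n : ℕ} (ψ : Cutoff n) (x : Sp n) : ℝ :=
  ψ.toFun x - ψ.toFun ((2 : ℝ) • x)

/-- The frequency localization `P_R` on tempered distributions: multiplication of the Fourier
transform by `χ(ξ / R)`. -/
def freqLoc {n : ℕ} (ψ : Cutoff n) (R : ℝ) : 𝓢'(Sp n, ℂ) →L[ℂ] 𝓢'(Sp n, ℂ) :=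
  TemperedDistribution.fourierMultiplierCLM ℂ
    (fun ξ : Sp n => ((ψ.bump ((2 * Real.pi / R) • ξ) : ℝ) : ℂ))

/-- The dyadic number `2 ^ j`. -/
def dyadic (j : ℤ) : ℝ := (2 : ℝ) ^ j

/-! ### The propagator and the retarded Duhamel integral on `L²` -/

/-- The symbol `exp(i t |ξ| ^ a)`. -/
def propagatorSymbol (n : ℕ) (a t : ℝ) (ξ : Sp n) : ℂ :=
  Complex.exp (Complex.I * ((t * (2 * Real.pi * ‖ξ‖) ^ a : ℝ) : ℂ))

theorem propagatorSymbol_memLp (n : ℕ) (a t : ℝ) :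
    MemLp (propagatorSymbol n a t) ∞ (volume : Measure (Sp n)) := by
  refine memLp_top_of_bound ?_ 1 (Filter.Eventually.of_forall fun ξ => ?_)
  · apply Measurable.aestronglyMeasurable
    unfold propagatorSymbol
    fun_prop
  · rw [propagatorSymbol, mul_comm, Complex.norm_exp_ofReal_mul_I]

/-- The unitary group `exp(i t D ^ a)` on `L²(ℝⁿ)`, where `D = (-Δ) ^ (1/2)`. -/
def propagator {n : ℕ} (a t : ℝ) (f : L2 n) : L2 n :=
  𝓕⁻ ((propagatorSymbol_memLp n a t).toLp _ • 𝓕 f : L2 n)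

/-- The retarded Duhamel integral `∫_{-∞}^t exp(i (t - τ) D ^ a) F(τ) dτ`. -/
def duhamel {n : ℕ} (a : ℝ) (F : ℝ → L2 n) (t : ℝ) : L2 n :=
  ∫ τ in Set.Iic t, propagator a (t - τ) (F τ)

/-! ### Range spaces -/

/-- The dilation `f ↦ f(lam ·)` of tempered distributions,
`⟨f(lam ·), φ⟩ = lam ^ (-n) ⟨f, φ(· / lam)⟩`. -/
def dilate {n : ℕ} (lam : ℝ) (hlam : 0 < lam) (T : 𝓢'(Sp n, ℂ)) : 𝓢'(Sp n, ℂ) :=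
  ((lam : ℂ) ^ n)⁻¹ • PointwiseConvergenceCLM.precomp ℂ
    (SchwartzMap.compCLMOfContinuousLinearEquiv ℂ
      (ContinuousLinearEquiv.smulLeft (M₁ := Sp n) (Units.mk0 lam hlam.ne')⁻¹)) T

/-- A family `(Z_p)`, `p ∈ [1, ∞]`, of Banach spaces of tempered distributions on `ℝⁿ` with the
compatibility property. The space `Z_p` is the image of `Lᵖ((0, ∞), r ^ (n - 1) dr; H)` under the
continuous injection `emb p`, with the norm carried over. -/
structure RangeSpaces (n : ℕ) (ψ : Cutoff n) (H : Type*) [NormedAddCommGroup H]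
    [InnerProductSpace ℂ H] where
  /-- the continuous embedding `Z_p ↪ 𝓢'` -/
  emb : (p : ℝ≥0∞) → [Fact (1 ≤ p)] → Lp H p (radialMeasure n) →L[ℂ] 𝓢'(Sp n, ℂ)
  /-- each embedding is injective, and the identifications for different `p` are the same one -/
  emb_eq_iff : ∀ (p q : ℝ≥0∞) [Fact (1 ≤ p)] [Fact (1 ≤ q)]
    (f : Lp H p (radialMeasure n)) (g : Lp H q (radialMeasure n)),
    emb p f = emb q g ↔ (f : Set.Ioi (0 : ℝ) →ₘ[radialMeasure n] H) = g
  /-- the variable in `(0, ∞)` is the radial one: dilations of `ℝⁿ` act as dilations of it -/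
  emb_dilate : ∀ (p : ℝ≥0∞) [Fact (1 ≤ p)] (lam : ℝ) (hlam : 0 < lam)
    (f g : Lp H p (radialMeasure n)),
    (∀ᵐ r ∂(radialMeasure n), g r = f ⟨lam * r.1, mul_pos hlam r.2⟩) →
    emb p g = dilate lam hlam (emb p f)
  /-- `Z_2` is a space of `L²` functions and carries the norm of `L²(ℝⁿ)`, up to a constant
  factor; so the duality of `Z_p` and `Z_{p'}` is the one of the pairing of `L²(ℝⁿ)` -/
  emb_two : ∃ c : ℝ, 0 < c ∧ ∀ f : Lp H 2 (radialMeasure n), ∃ u : L2 n,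
    emb 2 f = toDist u ∧ ‖u‖ = c * ‖f‖
  /-- the operators `P_R` are bounded on `Z_p` uniformly in `R` and `p` -/
  freqLoc_bound : ∃ C : ℝ, ∀ R : ℝ, 0 < R → ∀ (p : ℝ≥0∞) [Fact (1 ≤ p)]
    (f : Lp H p (radialMeasure n)), ∃ g : Lp H p (radialMeasure n),
    emb p g = freqLoc ψ R (emb p f) ∧ ‖g‖ ≤ C * ‖f‖

section Norms

variable {n : ℕ} {ψ : Cutoff n} {H : Type*} [NormedAddCommGroup H] [InnerProductSpace ℂ H]

/-- The norm of `Z_p` on tempered distributions; it is `∞` outside of `Z_p`. -/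
def RangeSpaces.zNorm (Z : RangeSpaces n ψ H) (p : ℝ≥0∞) [Fact (1 ≤ p)]
    (T : 𝓢'(Sp n, ℂ)) : ℝ≥0∞ :=
  ⨅ (f : Lp H p (radialMeasure n)) (_ : Z.emb p f = T), ‖f‖ₑ

/-- The Besov-like norm of `Z^s_p`: `(∑_N N ^ (2 s) ‖P_N T‖²_{Z_p}) ^ (1/2)`. -/
def RangeSpaces.zsNorm (Z : RangeSpaces n ψ H) (s : ℝ) (p : ℝ≥0∞) [Fact (1 ≤ p)]
    (T : 𝓢'(Sp n, ℂ)) : ℝ≥0∞ :=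
  (∑' j : ℤ, ENNReal.ofReal (dyadic j ^ (2 * s)) *
    Z.zNorm p (freqLoc ψ (dyadic j) T) ^ 2) ^ (1 / 2 : ℝ)

/-- The norm of `L_t^q Z_p`. -/
def RangeSpaces.tzNorm (Z : RangeSpaces n ψ H) (q p : ℝ≥0∞) [Fact (1 ≤ p)]
    (F : ℝ → 𝓢'(Sp n, ℂ)) : ℝ≥0∞ :=
  eLpNorm (fun t => Z.zNorm p (F t)) q volume

/-- The norm of `L_t^q Z^s_p`. -/
def RangeSpaces.tzsNorm (Z : RangeSpaces n ψ H) (s : ℝ) (q p : ℝ≥0∞) [Fact (1 ≤ p)]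
    (F : ℝ → L2 n) : ℝ≥0∞ :=
  eLpNorm (fun t => Z.zsNorm s p (toDist (F t))) q volume

/-- The norm of `Z^s_{p,q}`: `(∑_N N ^ (2 s) ‖P_N F‖²_{L_t^q Z_p}) ^ (1/2)`. -/
def RangeSpaces.zspqNorm (Z : RangeSpaces n ψ H) (s : ℝ) (p q : ℝ≥0∞) [Fact (1 ≤ p)]
    (F : ℝ → L2 n) : ℝ≥0∞ :=
  (∑' j : ℤ, ENNReal.ofReal (dyadic j ^ (2 * s)) *
    Z.tzNorm q p (fun t => freqLoc ψ (dyadic j) (toDist (F t))) ^ 2) ^ (1 / 2 : ℝ)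

/-- The function `f ∈ L²(ℝⁿ)` belongs to `Z_2`. -/
def RangeSpaces.MemTwo (Z : RangeSpaces n ψ H) (f : L2 n) : Prop :=
  ∃ g : Lp H 2 (radialMeasure n), Z.emb 2 g = toDist f

/-- The forcing terms: `F ∈ L¹(ℝ; L²(ℝⁿ))` with values in `Z_2`. -/
def RangeSpaces.IsSource (Z : RangeSpaces n ψ H) (F : ℝ → L2 n) : Prop :=
  Integrable F ∧ ∀ᵐ t, Z.MemTwo (F t)

end Norms

/-! ### Strichartz estimates, dispersive estimate and exponents -/

/-- The decay parameter `σ(a, n)` of `exp(i t D ^ a)`. -/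
def decayParameter (a : ℝ) (n : ℕ) : ℝ :=
  open Classical in if a = 1 then ((n : ℝ) - 1) / 2 else (n : ℝ) / 2

/-- The reciprocal `1 / p` as a real number, with `1 / ∞ = 0`. -/
def recip (p : ℝ≥0∞) : ℝ := (p⁻¹).toReal

section Estimates

variable {n : ℕ} {ψ : Cutoff n} {H : Type*} [NormedAddCommGroup H] [InnerProductSpace ℂ H]

/-- Generalized homogeneous Strichartz estimates with extended decay parameter `σ'`:
`1 ≤ σ < σ'` and `‖P_N exp(i t D ^ a) u₀‖_{L_t^q Z_p} ≲ N ^ (-s) ‖u₀‖_{L²}` for all dyadic `N` and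
all `u₀` in `Z_2`, whenever `1/q = τ (1/2 - 1/p)` with `τ ∈ (σ, σ')`, `q, p ≥ 2` and
`s = -n/2 + n/p + a/q`. -/
def AdmitsStrichartz (Z : RangeSpaces n ψ H) (a σ' : ℝ) : Prop :=
  1 ≤ decayParameter a n ∧ decayParameter a n < σ' ∧
  ∀ (p q : ℝ≥0∞) [Fact (1 ≤ p)], 2 ≤ p → 2 ≤ q →
    ∀ τ ∈ Set.Ioo (decayParameter a n) σ', recip q = τ * (1 / 2 - recip p) →
    ∃ C : ℝ≥0, ∀ (j : ℤ) (u₀ : L2 n), Z.MemTwo u₀ →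
      Z.tzNorm q p (fun t => freqLoc ψ (dyadic j) (toDist (propagator a t u₀))) ≤
        C * ENNReal.ofReal (dyadic j ^ (-(-(n : ℝ) / 2 + n * recip p + a * recip q))) * ‖u₀‖ₑ

/-- The generalized dispersive estimate: for intervals `I = [b, b + 1]` and `J = [c, c + 1]` with
distance `|b - c| - 1` comparable to `1` and `F` supported in `I`,
`‖P_N ∫_{-∞}^t exp(i (t - τ) D ^ a) F(τ) dτ‖_{L^∞(J; Z_∞)} ≲ N ^ (n - a σ) ‖F‖_{L^1(I; Z_1)}`. -/
def AdmitsDispersive (Z : RangeSpaces n ψ H) (a : ℝ) : Prop :=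
  ∀ κ : ℝ, 1 ≤ κ → ∃ C : ℝ≥0, ∀ b c : ℝ, κ⁻¹ ≤ |b - c| - 1 → |b - c| - 1 ≤ κ →
    ∀ (j : ℤ) (F : ℝ → L2 n), Z.IsSource F → (∀ t ∉ Set.Icc b (b + 1), F t = 0) →
      eLpNorm (fun t => Z.zNorm ∞ (freqLoc ψ (dyadic j) (toDist (duhamel a F t))))
          ∞ (volume.restrict (Set.Icc c (c + 1))) ≤
        C * ENNReal.ofReal (dyadic j ^ ((n : ℝ) - a * decayParameter a n)) *
          eLpNorm (fun t => Z.zNorm 1 (toDist (F t)))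
            1 (volume.restrict (Set.Icc b (b + 1)))

/-- The estimate of the Duhamel integral from `L_t^{qt'} Z^{-s}_{pt'}` to `L_t^q Z^s_p`, where
`pt'`, `qt'` stand for the conjugate exponents of `pt`, `qt`. -/
def TimeEstimate (Z : RangeSpaces n ψ H) (a s : ℝ) (q p qt' pt' : ℝ≥0∞)
    [Fact (1 ≤ p)] [Fact (1 ≤ pt')] : Prop :=
  ∃ C : ℝ≥0, ∀ F : ℝ → L2 n, Z.IsSource F →
    Z.tzsNorm s q p (duhamel a F) ≤ C * Z.tzsNorm (-s) qt' pt' F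

/-- The estimate of the Duhamel integral from `Z^{-s}_{pt', qt'}` to `Z^s_{p,q}`. -/
def FreqEstimate (Z : RangeSpaces n ψ H) (a s : ℝ) (q p qt' pt' : ℝ≥0∞)
    [Fact (1 ≤ p)] [Fact (1 ≤ pt')] : Prop :=
  ∃ C : ℝ≥0, ∀ F : ℝ → L2 n, Z.IsSource F →
    Z.zspqNorm s p q (duhamel a F) ≤ C * Z.zspqNorm (-s) pt' qt' F

end Estimates

/-- The scaling function
`β_a = 1/q + 1/qt - (n/a) (1 - 1/p - 1/pt) - 2 s / a`. -/
def scalingBeta (n : ℕ) (a : ℝ) (q qt p pt : ℝ≥0∞) (s : ℝ) : ℝ :=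
  recip q + recip qt - n / a * (1 - recip p - recip pt) - 2 * s / a

/-- The quantity `μ`, with `r = (a σ - n) / 2`. -/
def muParam (n : ℕ) (a : ℝ) (p pt : ℝ≥0∞) (s σ₁ σ₂ : ℝ) : ℝ :=
  (a / 2 * (σ₁ / 2 + σ₂ / 2 - decayParameter a n)) /
    (s - (a * decayParameter a n - n) / 2 +
      ((a * σ₁ - n) * recip p + (a * σ₂ - n) * recip pt) / 2)

/-- The inequalities on `μ` in the non-sharp case, with the conventions of `[0, ∞]` for `p = ∞`
and `q = ∞`. Since `1 ≤ μ` and `x / 0 = 0`, the denominator of `μ` is positive. -/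
def NonsharpCondition (n : ℕ) (a : ℝ) (q qt p pt : ℝ≥0∞) (s σ₁ σ₂ : ℝ) : Prop :=
  let μ : ℝ := muParam n a p pt s σ₁ σ₂
  1 ≤ μ ∧
  ENNReal.ofReal ((σ₁ - 1) / σ₁) * (p / 2) ≤ ENNReal.ofReal μ ∧ ENNReal.ofReal μ ≤ p / 2 ∧
  ENNReal.ofReal ((σ₂ - 1) / σ₂) * (pt / 2) ≤ ENNReal.ofReal μ ∧ ENNReal.ofReal μ ≤ pt / 2 ∧
  ENNReal.ofReal (σ₁ / 2) / (1 / q + ENNReal.ofReal σ₁ / p) < ENNReal.ofReal μ ∧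
  ENNReal.ofReal (σ₂ / 2) / (1 / qt + ENNReal.ofReal σ₂ / pt) < ENNReal.ofReal μ

/-- The strict inequalities on `μ` in the sharp case, and `1/p ≤ 1/q`, `1/pt ≤ 1/qt`. -/
def SharpCondition (n : ℕ) (a : ℝ) (q qt p pt : ℝ≥0∞) (s σ₁ σ₂ : ℝ) : Prop :=
  let μ : ℝ := muParam n a p pt s σ₁ σ₂
  1 < μ ∧
  ENNReal.ofReal ((σ₁ - 1) / σ₁) * (p / 2) < ENNReal.ofReal μ ∧ ENNReal.ofReal μ < p / 2 ∧
  ENNReal.ofReal ((σ₂ - 1) / σ₂) * (pt / 2) < ENNReal.ofReal μ ∧ ENNReal.ofReal μ < pt / 2 ∧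
  ENNReal.ofReal (σ₁ / 2) / (1 / q + ENNReal.ofReal σ₁ / p) < ENNReal.ofReal μ ∧
  ENNReal.ofReal (σ₂ / 2) / (1 / qt + ENNReal.ofReal σ₂ / pt) < ENNReal.ofReal μ ∧
  1 / p ≤ 1 / q ∧ 1 / pt ≤ 1 / qt

end

/-!
The estimates are dual to bounds for the forms `∫∫_{τ < t} ⟪G(t), P_N e^{i(t-τ)D^a} F(τ)⟫ dτ dt`.
The space `Z_2` is closed in `L²(ℝⁿ)` and invariant under the localized propagator: the Strichartz
estimate at the endpoint `(q, p) = (∞, 2)` gives invariance at almost every time, and continuity at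
every time. Hence `P_N e^{itD^a}` acts as a bounded self-dual flow on the model
`L²((0, ∞), r ^ (n - 1) dr; H)` (`RangeSpaces.flow`), where it suffices to bound the form on
functions that are simple in `t` and in `r` (`lpSize_retarded_le_of_stepFn`).

**Local estimates.** The region `τ < t` is the disjoint union of boxes `I × J` of dyadic intervals
of length `2ᵏ` whose distance is comparable to `2ᵏ`. On such a box two bounds are available. The
dispersive estimate, transported by dilations from intervals of unit length to length `2ᵏ`
(`AdmitsDispersive.exists_dyadic_le`), bounds the form by
`N ^ (n - a σ) 2 ^ (-k σ) ‖F‖_{L¹L¹} ‖G‖_{L¹L¹}`. Factoring `P_N e^{i(t-τ)D^a}` into two flows and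
applying the Strichartz estimates to each, with decay parameters `σ₁` and `σ₂`, bounds it without
any gain in `k`. Complex interpolation between the two with weight `θ = 1 - 1/μ`
(`IsDispersive.exists_local`) gives spatial exponents `p`, `p̃`, the time exponents `1/ω`, `1/ω̃`
with `ω = σ₁ (1/(2μ) - 1/p)` and `ω̃ = σ₂ (1/(2μ) - 1/p̃)`, and the factor `2 ^ (-k σ θ)`. The bounds
on `μ` in terms of `p` and `p̃` say that the Strichartz exponents are admissible, the last two
conditions on `μ` say that `ω < 1/q` and `ω̃ < 1/q̃`, and, given the scaling condition, the
definition of `μ` is the identity `1/q + 1/q̃ = σ θ + ω + ω̃` (`add_eq_of_muParam`), which makes the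
bounds on boxes scale as the desired one. For `μ = 1` these relations are contradictory, so that
`0 < θ` may be assumed. For a single scale `k` the estimate in `L^q`, `L^q̃` follows
by Hölder's inequality in time. The difficulty is the sum over `k`, as each scale satisfies the same
bound.

**Non-sharp case** (`IsDispersive.exists_nonsharp`). As `1/q + 1/q̃ < 1`, the exponents of time can
be varied. The functions `‖F(t)‖` and `‖G(t)‖` are split into atoms, an atom being the part of the
function on those of its dyadic level sets whose measure lies in `[2ᵐ, 2^(m+1))`. On an atom all
Lebesgue norms are comparable up to powers of `2ᵐ` (`exists_lintegral_atom_le`), so the variation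
of the exponents in both directions turns into a gain `2 ^ (-ε |m - k|)` for each of the two
functions, and the sum is controlled by Schur's test and by Hölder's inequality for sums, which
needs `1/q' + 1/q̃' ≥ 1` (`exists_whitney_sum_le`). The frequencies are combined in `ℓ²` by
Minkowski's inequality before the summation over the scales, as the local time exponents are less
than `2`; this gives (I) together with (II).

**Sharp case** (`IsDispersive.exists_sharp`). If `1/q + 1/q̃ = 1` there is no room in the exponents
of time. Instead the values `F(t)` and `G(t)` are split into spatial atoms and the exponents `p`
and `p̃` are varied, which the strict inequalities for `μ` permit. The gain is now in
`|m - σ₂ k - (a σ₂ - n) j|` and `|l - σ₁ k - (a σ₁ - n) j|`, with `N = 2ʲ` and with `m`, `l` the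
indices of the atoms of `F(t)`, `G(t)`. The conditions `1/p ≤ 1/q` and `1/p̃ ≤ 1/q̃` are what allows
the norms of the atoms to be summed back (`StepFn.tsum_lpSize_atom_le`).

Finally the frequencies are summed; the localized source at `N` involves those at `N / 2`, `N`
and `2 N` (`sqSum_neighbors_le`).
-/

noncomputable section

/-! ### Discrete inequalities in `[0, ∞]` -/

theorem ENNReal.tsum_mul_le_of_holderConjugate {ι : Type*} {u v : ℝ} (huv : u.HolderConjugate v)
    (a b : ι → ℝ≥0∞) :
    ∑' i, a i * b i ≤ (∑' i, a i ^ u) ^ (1 / u) * (∑' i, b i ^ v) ^ (1 / v) := by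
  let _ : MeasurableSpace ι := ⊤
  have h := ENNReal.lintegral_mul_le_Lp_mul_Lq (Measure.count : Measure ι) huv
    (f := a) (g := b) (measurable_from_top).aemeasurable (measurable_from_top).aemeasurable
  simpa [lintegral_count] using h

/-- `ℓᵘ` norms decrease in the exponent. -/
theorem ENNReal.tsum_rpow_le_of_le {ι : Type*} {v w : ℝ} (hv : 0 < v) (hvw : v ≤ w)
    (b : ι → ℝ≥0∞) : (∑' i, b i ^ w) ^ (1 / w) ≤ (∑' i, b i ^ v) ^ (1 / v) := by
  set B := (∑' i, b i ^ v) ^ (1 / v) with hB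
  have hBv : ∑' i, b i ^ v = B ^ v := by
    rw [hB, ← ENNReal.rpow_mul, one_div_mul_cancel hv.ne', ENNReal.rpow_one]
  have hb : ∀ i, b i ≤ B := fun i => by
    rw [← ENNReal.rpow_le_rpow_iff hv, ← hBv]
    exact ENNReal.le_tsum i
  have hw : 0 < w := hv.trans_le hvw
  have : ∑' i, b i ^ w ≤ B ^ w := by
    calc ∑' i, b i ^ w ≤ ∑' i, b i ^ v * B ^ (w - v) := by
          refine ENNReal.tsum_le_tsum fun i => ?_
          calc b i ^ w = b i ^ v * b i ^ (w - v) := by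
                rw [← ENNReal.rpow_add_of_nonneg _ _ hv.le (by linarith)]; congr 1; ring
            _ ≤ _ := by
              gcongr
              exact hb i
      _ = B ^ w := by
          rw [ENNReal.tsum_mul_right, hBv, ← ENNReal.rpow_add_of_nonneg _ _ hv.le (by linarith)]
          congr 1; ring
  calc (∑' i, b i ^ w) ^ (1 / w) ≤ (B ^ w) ^ (1 / w) := by gcongr
    _ = B := by rw [← ENNReal.rpow_mul, mul_one_div_cancel hw.ne', ENNReal.rpow_one]

/-- Hölder's inequality for sums holds whenever the reciprocals add up to at least `1`. -/
theorem ENNReal.tsum_mul_le_of_one_le {ι : Type*} {u v : ℝ} (hu : 1 ≤ u) (hv : 1 ≤ v)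
    (huv : 1 ≤ 1 / u + 1 / v) (a b : ι → ℝ≥0∞) :
    ∑' i, a i * b i ≤ (∑' i, a i ^ u) ^ (1 / u) * (∑' i, b i ^ v) ^ (1 / v) := by
  rcases hu.eq_or_lt with rfl | hu1
  · have hb : ∀ i, b i ≤ (∑' i, b i ^ v) ^ (1 / v) := fun i => by
      have hv0 : 0 < v := by linarith
      rw [← ENNReal.rpow_le_rpow_iff hv0, ← ENNReal.rpow_mul, one_div_mul_cancel hv0.ne',
        ENNReal.rpow_one]
      exact ENNReal.le_tsum i
    calc ∑' i, a i * b i ≤ ∑' i, a i * (∑' i, b i ^ v) ^ (1 / v) :=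
          ENNReal.tsum_le_tsum fun i => by gcongr; exact hb i
      _ = _ := by simp [ENNReal.tsum_mul_right]
  · have hc := Real.HolderConjugate.conjExponent hu1
    refine (ENNReal.tsum_mul_le_of_holderConjugate hc a b).trans ?_
    gcongr
    apply ENNReal.tsum_rpow_le_of_le (by linarith)
    have h1 := hc.inv_add_inv_eq_one
    have h2 : (u.conjExponent)⁻¹ ≤ v⁻¹ := by
      simp only [one_div] at huv; linarith
    exact (inv_le_inv₀ hc.symm.pos (by linarith)).1 h2

/-- Schur's test with constant weights sums. -/
theorem ENNReal.tsum_schur {ι κ : Type*} {u : ℝ} (hu : 1 ≤ u) (w : κ → ι → ℝ≥0∞) {C : ℝ≥0∞}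
    (h1 : ∀ k, ∑' i, w k i ≤ C) (h2 : ∀ i, ∑' k, w k i ≤ C) (a : ι → ℝ≥0∞) :
    (∑' k, (∑' i, w k i * a i) ^ u) ^ (1 / u) ≤ C * (∑' i, a i ^ u) ^ (1 / u) := by
  have hu0 : 0 < u := by linarith
  have key : ∀ k, (∑' i, w k i * a i) ^ u ≤ C ^ (u - 1) * ∑' i, w k i * a i ^ u := by
    intro k
    rcases hu.eq_or_lt with rfl | hu1
    · simp
    · have hc := Real.HolderConjugate.conjExponent hu1
      have h := ENNReal.tsum_mul_le_of_holderConjugate hc.symm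
        (fun i => w k i ^ (1 / u.conjExponent)) (fun i => w k i ^ (1 / u) * a i)
      have e1 : ∀ i, w k i ^ (1 / u.conjExponent) * (w k i ^ (1 / u) * a i) = w k i * a i := by
        intro i
        rw [← mul_assoc, ← ENNReal.rpow_add_of_nonneg _ _ (by simp [hc.symm.nonneg])
          (by positivity)]
        have := hc.symm.inv_add_inv_eq_one
        rw [one_div, one_div, this, ENNReal.rpow_one]
      have e2 : ∀ i, (w k i ^ (1 / u.conjExponent)) ^ u.conjExponent = w k i := by
        intro i
        rw [← ENNReal.rpow_mul, one_div_mul_cancel hc.symm.ne_zero, ENNReal.rpow_one]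
      have e3 : ∀ i, (w k i ^ (1 / u) * a i) ^ u = w k i * a i ^ u := by
        intro i
        rw [ENNReal.mul_rpow_of_nonneg _ _ hu0.le, ← ENNReal.rpow_mul,
          one_div_mul_cancel hu0.ne', ENNReal.rpow_one]
      simp only [e1, e2, e3] at h
      calc (∑' i, w k i * a i) ^ u
          ≤ ((∑' i, w k i) ^ (1 / u.conjExponent) * (∑' i, w k i * a i ^ u) ^ (1 / u)) ^ u := by
            gcongr
        _ = (∑' i, w k i) ^ (u - 1) * ∑' i, w k i * a i ^ u := by
            rw [ENNReal.mul_rpow_of_nonneg _ _ hu0.le, ← ENNReal.rpow_mul, ← ENNReal.rpow_mul,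
              one_div_mul_cancel hu0.ne', ENNReal.rpow_one]
            congr 2
            rw [Real.conjExponent]; field_simp
        _ ≤ _ := by
            gcongr
            exact h1 k
  have : ∑' k, (∑' i, w k i * a i) ^ u ≤ C ^ u * ∑' i, a i ^ u := by
    calc ∑' k, (∑' i, w k i * a i) ^ u ≤ ∑' k, C ^ (u - 1) * ∑' i, w k i * a i ^ u :=
          ENNReal.tsum_le_tsum key
      _ = C ^ (u - 1) * ∑' i, (∑' k, w k i) * a i ^ u := by
          rw [ENNReal.tsum_mul_left, ENNReal.tsum_comm]
          simp_rw [ENNReal.tsum_mul_right]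
      _ ≤ C ^ (u - 1) * ∑' i, C * a i ^ u := by
          gcongr with i
          exact h2 i
      _ = C ^ u * ∑' i, a i ^ u := by
          rw [ENNReal.tsum_mul_left, ← mul_assoc]
          congr 1
          nth_rw 2 [← ENNReal.rpow_one C]
          rw [← ENNReal.rpow_add_of_nonneg _ _ (by linarith) (by norm_num)]
          congr 1; ring
  calc _ ≤ (C ^ u * ∑' i, a i ^ u) ^ (1 / u) := by gcongr
    _ = _ := by
      rw [ENNReal.mul_rpow_of_nonneg _ _ (by positivity), ← ENNReal.rpow_mul,
        mul_one_div_cancel hu0.ne', ENNReal.rpow_one]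

theorem two_rpow_eq_ofReal (x : ℝ) : (2 : ℝ≥0∞) ^ x = ENNReal.ofReal ((2 : ℝ) ^ x) := by
  rw [← ENNReal.ofReal_rpow_of_pos (by norm_num)]; norm_num

theorem two_rpow_add (x y : ℝ) : (2 : ℝ≥0∞) ^ (x + y) = 2 ^ x * 2 ^ y :=
  ENNReal.rpow_add _ _ (by norm_num) (by norm_num)

theorem two_rpow_ne_zero (x : ℝ) : (2 : ℝ≥0∞) ^ x ≠ 0 := by
  simp [ENNReal.rpow_eq_zero_iff]

theorem two_rpow_ne_top (x : ℝ) : (2 : ℝ≥0∞) ^ x ≠ ∞ := by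
  simp [ENNReal.rpow_eq_top_iff]

/-- The weights `2 ^ (-ε |c k + d|)` are summable over `k`, uniformly in `d`. -/
theorem exists_tsum_weight_le {ε c : ℝ} (hε : 0 < ε) (hc : c ≠ 0) :
    ∃ C : ℝ≥0, ∀ d : ℝ, ∑' k : ℤ, (2 : ℝ≥0∞) ^ (-ε * |c * k + d|) ≤ C := by
  simp_rw [two_rpow_eq_ofReal]
  set ρ : ℝ := (2 : ℝ) ^ (-ε * |c|) with hρ
  have hρ0 : 0 < ρ := by positivity
  have hρ1 : ρ < 1 := Real.rpow_lt_one_of_one_lt_of_neg (by norm_num)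
    (by have := abs_pos.2 hc; nlinarith)
  have hsum : Summable fun k : ℤ => (2 : ℝ) ^ (ε * |c|) * ρ ^ k.natAbs := by
    apply Summable.mul_left
    have hg := summable_geometric_of_lt_one hρ0.le hρ1
    apply Summable.of_nat_of_neg <;> simpa using hg
  refine ⟨(∑' k : ℤ, (2 : ℝ) ^ (ε * |c|) * ρ ^ k.natAbs).toNNReal, fun d => ?_⟩
  rw [← (Equiv.addRight ⌊-d / c⌋).tsum_eq
    (fun k : ℤ => ENNReal.ofReal ((2 : ℝ) ^ (-ε * |c * k + d|)))]
  have : ((∑' k : ℤ, (2 : ℝ) ^ (ε * |c|) * ρ ^ k.natAbs).toNNReal : ℝ≥0∞)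
      = ∑' k : ℤ, ENNReal.ofReal ((2 : ℝ) ^ (ε * |c|) * ρ ^ k.natAbs) := by
    rw [← ENNReal.ofReal_tsum_of_nonneg (fun k => by positivity) hsum]; rfl
  rw [this]
  refine ENNReal.tsum_le_tsum fun k => ENNReal.ofReal_le_ofReal ?_
  have h1 : ρ ^ k.natAbs = (2 : ℝ) ^ (-ε * |c| * |(k : ℝ)|) := by
    rw [hρ, ← Real.rpow_natCast, ← Real.rpow_mul (by norm_num), Nat.cast_natAbs]; simp
  rw [h1, ← Real.rpow_add (by norm_num)]
  apply Real.rpow_le_rpow_of_exponent_le (by norm_num)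
  have h2 : |c| * (|(k : ℝ)| - 1) ≤ |c * ((k + ⌊-d / c⌋ : ℤ) : ℝ) + d| := by
    have : c * ((k + ⌊-d / c⌋ : ℤ) : ℝ) + d = c * (k - Int.fract (-d / c)) := by
      rw [Int.fract]; push_cast; field_simp; ring
    rw [this, abs_mul]
    gcongr
    have := abs_sub_abs_le_abs_sub (k : ℝ) (Int.fract (-d / c))
    have h3 : |Int.fract (-d / c)| ≤ 1 := by
      rw [abs_of_nonneg (Int.fract_nonneg _)]; exact (Int.fract_lt_one _).le
    linarith
  simp only [Equiv.coe_addRight]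
  nlinarith

/-- Off-diagonal decay in two indices is summable against `ℓᵘ × ℓᵛ` when `1/u + 1/v ≥ 1`; the
shifts `d₁`, `d₂` do not enter the constant. -/
theorem exists_tsum_offDiagonal_le {ε c₁ c₂ : ℝ} (hε : 0 < ε) (h₁ : c₁ ≠ 0) (h₂ : c₂ ≠ 0)
    {u v : ℝ} (hu : 1 ≤ u) (hv : 1 ≤ v) (huv : 1 ≤ 1 / u + 1 / v) :
    ∃ C : ℝ≥0, ∀ (d₁ d₂ : ℝ) (a b : ℤ → ℝ≥0∞),
      ∑' k : ℤ, (∑' m : ℤ, (2 : ℝ≥0∞) ^ (-ε * |m - c₁ * k - d₁|) * a m) *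
        (∑' l : ℤ, (2 : ℝ≥0∞) ^ (-ε * |l - c₂ * k - d₂|) * b l) ≤
      C * ((∑' m, a m ^ u) ^ (1 / u) * (∑' l, b l ^ v) ^ (1 / v)) := by
  obtain ⟨C0, hC0⟩ := exists_tsum_weight_le hε one_ne_zero
  obtain ⟨C1, hC1⟩ := exists_tsum_weight_le hε (neg_ne_zero.2 h₁)
  obtain ⟨C2, hC2⟩ := exists_tsum_weight_le hε (neg_ne_zero.2 h₂)
  refine ⟨max C0 C1 * max C0 C2, fun d₁ d₂ a b => ?_⟩
  refine (ENNReal.tsum_mul_le_of_one_le hu hv huv _ _).trans ?_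
  have hA := ENNReal.tsum_schur hu
    (fun (k m : ℤ) => (2 : ℝ≥0∞) ^ (-ε * |m - c₁ * k - d₁|))
    (C := (max C0 C1 : ℝ≥0)) (fun k => by
      refine le_trans (le_trans (le_of_eq ?_) (hC0 (- c₁ * k - d₁)))
        (ENNReal.coe_le_coe.2 (le_max_left _ _))
      congr 1; ext m; congr 3; ring) (fun m => by
      refine le_trans (le_trans (le_of_eq ?_) (hC1 (m - d₁)))
        (ENNReal.coe_le_coe.2 (le_max_right _ _))
      congr 1; ext m; congr 3; ring) a
  have hB := ENNReal.tsum_schur hv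
    (fun (k m : ℤ) => (2 : ℝ≥0∞) ^ (-ε * |m - c₂ * k - d₂|))
    (C := (max C0 C2 : ℝ≥0)) (fun k => by
      refine le_trans (le_trans (le_of_eq ?_) (hC0 (- c₂ * k - d₂)))
        (ENNReal.coe_le_coe.2 (le_max_left _ _))
      congr 1; ext m; congr 3; ring) (fun m => by
      refine le_trans (le_trans (le_of_eq ?_) (hC2 (m - d₂)))
        (ENNReal.coe_le_coe.2 (le_max_right _ _))
      congr 1; ext m; congr 3; ring) b
  calc _ ≤ _ := mul_le_mul' hA hB
    _ = _ := by push_cast; ring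

/-! ### Atomic decomposition by the measure of dyadic level sets -/

/-- The integer `i` with `2 ^ i ≤ y < 2 ^ (i + 1)`. -/
def dyadicLevel (y : ℝ≥0∞) : ℤ := Int.log 2 y.toReal

theorem two_rpow_intCast (i : ℤ) : (2 : ℝ≥0∞) ^ (i : ℝ) = ENNReal.ofReal ((2 : ℝ) ^ i) := by
  rw [two_rpow_eq_ofReal, Real.rpow_intCast]

theorem two_rpow_dyadicLevel_le {y : ℝ≥0∞} (h0 : y ≠ 0) (h1 : y ≠ ∞) :
    (2 : ℝ≥0∞) ^ (dyadicLevel y : ℝ) ≤ y := by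
  rw [two_rpow_intCast, ← ENNReal.ofReal_toReal h1]
  apply ENNReal.ofReal_le_ofReal
  have := Int.zpow_log_le_self (R := ℝ) (b := 2) (by norm_num) (ENNReal.toReal_pos h0 h1)
  simpa [dyadicLevel, ENNReal.toReal_ofReal] using this

theorem lt_two_rpow_dyadicLevel {y : ℝ≥0∞} (h1 : y ≠ ∞) :
    y < (2 : ℝ≥0∞) ^ (dyadicLevel y + 1 : ℝ) := by
  have : ((dyadicLevel y : ℝ) + 1) = ((dyadicLevel y + 1 : ℤ) : ℝ) := by push_cast; ring
  rw [this, two_rpow_intCast]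
  nth_rw 1 [← ENNReal.ofReal_toReal h1]
  rw [ENNReal.ofReal_lt_ofReal_iff (by positivity)]
  have := Int.lt_zpow_succ_log_self (R := ℝ) (b := 2) (by norm_num) y.toReal
  simpa [dyadicLevel] using this

theorem measurable_dyadicLevel : Measurable dyadicLevel := by
  refine measurable_of_Ici fun i => ?_
  have : dyadicLevel ⁻¹' Set.Ici i = {y | (2 : ℝ) ^ i ≤ y.toReal} ∪
      (if i ≤ 0 then {y | y.toReal ≤ 0} else ∅) := by
    ext y
    simp only [Set.mem_preimage, Set.mem_Ici, dyadicLevel, Set.mem_union, Set.mem_ofPred_eq]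
    rcases (ENNReal.toReal_nonneg (a := y)).eq_or_lt with h | h
    · rw [← h]
      have : ¬ (2 : ℝ) ^ i ≤ 0 := by simp only [not_le]; positivity
      split_ifs with h' <;> simp [this, h', ← h]
    · have := Int.zpow_le_iff_le_log (R := ℝ) (b := 2) (by norm_num) (x := i) h
      simp only [Nat.cast_ofNat] at this
      rw [this]
      split_ifs <;> simp [h.not_ge]
  rw [this]
  refine MeasurableSet.union (measurableSet_le measurable_const ENNReal.measurable_toReal) ?_
  split_ifs
  · exact measurableSet_le ENNReal.measurable_toReal measurable_const
  · exact MeasurableSet.empty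

variable {X : Type*} [MeasurableSpace X]

/-- The set where `2 ^ i ≤ h < 2 ^ (i + 1)`. -/
def levelSet (h : X → ℝ≥0∞) (i : ℤ) : Set X :=
  {x | h x ≠ 0 ∧ h x ≠ ∞ ∧ dyadicLevel (h x) = i}

/-- The `m`-th atom of `h`: the union of those dyadic level sets of `h` whose measure lies in
`[2 ^ m, 2 ^ (m + 1))`, described by the values which `h` takes there. -/
def atomValues (ν : Measure X) (h : X → ℝ≥0∞) (m : ℤ) : Set ℝ≥0∞ :=
  {y | y ≠ 0 ∧ y ≠ ∞ ∧ dyadicLevel (ν (levelSet h (dyadicLevel y))) = m}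

theorem measurableSet_atomValues (ν : Measure X) (h : X → ℝ≥0∞) (m : ℤ) :
    MeasurableSet (atomValues ν h m) := by
  have : Measurable fun y : ℝ≥0∞ => dyadicLevel (ν (levelSet h (dyadicLevel y))) :=
    (measurable_from_top (f := fun i : ℤ => dyadicLevel (ν (levelSet h i)))).comp
      measurable_dyadicLevel
  exact (MeasurableSet.singleton (0 : ℝ≥0∞)).compl.inter
    ((MeasurableSet.singleton (∞ : ℝ≥0∞)).compl.inter (this (MeasurableSet.singleton m)))

theorem measurableSet_levelSet {h : X → ℝ≥0∞} (hh : Measurable h) (i : ℤ) :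
    MeasurableSet (levelSet h i) :=
  (hh (MeasurableSet.singleton (0 : ℝ≥0∞)).compl).inter
    ((hh (MeasurableSet.singleton (∞ : ℝ≥0∞)).compl).inter
      ((measurable_dyadicLevel.comp hh) (MeasurableSet.singleton i)))

theorem pairwise_disjoint_atomValues (ν : Measure X) (h : X → ℝ≥0∞) :
    Pairwise (Function.onFun Disjoint (atomValues ν h)) := by
  intro m l hml
  refine Set.disjoint_left.2 fun y h1 h2 => hml ?_
  rw [← h1.2.2, ← h2.2.2]

/-- Dyadic numbers `2 ^ i` below `R` form a geometric series. -/
theorem tsum_two_rpow_le {P : ℝ} (hP : 0 < P) (R : ℝ≥0∞) (hR : R ≠ ∞) :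
    ∑' i : ℤ, (if (2 : ℝ≥0∞) ^ (i : ℝ) ≤ R then (2 : ℝ≥0∞) ^ (i * P) else 0) ≤
      (1 - 2 ^ (-P))⁻¹ * R ^ P := by
  rcases eq_or_ne R 0 with rfl | hR0
  · refine le_of_eq_of_le (ENNReal.tsum_eq_zero.2 fun i => ?_) zero_le
    have := two_rpow_ne_zero (i : ℝ)
    rw [if_neg (by simpa using this)]
  set i0 := dyadicLevel R
  have hinj : Function.Injective fun k : ℕ => i0 - (k : ℤ) := fun a b hab => by simpa using hab
  have hsupp : Function.support (fun i : ℤ =>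
      if (2 : ℝ≥0∞) ^ (i : ℝ) ≤ R then (2 : ℝ≥0∞) ^ (i * P) else 0) ⊆
      Set.range fun k : ℕ => i0 - (k : ℤ) := by
    intro i hi
    simp only [Function.mem_support, ne_eq, ite_eq_right_iff, Classical.not_imp] at hi
    have h := hi.1.trans_lt (lt_two_rpow_dyadicLevel hR)
    have h' : (i : ℝ) < dyadicLevel R + 1 := by
      by_contra hcon
      exact absurd h (not_lt.2 (ENNReal.rpow_le_rpow_of_exponent_le (by norm_num)
        (not_lt.1 hcon)))
    have : i ≤ i0 := by
      have : i < i0 + 1 := by exact_mod_cast h'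
      omega
    exact ⟨(i0 - i).toNat, by simp only; omega⟩
  rw [← hinj.tsum_eq hsupp]
  calc ∑' k : ℕ, (if (2 : ℝ≥0∞) ^ ((i0 - (k : ℤ) : ℤ) : ℝ) ≤ R
        then (2 : ℝ≥0∞) ^ (((i0 - (k : ℤ) : ℤ) : ℝ) * P) else 0)
      ≤ ∑' k : ℕ, (2 ^ (-P)) ^ k * R ^ P := by
        refine ENNReal.tsum_le_tsum fun k => ?_
        split_ifs
        · calc (2 : ℝ≥0∞) ^ (((i0 - (k : ℤ) : ℤ) : ℝ) * P)
              = (2 ^ (-P)) ^ k * (2 ^ (i0 : ℝ)) ^ P := by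
                rw [← ENNReal.rpow_natCast, ← ENNReal.rpow_mul, ← ENNReal.rpow_mul,
                  ← two_rpow_add]
                congr 1; push_cast; ring
            _ ≤ _ := by gcongr; exact two_rpow_dyadicLevel_le hR0 hR
        · exact zero_le
    _ = _ := by rw [ENNReal.tsum_mul_right, ENNReal.tsum_geometric]

/-- On an atom all `Lᴾ` norms are comparable, as for a function of constant modulus on a set of
measure `2 ^ m`. -/
theorem exists_lintegral_atom_le {P p : ℝ} (hP : 0 < P) (hp : 0 < p) :
    ∃ C : ℝ≥0, ∀ {X : Type*} [MeasurableSpace X] (ν : Measure X) (h : X → ℝ≥0∞),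
      Measurable h → (∀ i, ν (levelSet h i) ≠ ∞) → ∀ m : ℤ,
      ∫⁻ x in h ⁻¹' atomValues ν h m, h x ^ P ∂ν ≤
        C * 2 ^ (m : ℝ) * (2 ^ (-m : ℝ) * ∫⁻ x in h ⁻¹' atomValues ν h m, h x ^ p ∂ν) ^ (P / p) := by
  have h2P : (2 : ℝ≥0∞) ^ (-P) < 1 := ENNReal.rpow_lt_one_of_one_lt_of_neg (by norm_num)
    (by linarith)
  have hfin : (2 : ℝ≥0∞) * 2 ^ P * (1 - 2 ^ (-P))⁻¹ ≠ ∞ := by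
    refine ENNReal.mul_ne_top (ENNReal.mul_ne_top (by norm_num) (two_rpow_ne_top _)) ?_
    simp [ENNReal.inv_eq_top, tsub_eq_zero_iff_le, h2P]
  refine ⟨(2 * 2 ^ P * (1 - 2 ^ (-P))⁻¹ : ℝ≥0∞).toNNReal, fun ν h hh hfinlev m => ?_⟩
  rw [ENNReal.coe_toNNReal hfin]
  set S := h ⁻¹' atomValues ν h m
  have hS : MeasurableSet S := hh (measurableSet_atomValues ν h m)
  set A := ∫⁻ x in S, h x ^ p ∂ν
  rcases eq_or_ne A ∞ with hA | hA
  · rw [hA, ENNReal.mul_top (two_rpow_ne_zero _), ENNReal.top_rpow_of_pos (by positivity),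
      ENNReal.mul_top]
    · exact le_top
    · refine mul_ne_zero (mul_ne_zero (mul_ne_zero (by norm_num) (two_rpow_ne_zero _)) ?_)
        (two_rpow_ne_zero _)
      simp [ENNReal.inv_eq_zero]
  set R : ℝ≥0∞ := (2 ^ (-m : ℝ) * A) ^ (1 / p)
  have hR : R ≠ ∞ := ENNReal.rpow_ne_top_of_nonneg (by positivity)
    (ENNReal.mul_ne_top (two_rpow_ne_top _) hA)
  have hRP : R ^ P = (2 ^ (-m : ℝ) * A) ^ (P / p) := by
    rw [← ENNReal.rpow_mul]; congr 1; ring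
  -- a level which contributes to the atom is bounded by the normalized `Lᵖ` norm of the atom
  have hlev : ∀ i, dyadicLevel (ν (levelSet h i)) = m → ν (levelSet h i) ≠ 0 →
      (2 : ℝ≥0∞) ^ (i : ℝ) ≤ R := by
    intro i hi h0
    have hsub : levelSet h i ⊆ S := fun x hx => ⟨hx.1, hx.2.1, by rw [hx.2.2]; exact hi⟩
    have h1 : (2 : ℝ≥0∞) ^ (i * p) * 2 ^ (m : ℝ) ≤ A := by
      calc (2 : ℝ≥0∞) ^ (i * p) * 2 ^ (m : ℝ) ≤ 2 ^ (i * p) * ν (levelSet h i) := by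
            gcongr; rw [← hi]; exact two_rpow_dyadicLevel_le h0 (hfinlev i)
        _ = ∫⁻ _ in levelSet h i, 2 ^ (i * p) ∂ν := by simp
        _ ≤ ∫⁻ x in levelSet h i, h x ^ p ∂ν := by
            refine setLIntegral_mono' (measurableSet_levelSet hh i) fun x hx => ?_
            rw [ENNReal.rpow_mul]
            gcongr
            rw [← hx.2.2]; exact two_rpow_dyadicLevel_le hx.1 hx.2.1
        _ ≤ A := lintegral_mono_set hsub
    have h2 : (2 : ℝ≥0∞) ^ (i * p) ≤ 2 ^ (-m : ℝ) * A := by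
      calc (2 : ℝ≥0∞) ^ (i * p) = 2 ^ (-m : ℝ) * (2 ^ (i * p) * 2 ^ (m : ℝ)) := by
            rw [← two_rpow_add, ← two_rpow_add]; congr 1; ring
        _ ≤ _ := by gcongr
    calc (2 : ℝ≥0∞) ^ (i : ℝ) = (2 ^ (i * p)) ^ (1 / p) := by
          rw [← ENNReal.rpow_mul]; congr 1; field_simp
      _ ≤ R := by simp only [R]; gcongr
  calc ∫⁻ x in S, h x ^ P ∂ν
      ≤ ∫⁻ x, ∑' i : ℤ, (if dyadicLevel (ν (levelSet h i)) = m then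
          (levelSet h i).indicator (fun _ => (2 : ℝ≥0∞) ^ ((i + 1) * P)) x else 0) ∂ν := by
        rw [← lintegral_indicator hS]
        refine lintegral_mono fun x => ?_
        by_cases hx : x ∈ S
        · rw [Set.indicator_of_mem hx]
          refine le_trans ?_ (ENNReal.le_tsum (dyadicLevel (h x)))
          have hx' : x ∈ levelSet h (dyadicLevel (h x)) := ⟨hx.1, hx.2.1, rfl⟩
          rw [if_pos hx.2.2, Set.indicator_of_mem hx', ENNReal.rpow_mul]
          gcongr
          exact (lt_two_rpow_dyadicLevel hx.2.1).le
        · simp [Set.indicator_of_notMem hx]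
    _ = ∑' i : ℤ, (if dyadicLevel (ν (levelSet h i)) = m then
          (2 : ℝ≥0∞) ^ ((i + 1) * P) * ν (levelSet h i) else 0) := by
        rw [lintegral_tsum]
        · congr 1; ext i
          split_ifs
          · rw [lintegral_indicator (measurableSet_levelSet hh i)]; simp
          · simp
        · intro i
          split_ifs
          · exact (measurable_const.indicator (measurableSet_levelSet hh i)).aemeasurable
          · exact aemeasurable_const
    _ ≤ ∑' i : ℤ, (2 * 2 ^ P * 2 ^ (m : ℝ)) *
          (if (2 : ℝ≥0∞) ^ (i : ℝ) ≤ R then (2 : ℝ≥0∞) ^ (i * P) else 0) := by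
        refine ENNReal.tsum_le_tsum fun i => ?_
        split_ifs with h1 h2 h2
        · calc (2 : ℝ≥0∞) ^ ((i + 1) * P) * ν (levelSet h i)
              ≤ 2 ^ ((i + 1) * P) * 2 ^ ((m : ℝ) + 1) := by
                gcongr; rw [← h1]; exact (lt_two_rpow_dyadicLevel (hfinlev i)).le
            _ = _ := by
                nth_rw 3 [← ENNReal.rpow_one 2]
                simp only [← two_rpow_add]; congr 1; ring
        · have : ν (levelSet h i) = 0 := by
            by_contra h0; exact h2 (hlev i h1 h0)
          simp [this]
        · exact zero_le
        · exact zero_le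
    _ ≤ (2 * 2 ^ P * 2 ^ (m : ℝ)) * ((1 - 2 ^ (-P))⁻¹ * R ^ P) := by
        rw [ENNReal.tsum_mul_left]; gcongr; exact tsum_two_rpow_le hP R hR
    _ = _ := by rw [hRP]; ring

theorem tsum_lintegral_atom_le (ν : Measure X) {h : X → ℝ≥0∞} (hh : Measurable h)
    (g : X → ℝ≥0∞) :
    ∑' m : ℤ, ∫⁻ x in h ⁻¹' atomValues ν h m, g x ∂ν ≤ ∫⁻ x, g x ∂ν := by
  rw [← lintegral_iUnion (fun m => hh (measurableSet_atomValues ν h m))]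
  · exact setLIntegral_le_lintegral _ _
  · intro m l hml
    exact (pairwise_disjoint_atomValues ν h hml).preimage h

theorem levelSet_measure_ne_top (ν : Measure X) {h : X → ℝ≥0∞} (hh : Measurable h) {p : ℝ}
    (hp : 0 < p) (hfin : ∫⁻ x, h x ^ p ∂ν ≠ ∞) (i : ℤ) : ν (levelSet h i) ≠ ∞ := by
  have h1 : (2 : ℝ≥0∞) ^ (i * p) * ν (levelSet h i) ≤ ∫⁻ x, h x ^ p ∂ν := by
    calc (2 : ℝ≥0∞) ^ (i * p) * ν (levelSet h i) = ∫⁻ _ in levelSet h i, 2 ^ (i * p) ∂ν := by simp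
      _ ≤ ∫⁻ x in levelSet h i, h x ^ p ∂ν := by
          refine setLIntegral_mono' (measurableSet_levelSet hh i) fun x hx => ?_
          rw [ENNReal.rpow_mul]
          gcongr
          rw [← hx.2.2]; exact two_rpow_dyadicLevel_le hx.1 hx.2.1
      _ ≤ _ := setLIntegral_le_lintegral _ _
  intro htop
  rw [htop, ENNReal.mul_top (two_rpow_ne_zero _)] at h1
  exact hfin (top_le_iff.1 h1)

/-- A bound which may be read with either sign of two exponents gives off-diagonal decay, hence
summability. -/
theorem exists_tsum_le_of_signs {ε c₁ c₂ : ℝ} (hε : 0 < ε) (h₁ : c₁ ≠ 0) (h₂ : c₂ ≠ 0)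
    {u v : ℝ} (hu : 1 ≤ u) (hv : 1 ≤ v) (huv : 1 ≤ 1 / u + 1 / v) :
    ∃ C : ℝ≥0, ∀ (d₁ d₂ : ℝ) (K : ℝ≥0∞) (β : ℤ → ℤ → ℤ → ℝ≥0∞) (a b : ℤ → ℝ≥0∞),
      (∀ k m l : ℤ, ∀ s₁ ∈ ({1, -1} : Set ℝ), ∀ s₂ ∈ ({1, -1} : Set ℝ),
        β k m l ≤ K * ((2 ^ (s₁ * ε * (m - c₁ * k - d₁)) * a m) *
          (2 ^ (s₂ * ε * (l - c₂ * k - d₂)) * b l))) →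
      ∑' k, ∑' m, ∑' l, β k m l ≤
        C * K * ((∑' m, a m ^ u) ^ (1 / u) * (∑' l, b l ^ v) ^ (1 / v)) := by
  obtain ⟨C, hC⟩ := exists_tsum_offDiagonal_le hε h₁ h₂ hu hv huv
  refine ⟨C, fun d₁ d₂ K β a b h => ?_⟩
  have hsign : ∀ y : ℝ, ∃ s ∈ ({1, -1} : Set ℝ), s * ε * y = -ε * |y| := by
    intro y
    rcases le_total 0 y with hy | hy
    · exact ⟨-1, by simp, by rw [abs_of_nonneg hy]; ring⟩
    · exact ⟨1, by simp, by rw [abs_of_nonpos hy]; ring⟩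
  have key : ∀ k m l : ℤ, β k m l ≤ K * ((2 ^ (-ε * |m - c₁ * k - d₁|) * a m) *
      (2 ^ (-ε * |l - c₂ * k - d₂|) * b l)) := by
    intro k m l
    obtain ⟨s₁, hs₁, e₁⟩ := hsign (m - c₁ * k - d₁)
    obtain ⟨s₂, hs₂, e₂⟩ := hsign (l - c₂ * k - d₂)
    rw [← e₁, ← e₂]
    exact h k m l s₁ hs₁ s₂ hs₂
  calc ∑' k, ∑' m, ∑' l, β k m l
      ≤ ∑' k : ℤ, ∑' m : ℤ, ∑' l : ℤ, K * ((2 ^ (-ε * |m - c₁ * k - d₁|) * a m) *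
      (2 ^ (-ε * |l - c₂ * k - d₂|) * b l)) :=
        ENNReal.tsum_le_tsum fun k => ENNReal.tsum_le_tsum fun m =>
          ENNReal.tsum_le_tsum fun l => key k m l
    _ = K * ∑' k : ℤ, (∑' m : ℤ, 2 ^ (-ε * |m - c₁ * k - d₁|) * a m) *
          ∑' l : ℤ, 2 ^ (-ε * |l - c₂ * k - d₂|) * b l := by
        simp_rw [ENNReal.tsum_mul_left, ENNReal.tsum_mul_right]
    _ ≤ K * (C * ((∑' m, a m ^ u) ^ (1 / u) * (∑' l, b l ^ v) ^ (1 / v))) := by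
        gcongr; exact hC d₁ d₂ a b
    _ = _ := by ring

/-! ### Dyadic time intervals and the Whitney decomposition of `{τ < t}` -/

/-- The `Lˣ` norm, for real `x > 0`, of a function with values in `[0, ∞]`. -/
def lpSize {X : Type*} [MeasurableSpace X] (x : ℝ) (ν : Measure X) (f : X → ℝ≥0∞) : ℝ≥0∞ :=
  (∫⁻ t, f t ^ x ∂ν) ^ (1 / x)

theorem lpSize_rpow {X : Type*} [MeasurableSpace X] {x : ℝ} (hx : 0 < x) (ν : Measure X)
    (f : X → ℝ≥0∞) : lpSize x ν f ^ x = ∫⁻ t, f t ^ x ∂ν := by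
  rw [lpSize, ← ENNReal.rpow_mul, one_div_mul_cancel hx.ne', ENNReal.rpow_one]

theorem lpSize_mono {X : Type*} [MeasurableSpace X] {x : ℝ} (hx : 0 < x) (ν : Measure X)
    {f g : X → ℝ≥0∞} (h : ∀ t, f t ≤ g t) : lpSize x ν f ≤ lpSize x ν g := by
  unfold lpSize
  gcongr with t
  exact h t

theorem lpSize_le_of_le {X : Type*} [MeasurableSpace X] {x y : ℝ} (hx : 0 < x) (hxy : x ≤ y)
    (ν : Measure X) {f : X → ℝ≥0∞} (hf : AEMeasurable f ν) :
    lpSize x ν f ≤ ν Set.univ ^ (1 / x - 1 / y) * lpSize y ν f := by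
  rcases hxy.eq_or_lt with rfl | hlt
  · simp
  have h := ENNReal.lintegral_Lp_mul_le_Lq_mul_Lr (p := x) (q := y) (r := (1 / x - 1 / y)⁻¹)
    hx hlt (by rw [one_div (_)⁻¹, inv_inv]; ring) ν hf (aemeasurable_const (b := (1 : ℝ≥0∞)))
  simp only [Pi.mul_apply, mul_one, ENNReal.one_rpow, lintegral_const, one_mul, one_div,
    inv_inv] at h
  rw [mul_comm]
  simpa [lpSize] using h

/-- The dyadic interval `[n 2ᵏ, (n + 1) 2ᵏ)`. -/
def dyInt (k n : ℤ) : Set ℝ := Set.Ico (n * (2 : ℝ) ^ k) ((n + 1) * (2 : ℝ) ^ k)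

theorem mem_dyInt_iff {k n : ℤ} {t : ℝ} : t ∈ dyInt k n ↔ ⌊t / 2 ^ k⌋ = n := by
  have : (0 : ℝ) < 2 ^ k := by positivity
  rw [Int.floor_eq_iff, le_div_iff₀ this, div_lt_iff₀ this]; rfl

theorem measurableSet_dyInt (k n : ℤ) : MeasurableSet (dyInt k n) := measurableSet_Ico

theorem volume_dyInt (k n : ℤ) : volume (dyInt k n) = 2 ^ (k : ℝ) := by
  rw [dyInt, Real.volume_Ico, two_rpow_intCast]; congr 1; ring

theorem pairwise_disjoint_dyInt (k : ℤ) : Pairwise (Function.onFun Disjoint (dyInt k)) := by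
  intro m n hmn
  refine Set.disjoint_left.2 fun t h1 h2 => hmn ?_
  rw [mem_dyInt_iff] at h1 h2; omega

/-- The index of the interval for the past variable `τ` in the Whitney decomposition. -/
def whitneyPast (n : ℤ) (b : Bool) : ℤ := if b then 2 * n else n

/-- The index of the interval for the variable `t` in the Whitney decomposition: at distance `2`,
or at distance `3` if the first index is even. -/
def whitneyFuture (n : ℤ) (b : Bool) : ℤ := if b then 2 * n + 3 else n + 2

theorem whitneyPast_injective (b : Bool) : Function.Injective fun n => whitneyPast n b := by
  intro m n h; cases b <;> simp [whitneyPast] at h <;> omega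

theorem whitneyFuture_injective (b : Bool) : Function.Injective fun n => whitneyFuture n b := by
  intro m n h; cases b <;> simp [whitneyFuture] at h <;> omega

/-- The product of dyadic intervals of length `2ᵏ` in the Whitney decomposition. -/
def whitneyBox (i : ℤ × ℤ × Bool) : Set (ℝ × ℝ) :=
  dyInt i.1 (whitneyPast i.2.1 i.2.2) ×ˢ dyInt i.1 (whitneyFuture i.2.1 i.2.2)

theorem floor_div_two_zpow_succ (t : ℝ) (k : ℤ) : ⌊t / 2 ^ (k + 1)⌋ = ⌊t / 2 ^ k⌋ / 2 := by
  have h : t / 2 ^ (k + 1) = t / 2 ^ k / ((2 : ℕ) : ℝ) := by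
    rw [zpow_add₀ (by norm_num)]; simp [div_div]
  rw [h, Int.floor_div_natCast]; rfl

theorem mem_whitneyBox_iff {k n : ℤ} {b : Bool} {τ t : ℝ} :
    (τ, t) ∈ whitneyBox (k, n, b) ↔
      ⌊τ / 2 ^ k⌋ = whitneyPast n b ∧ ⌊t / 2 ^ k⌋ = whitneyFuture n b := by
  simp [whitneyBox, mem_dyInt_iff]

/-- A point lies in a box of scale `2ᵏ` exactly when `k` is the largest scale at which its
coordinates lie in separated intervals. -/
theorem exists_mem_whitneyBox_iff {k : ℤ} {τ t : ℝ} :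
    (∃ n b, (τ, t) ∈ whitneyBox (k, n, b)) ↔
      2 ≤ ⌊t / 2 ^ k⌋ - ⌊τ / 2 ^ k⌋ ∧ ⌊t / 2 ^ (k + 1)⌋ - ⌊τ / 2 ^ (k + 1)⌋ ≤ 1 := by
  simp only [mem_whitneyBox_iff, floor_div_two_zpow_succ]
  constructor
  · rintro ⟨n, b, h1, h2⟩
    cases b <;> simp [whitneyPast, whitneyFuture] at h1 h2 <;> omega
  · rintro ⟨h1, h2⟩
    by_cases h : ⌊t / 2 ^ k⌋ - ⌊τ / 2 ^ k⌋ = 2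
    · exact ⟨⌊τ / 2 ^ k⌋, false, by simp [whitneyPast], by simp [whitneyFuture]; omega⟩
    · exact ⟨⌊τ / 2 ^ k⌋ / 2, true, by simp [whitneyPast]; omega, by simp [whitneyFuture]; omega⟩

theorem separated_of_le {k l : ℤ} (hkl : k ≤ l) {τ t : ℝ}
    (h : 2 ≤ ⌊t / 2 ^ l⌋ - ⌊τ / 2 ^ l⌋) : 2 ≤ ⌊t / 2 ^ k⌋ - ⌊τ / 2 ^ k⌋ := by
  induction k, hkl using Int.leInductionDown with
  | base => exact h
  | pred k _ ih =>
    have h1 := floor_div_two_zpow_succ t (k - 1)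
    have h2 := floor_div_two_zpow_succ τ (k - 1)
    simp only [sub_add_cancel] at h1 h2
    omega

theorem iUnion_whitneyBox : ⋃ i, whitneyBox i = {z : ℝ × ℝ | z.1 < z.2} := by
  ext ⟨τ, t⟩
  simp only [Set.mem_iUnion, Set.mem_ofPred_eq, Prod.exists]
  constructor
  · rintro ⟨k, n, b, h⟩
    have h1 := (exists_mem_whitneyBox_iff.1 ⟨n, b, h⟩).1
    by_contra hlt
    have : ⌊t / 2 ^ k⌋ ≤ ⌊τ / 2 ^ k⌋ := Int.floor_le_floor (by gcongr; exact not_lt.1 hlt)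
    omega
  · intro hlt
    simp_rw [exists_mem_whitneyBox_iff]
    -- separation holds at small scales and fails at large ones
    have hsmall : ∃ k : ℤ, 2 ≤ ⌊t / 2 ^ k⌋ - ⌊τ / 2 ^ k⌋ := by
      obtain ⟨m, hm⟩ := pow_unbounded_of_one_lt (3 / (t - τ)) (one_lt_two (α := ℝ))
      refine ⟨-m, ?_⟩
      rw [div_lt_iff₀ (by linarith)] at hm
      have e : ∀ y : ℝ, y / 2 ^ (-(m : ℤ)) = y * 2 ^ m := fun y => by simp
      rw [e, e]
      have h1 := Int.floor_le (τ * 2 ^ m)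
      have h2 := Int.lt_floor_add_one (t * 2 ^ m)
      have : (1 : ℝ) < ((⌊t * 2 ^ m⌋ - ⌊τ * 2 ^ m⌋ : ℤ) : ℝ) := by push_cast; nlinarith
      have : 1 < ⌊t * 2 ^ m⌋ - ⌊τ * 2 ^ m⌋ := by exact_mod_cast this
      omega
    have hlarge : ∃ l : ℤ, ∀ k, 2 ≤ ⌊t / 2 ^ k⌋ - ⌊τ / 2 ^ k⌋ → k ≤ l := by
      obtain ⟨m, hm⟩ := pow_unbounded_of_one_lt (t - τ) (one_lt_two (α := ℝ))
      refine ⟨m, fun k hk => ?_⟩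
      by_contra hcon
      have h3 := separated_of_le (not_le.1 hcon).le hk
      have h1 := Int.lt_floor_add_one (τ / 2 ^ (m : ℤ))
      have h2 := Int.floor_le (t / 2 ^ (m : ℤ))
      have h4 : t / 2 ^ (m : ℤ) - τ / 2 ^ (m : ℤ) < 1 := by
        rw [← sub_div, div_lt_one (by positivity)]; simpa using hm
      have : ((⌊t / 2 ^ (m : ℤ)⌋ - ⌊τ / 2 ^ (m : ℤ)⌋ : ℤ) : ℝ) < 2 := by push_cast; linarith
      have : ⌊t / 2 ^ (m : ℤ)⌋ - ⌊τ / 2 ^ (m : ℤ)⌋ < 2 := by exact_mod_cast this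
      omega
    obtain ⟨l, hl⟩ := hlarge
    obtain ⟨k, hk, hmax⟩ := Int.exists_greatest_of_bdd ⟨l, hl⟩ hsmall
    refine ⟨k, hk, ?_⟩
    by_contra hcon
    have := hmax (k + 1) (by omega)
    omega

theorem pairwise_disjoint_whitneyBox : Pairwise (Function.onFun Disjoint whitneyBox) := by
  rintro ⟨k, n, b⟩ ⟨k', n', b'⟩ hne
  refine Set.disjoint_left.2 ?_
  rintro ⟨τ, t⟩ h h'
  have hk := exists_mem_whitneyBox_iff.1 ⟨n, b, h⟩
  have hk' := exists_mem_whitneyBox_iff.1 ⟨n', b', h'⟩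
  obtain rfl : k = k' := by
    rcases lt_trichotomy k k' with hlt | heq | hlt
    · have := separated_of_le (show k + 1 ≤ k' by omega) hk'.1; omega
    · exact heq
    · have := separated_of_le (show k' + 1 ≤ k by omega) hk.1; omega
  rw [mem_whitneyBox_iff] at h h'
  apply hne
  cases b <;> cases b' <;> simp [whitneyPast, whitneyFuture] at h h' ⊢ <;> omega

theorem measurableSet_whitneyBox (i : ℤ × ℤ × Bool) : MeasurableSet (whitneyBox i) :=
  (measurableSet_dyInt _ _).prod (measurableSet_dyInt _ _)

theorem tsum_lpSize_rpow_le {x : ℝ} (hx : 0 < x) (f : ℝ → ℝ≥0∞) (k : ℤ) {e : ℤ → ℤ}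
    (he : Function.Injective e) :
    ∑' n : ℤ, lpSize x (volume.restrict (dyInt k (e n))) f ^ x ≤ lpSize x volume f ^ x := by
  simp_rw [lpSize_rpow hx]
  rw [← lintegral_iUnion (fun n => measurableSet_dyInt k (e n))]
  · exact setLIntegral_le_lintegral _ _
  · exact fun m n hmn => pairwise_disjoint_dyInt k (he.ne hmn)

/-- The contribution of one scale, for exponents whose reciprocals add up to at least `1`. -/
theorem tsum_whitney_scale_le {x u X Y : ℝ} (hx : 1 ≤ x) (hu : 1 ≤ u) (hxX : x ≤ X) (huY : u ≤ Y)
    (hXY : 1 ≤ 1 / X + 1 / Y) {f g : ℝ → ℝ≥0∞} (hf : Measurable f) (hg : Measurable g) (k : ℤ) :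
    ∑' (n : ℤ) (b : Bool), lpSize x (volume.restrict (dyInt k (whitneyPast n b))) f *
        lpSize u (volume.restrict (dyInt k (whitneyFuture n b))) g ≤
      2 * 2 ^ (k * ((1 / x - 1 / X) + (1 / u - 1 / Y))) *
        (lpSize X volume f * lpSize Y volume g) := by
  have hX0 : 0 < X := by linarith
  have hY0 : 0 < Y := by linarith
  rw [ENNReal.tsum_comm]
  have key : ∀ b : Bool, ∑' (n : ℤ), lpSize x (volume.restrict (dyInt k (whitneyPast n b))) f *
        lpSize u (volume.restrict (dyInt k (whitneyFuture n b))) g ≤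
      2 ^ (k * ((1 / x - 1 / X) + (1 / u - 1 / Y))) *
        (lpSize X volume f * lpSize Y volume g) := by
    intro b
    have h1 : ∀ (y Z : ℝ), 1 ≤ y → y ≤ Z → ∀ (h : ℝ → ℝ≥0∞), Measurable h → ∀ n,
        lpSize y (volume.restrict (dyInt k n)) h ≤
          2 ^ (k * (1 / y - 1 / Z)) * lpSize Z (volume.restrict (dyInt k n)) h := by
      intro y Z hy hyZ h hh n
      refine (lpSize_le_of_le (by linarith) hyZ _ hh.aemeasurable).trans (le_of_eq ?_)
      rw [Measure.restrict_apply_univ, volume_dyInt, ← ENNReal.rpow_mul]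
    have h2 : ∀ (Z : ℝ), 0 < Z → ∀ (h : ℝ → ℝ≥0∞) (e : ℤ → ℤ), Function.Injective e →
        (∑' n : ℤ, lpSize Z (volume.restrict (dyInt k (e n))) h ^ Z) ^ (1 / Z) ≤
          lpSize Z volume h := by
      intro Z hZ h e he
      calc _ ≤ (lpSize Z volume h ^ Z) ^ (1 / Z) := by
            gcongr; exact tsum_lpSize_rpow_le hZ h k he
        _ = _ := by rw [← ENNReal.rpow_mul, mul_one_div_cancel hZ.ne', ENNReal.rpow_one]
    calc _ ≤ ∑' (n : ℤ), 2 ^ (k * ((1 / x - 1 / X) + (1 / u - 1 / Y))) *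
          (lpSize X (volume.restrict (dyInt k (whitneyPast n b))) f *
          lpSize Y (volume.restrict (dyInt k (whitneyFuture n b))) g) := by
          refine ENNReal.tsum_le_tsum fun n => ?_
          refine (mul_le_mul' (h1 x X hx hxX f hf _) (h1 u Y hu huY g hg _)).trans (le_of_eq ?_)
          rw [mul_add, two_rpow_add]; ring
      _ ≤ _ := by
          rw [ENNReal.tsum_mul_left]
          gcongr
          refine (ENNReal.tsum_mul_le_of_one_le (hx.trans hxX) (hu.trans huY) hXY _ _).trans ?_
          exact mul_le_mul' (h2 X hX0 f _ (whitneyPast_injective b))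
            (h2 Y hY0 g _ (whitneyFuture_injective b))
  rw [tsum_fintype, Fintype.sum_bool]
  refine (add_le_add (key true) (key false)).trans (le_of_eq ?_)
  ring

section Atoms

variable {X : Type*} [MeasurableSpace X]

/-- The restriction of `h` to its `m`-th atom. -/
def atomPart (ν : Measure X) (h : X → ℝ≥0∞) (m : ℤ) : X → ℝ≥0∞ :=
  (h ⁻¹' atomValues ν h m).indicator h

theorem measurable_atomPart (ν : Measure X) {h : X → ℝ≥0∞} (hh : Measurable h) (m : ℤ) :
    Measurable (atomPart ν h m) :=
  hh.indicator (hh (measurableSet_atomValues ν h m))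

theorem lintegral_atomPart_rpow (ν ν' : Measure X) {h : X → ℝ≥0∞} (hh : Measurable h) (m : ℤ)
    {P : ℝ} (hP : 0 < P) :
    ∫⁻ x, atomPart ν h m x ^ P ∂ν' = ∫⁻ x in h ⁻¹' atomValues ν h m, h x ^ P ∂ν' := by
  rw [← lintegral_indicator (hh (measurableSet_atomValues ν h m))]
  congr 1; ext x
  by_cases hx : x ∈ h ⁻¹' atomValues ν h m
  · simp only [atomPart, Set.indicator_of_mem hx]
  · simp only [atomPart, Set.indicator_of_notMem hx, ENNReal.zero_rpow_of_pos hP]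

theorem exists_lpSize_atomPart_le {P p : ℝ} (hP : 0 < P) (hp : 0 < p) :
    ∃ C : ℝ≥0, ∀ {X : Type*} [MeasurableSpace X] (ν : Measure X) (h : X → ℝ≥0∞),
      Measurable h → (∀ i, ν (levelSet h i) ≠ ∞) → ∀ m : ℤ,
      lpSize P ν (atomPart ν h m) ≤
        C * 2 ^ (m * (1 / P - 1 / p)) * lpSize p ν (atomPart ν h m) := by
  obtain ⟨C, hC⟩ := exists_lintegral_atom_le hP hp
  refine ⟨C ^ (1 / P), fun ν h hh hlev m => ?_⟩
  have hP1 : 0 ≤ 1 / P := by positivity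
  unfold lpSize
  rw [lintegral_atomPart_rpow ν ν hh m hP, lintegral_atomPart_rpow ν ν hh m hp]
  calc _ ≤ _ := ENNReal.rpow_le_rpow (hC ν h hh hlev m) hP1
    _ = _ := by
      rw [ENNReal.mul_rpow_of_nonneg _ _ hP1, ENNReal.mul_rpow_of_nonneg _ _ hP1,
        ← ENNReal.rpow_mul, ENNReal.mul_rpow_of_nonneg _ _ (by positivity), ← ENNReal.rpow_mul,
        ENNReal.mul_rpow_of_nonneg _ _ hP1, ← ENNReal.rpow_mul, ← ENNReal.rpow_mul, ENNReal.coe_rpow_of_nonneg _ hP1, mul_sub,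
        sub_eq_add_neg, two_rpow_add]
      have e1 : P / p * (1 / P) = 1 / p := by field_simp
      have e2 : -(m : ℝ) * (P / p) * (1 / P) = -((m : ℝ) * (1 / p)) := by rw [mul_assoc, e1]; ring
      rw [e2, e1]; ring

theorem tsum_lpSize_atomPart_le (ν : Measure X) {h : X → ℝ≥0∞} (hh : Measurable h) {p : ℝ}
    (hp : 0 < p) : (∑' m, lpSize p ν (atomPart ν h m) ^ p) ^ (1 / p) ≤ lpSize p ν h := by
  simp_rw [lpSize_rpow hp, lintegral_atomPart_rpow ν ν hh _ hp]
  unfold lpSize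
  gcongr
  exact tsum_lintegral_atom_le ν hh _

theorem le_tsum_atomPart_rpow (ν : Measure X) (h : X → ℝ≥0∞) {x : X}
    (hx : h x ≠ ∞) {z : ℝ} (hz : 0 < z) : h x ^ z ≤ ∑' m, atomPart ν h m x ^ z := by
  rcases eq_or_ne (h x) 0 with h0 | h0
  · simp [h0, hz]
  · refine le_trans ?_ (ENNReal.le_tsum (dyadicLevel (ν (levelSet h (dyadicLevel (h x))))))
    have : x ∈ h ⁻¹' atomValues ν h (dyadicLevel (ν (levelSet h (dyadicLevel (h x))))) :=
      ⟨h0, hx, rfl⟩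
    rw [atomPart, Set.indicator_of_mem this]

theorem lpSize_le_tsum_atomPart (ν ν' : Measure X) {h : X → ℝ≥0∞} (hh : Measurable h)
    (hfin : ∀ x, h x ≠ ∞) {z : ℝ} (hz : 1 ≤ z) :
    lpSize z ν' h ≤ ∑' m, lpSize z ν' (atomPart ν h m) := by
  have hz0 : 0 < z := by linarith
  calc lpSize z ν' h ≤ (∑' m, lpSize z ν' (atomPart ν h m) ^ z) ^ (1 / z) := by
        simp_rw [lpSize_rpow hz0]
        rw [← lintegral_tsum (fun m =>
          ((measurable_atomPart ν hh m).pow_const z).aemeasurable)]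
        unfold lpSize
        gcongr with x
        exact le_tsum_atomPart_rpow ν h (hfin x) hz0
    _ ≤ (∑' m, lpSize z ν' (atomPart ν h m) ^ (1 : ℝ)) ^ (1 / (1 : ℝ)) :=
        ENNReal.tsum_rpow_le_of_le one_pos hz _
    _ = _ := by simp

end Atoms

/-- Summation of local estimates over the Whitney decomposition below the line of duality. Time
atoms of `f` and `g` at scale `2ᵐ` interact with intervals of length `2ᵏ` with a gain in
`|m - k|`, since the exponents of the local estimate may be varied. -/
theorem exists_whitney_sum_le {x u X₀ Y₀ : ℝ} (hx : 1 ≤ x) (hu : 1 ≤ u) (hxX : x < X₀)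
    (huY : u < Y₀) (hXY : 1 < 1 / X₀ + 1 / Y₀) :
    ∃ C : ℝ≥0, ∀ f g : ℝ → ℝ≥0∞, Measurable f → Measurable g → (∀ t, f t ≠ ∞) →
      (∀ t, g t ≠ ∞) → lpSize X₀ volume f ≠ ∞ → lpSize Y₀ volume g ≠ ∞ →
      ∑' (k : ℤ) (n : ℤ) (b : Bool), 2 ^ (k * (1 / X₀ + 1 / Y₀ - 1 / x - 1 / u)) *
        (lpSize x (volume.restrict (dyInt k (whitneyPast n b))) f *
          lpSize u (volume.restrict (dyInt k (whitneyFuture n b))) g) ≤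
      C * (lpSize X₀ volume f * lpSize Y₀ volume g) := by
  have hX0 : 0 < X₀ := by linarith
  have hY0 : 0 < Y₀ := by linarith
  have dx : 0 < 1 / x - 1 / X₀ := sub_pos.2 (one_div_lt_one_div_of_lt (by linarith) hxX)
  have du : 0 < 1 / u - 1 / Y₀ := sub_pos.2 (one_div_lt_one_div_of_lt (by linarith) huY)
  obtain ⟨ε, hε, e1, e2, e3, e4, e5⟩ : ∃ ε : ℝ, 0 < ε ∧ ε ≤ 1 / x - 1 / X₀ ∧
      ε ≤ 1 / u - 1 / Y₀ ∧ ε ≤ (1 / X₀ + 1 / Y₀ - 1) / 2 ∧ ε < 1 / X₀ ∧ ε < 1 / Y₀ := by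
    refine ⟨min (min (1 / x - 1 / X₀) (1 / u - 1 / Y₀)) (min ((1 / X₀ + 1 / Y₀ - 1) / 2)
      (min (1 / X₀ / 2) (1 / Y₀ / 2))), ?_, ?_, ?_, ?_, ?_, ?_⟩
    · have : 0 < 1 / X₀ := by positivity
      have : 0 < 1 / Y₀ := by positivity
      refine lt_min (lt_min dx du) (lt_min (by linarith) (lt_min (by linarith) (by linarith)))
    · exact (min_le_left _ _).trans (min_le_left _ _)
    · exact (min_le_left _ _).trans (min_le_right _ _)
    · exact (min_le_right _ _).trans (min_le_left _ _)
    · refine (((min_le_right _ _).trans (min_le_right _ _)).trans (min_le_left _ _)).trans_lt ?_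
      have : 0 < 1 / X₀ := by positivity
      linarith
    · refine (((min_le_right _ _).trans (min_le_right _ _)).trans (min_le_right _ _)).trans_lt ?_
      have : 0 < 1 / Y₀ := by positivity
      linarith
  obtain ⟨C0, hC0⟩ := exists_tsum_le_of_signs (c₁ := 1) (c₂ := 1) hε one_ne_zero one_ne_zero
    (hx.trans hxX.le) (hu.trans huY.le) hXY.le
  have hsgn : ∀ s ∈ ({1, -1} : Set ℝ), |s * ε| = ε := by
    rintro s (rfl | rfl) <;> simp [abs_of_pos hε]
  -- the perturbed exponents `1 / X = 1 / X₀ ± ε`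
  have hA : ∃ C : ℝ≥0, ∀ (Z : ℝ), 0 < Z → ε < 1 / Z → Z = X₀ ∨ Z = Y₀ →
      ∀ s ∈ ({1, -1} : Set ℝ), ∀ h : ℝ → ℝ≥0∞, Measurable h →
      (∀ i, volume (levelSet h i) ≠ ∞) → ∀ m : ℤ,
      lpSize (1 / (1 / Z + s * ε)) volume (atomPart volume h m) ≤
        C * 2 ^ (m * (s * ε)) * lpSize Z volume (atomPart volume h m) := by
    have hone : ∀ (Z : ℝ), 0 < Z → ε < 1 / Z → ∀ s ∈ ({1, -1} : Set ℝ), ∃ C : ℝ≥0,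
        ∀ h : ℝ → ℝ≥0∞, Measurable h → (∀ i, volume (levelSet h i) ≠ ∞) → ∀ m : ℤ,
        lpSize (1 / (1 / Z + s * ε)) volume (atomPart volume h m) ≤
        C * 2 ^ (m * (s * ε)) * lpSize Z volume (atomPart volume h m) := by
      intro Z hZ hZε s hs
      have hpos : 0 < 1 / Z + s * ε := by
        have := neg_abs_le (s * ε); rw [hsgn s hs] at this; linarith
      obtain ⟨C, hC⟩ := exists_lpSize_atomPart_le (P := 1 / (1 / Z + s * ε)) (p := Z)
        (by positivity) hZ
      refine ⟨C, fun h hh hlev m => (hC volume h hh hlev m).trans (le_of_eq ?_)⟩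
      rw [one_div_one_div]; congr 3; ring
    obtain ⟨a, ha⟩ := hone X₀ hX0 e4 1 (by simp)
    obtain ⟨b, hb⟩ := hone X₀ hX0 e4 (-1) (by simp)
    obtain ⟨c, hc⟩ := hone Y₀ hY0 e5 1 (by simp)
    obtain ⟨d, hd⟩ := hone Y₀ hY0 e5 (-1) (by simp)
    refine ⟨max (max a b) (max c d), ?_⟩
    rintro Z hZ hZε (rfl | rfl) s (rfl | rfl) h hh hlev m
    · refine (ha h hh hlev m).trans ?_
      gcongr; exact (le_max_left a b).trans (le_max_left _ _)
    · refine (hb h hh hlev m).trans ?_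
      gcongr; exact (le_max_right a b).trans (le_max_left _ _)
    · refine (hc h hh hlev m).trans ?_
      gcongr; exact (le_max_left c d).trans (le_max_right _ _)
    · refine (hd h hh hlev m).trans ?_
      gcongr; exact (le_max_right c d).trans (le_max_right _ _)
  obtain ⟨C1, hC1⟩ := hA
  refine ⟨C0 * (2 * C1 * C1), fun f g hf hg hft hgt hfn hgn => ?_⟩
  have hlf : ∀ i, volume (levelSet f i) ≠ ∞ := levelSet_measure_ne_top _ hf hX0 (by
    rw [← lpSize_rpow hX0]; exact ENNReal.rpow_ne_top_of_nonneg hX0.le hfn)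
  have hlg : ∀ i, volume (levelSet g i) ≠ ∞ := levelSet_measure_ne_top _ hg hY0 (by
    rw [← lpSize_rpow hY0]; exact ENNReal.rpow_ne_top_of_nonneg hY0.le hgn)
  set γ := 1 / X₀ + 1 / Y₀ - 1 / x - 1 / u with hγ
  set F := fun m => atomPart volume f m
  set G := fun l => atomPart volume g l
  set β : ℤ → ℤ → ℤ → ℝ≥0∞ := fun k m l => ∑' (n : ℤ) (b : Bool), 2 ^ (k * γ) *
    (lpSize x (volume.restrict (dyInt k (whitneyPast n b))) (F m) *
      lpSize u (volume.restrict (dyInt k (whitneyFuture n b))) (G l)) with hβ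
  have hsplit : ∑' (k : ℤ) (n : ℤ) (b : Bool), 2 ^ (k * γ) *
        (lpSize x (volume.restrict (dyInt k (whitneyPast n b))) f *
          lpSize u (volume.restrict (dyInt k (whitneyFuture n b))) g) ≤
      ∑' k, ∑' m, ∑' l, β k m l := by
    refine ENNReal.tsum_le_tsum fun k => ?_
    calc _ ≤ ∑' (n : ℤ) (b : Bool) (m : ℤ) (l : ℤ), 2 ^ (k * γ) *
          (lpSize x (volume.restrict (dyInt k (whitneyPast n b))) (F m) *
          lpSize u (volume.restrict (dyInt k (whitneyFuture n b))) (G l)) := by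
          refine ENNReal.tsum_le_tsum fun n => ENNReal.tsum_le_tsum fun b => ?_
          simp_rw [ENNReal.tsum_mul_left, ENNReal.tsum_mul_right]
          gcongr
          · exact lpSize_le_tsum_atomPart volume _ hf hft hx
          · exact lpSize_le_tsum_atomPart volume _ hg hgt hu
      _ = _ := by
          simp_rw [hβ]
          have e : ∀ n : ℤ, ∀ a : Bool → ℤ → ℤ → ℝ≥0∞,
              ∑' b, ∑' m, ∑' l, a b m l = ∑' m, ∑' l, ∑' b, a b m l := by
            intro n a
            rw [ENNReal.tsum_comm]
            congr 1; ext m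
            rw [ENNReal.tsum_comm]
          simp_rw [e 0]
          rw [ENNReal.tsum_comm]
          congr 1; ext m
          rw [ENNReal.tsum_comm]
  refine hsplit.trans ?_
  have hmain := hC0 0 0 (2 * C1 * C1) β (fun m => lpSize X₀ volume (F m))
    (fun l => lpSize Y₀ volume (G l)) ?_
  · refine hmain.trans ?_
    push_cast
    gcongr
    · exact tsum_lpSize_atomPart_le volume hf hX0
    · exact tsum_lpSize_atomPart_le volume hg hY0
  · intro k m l s₁ hs₁ s₂ hs₂
    have a1 := le_abs_self (s₁ * ε); have a1' := neg_abs_le (s₁ * ε)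
    have a2 := le_abs_self (s₂ * ε); have a2' := neg_abs_le (s₂ * ε)
    rw [hsgn s₁ hs₁] at a1 a1'; rw [hsgn s₂ hs₂] at a2 a2'
    have hpX : 0 < 1 / X₀ + s₁ * ε := by linarith
    have hpY : 0 < 1 / Y₀ + s₂ * ε := by linarith
    have hxZ : x ≤ 1 / (1 / X₀ + s₁ * ε) := by
      rw [le_one_div (by linarith) hpX]; linarith
    have huZ : u ≤ 1 / (1 / Y₀ + s₂ * ε) := by
      rw [le_one_div (by linarith) hpY]; linarith
    have h1 := tsum_whitney_scale_le hx hu hxZ huZ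
      (by rw [one_div_one_div, one_div_one_div]; linarith)
      (measurable_atomPart volume hf m) (measurable_atomPart volume hg l) k
    rw [one_div_one_div, one_div_one_div] at h1
    calc β k m l = 2 ^ (k * γ) * ∑' (n : ℤ) (b : Bool),
          lpSize x (volume.restrict (dyInt k (whitneyPast n b))) (F m) *
          lpSize u (volume.restrict (dyInt k (whitneyFuture n b))) (G l) := by
          simp_rw [hβ, ENNReal.tsum_mul_left]
      _ ≤ 2 ^ (k * γ) * (2 * 2 ^ (k * ((1 / x - (1 / X₀ + s₁ * ε)) +
          (1 / u - (1 / Y₀ + s₂ * ε)))) *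
          ((C1 * 2 ^ (m * (s₁ * ε)) * lpSize X₀ volume (F m)) *
            (C1 * 2 ^ (l * (s₂ * ε)) * lpSize Y₀ volume (G l)))) := by
          gcongr
          refine h1.trans ?_
          gcongr
          · exact hC1 X₀ hX0 e4 (Or.inl rfl) s₁ hs₁ f hf hlf m
          · exact hC1 Y₀ hY0 e5 (Or.inr rfl) s₂ hs₂ g hg hlg l
      _ = _ := by
          have e : (2 : ℝ≥0∞) ^ (k * γ) * 2 ^ (k * ((1 / x - (1 / X₀ + s₁ * ε)) +
              (1 / u - (1 / Y₀ + s₂ * ε)))) * 2 ^ (m * (s₁ * ε)) * 2 ^ (l * (s₂ * ε)) =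
              2 ^ (s₁ * ε * (m - 1 * k - 0)) * 2 ^ (s₂ * ε * (l - 1 * k - 0)) := by
            simp only [← two_rpow_add]; congr 1; rw [hγ]; ring
          calc _ = 2 * C1 * C1 * (((2 : ℝ≥0∞) ^ (k * γ) * 2 ^ (k * ((1 / x - (1 / X₀ + s₁ * ε)) +
              (1 / u - (1 / Y₀ + s₂ * ε)))) * 2 ^ (m * (s₁ * ε)) * 2 ^ (l * (s₂ * ε))) *
              (lpSize X₀ volume (F m) * lpSize Y₀ volume (G l))) := by ring
            _ = _ := by rw [e]; ring

/-! ### `Lʸ` norms on the Hilbert space `L²(μ; H)` -/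

section SpaceNorm

variable {X : Type*} [MeasurableSpace X] {μ : Measure X}
  {H : Type*} [NormedAddCommGroup H]

/-- The `Lʸ` norm, possibly infinite, of an element of `L²(μ; H)`. -/
def spSize (y : ℝ) (f : Lp H 2 μ) : ℝ≥0∞ := lpSize y μ fun r => ‖f r‖ₑ

theorem spSize_eq_eLpNorm {y : ℝ} (hy : 0 < y) (f : Lp H 2 μ) :
    spSize y f = eLpNorm f (ENNReal.ofReal y) μ := by
  rw [eLpNorm_eq_lintegral_rpow_enorm_toReal (by simpa using hy) ENNReal.ofReal_ne_top,
    ENNReal.toReal_ofReal hy.le]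
  rfl

theorem spSize_two (f : Lp H 2 μ) : spSize 2 f = ‖f‖ₑ := by
  rw [spSize_eq_eLpNorm (by norm_num), Lp.enorm_def]; norm_num

theorem isClosed_spSize_le {y : ℝ} (hy : 0 < y) (c : ℝ≥0∞) :
    IsClosed {f : Lp H 2 μ | spSize y f ≤ c} := by
  simp_rw [spSize_eq_eLpNorm hy]
  refine IsSeqClosed.isClosed fun f f' hf hlim => ?_
  obtain ⟨ns, hns, hae⟩ := (tendstoInMeasure_of_tendsto_Lp hlim).exists_seq_tendsto_ae
  exact Lp.eLpNorm_le_of_ae_tendsto (u := Filter.atTop) (Filter.Eventually.of_forall fun n => hf (ns n))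
    (fun n => Lp.aestronglyMeasurable _) hae

theorem measurable_spSize [MeasurableSpace (Lp H 2 μ)] [BorelSpace (Lp H 2 μ)] {y : ℝ}
    (hy : 0 < y) : Measurable (spSize y : Lp H 2 μ → ℝ≥0∞) :=
  LowerSemicontinuous.measurable
    (lowerSemicontinuous_iff_isClosed_preimage.2 fun c => isClosed_spSize_le hy c)

theorem aemeasurable_spSize {Ω : Type*} [MeasurableSpace Ω] {ν : Measure Ω} {y : ℝ} (hy : 0 < y)
    {F : Ω → Lp H 2 μ} (hF : AEStronglyMeasurable F ν) :
    AEMeasurable (fun t => spSize y (F t)) ν := by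
  let _ : MeasurableSpace (Lp H 2 μ) := borel _
  have : BorelSpace (Lp H 2 μ) := ⟨rfl⟩
  exact (measurable_spSize hy).comp_aemeasurable hF.aemeasurable

theorem spSize_add_le {y : ℝ} (hy : 1 ≤ y) (f g : Lp H 2 μ) :
    spSize y (f + g) ≤ spSize y f + spSize y g := by
  have hy0 : 0 < y := by linarith
  simp_rw [spSize_eq_eLpNorm hy0]
  rw [eLpNorm_congr_ae (Lp.coeFn_add f g)]
  exact eLpNorm_add_le (Lp.aestronglyMeasurable f) (Lp.aestronglyMeasurable g) (by simpa using hy)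

theorem spSize_neg (y : ℝ) (f : Lp H 2 μ) : spSize y (-f) = spSize y f := by
  unfold spSize lpSize
  congr 1
  refine lintegral_congr_ae ?_
  filter_upwards [Lp.coeFn_neg f] with r hr
  rw [hr, Pi.neg_apply, enorm_neg]

theorem spSize_zero {y : ℝ} (hy : 0 < y) : spSize y (0 : Lp H 2 μ) = 0 := by
  rw [spSize_eq_eLpNorm hy, eLpNorm_congr_ae (Lp.coeFn_zero H 2 μ), eLpNorm_zero]

theorem spSize_smul [InnerProductSpace ℂ H] {y : ℝ} (hy : 0 < y) (c : ℂ) (f : Lp H 2 μ) :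
    spSize y (c • f) = ‖c‖ₑ * spSize y f := by
  simp_rw [spSize_eq_eLpNorm hy]
  rw [eLpNorm_congr_ae (Lp.coeFn_smul c f), eLpNorm_const_smul]

variable [InnerProductSpace ℂ H]

theorem enorm_inner_le_lintegral (f g : Lp H 2 μ) :
    ‖inner ℂ f g‖ₑ ≤ ∫⁻ r, ‖f r‖ₑ * ‖g r‖ₑ ∂μ := by
  rw [L2.inner_def]
  refine (enorm_integral_le_lintegral_enorm _).trans (lintegral_mono fun r => ?_)
  rw [← ofReal_norm, ← ofReal_norm, ← ofReal_norm, ← ENNReal.ofReal_mul (norm_nonneg _)]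
  exact ENNReal.ofReal_le_ofReal (norm_inner_le_norm _ _)

theorem enorm_inner_le_spSize {y z : ℝ} (hyz : y.HolderConjugate z) (f g : Lp H 2 μ) :
    ‖inner ℂ f g‖ₑ ≤ spSize y f * spSize z g :=
  (enorm_inner_le_lintegral f g).trans
    (ENNReal.lintegral_mul_le_Lp_mul_Lq μ hyz (Lp.aestronglyMeasurable f).enorm
      (Lp.aestronglyMeasurable g).enorm)

theorem enorm_inner_le_spSize_one (f g : Lp H 2 μ) :
    ‖inner ℂ f g‖ₑ ≤ spSize 1 f * eLpNorm g ∞ μ := by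
  refine (enorm_inner_le_lintegral f g).trans ?_
  rw [spSize, lpSize, one_div_one, ENNReal.rpow_one, eLpNorm_exponent_top]
  simp_rw [ENNReal.rpow_one]
  rw [← lintegral_mul_const'' _ (Lp.aestronglyMeasurable f).enorm]
  refine lintegral_mono_ae ?_
  filter_upwards [enorm_ae_le_eLpNormEssSup g μ] with r hr
  gcongr

/-- The converse of Hölder's inequality: the `Lᵖ` norm is attained by testing against elements of
the dual unit ball which lie in `L²`. -/
theorem spSize_le_of_forall_inner {p p' : ℝ} (hp : 2 < p) (hpp : p.HolderConjugate p')
    (u : Lp H 2 μ) (S : ℝ≥0∞)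
    (hS : ∀ h : Lp H 2 μ, spSize p' h ≤ 1 → ENNReal.ofReal (inner ℂ h u).re ≤ S) :
    spSize p u ≤ S := by
  have hp0 : 0 < p := by linarith
  have hp'0 : 0 < p' := hpp.symm.pos
  -- truncations of the extremizer `|u| ^ (p - 2) u`
  have key : ∀ R : ℕ, (∫⁻ r in {r | ‖u r‖ ≤ R}, ‖u r‖ₑ ^ p ∂μ) ^ (1 / p) ≤ S := by
    intro R
    set A : Set X := {r | ‖u r‖ ≤ R} with hA
    have hum : StronglyMeasurable (u : X → H) := Lp.stronglyMeasurable u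
    have hAm : MeasurableSet A := measurableSet_le hum.norm.measurable measurable_const
    set K := ∫⁻ r in A, ‖u r‖ₑ ^ p ∂μ with hK
    have hKfin : K ≠ ∞ := by
      have h2 : ∫⁻ r, ‖u r‖ₑ ^ (2 : ℝ) ∂μ ≠ ∞ := by
        have h3 := lpSize_rpow (x := 2) (by norm_num) μ fun r => ‖u r‖ₑ
        rw [← h3]
        refine ENNReal.rpow_ne_top_of_nonneg (by norm_num) ?_
        have : lpSize 2 μ (fun r => ‖u r‖ₑ) = spSize 2 u := rfl
        rw [this, spSize_two]; exact enorm_ne_top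
      refine ne_top_of_le_ne_top (ENNReal.mul_ne_top (ENNReal.rpow_ne_top_of_nonneg
        (y := p - 2) (by linarith) (ENNReal.natCast_ne_top R)) h2) ?_
      rw [← lintegral_const_mul _ (hum.enorm.pow_const _)]
      refine le_trans (setLIntegral_mono' hAm fun r hr => ?_) (setLIntegral_le_lintegral A _)
      have hr' : ‖u r‖ₑ ≤ (R : ℝ≥0∞) := by
        rw [← ofReal_norm, ← ENNReal.ofReal_natCast]; exact ENNReal.ofReal_le_ofReal hr
      calc ‖u r‖ₑ ^ p = ‖u r‖ₑ ^ (p - 2) * ‖u r‖ₑ ^ (2 : ℝ) := by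
            rw [← ENNReal.rpow_add_of_nonneg _ _ (by linarith) (by norm_num)]; congr 1; ring
        _ ≤ _ := by gcongr
    rcases eq_or_ne K 0 with hK0 | hK0
    · rw [hK0, ENNReal.zero_rpow_of_pos (by positivity)]; exact zero_le
    -- the test function, before normalization
    set φ : X → H := A.indicator fun r => ((‖u r‖ ^ (p - 2) : ℝ) : ℂ) • u r with hφ
    have hφm : StronglyMeasurable φ := by
      refine StronglyMeasurable.indicator (StronglyMeasurable.smul ?_ hum) hAm
      exact (Complex.continuous_ofReal.measurable.comp
        (hum.norm.measurable.pow_const _)).stronglyMeasurable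
    have hφn : ∀ r, ‖φ r‖ₑ = A.indicator (fun r => ‖u r‖ₑ ^ (p - 1)) r := by
      intro r
      by_cases hr : r ∈ A
      · simp only [hφ, Set.indicator_of_mem hr, enorm_smul]
        have : ‖((‖u r‖ ^ (p - 2) : ℝ) : ℂ)‖ₑ = ‖u r‖ₑ ^ (p - 2) := by
          rw [← ofReal_norm, ← ofReal_norm, Complex.norm_real, Real.norm_of_nonneg (by positivity),
            ENNReal.ofReal_rpow_of_nonneg (norm_nonneg _) (by linarith)]
        rw [this]
        nth_rw 2 [← ENNReal.rpow_one ‖u r‖ₑ]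
        rw [← ENNReal.rpow_add_of_nonneg _ _ (by linarith) (by norm_num)]
        congr 1; ring
      · simp [hφ, Set.indicator_of_notMem hr]
    have hφ2 : MemLp φ 2 μ := by
      refine MemLp.of_enorm_le_mul (c := ((R : ℝ≥0) ^ (p - 2))) (Lp.memLp u)
        hφm.aestronglyMeasurable (Filter.Eventually.of_forall fun r => ?_)
      rw [hφn r]
      by_cases hr : r ∈ A
      · rw [Set.indicator_of_mem hr]
        have hr' : ‖u r‖ₑ ≤ (R : ℝ≥0∞) := by
          rw [← ofReal_norm, ← ENNReal.ofReal_natCast]; exact ENNReal.ofReal_le_ofReal hr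
        calc ‖u r‖ₑ ^ (p - 1) = ‖u r‖ₑ ^ (p - 2) * ‖u r‖ₑ ^ (1 : ℝ) := by
              rw [← ENNReal.rpow_add_of_nonneg _ _ (by linarith) (by norm_num)]; congr 1; ring
          _ ≤ _ := by
              rw [ENNReal.rpow_one, ENNReal.coe_rpow_of_nonneg _ (by linarith)]
              gcongr
              simpa using hr'
      · simp [Set.indicator_of_notMem hr]
    set h := hφ2.toLp φ with hh
    have hint : (inner ℂ h u).re = K.toReal := by
      have e1 : ∀ᵐ r ∂μ, inner ℂ (h r) (u r) =
          ((A.indicator (fun r => ‖u r‖ ^ p) r : ℝ) : ℂ) := by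
        filter_upwards [hφ2.coeFn_toLp] with r hr
        rw [hh, hr]
        by_cases hrA : r ∈ A
        · simp only [hφ, Set.indicator_of_mem hrA, inner_smul_left, Complex.conj_ofReal]
          rw [inner_self_eq_norm_sq_to_K]
          simp only [Complex.coe_algebraMap]
          norm_cast
          rw [← Real.rpow_natCast, ← Real.rpow_add_of_nonneg (norm_nonneg _) (by linarith)
            (by norm_num)]
          congr 1; push_cast; ring
        · simp [hφ, Set.indicator_of_notMem hrA]
      rw [L2.inner_def, integral_congr_ae e1, integral_complex_ofReal, Complex.ofReal_re,
        integral_eq_lintegral_of_nonneg_ae]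
      · congr 1
        rw [hK, ← lintegral_indicator hAm]
        congr 1; ext r
        by_cases hrA : r ∈ A
        · rw [Set.indicator_of_mem hrA, Set.indicator_of_mem hrA,
            ← ENNReal.ofReal_rpow_of_nonneg (norm_nonneg _) hp0.le, ofReal_norm]
        · simp [Set.indicator_of_notMem hrA]
      · exact Filter.Eventually.of_forall fun r => Set.indicator_nonneg
          (fun r _ => by positivity) r
      · exact ((hum.norm.measurable.pow_const _).indicator hAm).aestronglyMeasurable
    have hsize : spSize p' h = K ^ (1 / p') := by
      unfold spSize lpSize
      congr 1
      rw [hK, ← lintegral_indicator hAm]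
      refine lintegral_congr_ae ?_
      filter_upwards [hφ2.coeFn_toLp] with r hr
      rw [hh, hr, hφn r]
      by_cases hrA : r ∈ A
      · rw [Set.indicator_of_mem hrA, Set.indicator_of_mem hrA, ← ENNReal.rpow_mul]
        congr 1; rw [hpp.conjugate_eq]; field_simp [hpp.sub_one_ne_zero]
      · simp [Set.indicator_of_notMem hrA, hp'0]
    set κ : ℝ := (K ^ (1 / p')).toReal with hκ
    have hKp : K ^ (1 / p') ≠ ∞ := ENNReal.rpow_ne_top_of_nonneg (by positivity) hKfin
    have hKp0 : K ^ (1 / p') ≠ 0 := by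
      simp [ENNReal.rpow_eq_zero_iff, hK0, hKfin]
    have hκ0 : 0 < κ := ENNReal.toReal_pos hKp0 hKp
    have h1 := hS (((κ⁻¹ : ℝ) : ℂ) • h) (by
      rw [spSize_smul hp'0, hsize, ← ofReal_norm, Complex.norm_real,
        Real.norm_of_nonneg (by positivity), ENNReal.ofReal_inv_of_pos hκ0, hκ,
        ENNReal.ofReal_toReal hKp]
      exact ENNReal.inv_mul_le_one _)
    rw [inner_smul_left, Complex.conj_ofReal, Complex.re_ofReal_mul, hint,
      ENNReal.ofReal_mul (by positivity), ENNReal.ofReal_toReal hKfin,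
      ENNReal.ofReal_inv_of_pos hκ0, hκ, ENNReal.ofReal_toReal hKp] at h1
    refine le_trans (le_of_eq ?_) h1
    rw [← ENNReal.rpow_neg]
    nth_rw 3 [← ENNReal.rpow_one K]
    rw [← ENNReal.rpow_add _ _ hK0 hKfin]
    congr 1
    have := hpp.inv_add_inv_eq_one
    simp only [one_div]; linarith
  -- let the truncation tend to infinity
  have hmono : (∫⁻ r, ‖u r‖ₑ ^ p ∂μ) ≤ S ^ p := by
    have hun : (⋃ R : ℕ, {r | ‖u r‖ ≤ R}) = Set.univ := by
      ext r; simpa using exists_nat_ge ‖u r‖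
    rw [← setLIntegral_univ, ← hun, setLIntegral_iUnion_of_directed]
    · refine iSup_le fun R => ?_
      have := key R
      calc _ = ((∫⁻ r in {r | ‖u r‖ ≤ R}, ‖u r‖ₑ ^ p ∂μ) ^ (1 / p)) ^ p := by
            rw [← ENNReal.rpow_mul, one_div_mul_cancel hp0.ne', ENNReal.rpow_one]
        _ ≤ S ^ p := by gcongr
    · refine Monotone.directed_le fun R R' hRR r hr => ?_
      have : (R : ℝ) ≤ R' := by exact_mod_cast hRR
      exact le_trans (show ‖u r‖ ≤ R from hr) this
  calc spSize p u ≤ (S ^ p) ^ (1 / p) := by unfold spSize lpSize; gcongr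
    _ = S := by rw [← ENNReal.rpow_mul, mul_one_div_cancel hp0.ne', ENNReal.rpow_one]

/-- A countable norming family for the `Lᵖ` norm, in the dual unit ball. -/
theorem exists_norming_seq [TopologicalSpace.SeparableSpace (Lp H 2 μ)] {p p' : ℝ} (hp : 2 < p)
    (hpp : p.HolderConjugate p') :
    ∃ h : ℕ → Lp H 2 μ, (∀ i, spSize p' (h i) ≤ 1) ∧
      ∀ u, spSize p u ≤ ⨆ i, ENNReal.ofReal (inner ℂ (h i) u).re := by
  have hp'0 : 0 < p' := hpp.symm.pos
  set B : Set (Lp H 2 μ) := {h | spSize p' h ≤ 1}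
  have : Nonempty B := ⟨⟨0, by simp [B, spSize_zero hp'0]⟩⟩
  have : SecondCountableTopology (Lp H 2 μ) := UniformSpace.secondCountable_of_separable _
  refine ⟨fun i => TopologicalSpace.denseSeq B i, fun i => (TopologicalSpace.denseSeq B i).2,
    fun u => spSize_le_of_forall_inner hp hpp u _ fun h hh => ?_⟩
  set S := ⨆ i, ENNReal.ofReal (inner ℂ (TopologicalSpace.denseSeq B i : Lp H 2 μ) u).re
  have hcl : IsClosed {h : B | ENNReal.ofReal (inner ℂ (h : Lp H 2 μ) u).re ≤ S} := by
    refine isClosed_le ?_ continuous_const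
    exact ENNReal.continuous_ofReal.comp (Complex.continuous_re.comp
      (Continuous.inner continuous_subtype_val continuous_const))
  have hsub : Set.range (TopologicalSpace.denseSeq B) ⊆
      {h : B | ENNReal.ofReal (inner ℂ (h : Lp H 2 μ) u).re ≤ S} := by
    rintro _ ⟨i, rfl⟩
    exact le_iSup (fun i => ENNReal.ofReal
      (inner ℂ (TopologicalSpace.denseSeq B i : Lp H 2 μ) u).re) i
  have := hcl.closure_subset_iff.2 hsub
  rw [(TopologicalSpace.denseRange_denseSeq B).closure_range] at this
  exact this (Set.mem_univ (⟨h, hh⟩ : B))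

end SpaceNorm

section Testing

variable {X : Type*} [MeasurableSpace X] {μ : Measure X}
  {H : Type*} [NormedAddCommGroup H] [InnerProductSpace ℂ H]

theorem ENNReal.rpow_one_div_le_of_le_mul {p p' : ℝ} (hpp : p.HolderConjugate p') {K S : ℝ≥0∞}
    (hK : K ≠ ∞) (h : K ≤ S * K ^ (1 / p')) : K ^ (1 / p) ≤ S := by
  rcases eq_or_ne K 0 with rfl | hK0
  · rw [ENNReal.zero_rpow_of_pos (one_div_pos.2 hpp.pos)]; exact zero_le
  have hp' := hpp.symm.pos
  have h1 : K ^ (1 / p') ≠ ∞ := ENNReal.rpow_ne_top_of_nonneg (by positivity) hK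
  have h2 : K ^ (1 / p') ≠ 0 := by simp [ENNReal.rpow_eq_zero_iff, hK0, hK]
  have h3 : K ^ (1 / p) * K ^ (1 / p') = K := by
    rw [← ENNReal.rpow_add _ _ hK0 hK, one_div, one_div, hpp.inv_add_inv_eq_one, ENNReal.rpow_one]
  rw [← ENNReal.mul_le_mul_iff_left h2 h1, h3]
  exact h

/-- A measurable choice of almost optimal test vectors: the `n`-th choice is the best among the
first `n` members of a norming sequence. -/
theorem exists_greedy_test [TopologicalSpace.SeparableSpace (Lp H 2 μ)] {p p' : ℝ} (hp : 2 < p)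
    (hpp : p.HolderConjugate p') :
    ∃ b : ℕ → Lp H 2 μ → Lp H 2 μ, (∀ n v, spSize p' (b n v) ≤ 1) ∧
      (∀ n, ∃ C : ℝ, ∀ v, ‖b n v‖ ≤ C) ∧
      (∀ n (F : ℝ → Lp H 2 μ), StronglyMeasurable F → StronglyMeasurable fun t => b n (F t)) ∧
      (∀ v, Monotone fun n => (inner ℂ (b n v) v).re) ∧ (∀ n v, 0 ≤ (inner ℂ (b n v) v).re) ∧
      ∀ v, spSize p v ≤ ⨆ n, ENNReal.ofReal (inner ℂ (b n v) v).re := by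
  classical
  obtain ⟨h, h1, h2⟩ := exists_norming_seq (μ := μ) (H := H) hp hpp
  have : SecondCountableTopology (Lp H 2 μ) := UniformSpace.secondCountable_of_separable _
  let _ : MeasurableSpace (Lp H 2 μ) := borel _
  have : BorelSpace (Lp H 2 μ) := ⟨rfl⟩
  let b : ℕ → Lp H 2 μ → Lp H 2 μ := fun n => Nat.rec (fun _ => 0)
    (fun n bn v => if (inner ℂ (bn v) v).re < (inner ℂ (h n) v).re then h n else bn v) n
  have b0 : ∀ v, b 0 v = 0 := fun v => rfl
  have bs : ∀ n v, b (n + 1) v =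
    if (inner ℂ (b n v) v).re < (inner ℂ (h n) v).re then h n else b n v := fun n v => rfl
  have hmono : ∀ v, Monotone fun n => (inner ℂ (b n v) v).re := by
    intro v
    refine monotone_nat_of_le_succ fun n => ?_
    rw [bs]
    split_ifs with hlt
    · exact hlt.le
    · exact le_rfl
  have hmeas : ∀ n, Measurable (b n) := by
    intro n
    induction n with
    | zero => exact measurable_const
    | succ n ih =>
      refine Measurable.ite (measurableSet_lt ?_ ?_) measurable_const ih
      · exact Complex.measurable_re.comp (ih.inner measurable_id)
      · exact Complex.measurable_re.comp (measurable_const.inner measurable_id)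
  refine ⟨b, ?_, ?_, fun n F hF => ((hmeas n).comp hF.measurable).stronglyMeasurable, hmono, ?_, ?_⟩
  · intro n v
    induction n with
    | zero => rw [b0, spSize_zero hpp.symm.pos]; exact zero_le
    | succ n ih => rw [bs]; split_ifs; exacts [h1 n, ih]
  · intro n
    induction n with
    | zero => exact ⟨0, fun v => by rw [b0, norm_zero]⟩
    | succ n ih =>
      obtain ⟨C, hC⟩ := ih
      refine ⟨max C ‖h n‖, fun v => ?_⟩
      rw [bs]; split_ifs
      exacts [le_max_right _ _, (hC v).trans (le_max_left _ _)]
  · intro n v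
    have := hmono v (Nat.zero_le n)
    simpa [b0] using this
  · intro v
    refine (h2 v).trans (iSup_le fun i => le_trans ?_ (le_iSup _ (i + 1)))
    apply ENNReal.ofReal_le_ofReal
    rw [bs]
    split_ifs with hlt
    exacts [le_rfl, not_lt.1 hlt]

/-- The weighted `ℓ²` combination `(∑ i ∈ S, (w i * a i) ^ 2) ^ (1 / 2)`. -/
def sqComb {ι : Type*} (S : Finset ι) (w a : ι → ℝ≥0∞) : ℝ≥0∞ :=
  (∑ i ∈ S, (w i * a i) ^ 2) ^ (1 / 2 : ℝ)

theorem sqComb_mono {ι : Type*} (S : Finset ι) (w : ι → ℝ≥0∞) {a b : ι → ℝ≥0∞}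
    (h : ∀ i ∈ S, a i ≤ b i) : sqComb S w a ≤ sqComb S w b := by
  unfold sqComb
  gcongr with i hi
  exact h i hi

/-- Converse Hölder inequality for `L^q_t ℓ² Lᵖ`: the norm of a bounded family of curves in
`L²(μ; H)` is controlled by its pairing with integrable families. -/
theorem lpSize_sqComb_le_of_forall_test [TopologicalSpace.SeparableSpace (Lp H 2 μ)]
    {ι : Type*} (S : Finset ι) {p p' q q' : ℝ} (hp : 2 < p) (hpp : p.HolderConjugate p')
    (hqq : q.HolderConjugate q') (w : ι → ℝ≥0∞) (hw0 : ∀ i, w i ≠ 0) (hw1 : ∀ i, w i ≠ ∞)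
    (V : ι → ℝ → Lp H 2 μ) (hV : ∀ i, StronglyMeasurable (V i)) (M : ℝ)
    (hM : ∀ i t, ‖V i t‖ ≤ M) (A : ℝ≥0∞)
    (hA : ∀ G : ι → ℝ → Lp H 2 μ, (∀ i, Integrable (G i)) →
      ‖∑ i ∈ S, ∫ t, inner ℂ (G i t) (V i t)‖ₑ ≤
        A * lpSize q' volume fun t => sqComb S (fun i => (w i)⁻¹) fun i => spSize p' (G i t)) :
    lpSize q volume (fun t => sqComb S w fun i => spSize p (V i t)) ≤ A := by
  classical
  obtain ⟨b, b1, b2, b3, b4, b5, b6⟩ := exists_greedy_test (μ := μ) (H := H) hp hpp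
  have hq0 : 0 < q := hqq.pos
  have hq1 : 1 < q := hqq.lt
  set ω : ι → ℝ := fun i => (w i).toReal with hω
  have hω0 : ∀ i, 0 < ω i := fun i => ENNReal.toReal_pos (hw0 i) (hw1 i)
  have hwω : ∀ i, w i = ENNReal.ofReal (ω i) := fun i => (ENNReal.ofReal_toReal (hw1 i)).symm
  set φ : ℕ → ι → ℝ → ℝ := fun n i t => (inner ℂ (b n (V i t)) (V i t)).re with hφ
  have φ0 : ∀ n i t, 0 ≤ φ n i t := fun n i t => b5 n _
  have φm : ∀ n i, Measurable (φ n i) := fun n i =>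
    Complex.measurable_re.comp ((b3 n _ (hV i)).inner (hV i)).measurable
  set W : ℕ → ℝ → ℝ := fun n t => Real.sqrt (∑ i ∈ S, (ω i * φ n i t) ^ 2) with hW
  have W0 : ∀ n t, 0 ≤ W n t := fun n t => Real.sqrt_nonneg _
  have Wm : ∀ n, Measurable (W n) := fun n => by
    refine Measurable.sqrt (Finset.measurable_fun_sum S fun i _ => ?_)
    exact ((φm n i).const_mul _).pow_const 2
  have Wsq : ∀ n t, W n t ^ 2 = ∑ i ∈ S, (ω i * φ n i t) ^ 2 := fun n t =>
    Real.sq_sqrt (Finset.sum_nonneg fun i _ => sq_nonneg _)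
  have Wle : ∀ n i t, i ∈ S → ω i * φ n i t ≤ W n t := fun n i t hi => by
    refine Real.le_sqrt_of_sq_le ?_
    exact Finset.single_le_sum (f := fun i => (ω i * φ n i t) ^ 2) (fun i _ => sq_nonneg _) hi
  -- the sizes of the approximate extremizers, in `[0, ∞]`
  have hWE : ∀ n t, sqComb S w (fun i => ENNReal.ofReal (φ n i t)) = ENNReal.ofReal (W n t) := by
    intro n t
    change _ = ENNReal.ofReal (Real.sqrt _)
    rw [Real.sqrt_eq_rpow, ← ENNReal.ofReal_rpow_of_nonneg
      (Finset.sum_nonneg fun i _ => sq_nonneg _) (by norm_num),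
      ENNReal.ofReal_sum_of_nonneg fun i _ => sq_nonneg _]
    unfold sqComb
    congr 2; ext i
    rw [hwω i, ← ENNReal.ofReal_mul (hω0 i).le, ENNReal.ofReal_pow (by
      have := hω0 i; have := φ0 n i t; positivity)]
  have hbound : ∀ n, ∃ C : ℝ, 0 ≤ C ∧ ∀ t, W n t ≤ C := by
    intro n
    obtain ⟨C, hC⟩ := b2 n
    have hCM : ∀ i t, φ n i t ≤ |C * M| := by
      intro i t
      have h1 : φ n i t ≤ ‖b n (V i t)‖ * ‖V i t‖ :=
        (Complex.re_le_norm _).trans (norm_inner_le_norm _ _)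
      refine h1.trans (le_trans ?_ (le_abs_self _))
      have := hM i t; have := hC (V i t)
      have := norm_nonneg (b n (V i t))
      gcongr
      linarith
    refine ⟨Real.sqrt (∑ i ∈ S, (ω i * |C * M|) ^ 2), Real.sqrt_nonneg _, fun t => ?_⟩
    apply Real.sqrt_le_sqrt
    refine Finset.sum_le_sum fun i _ => ?_
    have := hω0 i; have := φ0 n i t; have := hCM i t
    gcongr
  have key : ∀ n : ℕ, ∫⁻ t in Set.Icc (-(n : ℝ)) n, ENNReal.ofReal (W n t) ^ q ≤ A ^ q := by
    intro n
    set I : Set ℝ := Set.Icc (-(n : ℝ)) n with hI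
    have hIm : MeasurableSet I := measurableSet_Icc
    obtain ⟨C, hC0, hC⟩ := hbound n
    obtain ⟨C', hC'⟩ := b2 n
    set l : ι → ℝ → ℝ := fun i => I.indicator fun t => ω i ^ 2 * φ n i t * W n t ^ (q - 2) with hl
    have l0 : ∀ i t, 0 ≤ l i t := fun i t => Set.indicator_nonneg (fun t _ => by
      have := φ0 n i t; have := W0 n t; positivity) t
    have lm : ∀ i, Measurable (l i) := fun i =>
      (((φm n i).const_mul _).mul ((Wm n).pow_const _)).indicator hIm
    have hWW : ∀ t, W n t * W n t ^ (q - 2) = W n t ^ (q - 1) := by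
      intro t
      rcases (W0 n t).eq_or_lt with h | h
      · rw [← h, Real.zero_rpow (by linarith : q - 1 ≠ 0), zero_mul]
      · nth_rw 1 [← Real.rpow_one (W n t)]; rw [← Real.rpow_add h]; congr 1; ring
    have llei : ∀ i ∈ S, ∀ t, l i t ≤ ω i * C ^ (q - 1) := by
      intro i hi t
      by_cases ht : t ∉ I
      · have h0 : l i t = 0 := Set.indicator_of_notMem ht _
        have := hω0 i
        rw [h0]; positivity
      rw [hl]
      simp only [Set.indicator_of_mem (not_not.1 ht)]
      calc ω i ^ 2 * φ n i t * W n t ^ (q - 2) = ω i * ((ω i * φ n i t) * W n t ^ (q - 2)) := by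
            ring
        _ ≤ ω i * (W n t * W n t ^ (q - 2)) := by
            have := hω0 i; have := W0 n t
            gcongr; exact Wle n i t hi
        _ ≤ ω i * C ^ (q - 1) := by
            rw [hWW]
            have := hω0 i
            gcongr
            exact hC t
    set G : ι → ℝ → Lp H 2 μ := fun i t => if i ∈ S then ((l i t : ℝ) : ℂ) • b n (V i t) else 0
      with hG
    have hGi : ∀ i, Integrable (G i) := by
      intro i
      by_cases hi : i ∈ S
      · have hint : Integrable (I.indicator fun _ => (1 : ℝ)) volume :=
          (integrable_indicator_iff hIm).2 (integrableOn_const (by simp [hI]))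
        simp only [hG, hi, if_true]
        refine Integrable.mono' (g := fun t => (ω i * C ^ (q - 1) * |C'|) *
          I.indicator (fun _ => (1 : ℝ)) t) (hint.const_mul _) ?_
          (Filter.Eventually.of_forall fun t => ?_)
        · exact ((Complex.measurable_ofReal.comp (lm i)).stronglyMeasurable.smul
            (b3 n _ (hV i))).aestronglyMeasurable
        · by_cases ht : t ∈ I
          · rw [norm_smul, Complex.norm_real, Real.norm_of_nonneg (l0 i t),
              Set.indicator_of_mem ht, mul_one]
            have := l0 i t
            exact mul_le_mul (llei i hi t) ((hC' _).trans (le_abs_self _)) (norm_nonneg _)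
              (this.trans (llei i hi t))
          · have : l i t = 0 := Set.indicator_of_notMem ht _
            simp [this, Set.indicator_of_notMem ht]
      · simp only [hG, hi, if_false]; exact integrable_zero _ _ _
    have hA' := hA G hGi
    set K := ∫⁻ t in I, ENNReal.ofReal (W n t) ^ q with hK
    have hKfin : K ≠ ∞ := by
      refine ne_top_of_le_ne_top (b := ENNReal.ofReal C ^ q * volume I) ?_ ?_
      · refine ENNReal.mul_ne_top (ENNReal.rpow_ne_top_of_nonneg hq0.le ENNReal.ofReal_ne_top) ?_
        simp [hI]
      · rw [← setLIntegral_const]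
        refine lintegral_mono fun t => ?_
        have := hC t
        gcongr
    -- the pairing reproduces the `q`-th power of the size
    have hleft : K ≤ ‖∑ i ∈ S, ∫ t, inner ℂ (G i t) (V i t)‖ₑ := by
      have hprod : ∀ i ∈ S, ∀ t, inner ℂ (G i t) (V i t) =
          (l i t : ℂ) * inner ℂ (b n (V i t)) (V i t) := by
        intro i hi t
        simp only [hG, hi, if_true]
        rw [inner_smul_left, Complex.conj_ofReal]
      have hint : ∀ i ∈ S, Integrable fun t => inner ℂ (G i t) (V i t) := by
        intro i hi
        refine Integrable.mono' (g := fun t => ‖G i t‖ * M) ((hGi i).norm.mul_const M)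
          ((hGi i).aestronglyMeasurable.inner (hV i).aestronglyMeasurable)
          (Filter.Eventually.of_forall fun t => ?_)
        refine (norm_inner_le_norm _ _).trans ?_
        have := hM i t
        gcongr
      have hre : (∑ i ∈ S, ∫ t, inner ℂ (G i t) (V i t)).re =
          ∫ t, I.indicator (fun t => W n t ^ q) t := by
        rw [Complex.re_sum]
        have : ∀ i ∈ S, (∫ t, inner ℂ (G i t) (V i t)).re = ∫ t, l i t * φ n i t := by
          intro i hi
          have h1 := integral_re (hint i hi)
          simp only [RCLike.re_eq_complex_re] at h1
          rw [← h1]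
          congr 1; ext t
          rw [hprod i hi t, Complex.re_ofReal_mul]
        rw [Finset.sum_congr rfl this, ← integral_finsetSum]
        · congr 1; ext t
          by_cases ht : t ∈ I
          · simp only [hl, Set.indicator_of_mem ht]
            calc ∑ i ∈ S, ω i ^ 2 * φ n i t * W n t ^ (q - 2) * φ n i t
                = (∑ i ∈ S, (ω i * φ n i t) ^ 2) * W n t ^ (q - 2) := by
                  rw [Finset.sum_mul]; congr 1; ext i; ring
              _ = W n t * (W n t * W n t ^ (q - 2)) := by rw [← Wsq]; ring
              _ = W n t ^ q := by
                  rw [hWW]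
                  rcases (W0 n t).eq_or_lt with h | h
                  · rw [← h, Real.zero_rpow hq0.ne', zero_mul]
                  · nth_rw 1 [← Real.rpow_one (W n t)]; rw [← Real.rpow_add h]; congr 1; ring
          · simp [hl, Set.indicator_of_notMem ht]
        · intro i hi
          have h1 := (hint i hi).re
          simp only [RCLike.re_eq_complex_re] at h1
          refine h1.congr (Filter.Eventually.of_forall fun t => ?_)
          simp only [hprod i hi t, Complex.re_ofReal_mul]; rfl
      have hKe : K = ENNReal.ofReal (∫ t, I.indicator (fun t => W n t ^ q) t) := by
        rw [ofReal_integral_eq_lintegral_ofReal]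
        · rw [hK, ← lintegral_indicator hIm]
          congr 1; ext t
          by_cases ht : t ∈ I
          · rw [Set.indicator_of_mem ht, Set.indicator_of_mem ht,
              ENNReal.ofReal_rpow_of_nonneg (W0 n t) hq0.le]
          · simp [Set.indicator_of_notMem ht]
        · refine Integrable.mono' (g := I.indicator fun _ => C ^ q)
            ((integrable_indicator_iff hIm).2 (integrableOn_const (by simp [hI])))
            (((Wm n).pow_const q).indicator hIm).aestronglyMeasurable
            (Filter.Eventually.of_forall fun t => ?_)
          by_cases ht : t ∈ I
          · rw [Set.indicator_of_mem ht, Set.indicator_of_mem ht,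
              Real.norm_of_nonneg (Real.rpow_nonneg (W0 n t) _)]
            have := W0 n t; have := hC t
            gcongr
          · simp [Set.indicator_of_notMem ht]
        · exact Filter.Eventually.of_forall fun t => Set.indicator_nonneg
            (fun t _ => Real.rpow_nonneg (W0 n t) _) t
      rw [hKe, ← hre, ← ofReal_norm]
      exact ENNReal.ofReal_le_ofReal (Complex.re_le_norm _)
    have hright : (lpSize q' volume fun t =>
        sqComb S (fun i => (w i)⁻¹) fun i => spSize p' (G i t)) ≤ K ^ (1 / q') := by
      unfold lpSize
      have hq' := hqq.symm.pos
      gcongr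
      rw [hK, ← lintegral_indicator hIm]
      refine lintegral_mono fun t => ?_
      have h1 : ∀ i ∈ S, (w i)⁻¹ * spSize p' (G i t) ≤ ENNReal.ofReal ((ω i)⁻¹ * l i t) := by
        intro i hi
        simp only [hG, hi, if_true]
        rw [spSize_smul hpp.symm.pos, ← ofReal_norm, Complex.norm_real,
          Real.norm_of_nonneg (l0 i t), hwω i, ← ENNReal.ofReal_inv_of_pos (hω0 i),
          ENNReal.ofReal_mul (inv_nonneg.2 (hω0 i).le)]
        gcongr
        calc _ ≤ ENNReal.ofReal (l i t) * 1 := by gcongr; exact b1 n _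
          _ = _ := mul_one _
      by_cases ht : t ∈ I
      · rw [Set.indicator_of_mem ht]
        have h2 : sqComb S (fun i => (w i)⁻¹) (fun i => spSize p' (G i t)) ≤
            ENNReal.ofReal (W n t ^ (q - 1)) := by
          unfold sqComb
          calc _ ≤ (∑ i ∈ S, ENNReal.ofReal ((ω i)⁻¹ * l i t) ^ 2) ^ (1 / 2 : ℝ) := by
                gcongr with i hi; exact h1 i hi
            _ = ENNReal.ofReal (Real.sqrt (∑ i ∈ S, ((ω i)⁻¹ * l i t) ^ 2)) := by
                rw [Real.sqrt_eq_rpow, ← ENNReal.ofReal_rpow_of_nonneg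
                  (Finset.sum_nonneg fun i _ => sq_nonneg _) (by norm_num),
                  ENNReal.ofReal_sum_of_nonneg fun i _ => sq_nonneg _]
                congr 2; ext i
                rw [ENNReal.ofReal_pow (by have := hω0 i; have := l0 i t; positivity)]
            _ ≤ _ := by
                apply ENNReal.ofReal_le_ofReal
                apply le_of_eq
                have : ∑ i ∈ S, ((ω i)⁻¹ * l i t) ^ 2 = (W n t ^ (q - 1)) ^ 2 := by
                  rw [← hWW, mul_pow, Wsq, Finset.sum_mul]
                  congr 1; ext i
                  simp only [hl, Set.indicator_of_mem ht]
                  have := (hω0 i).ne'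
                  field_simp
                rw [this, Real.sqrt_sq (Real.rpow_nonneg (W0 n t) _)]
        calc _ ≤ ENNReal.ofReal (W n t ^ (q - 1)) ^ q' := by gcongr
          _ = _ := by
            rw [← ENNReal.ofReal_rpow_of_nonneg (W0 n t) (by linarith), ← ENNReal.rpow_mul]
            congr 1; rw [hqq.conjugate_eq]; field_simp [hqq.sub_one_ne_zero]
      · have hz0 : sqComb S (fun i => (w i)⁻¹) (fun i => spSize p' (G i t)) = 0 := by
          unfold sqComb
          have hz : ∑ i ∈ S, ((w i)⁻¹ * spSize p' (G i t)) ^ 2 = 0 := by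
            refine Finset.sum_eq_zero fun i hi => ?_
            have h3 := h1 i hi
            have : l i t = 0 := Set.indicator_of_notMem ht _
            rw [this, mul_zero, ENNReal.ofReal_zero, nonpos_iff_eq_zero] at h3
            rw [h3]; simp
          rw [hz, ENNReal.zero_rpow_of_pos (by norm_num)]
        simp only [hz0, Set.indicator_of_notMem ht, ENNReal.zero_rpow_of_pos hq', le_refl]
    have hfin := ENNReal.rpow_one_div_le_of_le_mul hqq hKfin
      (hleft.trans (hA'.trans (mul_le_mul_right hright A)))
    calc K = (K ^ (1 / q)) ^ q := by
          rw [← ENNReal.rpow_mul, one_div_mul_cancel hq0.ne', ENNReal.rpow_one]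
      _ ≤ A ^ q := by gcongr
  -- pass to the limit by Fatou's lemma
  have hlim : ∀ t, Filter.Tendsto (fun n : ℕ =>
      (Set.Icc (-(n : ℝ)) n).indicator (fun t => ENNReal.ofReal (W n t) ^ q) t) Filter.atTop
      (nhds (sqComb S w (fun i => ⨆ n, ENNReal.ofReal (φ n i t)) ^ q)) := by
    intro t
    have h1 : Filter.Tendsto (fun n : ℕ => ENNReal.ofReal (W n t) ^ q) Filter.atTop
        (nhds (sqComb S w (fun i => ⨆ n, ENNReal.ofReal (φ n i t)) ^ q)) := by
      simp_rw [← hWE]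
      refine (ENNReal.continuous_rpow_const.tendsto _).comp ?_
      refine (ENNReal.continuous_rpow_const.tendsto _).comp ?_
      refine tendsto_finsetSum S fun i _ => ENNReal.Tendsto.pow ?_
      refine ENNReal.Tendsto.const_mul ?_ (Or.inr (hw1 i))
      exact tendsto_atTop_iSup fun m n hmn => ENNReal.ofReal_le_ofReal (b4 (V i t) hmn)
    refine h1.congr' ?_
    obtain ⟨N, hN⟩ := exists_nat_ge |t|
    filter_upwards [Filter.eventually_ge_atTop N] with n hn
    have : (N : ℝ) ≤ n := by exact_mod_cast hn
    have := abs_le.1 (hN.trans this)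
    rw [Set.indicator_of_mem (Set.mem_Icc.2 this)]
  have hfatou : ∫⁻ t, sqComb S w (fun i => spSize p (V i t)) ^ q ≤ A ^ q := by
    calc _ ≤ ∫⁻ t, Filter.liminf (fun n : ℕ => (Set.Icc (-(n : ℝ)) n).indicator
          (fun t => ENNReal.ofReal (W n t) ^ q) t) Filter.atTop := by
          refine lintegral_mono fun t => ?_
          rw [(hlim t).liminf_eq]
          gcongr
          exact sqComb_mono S w fun i _ => b6 (V i t)
      _ ≤ Filter.liminf (fun n : ℕ => ∫⁻ t, (Set.Icc (-(n : ℝ)) n).indicator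
          (fun t => ENNReal.ofReal (W n t) ^ q) t) Filter.atTop :=
          lintegral_liminf_le fun n => ((Wm n).ennreal_ofReal.pow_const q).indicator
            measurableSet_Icc
      _ ≤ A ^ q := by
          refine Filter.liminf_le_of_le (by isBoundedDefault) fun c hc => ?_
          obtain ⟨n, hn⟩ := hc.exists
          rw [lintegral_indicator measurableSet_Icc] at hn
          exact hn.trans (key n)
  calc _ ≤ (A ^ q) ^ (1 / q) := by unfold lpSize; gcongr
    _ = A := by rw [← ENNReal.rpow_mul, mul_one_div_cancel hq0.ne', ENNReal.rpow_one]

end Testing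

/-! ### Step functions and their density -/

/-- A step function: a simple function of time whose values are simple functions on `X`. -/
structure StepFn {X : Type*} [MeasurableSpace X] (μ : Measure X) (H : Type*)
    [NormedAddCommGroup H] where
  toFun : SimpleFunc ℝ (SimpleFunc X H)
  finite_support : volume (Function.support toFun) ≠ ∞
  memLp : ∀ t, MemLp (toFun t) 2 μ

section Step

variable {X : Type*} [MeasurableSpace X] {μ : Measure X}
  {H : Type*} [NormedAddCommGroup H]

theorem lpSize_add_le {Ω : Type*} [MeasurableSpace Ω] {ν : Measure Ω} {x : ℝ} (hx : 1 ≤ x)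
    {f g : Ω → ℝ≥0∞} (hf : AEMeasurable f ν) (hg : AEMeasurable g ν) :
    lpSize x ν (fun t => f t + g t) ≤ lpSize x ν f + lpSize x ν g :=
  ENNReal.lintegral_Lp_add_le hf hg hx

theorem lpSize_mono_ae {Ω : Type*} [MeasurableSpace Ω] {ν : Measure Ω} {x : ℝ} (hx : 0 < x)
    {f g : Ω → ℝ≥0∞} (h : ∀ᵐ t ∂ν, f t ≤ g t) : lpSize x ν f ≤ lpSize x ν g := by
  unfold lpSize
  refine ENNReal.rpow_le_rpow (lintegral_mono_ae ?_) (by positivity)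
  filter_upwards [h] with t ht
  gcongr

theorem lpSize_const_mul {Ω : Type*} [MeasurableSpace Ω] {ν : Measure Ω} {x : ℝ} (hx : 0 < x)
    {c : ℝ≥0∞} (hc : c ≠ ∞) (f : Ω → ℝ≥0∞) :
    lpSize x ν (fun t => c * f t) = c * lpSize x ν f := by
  unfold lpSize
  simp_rw [ENNReal.mul_rpow_of_nonneg _ _ hx.le]
  rw [lintegral_const_mul' _ _ (ENNReal.rpow_ne_top_of_nonneg hx.le hc),
    ENNReal.mul_rpow_of_nonneg _ _ (by positivity), ← ENNReal.rpow_mul,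
    mul_one_div_cancel hx.ne', ENNReal.rpow_one]

/-- Restriction of an `L²` function to a measurable set. -/
def truncL2 (B : Set X) (hB : MeasurableSet B) (f : Lp H 2 μ) : Lp H 2 μ :=
  ((Lp.memLp f).indicator hB).toLp

theorem coeFn_truncL2 (B : Set X) (hB : MeasurableSet B) (f : Lp H 2 μ) :
    truncL2 B hB f =ᵐ[μ] B.indicator f := MemLp.coeFn_toLp _

theorem truncL2_sub (B : Set X) (hB : MeasurableSet B) (f g : Lp H 2 μ) :
    truncL2 B hB (f - g) = truncL2 B hB f - truncL2 B hB g := by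
  refine Lp.ext ?_
  filter_upwards [coeFn_truncL2 B hB (f - g), coeFn_truncL2 B hB f, coeFn_truncL2 B hB g,
    Lp.coeFn_sub f g, Lp.coeFn_sub (truncL2 B hB f) (truncL2 B hB g)] with r h1 h2 h3 h4 h5
  rw [h1, h5, Pi.sub_apply, h2, h3]
  by_cases hr : r ∈ B
  · simp only [Set.indicator_of_mem hr, h4, Pi.sub_apply]
  · simp only [Set.indicator_of_notMem hr, sub_zero]

theorem spSize_truncL2_le (B : Set X) (hB : MeasurableSet B) {z : ℝ} (hz : 0 < z) (f : Lp H 2 μ) :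
    spSize z (truncL2 B hB f) ≤ spSize z f := by
  refine lpSize_mono_ae hz ?_
  filter_upwards [coeFn_truncL2 B hB f] with r hr
  rw [hr, enorm_indicator_eq_indicator_enorm]
  exact Set.indicator_le_self _ _ _

theorem norm_truncL2_le (B : Set X) (hB : MeasurableSet B) (f : Lp H 2 μ) :
    ‖truncL2 B hB f‖ₑ ≤ ‖f‖ₑ := by
  simpa only [spSize_two] using spSize_truncL2_le B hB (z := 2) (by norm_num) f

theorem continuous_truncL2 (B : Set X) (hB : MeasurableSet B) :
    Continuous (truncL2 B hB : Lp H 2 μ → Lp H 2 μ) := by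
  have : LipschitzWith 1 (truncL2 B hB : Lp H 2 μ → Lp H 2 μ) := fun f g => by
    rw [edist_eq_enorm_sub, edist_eq_enorm_sub, ← truncL2_sub]
    simpa using norm_truncL2_le B hB (f - g)
  exact this.continuous

theorem spSize_truncL2_le_of_le (B : Set X) (hB : MeasurableSet B) {y : ℝ} (hy : 0 < y)
    (hy2 : y ≤ 2) (f : Lp H 2 μ) :
    spSize y (truncL2 B hB f) ≤ μ B ^ (1 / y - 1 / 2) * ‖f‖ₑ := by
  have h1 : spSize y (truncL2 B hB f) = lpSize y (μ.restrict B) (fun r => ‖f r‖ₑ) := by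
    unfold spSize lpSize
    congr 1
    rw [← lintegral_indicator hB]
    refine lintegral_congr_ae ?_
    filter_upwards [coeFn_truncL2 B hB f] with r hr
    rw [hr]
    by_cases hrB : r ∈ B <;> simp [hrB, hy]
  have h2 : lpSize 2 (μ.restrict B) (fun r => ‖f r‖ₑ) ≤ ‖f‖ₑ := by
    rw [← spSize_two]
    unfold spSize lpSize
    gcongr
    exact Measure.restrict_le_self
  rw [h1]
  refine (lpSize_le_of_le hy hy2 _ (Lp.aestronglyMeasurable f).enorm.restrict).trans ?_
  rw [Measure.restrict_apply_univ]
  gcongr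

theorem spSize_sub_truncL2 (B : Set X) (hB : MeasurableSet B) (z : ℝ)
    (f : Lp H 2 μ) :
    spSize z (f - truncL2 B hB f) = lpSize z μ (Bᶜ.indicator fun r => ‖f r‖ₑ) := by
  unfold spSize lpSize
  congr 1
  refine lintegral_congr_ae ?_
  filter_upwards [coeFn_truncL2 B hB f, Lp.coeFn_sub f (truncL2 B hB f)] with r h1 h2
  rw [h2, Pi.sub_apply, h1]
  by_cases hr : r ∈ B <;> simp [hr]

theorem tendsto_spSize_sub_truncL2 {B : ℕ → Set X} (hB : ∀ n, MeasurableSet (B n))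
    (hmono : Monotone B) (hun : ⋃ n, B n = Set.univ) {z : ℝ} (hz : 0 < z) (f : Lp H 2 μ)
    (hf : spSize z f ≠ ∞) :
    Filter.Tendsto (fun n => spSize z (f - truncL2 (B n) (hB n) f)) Filter.atTop (nhds 0) := by
  simp_rw [spSize_sub_truncL2]
  have h0 : (0 : ℝ≥0∞) = 0 ^ (1 / z) := by rw [ENNReal.zero_rpow_of_pos (by positivity)]
  rw [h0]
  refine (ENNReal.continuous_rpow_const.tendsto _).comp ?_
  have hfin : ∫⁻ r, ‖f r‖ₑ ^ z ∂μ ≠ ∞ := by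
    rw [← lpSize_rpow hz]; exact ENNReal.rpow_ne_top_of_nonneg hz.le hf
  have := tendsto_lintegral_of_dominated_convergence' (μ := μ)
    (F := fun n r => ((B n)ᶜ.indicator (fun r => ‖f r‖ₑ) r) ^ z) (f := fun _ => 0)
    (fun r => ‖f r‖ₑ ^ z)
    (fun n => ((Lp.aestronglyMeasurable f).enorm.indicator (hB n).compl).pow_const z)
    (fun n => Filter.Eventually.of_forall fun r => by
      exact ENNReal.rpow_le_rpow (Set.indicator_le_self _ _ _) hz.le) hfin
    (Filter.Eventually.of_forall fun r => ?_)
  · simpa using this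
  · obtain ⟨N, hN⟩ := Set.mem_iUnion.1 (hun.symm ▸ Set.mem_univ r : r ∈ ⋃ n, B n)
    refine tendsto_const_nhds.congr' ?_
    filter_upwards [Filter.eventually_ge_atTop N] with n hn
    have : r ∉ (B n)ᶜ := fun h => h (hmono hn hN)
    rw [Set.indicator_of_notMem this, ENNReal.zero_rpow_of_pos hz]

namespace StepFn

/-- The curve in `L²(μ; H)` given by a step function. -/
def val (F : StepFn μ H) (t : ℝ) : Lp H 2 μ := (F.memLp t).toLp _

theorem coeFn_val (F : StepFn μ H) (t : ℝ) : F.val t =ᵐ[μ] F.toFun t := MemLp.coeFn_toLp _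

theorem spSize_val (F : StepFn μ H) (y t : ℝ) :
    spSize y (F.val t) = lpSize y μ fun r => ‖F.toFun t r‖ₑ := by
  unfold spSize lpSize
  congr 1
  refine lintegral_congr_ae ?_
  filter_upwards [F.coeFn_val t] with r hr
  rw [hr]

open Classical in
/-- The curve of a step function, as a simple function. -/
def simpleVal (F : StepFn μ H) : SimpleFunc ℝ (Lp H 2 μ) :=
  F.toFun.map fun e : SimpleFunc X H => if h : MemLp e 2 μ then h.toLp e else 0

theorem coe_simpleVal (F : StepFn μ H) : (F.simpleVal : ℝ → Lp H 2 μ) = F.val := by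
  ext1 t
  simp only [simpleVal, SimpleFunc.map_apply, dif_pos (F.memLp t)]
  rfl

theorem val_eq_zero_of_notMem (F : StepFn μ H) {t : ℝ} (ht : t ∉ Function.support F.toFun) :
    F.val t = 0 := by
  have : F.toFun t = 0 := by simpa using ht
  refine Lp.ext ?_
  filter_upwards [F.coeFn_val t, Lp.coeFn_zero H 2 μ] with r h1 h2
  rw [h1, h2, this]; rfl

theorem stronglyMeasurable_val (F : StepFn μ H) : StronglyMeasurable F.val := by
  rw [← coe_simpleVal]; exact F.simpleVal.stronglyMeasurable

theorem measurable_comp_toFun {β : Type*} [MeasurableSpace β] (F : StepFn μ H)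
    (g : SimpleFunc X H → β) : Measurable fun t => g (F.toFun t) :=
  (F.toFun.map g).measurable

theorem exists_norm_val_le (F : StepFn μ H) : ∃ C : ℝ, ∀ t, ‖F.val t‖ ≤ C := by
  obtain ⟨C, hC⟩ := (F.simpleVal.map fun e => ‖e‖).exists_forall_le
  refine ⟨C, fun t => ?_⟩
  rw [← coe_simpleVal]; exact hC t

theorem measurableSet_support (F : StepFn μ H) : MeasurableSet (Function.support F.toFun) := by
  have : Function.support F.toFun = (F.toFun ⁻¹' {0})ᶜ := by ext t; simp
  rw [this]
  exact (F.toFun.measurableSet_preimage _).compl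

theorem integrable_val (F : StepFn μ H) : Integrable F.val := by
  obtain ⟨C, hC⟩ := F.exists_norm_val_le
  refine Integrable.mono' (g := (Function.support F.toFun).indicator fun _ => C)
    ((integrable_indicator_iff F.measurableSet_support).2
      (integrableOn_const F.finite_support)) F.stronglyMeasurable_val.aestronglyMeasurable
    (Filter.Eventually.of_forall fun t => ?_)
  by_cases ht : t ∈ Function.support F.toFun
  · rw [Set.indicator_of_mem ht]; exact hC t
  · rw [Set.indicator_of_notMem ht, F.val_eq_zero_of_notMem ht, norm_zero]

end StepFn

theorem ENNReal.exists_pos_mul_le {c ε : ℝ≥0∞} (hc : c ≠ ∞) (hε : ε ≠ 0) :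
    ∃ η : ℝ≥0∞, η ≠ 0 ∧ η ≠ ∞ ∧ c * η ≤ ε := by
  refine ⟨min (ε / (c + 1)) 1, ?_, ?_, ?_⟩
  · have : ε / (c + 1) ≠ 0 := by
      rw [ne_eq, ENNReal.div_eq_zero_iff]; simp [hε, hc]
    simp [min_eq_iff, this]
  · exact ne_top_of_le_ne_top ENNReal.one_ne_top (min_le_right _ _)
  · calc c * min (ε / (c + 1)) 1 ≤ (c + 1) * (ε / (c + 1)) := by
          gcongr
          · exact le_self_add
          · exact min_le_left _ _
      _ ≤ ε := ENNReal.mul_div_le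

set_option maxHeartbeats 1600000 in
/-- Step functions are dense among the integrable curves in `L²(μ; H)` with finite `L^x_t Lʸ`
norm, for `y ≤ 2`, simultaneously in both norms. -/
theorem exists_stepFn_approx [SigmaFinite μ] {F : ℝ → Lp H 2 μ} (hF : Integrable F) {x y : ℝ}
    (hx : 1 ≤ x) (hy : 1 ≤ y) (hy2 : y ≤ 2)
    (hfin : lpSize x volume (fun t => spSize y (F t)) ≠ ∞) {ε : ℝ≥0∞} (hε : ε ≠ 0) :
    ∃ s : StepFn μ H, ∫⁻ t, ‖F t - s.val t‖ₑ ≤ ε ∧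
      lpSize x volume (fun t => spSize y (F t - s.val t)) ≤ ε := by
  classical
  wlog hFm : StronglyMeasurable F generalizing F
  · obtain ⟨s, h1, h2⟩ := this (F := hF.1.mk F) (hF.congr hF.1.ae_eq_mk) (by
      convert hfin using 1
      unfold lpSize; congr 1
      refine lintegral_congr_ae ?_
      filter_upwards [hF.1.ae_eq_mk] with t ht
      rw [ht]) hF.1.stronglyMeasurable_mk
    refine ⟨s, le_trans (le_of_eq (lintegral_congr_ae ?_)) h1,
      (lpSize_mono_ae (by linarith) ?_).trans h2⟩
    all_goals
      filter_upwards [hF.1.ae_eq_mk] with t ht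
      rw [ht]
  have hx0 : 0 < x := by linarith
  have hy0 : 0 < y := by linarith
  set B := spanningSets μ
  have hB : ∀ n, MeasurableSet (B n) := measurableSet_spanningSets μ
  set A : ℕ → Set ℝ := fun n => {t | |t| ≤ n ∧ ‖F t‖ ≤ n} with hA
  have hAm : ∀ n, MeasurableSet (A n) := fun n =>
    (measurableSet_le measurable_id.abs measurable_const).inter
      (measurableSet_le hFm.norm.measurable measurable_const)
  set T : ℕ → ℝ → Lp H 2 μ := fun n => (A n).indicator fun t => truncL2 (B n) (hB n) (F t) with hT
  have hTm : ∀ n, StronglyMeasurable (T n) := fun n =>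
    ((continuous_truncL2 _ _).comp_stronglyMeasurable hFm).indicator (hAm n)
  -- truncation in time, in size and in space
  have hconv : ∀ (a z : ℝ), 0 < a → 1 ≤ z →
      lpSize a volume (fun t => spSize z (F t)) ≠ ∞ →
      Filter.Tendsto (fun n => lpSize a volume fun t => spSize z (F t - T n t)) Filter.atTop
        (nhds 0) := by
    intro a z ha hz hfin
    have hz0 : 0 < z := by linarith
    have h0 : (0 : ℝ≥0∞) = 0 ^ (1 / a) := by rw [ENNReal.zero_rpow_of_pos (by positivity)]
    rw [h0]
    refine (ENNReal.continuous_rpow_const.tendsto _).comp ?_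
    have hfin' : ∫⁻ t, spSize z (F t) ^ a ≠ ∞ := by
      rw [← lpSize_rpow ha]; exact ENNReal.rpow_ne_top_of_nonneg ha.le hfin
    have := tendsto_lintegral_of_dominated_convergence' (μ := (volume : Measure ℝ))
      (F := fun n t => spSize z (F t - T n t) ^ a) (f := fun _ => 0)
      (fun t => spSize z (F t) ^ a)
      (fun n => (aemeasurable_spSize hz0
        (hFm.sub (hTm n)).aestronglyMeasurable).pow_const a)
      (fun n => Filter.Eventually.of_forall fun t => ?_) hfin' ?_
    · simpa using this
    · simp only
      gcongr
      by_cases ht : t ∈ A n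
      · simp only [hT, Set.indicator_of_mem ht]
        rw [spSize_sub_truncL2]
        exact lpSize_mono hz0 _ fun r => Set.indicator_le_self _ _ _
      · simp only [hT, Set.indicator_of_notMem ht, sub_zero, le_refl]
    · have hae : ∀ᵐ t, spSize z (F t) ^ a < ∞ := by
        refine ae_lt_top' ((aemeasurable_spSize hz0 hFm.aestronglyMeasurable).pow_const a) hfin'
      filter_upwards [hae] with t ht
      have ht' : spSize z (F t) ≠ ∞ := fun h => by
        rw [h, ENNReal.top_rpow_of_pos ha] at ht; exact lt_irrefl _ ht
      have h1 := tendsto_spSize_sub_truncL2 hB (monotone_spanningSets μ) (iUnion_spanningSets μ)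
        hz0 (F t) ht'
      have h2 : (0 : ℝ≥0∞) = 0 ^ a := by rw [ENNReal.zero_rpow_of_pos ha]
      rw [h2]
      refine ((ENNReal.continuous_rpow_const.tendsto _).comp h1).congr' ?_
      obtain ⟨N, hN⟩ := exists_nat_ge (max |t| ‖F t‖)
      filter_upwards [Filter.eventually_ge_atTop N] with n hn
      have hNn : (N : ℝ) ≤ n := by exact_mod_cast hn
      have : t ∈ A n := ⟨(le_max_left _ _).trans (hN.trans hNn),
        (le_max_right _ _).trans (hN.trans hNn)⟩
      simp only [hT, Set.indicator_of_mem this, Function.comp_apply]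
  have hF1 : lpSize 1 volume (fun t => spSize 2 (F t)) ≠ ∞ := by
    simp only [lpSize, spSize_two, ENNReal.rpow_one, one_div_one]
    exact hF.2.ne
  have hε2 : ε / 2 ≠ 0 := by simp [hε]
  obtain ⟨n, hn1, hn2⟩ := ((hconv 1 2 one_pos (by norm_num) hF1).eventually_le_const
    (pos_iff_ne_zero.2 hε2) |>.and ((hconv x y hx0 hy hfin).eventually_le_const
    (pos_iff_ne_zero.2 hε2))).exists
  -- approximation of the truncated curve
  set I : Set ℝ := Set.Icc (-(n : ℝ)) n with hI
  have hIm : MeasurableSet I := measurableSet_Icc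
  have hIfin : volume I ≠ ∞ := by simp [hI]
  have hAI : A n ⊆ I := fun t ht => Set.mem_Icc.2 (abs_le.1 ht.1)
  set c : ℝ≥0∞ := μ (B n) ^ (1 / y - 1 / 2) + volume I ^ (1 / 1 - 1 / x) with hc
  have hyy : 0 ≤ 1 / y - 1 / 2 := sub_nonneg.2 (one_div_le_one_div_of_le hy0 hy2)
  have hxx : 0 ≤ 1 / 1 - 1 / x := sub_nonneg.2 (one_div_le_one_div_of_le one_pos hx)
  have hcfin : c ≠ ∞ := ENNReal.add_ne_top.2
    ⟨ENNReal.rpow_ne_top_of_nonneg hyy (measure_spanningSets_lt_top μ n).ne,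
      ENNReal.rpow_ne_top_of_nonneg hxx hIfin⟩
  obtain ⟨η, hη0, hηt, hη⟩ := ENNReal.exists_pos_mul_le hcfin hε2
  have hη2 : η / 2 ≠ 0 := by simp [hη0]
  obtain ⟨δ, hδ0, hδt, hδ⟩ := ENNReal.exists_pos_mul_le
    (ENNReal.rpow_ne_top_of_nonneg (y := 1 / x) (by positivity) hIfin) hη2
  have hTL : MemLp (T n) (ENNReal.ofReal x) volume := by
    have h1 : MemLp (I.indicator fun _ : ℝ => (n : ℝ)) (ENNReal.ofReal x) volume :=
      memLp_indicator_const _ hIm _ (Or.inr hIfin)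
    refine h1.mono (hTm n).aestronglyMeasurable (Filter.Eventually.of_forall fun t => ?_)
    by_cases ht : t ∈ A n
    · rw [Set.indicator_of_mem (hAI ht)]
      simp only [hT, Set.indicator_of_mem ht]
      refine le_trans ?_ (ht.2.trans (le_abs_self _))
      rw [← enorm_le_iff_norm_le]; exact norm_truncL2_le _ _ _
    · simp only [hT, Set.indicator_of_notMem ht, norm_zero, norm_nonneg]
  obtain ⟨g, hg, -⟩ := hTL.exists_simpleFunc_eLpNorm_sub_lt ENNReal.ofReal_ne_top hη2
  have hφ : ∀ e : Lp H 2 μ, ∃ k : SimpleFunc X H, eLpNorm (⇑e - ⇑k) 2 μ < δ ∧ MemLp k 2 μ := fun e =>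
    (Lp.memLp e).exists_simpleFunc_eLpNorm_sub_lt (by norm_num) hδ0
  choose φ hφ1 hφ2 using hφ
  have hval : ∀ t, ((g.map fun e => (φ e).restrict (B n)).restrict I) t =
      if t ∈ I then (φ (g t)).restrict (B n) else 0 := by
    intro t
    rw [SimpleFunc.restrict_apply _ hIm]
    by_cases ht : t ∈ I <;> simp [ht]
  have hvalmem : ∀ t, MemLp (((g.map fun e => (φ e).restrict (B n)).restrict I) t) 2 μ := by
    intro t
    rw [hval]
    split_ifs
    · rw [SimpleFunc.coe_restrict _ (hB n)]; exact (hφ2 _).indicator (hB n)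
    · exact MemLp.zero'
  refine ⟨⟨(g.map fun e => (φ e).restrict (B n)).restrict I, ?_, hvalmem⟩, ?_⟩
  · refine ne_top_of_le_ne_top hIfin (measure_mono fun t ht => ?_)
    by_contra hcon
    rw [Function.mem_support, hval, if_neg hcon] at ht
    exact ht rfl
  set s : StepFn μ H := ⟨(g.map fun e => (φ e).restrict (B n)).restrict I, _, hvalmem⟩ with hs
  have hsval : ∀ t, T n t - s.val t =
      I.indicator (fun t => truncL2 (B n) (hB n) (T n t - (hφ2 (g t)).toLp)) t := by
    intro t
    by_cases ht : t ∈ I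
    · rw [Set.indicator_of_mem ht, truncL2_sub]
      congr 1
      · by_cases htA : t ∈ A n
        · simp only [hT, Set.indicator_of_mem htA]
          refine Lp.ext ?_
          filter_upwards [coeFn_truncL2 (B n) (hB n) (F t),
            coeFn_truncL2 (B n) (hB n) (truncL2 (B n) (hB n) (F t))] with r h1 h2
          rw [h2]
          by_cases hr : r ∈ B n
          · rw [Set.indicator_of_mem hr]
          · rw [h1, Set.indicator_of_notMem hr, Set.indicator_of_notMem hr]
        · simp only [hT, Set.indicator_of_notMem htA]
          have := truncL2_sub (B n) (hB n) (0 : Lp H 2 μ) 0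
          simpa using this.symm
      · refine Lp.ext ?_
        filter_upwards [s.coeFn_val t, coeFn_truncL2 (B n) (hB n) (hφ2 (g t)).toLp,
          (hφ2 (g t)).coeFn_toLp] with r h1 h2 h3
        rw [h1, h2]
        change ((g.map fun e => (φ e).restrict (B n)).restrict I) t r = _
        rw [hval, if_pos ht, SimpleFunc.restrict_apply _ (hB n)]
        by_cases hr : r ∈ B n
        · rw [Set.indicator_of_mem hr, Set.indicator_of_mem hr, h3]
        · rw [Set.indicator_of_notMem hr, Set.indicator_of_notMem hr]
    · rw [Set.indicator_of_notMem ht]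
      have h1 : T n t = 0 := Set.indicator_of_notMem (fun h => ht (hAI h)) _
      have h2 : s.val t = 0 := s.val_eq_zero_of_notMem (by
        rw [Function.notMem_support]
        change ((g.map fun e => (φ e).restrict (B n)).restrict I) t = _
        rw [hval, if_neg ht])
      rw [h1, h2, sub_zero]
  set d : ℝ → ℝ≥0∞ := fun t => ‖T n t - (hφ2 (g t)).toLp‖ₑ with hd
  have hdm : ∀ t, d t ≤ ‖T n t - g t‖ₑ + δ := by
    intro t
    have h1 : ‖g t - (hφ2 (g t)).toLp‖ₑ ≤ δ := by
      rw [Lp.enorm_def, eLpNorm_congr_ae (g := ⇑(g t) - ⇑(φ (g t)))]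
      · exact (hφ1 _).le
      · filter_upwards [Lp.coeFn_sub (g t) (hφ2 (g t)).toLp, (hφ2 (g t)).coeFn_toLp] with r h1 h2
        rw [h1, Pi.sub_apply, Pi.sub_apply, h2]
    calc d t = ‖(T n t - g t) + (g t - (hφ2 (g t)).toLp)‖ₑ := by rw [hd, sub_add_sub_cancel]
      _ ≤ _ := (enorm_add_le _ _).trans (by gcongr)
  have hdx : lpSize x (volume.restrict I) (fun t => ‖T n t - g t‖ₑ + δ) ≤ η := by
    refine (lpSize_add_le hx ((hTm n).sub g.stronglyMeasurable).enorm.aemeasurable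
      aemeasurable_const).trans ?_
    have h1 : lpSize x (volume.restrict I) (fun t => ‖T n t - g t‖ₑ) ≤ η / 2 := by
      refine le_trans ?_ hg.le
      rw [eLpNorm_eq_lintegral_rpow_enorm_toReal (by simpa using hx0) ENNReal.ofReal_ne_top,
        ENNReal.toReal_ofReal hx0.le]
      exact ENNReal.rpow_le_rpow (lintegral_mono' Measure.restrict_le_self le_rfl) (by positivity)
    have h2 : lpSize x (volume.restrict I) (fun _ => δ) ≤ η / 2 := by
      refine le_trans (le_of_eq ?_) hδ
      rw [lpSize, lintegral_const, Measure.restrict_apply_univ,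
        ENNReal.mul_rpow_of_nonneg _ _ (by positivity), ← ENNReal.rpow_mul,
        mul_one_div_cancel hx0.ne', ENNReal.rpow_one, mul_comm]
    calc _ ≤ η / 2 + η / 2 := add_le_add h1 h2
      _ = η := ENNReal.add_halves η
  have hIind : ∀ (a : ℝ), 0 < a → ∀ f : ℝ → ℝ≥0∞,
      lpSize a volume (I.indicator f) = lpSize a (volume.restrict I) f := by
    intro a ha f
    unfold lpSize
    congr 1
    rw [← lintegral_indicator hIm]
    congr 1; ext t
    by_cases ht : t ∈ I <;> simp [ht, ha]
  have e1 : ∫⁻ t, ‖T n t - s.val t‖ₑ ≤ ε / 2 := by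
    calc ∫⁻ t, ‖T n t - s.val t‖ₑ ≤
          lpSize 1 volume (I.indicator fun t => ‖T n t - g t‖ₑ + δ) := by
          simp only [lpSize, ENNReal.rpow_one, one_div_one]
          refine lintegral_mono fun t => ?_
          rw [hsval]
          by_cases ht : t ∈ I
          · rw [Set.indicator_of_mem ht, Set.indicator_of_mem ht]
            exact (norm_truncL2_le _ _ _).trans (hdm t)
          · simp [Set.indicator_of_notMem ht]
      _ ≤ volume I ^ (1 / 1 - 1 / x) * η := by
          rw [hIind 1 one_pos]
          refine (lpSize_le_of_le one_pos hx _ (((hTm n).sub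
            g.stronglyMeasurable).enorm.aemeasurable.add aemeasurable_const)).trans ?_
          rw [Measure.restrict_apply_univ]
          gcongr
          exact hdx
      _ ≤ c * η := by gcongr; exact le_add_self
      _ ≤ ε / 2 := hη
  have e2 : lpSize x volume (fun t => spSize y (T n t - s.val t)) ≤ ε / 2 := by
    calc lpSize x volume (fun t => spSize y (T n t - s.val t)) ≤
          lpSize x volume (fun t => μ (B n) ^ (1 / y - 1 / 2) *
            I.indicator (fun t => ‖T n t - g t‖ₑ + δ) t) := by
          refine lpSize_mono hx0 _ fun t => ?_
          rw [hsval]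
          by_cases ht : t ∈ I
          · rw [Set.indicator_of_mem ht, Set.indicator_of_mem ht]
            refine (spSize_truncL2_le_of_le _ _ hy0 hy2 _).trans ?_
            gcongr
            exact hdm t
          · rw [Set.indicator_of_notMem ht, spSize_zero hy0]; exact zero_le
      _ ≤ c * η := by
          rw [lpSize_const_mul hx0 (ENNReal.rpow_ne_top_of_nonneg hyy
            (measure_spanningSets_lt_top μ n).ne), hIind x hx0]
          gcongr
          exact le_self_add
      _ ≤ ε / 2 := hη
  constructor
  · calc ∫⁻ t, ‖F t - s.val t‖ₑ ≤ ∫⁻ t, (‖F t - T n t‖ₑ + ‖T n t - s.val t‖ₑ) := by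
          refine lintegral_mono fun t => ?_
          rw [← sub_add_sub_cancel (F t) (T n t) (s.val t)]
          exact enorm_add_le _ _
      _ = (∫⁻ t, ‖F t - T n t‖ₑ) + ∫⁻ t, ‖T n t - s.val t‖ₑ :=
          lintegral_add_left (hFm.sub (hTm n)).enorm _
      _ ≤ ε / 2 + ε / 2 := by
          refine add_le_add ?_ e1
          simpa only [lpSize, spSize_two, ENNReal.rpow_one, one_div_one] using hn1
      _ = ε := ENNReal.add_halves ε
  · calc _ ≤ lpSize x volume (fun t => spSize y (F t - T n t) + spSize y (T n t - s.val t)) := by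
          refine lpSize_mono hx0 _ fun t => ?_
          rw [← sub_add_sub_cancel (F t) (T n t) (s.val t)]
          exact spSize_add_le hy _ _
      _ ≤ _ := lpSize_add_le hx (aemeasurable_spSize hy0 (hFm.sub (hTm n)).aestronglyMeasurable)
          (aemeasurable_spSize hy0 ((hTm n).sub s.stronglyMeasurable_val).aestronglyMeasurable)
      _ ≤ ε / 2 + ε / 2 := add_le_add hn2 e2
      _ = ε := ENNReal.add_halves ε

end Step

/-! ### Flows on `L²(μ; H)` and the Duhamel form -/

/-- Hölder's inequality in time, including the endpoint `q = ∞`, `x = 1`. -/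
theorem lintegral_mul_le_eLpNorm_mul_lpSize {Ω : Type*} [MeasurableSpace Ω] {ν : Measure Ω}
    {q : ℝ≥0∞} {x : ℝ} (hx : 1 ≤ x) (hq : (q⁻¹).toReal + 1 / x = 1) (hq1 : 1 ≤ q)
    {f g : Ω → ℝ≥0∞} (hf : AEMeasurable f ν) (hg : AEMeasurable g ν) :
    ∫⁻ t, f t * g t ∂ν ≤ eLpNorm f q ν * lpSize x ν g := by
  have hx0 : 0 < x := by linarith
  rcases eq_or_ne q ∞ with rfl | hqt
  · have : x = 1 := by
      simp only [ENNReal.inv_top, ENNReal.toReal_zero, zero_add] at hq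
      field_simp at hq; exact hq.symm
    subst this
    rw [lpSize, one_div_one, ENNReal.rpow_one, eLpNorm_exponent_top]
    simp_rw [ENNReal.rpow_one]
    rw [← lintegral_const_mul'' _ hg]
    refine lintegral_mono_ae ?_
    filter_upwards [enorm_ae_le_eLpNormEssSup f ν] with r hr
    gcongr
    exact hr
  · have hq0 : 0 < q.toReal := ENNReal.toReal_pos (by positivity) hqt
    rw [ENNReal.toReal_inv] at hq
    have hq2 : 1 ≤ q.toReal := by
      rw [← ENNReal.toReal_one]; exact ENNReal.toReal_mono hqt hq1
    have hq3 : q.toReal.HolderConjugate x := by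
      refine Real.holderConjugate_iff.2 ⟨?_, by rw [← hq, one_div]⟩
      rcases hq2.lt_or_eq with h | h
      · exact h
      · rw [← h] at hq
        have : 0 < 1 / x := by positivity
        simp at hq; linarith
    rw [eLpNorm_eq_lintegral_rpow_enorm_toReal (by positivity) hqt]
    exact ENNReal.lintegral_mul_le_Lp_mul_Lq ν hq3 hf hg

theorem lpSize_indicator {Ω : Type*} [MeasurableSpace Ω] {ν : Measure Ω} {I : Set Ω}
    (hI : MeasurableSet I) {a : ℝ} (ha : 0 < a) (f : Ω → ℝ≥0∞) :
    lpSize a ν (I.indicator f) = lpSize a (ν.restrict I) f := by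
  unfold lpSize
  congr 1
  rw [← lintegral_indicator hI]
  congr 1; ext t
  by_cases ht : t ∈ I <;> simp [ht, ha]

theorem integral_inner_left {Ω E : Type*} [MeasurableSpace Ω] {ν : Measure Ω}
    [NormedAddCommGroup E] [InnerProductSpace ℂ E] [CompleteSpace E] {f : Ω → E}
    (hf : Integrable f ν) (c : E) : ∫ t, inner ℂ (f t) c ∂ν = inner ℂ (∫ t, f t ∂ν) c := by
  calc ∫ t, inner ℂ (f t) c ∂ν = ∫ t, (starRingEnd ℂ) (inner ℂ c (f t)) ∂ν := by
        simp_rw [inner_conj_symm]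
    _ = _ := by rw [integral_conj, integral_inner hf, inner_conj_symm]

section Flow

variable {X : Type*} [MeasurableSpace X] {μ : Measure X}
  {H : Type*} [NormedAddCommGroup H] [InnerProductSpace ℂ H]

/-- A bounded strongly continuous family of operators `S t`, `t ∈ ℝ`, on `L²(μ; H)` such that the
adjoint of `S t` is `S (-t)`. -/
structure IsFlow (S : ℝ → Lp H 2 μ →L[ℂ] Lp H 2 μ) : Prop where
  continuous_uncurry : Continuous fun z : ℝ × Lp H 2 μ => S z.1 z.2
  bounded : ∃ M : ℝ≥0, ∀ t f, ‖S t f‖ ≤ M * ‖f‖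
  inner_left : ∀ t f g, inner ℂ (S t f) g = inner ℂ f (S (-t) g)

theorem IsFlow.add {S T : ℝ → Lp H 2 μ →L[ℂ] Lp H 2 μ} (hS : IsFlow S) (hT : IsFlow T) :
    IsFlow fun t => S t + T t := by
  obtain ⟨M, hM⟩ := hS.bounded
  obtain ⟨N, hN⟩ := hT.bounded
  refine ⟨?_, ⟨M + N, fun t f => ?_⟩, fun t f g => ?_⟩
  · exact hS.continuous_uncurry.add hT.continuous_uncurry
  · rw [add_apply, NNReal.coe_add, add_mul]
    exact (norm_add_le _ _).trans (add_le_add (hM t f) (hN t f))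
  · rw [add_apply, add_apply, inner_add_left,
      inner_add_right, hS.inner_left, hT.inner_left]

theorem IsFlow.stronglyMeasurable {S : ℝ → Lp H 2 μ →L[ℂ] Lp H 2 μ} (hS : IsFlow S)
    {Ω : Type*} [MeasurableSpace Ω] {ν : Measure Ω} {τ : Ω → ℝ} (hτ : Measurable τ)
    {F : Ω → Lp H 2 μ} (hF : AEStronglyMeasurable F ν) :
    AEStronglyMeasurable (fun z => S (τ z) (F z)) ν :=
  hS.continuous_uncurry.comp_aestronglyMeasurable
    (hτ.stronglyMeasurable.aestronglyMeasurable.prodMk hF)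

theorem IsFlow.integrable {S : ℝ → Lp H 2 μ →L[ℂ] Lp H 2 μ} (hS : IsFlow S)
    {ν : Measure ℝ} {τ : ℝ → ℝ} (hτ : Measurable τ)
    {F : ℝ → Lp H 2 μ} (hF : Integrable F ν) : Integrable (fun z => S (τ z) (F z)) ν := by
  obtain ⟨M, hM⟩ := hS.bounded
  exact (hF.norm.const_mul (M : ℝ)).mono' (hS.stronglyMeasurable hτ hF.1)
    (Filter.Eventually.of_forall fun t => hM _ _)

/-- The form `∫∫_D ⟪G(t), S(t - τ) F(τ)⟫ dτ dt`. -/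
def flowForm (S : ℝ → Lp H 2 μ →L[ℂ] Lp H 2 μ) (D : Set (ℝ × ℝ)) (F G : ℝ → Lp H 2 μ) : ℂ :=
  ∫ z in D, inner ℂ (G z.2) (S (z.2 - z.1) (F z.1))

theorem IsFlow.integrable_inner {S : ℝ → Lp H 2 μ →L[ℂ] Lp H 2 μ} (hS : IsFlow S)
    {F G : ℝ → Lp H 2 μ} (hF : Integrable F) (hG : Integrable G) :
    Integrable fun z : ℝ × ℝ => inner ℂ (G z.2) (S (z.2 - z.1) (F z.1)) := by
  obtain ⟨M, hM⟩ := hS.bounded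
  have h1 : Integrable (fun z : ℝ × ℝ => M * (‖F z.1‖ * ‖G z.2‖)) :=
    (hF.norm.mul_prod hG.norm).const_mul _
  refine h1.mono' ?_ (Filter.Eventually.of_forall fun z => ?_)
  · exact hG.1.comp_snd.inner (hS.stronglyMeasurable (by fun_prop) hF.1.comp_fst)
  · calc _ ≤ ‖G z.2‖ * (M * ‖F z.1‖) :=
        (norm_inner_le_norm _ _).trans (by gcongr; exact hM _ _)
      _ = _ := by ring

/-- The form is bounded by the `L¹_t L²` norms. -/
theorem IsFlow.exists_enorm_flowForm_le {S : ℝ → Lp H 2 μ →L[ℂ] Lp H 2 μ} (hS : IsFlow S) :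
    ∃ M : ℝ≥0, ∀ (D : Set (ℝ × ℝ)) (F G : ℝ → Lp H 2 μ), Integrable F → Integrable G →
      ‖flowForm S D F G‖ₑ ≤ M * ((∫⁻ t, ‖F t‖ₑ) * ∫⁻ t, ‖G t‖ₑ) := by
  obtain ⟨M, hM⟩ := hS.bounded
  refine ⟨M, fun D F G hF hG => ?_⟩
  calc ‖flowForm S D F G‖ₑ ≤ ∫⁻ z in D, ‖inner ℂ (G z.2) (S (z.2 - z.1) (F z.1))‖ₑ :=
        enorm_integral_le_lintegral_enorm _
    _ ≤ ∫⁻ z : ℝ × ℝ, M * (‖F z.1‖ₑ * ‖G z.2‖ₑ) := by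
        refine (lintegral_mono' Measure.restrict_le_self fun z => ?_)
        have : ‖inner ℂ (G z.2) (S (z.2 - z.1) (F z.1))‖ ≤ M * (‖F z.1‖ * ‖G z.2‖) :=
          calc _ ≤ ‖G z.2‖ * (M * ‖F z.1‖) :=
                (norm_inner_le_norm _ _).trans (by gcongr; exact hM _ _)
            _ = _ := by ring
        rw [← ofReal_norm, ← ofReal_norm, ← ofReal_norm, ← ENNReal.ofReal_mul (norm_nonneg _),
          ← ENNReal.ofReal_coe_nnreal, ← ENNReal.ofReal_mul (by positivity)]
        exact ENNReal.ofReal_le_ofReal this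
    _ = _ := by
        rw [lintegral_const_mul' _ _ ENNReal.coe_ne_top, Measure.volume_eq_prod,
          lintegral_prod_mul hF.1.enorm hG.1.enorm]

theorem IsFlow.flowForm_sub_sub {S : ℝ → Lp H 2 μ →L[ℂ] Lp H 2 μ} (hS : IsFlow S)
    (D : Set (ℝ × ℝ)) {F F' G G' : ℝ → Lp H 2 μ} (hF : Integrable F) (hF' : Integrable F')
    (hG : Integrable G) (hG' : Integrable G') :
    flowForm S D F G - flowForm S D F' G' =
      flowForm S D (F - F') G + flowForm S D F' (G - G') := by
  unfold flowForm
  rw [← integral_sub (hS.integrable_inner hF hG).integrableOn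
      (hS.integrable_inner hF' hG').integrableOn,
    ← integral_add (hS.integrable_inner (hF.sub hF') hG).integrableOn
      (hS.integrable_inner hF' (hG.sub hG')).integrableOn]
  congr 1; ext z
  simp only [Pi.sub_apply, map_sub, inner_sub_left, inner_sub_right]
  ring

/-- On a product set the form of a family that factors as `S (t - τ) = S t ∘ T (-τ)` is an inner
product of integrals. -/
theorem IsFlow.flowForm_prod [CompleteSpace H] {S T : ℝ → Lp H 2 μ →L[ℂ] Lp H 2 μ}
    (hS : IsFlow S) (hT : IsFlow T) (hST : ∀ t τ f, S (t - τ) f = S t (T (-τ) f))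
    (I J : Set ℝ) {F G : ℝ → Lp H 2 μ} (hF : Integrable F) (hG : Integrable G) :
    flowForm S (I ×ˢ J) F G =
      inner ℂ (∫ t in J, S (-t) (G t)) (∫ τ in I, T (-τ) (F τ)) := by
  have hb := (hT.integrable measurable_neg hF).restrict (s := I)
  have ha := (hS.integrable measurable_neg hG).restrict (s := J)
  have h1 : ∀ t τ : ℝ, inner ℂ (G t) (S (t - τ) (F τ)) =
      inner ℂ (S (-t) (G t)) (T (-τ) (F τ)) := by
    intro t τ
    rw [hST, hS.inner_left, neg_neg]
  unfold flowForm
  have h0 := (hS.integrable_inner hF hG).integrableOn (s := I ×ˢ J)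
  rw [Measure.volume_eq_prod] at h0 ⊢
  rw [setIntegral_prod _ h0]
  simp_rw [h1]
  calc ∫ τ in I, ∫ t in J, inner ℂ (S (-t) (G t)) (T (-τ) (F τ))
      = ∫ τ in I, inner ℂ (∫ t in J, S (-t) (G t)) (T (-τ) (F τ)) := by
        refine integral_congr_ae (Filter.Eventually.of_forall fun τ => ?_)
        exact integral_inner_left ha _
    _ = _ := integral_inner hb _

/-- The dual form of a bound of `t ↦ S t f` in `L_t^q Lᵖ` by the norm of `f`. -/
theorem IsFlow.enorm_integral_le [CompleteSpace H] {S : ℝ → Lp H 2 μ →L[ℂ] Lp H 2 μ}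
    (hS : IsFlow S) {A : ℝ≥0∞} {q : ℝ≥0∞} {p x y : ℝ} (hx : 1 ≤ x)
    (hq : (q⁻¹).toReal + 1 / x = 1) (hq1 : 1 ≤ q) (hpy : p.HolderConjugate y)
    (hA : ∀ f, eLpNorm (fun t => spSize p (S t f)) q volume ≤ A * ‖f‖ₑ)
    {F : ℝ → Lp H 2 μ} (hF : Integrable F) {I : Set ℝ} (hI : MeasurableSet I) :
    ‖∫ τ in I, S (-τ) (F τ)‖ₑ ≤ A * lpSize x (volume.restrict I) fun τ => spSize y (F τ) := by
  set v := ∫ τ in I, S (-τ) (F τ) with hv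
  by_cases hv0 : v = 0
  · rw [hv0, enorm_zero]; exact zero_le
  have hb := (hS.integrable measurable_neg hF).restrict (s := I)
  have hp0 : 0 < p := hpy.pos
  have hy0 : 0 < y := hpy.symm.pos
  have hx0 : 0 < x := by linarith
  have h1 : ‖v‖ₑ * ‖v‖ₑ ≤
      ‖v‖ₑ * (A * lpSize x (volume.restrict I) fun τ => spSize y (F τ)) := by
    calc ‖v‖ₑ * ‖v‖ₑ = ‖inner ℂ v v‖ₑ := by
          rw [inner_self_eq_norm_sq_to_K, sq, enorm_mul, ← ofReal_norm, ← ofReal_norm]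
          simp
      _ = ‖∫ τ in I, inner ℂ (S τ v) (F τ)‖ₑ := by
          conv_lhs => rw [hv]
          rw [← hv, ← integral_inner hb]
          simp_rw [hS.inner_left]
      _ ≤ ∫⁻ τ in I, spSize p (S τ v) * spSize y (F τ) :=
          (enorm_integral_le_lintegral_enorm _).trans
            (lintegral_mono fun τ => enorm_inner_le_spSize hpy _ _)
      _ = ∫⁻ τ, spSize p (S τ v) * I.indicator (fun τ => spSize y (F τ)) τ := by
          rw [← lintegral_indicator hI]
          congr 1; ext τ
          by_cases h : τ ∈ I <;> simp [h]
      _ ≤ eLpNorm (fun t => spSize p (S t v)) q volume *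
            lpSize x volume (I.indicator fun τ => spSize y (F τ)) :=
          lintegral_mul_le_eLpNorm_mul_lpSize hx hq hq1
            (aemeasurable_spSize hp0
              (hS.stronglyMeasurable measurable_id aestronglyMeasurable_const))
            ((aemeasurable_spSize hy0 hF.1).indicator hI)
      _ ≤ (A * ‖v‖ₑ) * lpSize x (volume.restrict I) (fun τ => spSize y (F τ)) := by
          rw [lpSize_indicator hI hx0]
          gcongr
          exact hA v
      _ = _ := by ring
  exact (ENNReal.mul_le_mul_iff_right (by simpa using hv0) enorm_ne_top).1 h1

/-- The bound of the form on a product set that follows from two homogeneous estimates. -/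
theorem IsFlow.enorm_flowForm_prod_le [CompleteSpace H] {S T : ℝ → Lp H 2 μ →L[ℂ] Lp H 2 μ}
    (hS : IsFlow S) (hT : IsFlow T) (hST : ∀ t τ f, S (t - τ) f = S t (T (-τ) f))
    {A B : ℝ≥0∞} {q qt : ℝ≥0∞} {p y pt yt x xt : ℝ}
    (hx : 1 ≤ x) (hq : (q⁻¹).toReal + 1 / x = 1) (hq1 : 1 ≤ q) (hpy : p.HolderConjugate y)
    (hxt : 1 ≤ xt) (hqt : (qt⁻¹).toReal + 1 / xt = 1) (hqt1 : 1 ≤ qt)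
    (hpyt : pt.HolderConjugate yt)
    (hA : ∀ f, eLpNorm (fun t => spSize p (S t f)) q volume ≤ A * ‖f‖ₑ)
    (hB : ∀ f, eLpNorm (fun t => spSize pt (T t f)) qt volume ≤ B * ‖f‖ₑ)
    {F G : ℝ → Lp H 2 μ} (hF : Integrable F) (hG : Integrable G) {I J : Set ℝ}
    (hI : MeasurableSet I) (hJ : MeasurableSet J) :
    ‖flowForm S (I ×ˢ J) F G‖ₑ ≤ A * B *
      ((lpSize xt (volume.restrict I) fun τ => spSize yt (F τ)) *
        lpSize x (volume.restrict J) fun τ => spSize y (G τ)) := by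
  rw [hS.flowForm_prod hT hST I J hF hG]
  refine (le_trans (b := ‖∫ t in J, S (-t) (G t)‖ₑ * ‖∫ τ in I, T (-τ) (F τ)‖ₑ) ?_
    (mul_le_mul' (hS.enorm_integral_le hx hq hq1 hpy hA hG hJ)
      (hT.enorm_integral_le hxt hqt hqt1 hpyt hB hF hI))).trans (le_of_eq (by ring))
  rw [← ofReal_norm, ← ofReal_norm, ← ofReal_norm, ← ENNReal.ofReal_mul (norm_nonneg _)]
  exact ENNReal.ofReal_le_ofReal (norm_inner_le_norm _ _)

end Flow

/-! ### Complex interpolation of forms on step functions -/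

section Interpolation

variable {X : Type*} [MeasurableSpace X] {μ : Measure X}
  {H : Type*} [NormedAddCommGroup H] [InnerProductSpace ℂ H]

/-- Three lines theorem for exponential sums with real frequencies. -/
theorem norm_exp_sum_le_interp {ι κ : Type*} (P : Finset ι) (Q : Finset κ) (a b : ι → ℝ)
    (a' b' : κ → ℝ) (K : ι → κ → ℂ) {f : ℂ → ℂ}
    (hf : ∀ z, f z = ∑ i ∈ P, ∑ k ∈ Q,
      Complex.exp (a i + b i * z) * Complex.exp (a' k + b' k * z) * K i k)
    {A B : ℝ} (hA : ∀ z : ℂ, z.re = 0 → ‖f z‖ ≤ A) (hB : ∀ z : ℂ, z.re = 1 → ‖f z‖ ≤ B)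
    {θ : ℝ} (h0 : 0 ≤ θ) (h1 : θ ≤ 1) : ‖f θ‖ ≤ A ^ (1 - θ) * B ^ θ := by
  have hfd : Differentiable ℂ f := by
    have : f = fun z => ∑ i ∈ P, ∑ k ∈ Q,
      Complex.exp (a i + b i * z) * Complex.exp (a' k + b' k * z) * K i k := funext hf
    rw [this]
    fun_prop
  have hexp : ∀ (a b : ℝ) (z : ℂ), 0 ≤ z.re → z.re ≤ 1 →
      ‖Complex.exp (a + b * z)‖ ≤ Real.exp (|a| + |b|) := by
    intro a b z hz0 hz1
    rw [Complex.norm_exp]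
    refine Real.exp_le_exp.2 ?_
    simp only [Complex.add_re, Complex.ofReal_re, Complex.mul_re, Complex.ofReal_im, zero_mul,
      sub_zero]
    have h2 : b * z.re ≤ |b| * 1 := mul_le_mul (le_abs_self b) hz1 hz0 (abs_nonneg b)
    linarith [le_abs_self a]
  have := Complex.HadamardThreeLines.norm_le_interp_of_mem_verticalClosedStrip₀₁' f
    (z := (θ : ℂ)) (a := A) (b := B)
    (by simp [Complex.HadamardThreeLines.verticalClosedStrip, h0, h1]) hfd.diffContOnCl
    ⟨∑ i ∈ P, ∑ k ∈ Q, Real.exp (|a i| + |b i|) * Real.exp (|a' k| + |b' k|) * ‖K i k‖, ?_⟩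
    (fun z hz => hA z hz) (fun z hz => hB z hz)
  · simpa using this
  · rintro _ ⟨z, hz, rfl⟩
    simp only [Complex.HadamardThreeLines.verticalClosedStrip, Set.mem_preimage, Set.mem_Icc] at hz
    simp only [Function.comp_apply, hf]
    refine (norm_sum_le _ _).trans (Finset.sum_le_sum fun i _ => ?_)
    refine (norm_sum_le _ _).trans (Finset.sum_le_sum fun k _ => ?_)
    rw [norm_mul, norm_mul]
    gcongr
    · exact hexp _ _ _ hz.1 hz.2
    · exact hexp _ _ _ hz.1 hz.2

namespace StepFn

/-- The step function whose value `h` on the level `e` of `F` is multiplied by `c e h`. -/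
def twist (F : StepFn μ H) (c : SimpleFunc X H → H → ℂ) : StepFn μ H where
  toFun := F.toFun.map fun e : SimpleFunc X H => e.map fun h => c e h • h
  finite_support := by
    refine ne_top_of_le_ne_top F.finite_support (measure_mono fun t ht => ?_)
    contrapose! ht
    rw [Function.notMem_support] at ht ⊢
    ext r
    rw [SimpleFunc.map_apply, SimpleFunc.map_apply, ht]
    simp
  memLp t := by
    obtain ⟨C, hC⟩ := ((F.toFun t).map fun h => ‖c (F.toFun t) h‖).exists_forall_le
    refine (F.memLp t).of_le_mul (c := C) (SimpleFunc.aestronglyMeasurable _)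
      (Filter.Eventually.of_forall fun r => ?_)
    rw [SimpleFunc.map_apply, SimpleFunc.map_apply, norm_smul]
    gcongr
    exact hC r

theorem twist_apply (F : StepFn μ H) (c : SimpleFunc X H → H → ℂ) (t : ℝ) (r : X) :
    (F.twist c).toFun t r = c (F.toFun t) (F.toFun t r) • F.toFun t r := rfl

theorem twist_one (F : StepFn μ H) : (F.twist fun _ _ => 1).val = F.val := by
  ext1 t
  refine Lp.ext ?_
  filter_upwards [F.coeFn_val t, (F.twist fun _ _ => 1).coeFn_val t] with r h1 h2
  rw [h1, h2, twist_apply, one_smul]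

open Classical in
/-- The part of a step function on which it has the value `i.2`, on the level `i.1`. -/
def piece (F : StepFn μ H) (i : SimpleFunc X H × H) : StepFn μ H :=
  F.twist fun e h => if (e, h) = i then 1 else 0

open Classical in
/-- The pairs of a level and a value of a step function. -/
def index (F : StepFn μ H) : Finset (SimpleFunc X H × H) :=
  F.toFun.range.biUnion fun e => e.range.image fun h => (e, h)

theorem mem_index (F : StepFn μ H) (t : ℝ) (r : X) : (F.toFun t, F.toFun t r) ∈ F.index := by
  classical
  simp only [index, Finset.mem_biUnion, Finset.mem_image]
  exact ⟨F.toFun t, SimpleFunc.mem_range_self _ _, F.toFun t r, SimpleFunc.mem_range_self _ _, rfl⟩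

theorem val_twist (F : StepFn μ H) (c : SimpleFunc X H → H → ℂ) (t : ℝ) :
    (F.twist c).val t = ∑ i ∈ F.index, c i.1 i.2 • (F.piece i).val t := by
  classical
  refine Lp.ext ?_
  have h1 : ∀ᵐ r ∂μ, ∀ i ∈ F.index, (F.piece i).val t r = (F.piece i).toFun t r :=
    (Finset.eventually_all _).2 fun i _ => (F.piece i).coeFn_val t
  have h2 : ∀ᵐ r ∂μ, ∀ i ∈ F.index,
      (c i.1 i.2 • (F.piece i).val t) r = c i.1 i.2 • (F.piece i).val t r :=
    (Finset.eventually_all _).2 fun i _ => Lp.coeFn_smul _ _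
  filter_upwards [(F.twist c).coeFn_val t, Lp.coeFn_finsetSum F.index
    (fun i => c i.1 i.2 • (F.piece i).val t), h1, h2] with r h3 h4 h5 h6
  rw [h3, h4, Finset.sum_apply, twist_apply, Finset.sum_eq_single (F.toFun t, F.toFun t r)]
  · rw [h6 _ (F.mem_index t r), h5 _ (F.mem_index t r), piece, twist_apply, if_pos rfl, one_smul]
  · intro i hi hne
    rw [h6 _ hi, h5 _ hi, piece, twist_apply, if_neg hne.symm, zero_smul, smul_zero]
  · intro h; exact absurd (F.mem_index t r) h

theorem memLp_toFun (F : StepFn μ H) (t : ℝ) (p : ℝ≥0∞) : MemLp (F.toFun t) p μ :=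
  SimpleFunc.memLp_of_finite_measure_preimage p
    (SimpleFunc.measure_preimage_lt_top_of_memLp (by norm_num) (by norm_num) _ (F.memLp t))

theorem spSize_val_ne_top (F : StepFn μ H) {y : ℝ} (hy : 0 < y) (t : ℝ) :
    spSize y (F.val t) ≠ ∞ := by
  rw [spSize_eq_eLpNorm hy, eLpNorm_congr_ae (F.coeFn_val t)]
  exact (F.memLp_toFun t _).2.ne

theorem exists_spSize_val_le (F : StepFn μ H) {y : ℝ} (hy : 0 < y) :
    ∃ C : ℝ≥0, ∀ t, spSize y (F.val t) ≤ C := by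
  obtain ⟨C, hC⟩ := (F.toFun.map fun e : SimpleFunc X H =>
    (lpSize y μ fun r => ‖e r‖ₑ).toNNReal).exists_forall_le
  refine ⟨C, fun t => ?_⟩
  rw [← ENNReal.coe_toNNReal (F.spSize_val_ne_top hy t), spSize_val]
  exact_mod_cast hC t

theorem lpSize_spSize_val_ne_top (F : StepFn μ H) {x y : ℝ} (hx : 0 < x) (hy : 0 < y)
    {ν : Measure ℝ} (hν : ν ≤ volume) : lpSize x ν (fun t => spSize y (F.val t)) ≠ ∞ := by
  obtain ⟨C, hC⟩ := F.exists_spSize_val_le hy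
  have h1 : lpSize x ν (fun t => spSize y (F.val t)) ≤
      lpSize x volume ((Function.support F.toFun).indicator fun _ => (C : ℝ≥0∞)) := by
    refine ENNReal.rpow_le_rpow (lintegral_mono' hν fun t => ?_) (by positivity)
    refine ENNReal.rpow_le_rpow ?_ hx.le
    by_cases ht : t ∈ Function.support F.toFun
    · rw [Set.indicator_of_mem ht]; exact hC t
    · change spSize y (F.val t) ≤ _
      rw [Set.indicator_of_notMem ht, F.val_eq_zero_of_notMem ht, spSize_zero hy]
  refine ne_top_of_le_ne_top ?_ h1
  rw [lpSize_indicator F.measurableSet_support hx]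
  unfold lpSize
  refine ENNReal.rpow_ne_top_of_nonneg (by positivity) ?_
  rw [lintegral_const, Measure.restrict_apply_univ]
  exact ENNReal.mul_ne_top (ENNReal.rpow_ne_top_of_nonneg hx.le ENNReal.coe_ne_top)
    F.finite_support

/-- The coefficient `‖e‖ʸ_{Lʸ}`, `|h|`, raised to powers which are affine in `z`. -/
def coeff (μ : Measure X) (y : ℝ) (α β : ℝ × ℝ) (z : ℂ) (e : SimpleFunc X H) (h : H) : ℂ :=
  Complex.exp (((α.1 * Real.log (lpSize y μ fun r => ‖e r‖ₑ).toReal +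
      β.1 * Real.log ‖h‖ : ℝ) : ℂ) +
    ((α.2 * Real.log (lpSize y μ fun r => ‖e r‖ₑ).toReal + β.2 * Real.log ‖h‖ : ℝ) : ℂ) * z)

theorem norm_coeff (y : ℝ) (α β : ℝ × ℝ) (z : ℂ) (e : SimpleFunc X H) (h : H) :
    ‖coeff μ y α β z e h‖ =
      Real.exp ((α.1 + α.2 * z.re) * Real.log (lpSize y μ fun r => ‖e r‖ₑ).toReal) *
      Real.exp ((β.1 + β.2 * z.re) * Real.log ‖h‖) := by
  rw [coeff, Complex.norm_exp, ← Real.exp_add]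
  congr 1
  simp only [Complex.add_re, Complex.ofReal_re, Complex.mul_re, Complex.ofReal_im, zero_mul,
    sub_zero]
  ring

/-- If `c e h` has the modulus `‖e‖ ^ (x / x₀ - y / y₀) |h| ^ (y / y₀ - 1)`, then the mixed norm
with exponents `x₀`, `y₀` of the twisted step function is a power of the one of `F` with exponents
`x`, `y`. -/
theorem lpSize_twist_le (F : StepFn μ H) {x y x₀ y₀ : ℝ} (hx : 0 < x) (hy : 0 < y)
    (hx₀ : 0 < x₀) (hy₀ : 0 < y₀) (c : SimpleFunc X H → H → ℂ)
    (hc : ∀ e h, ‖c e h‖ =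
      Real.exp ((x / x₀ - y / y₀) * Real.log (lpSize y μ fun r => ‖e r‖ₑ).toReal) *
      Real.exp ((y / y₀ - 1) * Real.log ‖h‖)) (ν : Measure ℝ) :
    lpSize x₀ ν (fun t => spSize y₀ ((F.twist c).val t)) ≤
      lpSize x ν (fun t => spSize y (F.val t)) ^ (x / x₀) := by
  have key : ∀ t, spSize y₀ ((F.twist c).val t) ≤ spSize y (F.val t) ^ (x / x₀) := by
    intro t
    rw [spSize_val, spSize_val]
    set N := lpSize y μ fun r => ‖F.toFun t r‖ₑ with hN
    have hNtop : N ≠ ∞ := by rw [hN, ← spSize_val]; exact F.spSize_val_ne_top hy t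
    have hpt : ∀ r, ‖(F.twist c).toFun t r‖ₑ =
        ENNReal.ofReal (Real.exp ((x / x₀ - y / y₀) * Real.log N.toReal)) *
          ‖F.toFun t r‖ₑ ^ (y / y₀) := by
      intro r
      rw [twist_apply, enorm_smul, ← ofReal_norm (c _ _), hc, ENNReal.ofReal_mul (by positivity),
        mul_assoc, ← hN]
      congr 1
      by_cases h : F.toFun t r = 0
      · rw [h, enorm_zero, mul_zero, ENNReal.zero_rpow_of_pos (by positivity)]
      · have hpos : 0 < ‖F.toFun t r‖ := norm_pos_iff.2 h
        rw [← ofReal_norm, ENNReal.ofReal_rpow_of_pos hpos, ← ENNReal.ofReal_mul (by positivity),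
          mul_comm _ (Real.log _), ← Real.rpow_def_of_pos hpos]
        congr 1
        nth_rewrite 2 [← Real.rpow_one ‖F.toFun t r‖]
        rw [← Real.rpow_add hpos]; ring_nf
    simp_rw [hpt]
    rw [lpSize_const_mul hy₀ ENNReal.ofReal_ne_top]
    have h2 : lpSize y₀ μ (fun r => ‖F.toFun t r‖ₑ ^ (y / y₀)) = N ^ (y / y₀) := by
      rw [hN]
      unfold lpSize
      simp_rw [← ENNReal.rpow_mul]
      rw [div_mul_cancel₀ _ hy₀.ne']
      congr 1; field_simp
    rw [h2]
    rcases eq_or_ne N 0 with h0 | h0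
    · rw [h0, ENNReal.zero_rpow_of_pos (by positivity), mul_zero]; exact zero_le
    · have hpos : 0 < N.toReal := ENNReal.toReal_pos h0 hNtop
      rw [mul_comm _ (Real.log _), ← Real.rpow_def_of_pos hpos, ← ENNReal.ofReal_rpow_of_pos hpos,
        ENNReal.ofReal_toReal hNtop, ← ENNReal.rpow_add _ _ h0 hNtop]
      apply le_of_eq; congr 1; ring
  calc _ ≤ lpSize x₀ ν (fun t => spSize y (F.val t) ^ (x / x₀)) := lpSize_mono hx₀ _ key
    _ = _ := by
      unfold lpSize
      simp_rw [← ENNReal.rpow_mul]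
      rw [div_mul_cancel₀ _ hx₀.ne']
      congr 1; field_simp

end StepFn

theorem IsFlow.flowForm_twist {S : ℝ → Lp H 2 μ →L[ℂ] Lp H 2 μ} (hS : IsFlow S)
    (D : Set (ℝ × ℝ)) (F G : StepFn μ H) (c d : SimpleFunc X H → H → ℂ) :
    flowForm S D (F.twist c).val (G.twist fun e h => (starRingEnd ℂ) (d e h)).val =
      ∑ i ∈ F.index, ∑ k ∈ G.index, c i.1 i.2 * d k.1 k.2 *
        flowForm S D (F.piece i).val (G.piece k).val := by
  unfold flowForm
  have hint : ∀ i k, Integrable (fun z : ℝ × ℝ => inner ℂ ((G.piece k).val z.2)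
      (S (z.2 - z.1) ((F.piece i).val z.1))) (volume.restrict D) := fun i k =>
    (hS.integrable_inner (F.piece i).integrable_val (G.piece k).integrable_val).integrableOn
  have hpt : ∀ z : ℝ × ℝ, inner ℂ ((G.twist fun e h => (starRingEnd ℂ) (d e h)).val z.2)
      (S (z.2 - z.1) ((F.twist c).val z.1)) =
      ∑ i ∈ F.index, ∑ k ∈ G.index, c i.1 i.2 * d k.1 k.2 *
        inner ℂ ((G.piece k).val z.2) (S (z.2 - z.1) ((F.piece i).val z.1)) := by
    intro z
    rw [StepFn.val_twist, StepFn.val_twist, map_sum, inner_sum]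
    refine Finset.sum_congr rfl fun i _ => ?_
    rw [sum_inner]
    refine Finset.sum_congr rfl fun k _ => ?_
    rw [map_smul, inner_smul_left, inner_smul_right, Complex.conj_conj]
    ring
  simp_rw [hpt]
  rw [integral_finsetSum _ fun i _ => integrable_finsetSum _ fun k _ => (hint i k).const_mul _]
  refine Finset.sum_congr rfl fun i _ => ?_
  rw [integral_finsetSum _ fun k _ => (hint i k).const_mul _]
  exact Finset.sum_congr rfl fun k _ => integral_const_mul _ _

/-- Complex interpolation between a bound of the form in mixed norms and a bound in `L¹_t L¹`. -/
theorem IsFlow.enorm_flowForm_le_interp {S : ℝ → Lp H 2 μ →L[ℂ] Lp H 2 μ} (hS : IsFlow S)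
    (D : Set (ℝ × ℝ)) {ν₁ ν₂ : Measure ℝ} (hν₁ : ν₁ ≤ volume) (hν₂ : ν₂ ≤ volume)
    {x₀ y₀ u₀ v₀ x y u v θ : ℝ} (h0 : 0 ≤ θ) (h1 : θ ≤ 1)
    (hx₀ : 0 < x₀) (hy₀ : 0 < y₀) (hu₀ : 0 < u₀) (hv₀ : 0 < v₀)
    (hx : 0 < x) (hy : 0 < y) (hu : 0 < u) (hv : 0 < v)
    (hx' : 1 / x = (1 - θ) / x₀ + θ) (hy' : 1 / y = (1 - θ) / y₀ + θ)
    (hu' : 1 / u = (1 - θ) / u₀ + θ) (hv' : 1 / v = (1 - θ) / v₀ + θ) {A B : ℝ≥0∞}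
    (hAt : A ≠ ∞) (hBt : B ≠ ∞)
    (hA : ∀ F G : StepFn μ H, ‖flowForm S D F.val G.val‖ₑ ≤
      A * (lpSize x₀ ν₁ (fun t => spSize y₀ (F.val t)) *
        lpSize u₀ ν₂ (fun t => spSize v₀ (G.val t))))
    (hB : ∀ F G : StepFn μ H, ‖flowForm S D F.val G.val‖ₑ ≤
      B * (lpSize 1 ν₁ (fun t => spSize 1 (F.val t)) *
        lpSize 1 ν₂ (fun t => spSize 1 (G.val t)))) (F G : StepFn μ H) :
    ‖flowForm S D F.val G.val‖ₑ ≤ A ^ (1 - θ) * B ^ θ *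
      (lpSize x ν₁ (fun t => spSize y (F.val t)) *
        lpSize u ν₂ (fun t => spSize v (G.val t))) := by
  set NF := lpSize x ν₁ (fun t => spSize y (F.val t)) with hNF
  set NG := lpSize u ν₂ (fun t => spSize v (G.val t)) with hNG
  have hNFt : NF ≠ ∞ := F.lpSize_spSize_val_ne_top hx hy hν₁
  have hNGt : NG ≠ ∞ := G.lpSize_spSize_val_ne_top hu hv hν₂
  set α : ℝ × ℝ := (x / x₀ - y / y₀, (x - y) - (x / x₀ - y / y₀)) with hα
  set β : ℝ × ℝ := (y / y₀ - 1, (y - 1) - (y / y₀ - 1)) with hβ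
  set α' : ℝ × ℝ := (u / u₀ - v / v₀, (u - v) - (u / u₀ - v / v₀)) with hα'
  set β' : ℝ × ℝ := (v / v₀ - 1, (v - 1) - (v / v₀ - 1)) with hβ'
  set c : ℂ → SimpleFunc X H → H → ℂ := fun z => StepFn.coeff μ y α β z with hc
  set d : ℂ → SimpleFunc X H → H → ℂ := fun z => StepFn.coeff μ v α' β' z with hd
  set f : ℂ → ℂ := fun z =>
    flowForm S D (F.twist (c z)).val (G.twist fun e h => (starRingEnd ℂ) (d z e h)).val with hf
  have hθ : ∀ {w w₀ : ℝ}, 0 < w → 0 < w₀ → 1 / w = (1 - θ) / w₀ + θ →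
      w / w₀ + (w - w / w₀) * θ = 1 := by
    intro w w₀ hw hw₀ h
    have : w * (1 / w) = w * ((1 - θ) / w₀ + θ) := by rw [h]
    rw [mul_one_div_cancel hw.ne'] at this
    rw [this]; ring
  have hfθ : f θ = flowForm S D F.val G.val := by
    have e1 : c θ = fun _ _ => 1 := by
      ext e h
      have hx3 := hθ hx hx₀ hx'
      have hy3 := hθ hy hy₀ hy'
      simp only [hc, StepFn.coeff, ← Complex.ofReal_mul, ← Complex.ofReal_add,
        ← Complex.ofReal_exp]
      rw [← Complex.ofReal_one, Complex.ofReal_inj, Real.exp_eq_one_iff]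
      simp only [hα, hβ]
      linear_combination (hx3 - hy3) * Real.log (lpSize y μ fun r => ‖e r‖ₑ).toReal +
        hy3 * Real.log ‖h‖
    have e2 : d θ = fun _ _ => 1 := by
      ext e h
      have hx3 := hθ hu hu₀ hu'
      have hy3 := hθ hv hv₀ hv'
      simp only [hd, StepFn.coeff, ← Complex.ofReal_mul, ← Complex.ofReal_add,
        ← Complex.ofReal_exp]
      rw [← Complex.ofReal_one, Complex.ofReal_inj, Real.exp_eq_one_iff]
      simp only [hα', hβ']
      linear_combination (hx3 - hy3) * Real.log (lpSize v μ fun r => ‖e r‖ₑ).toReal +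
        hy3 * Real.log ‖h‖
    simp only [hf, e1, e2, map_one, StepFn.twist_one]
  have htoR : ∀ {w : ℂ} {K : ℝ≥0∞} {a b : ℝ}, 0 ≤ a → 0 ≤ b → K ≠ ∞ →
      ‖w‖ₑ ≤ K * (NF ^ a * NG ^ b) → ‖w‖ ≤ K.toReal * (NF.toReal ^ a * NG.toReal ^ b) := by
    intro w K a b ha hb hK h
    have h3 : K * (NF ^ a * NG ^ b) ≠ ∞ := ENNReal.mul_ne_top hK (ENNReal.mul_ne_top
      (ENNReal.rpow_ne_top_of_nonneg ha hNFt) (ENNReal.rpow_ne_top_of_nonneg hb hNGt))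
    have := ENNReal.toReal_mono h3 h
    simpa [ENNReal.toReal_mul, ENNReal.toReal_rpow] using this
  have hcd : ∀ (y : ℝ) (α β : ℝ × ℝ) (z : ℂ) (x₀ y₀ x : ℝ), α.1 + α.2 * z.re = x / x₀ - y / y₀ →
      β.1 + β.2 * z.re = y / y₀ - 1 → ∀ (e : SimpleFunc X H) (h : H),
      ‖StepFn.coeff μ y α β z e h‖ =
      Real.exp ((x / x₀ - y / y₀) * Real.log (lpSize y μ fun r => ‖e r‖ₑ).toReal) *
      Real.exp ((y / y₀ - 1) * Real.log ‖h‖) := by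
    intro y α β z x₀ y₀ x h1 h2 e h
    rw [StepFn.norm_coeff, h1, h2]
  have hf0 : ∀ z : ℂ, z.re = 0 →
      ‖f z‖ ≤ A.toReal * (NF.toReal ^ (x / x₀) * NG.toReal ^ (u / u₀)) := by
    intro z hz
    refine htoR (by positivity) (by positivity) hAt ((hA _ _).trans ?_)
    gcongr
    · exact F.lpSize_twist_le hx hy hx₀ hy₀ _
        (hcd y α β z x₀ y₀ x (by simp [hα, hz]) (by simp [hβ, hz])) _
    · refine G.lpSize_twist_le hu hv hu₀ hv₀ _ (fun e h => ?_) _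
      rw [RCLike.norm_conj]
      exact hcd v α' β' z u₀ v₀ u (by simp [hα', hz]) (by simp [hβ', hz]) e h
  have hf1 : ∀ z : ℂ, z.re = 1 →
      ‖f z‖ ≤ B.toReal * (NF.toReal ^ x * NG.toReal ^ u) := by
    intro z hz
    refine htoR hx.le hu.le hBt ((hB _ _).trans ?_)
    rw [← div_one x, ← div_one u]
    gcongr
    · exact F.lpSize_twist_le hx hy one_pos one_pos _
        (hcd y α β z 1 1 x (by simp [hα, hz]) (by simp [hβ, hz])) _
    · refine G.lpSize_twist_le hu hv one_pos one_pos _ (fun e h => ?_) _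
      rw [RCLike.norm_conj]
      exact hcd v α' β' z 1 1 u (by simp [hα', hz]) (by simp [hβ', hz]) e h
  have hmain := norm_exp_sum_le_interp F.index G.index _ _ _ _ _
    (fun z => hS.flowForm_twist D F G (c z) (d z)) hf0 hf1 h0 h1
  change ‖f θ‖ ≤ _ at hmain
  rw [hfθ] at hmain
  have hxe : x / x₀ * (1 - θ) + x * θ = 1 := by have := hθ hx hx₀ hx'; linarith
  have hue : u / u₀ * (1 - θ) + u * θ = 1 := by have := hθ hu hu₀ hu'; linarith
  have hθ' : 0 ≤ 1 - θ := by linarith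
  have hpow : (A.toReal * (NF.toReal ^ (x / x₀) * NG.toReal ^ (u / u₀))) ^ (1 - θ) *
      (B.toReal * (NF.toReal ^ x * NG.toReal ^ u)) ^ θ =
      A.toReal ^ (1 - θ) * B.toReal ^ θ * (NF.toReal * NG.toReal) := by
    have hF0 : 0 ≤ NF.toReal := ENNReal.toReal_nonneg
    have hG0 : 0 ≤ NG.toReal := ENNReal.toReal_nonneg
    have e1 : NF.toReal = NF.toReal ^ (x / x₀ * (1 - θ)) * NF.toReal ^ (x * θ) := by
      rw [← Real.rpow_add_of_nonneg hF0 (by positivity) (by positivity), hxe, Real.rpow_one]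
    have e2 : NG.toReal = NG.toReal ^ (u / u₀ * (1 - θ)) * NG.toReal ^ (u * θ) := by
      rw [← Real.rpow_add_of_nonneg hG0 (by positivity) (by positivity), hue, Real.rpow_one]
    rw [Real.mul_rpow (by positivity) (by positivity), Real.mul_rpow (by positivity)
      (by positivity), Real.mul_rpow (by positivity) (by positivity), Real.mul_rpow (by positivity)
      (by positivity), ← Real.rpow_mul hF0, ← Real.rpow_mul hF0, ← Real.rpow_mul hG0,
      ← Real.rpow_mul hG0]
    conv_rhs => rw [e1, e2]
    ring
  rw [hpow] at hmain
  rw [← ofReal_norm]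
  refine (ENNReal.ofReal_le_ofReal hmain).trans (le_of_eq ?_)
  rw [ENNReal.ofReal_mul (by positivity), ENNReal.ofReal_mul (by positivity),
    ENNReal.ofReal_mul (by positivity), ← ENNReal.ofReal_rpow_of_nonneg (by positivity) hθ',
    ← ENNReal.ofReal_rpow_of_nonneg (by positivity) h0, ENNReal.ofReal_toReal hAt,
    ENNReal.ofReal_toReal hBt, ENNReal.ofReal_toReal hNFt, ENNReal.ofReal_toReal hNGt]

end Interpolation

/-! ### Local estimates and their sum off the line of duality -/

/-- Minkowski's integral inequality for a finite family of functions. -/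
theorem rpow_sum_lintegral_le {Ω ι : Type*} [MeasurableSpace Ω] {ν : Measure Ω} (S : Finset ι)
    {r : ℝ} (hr : 1 < r) (h : ι → Ω → ℝ≥0∞) (hh : ∀ i, AEMeasurable (h i) ν) :
    (∑ i ∈ S, (∫⁻ t, h i t ∂ν) ^ r) ^ (1 / r) ≤ ∫⁻ t, (∑ i ∈ S, h i t ^ r) ^ (1 / r) ∂ν := by
  have hr0 : 0 < r := by linarith
  set R := ∫⁻ t, (∑ i ∈ S, h i t ^ r) ^ (1 / r) ∂ν with hR
  set A : ι → ℝ≥0∞ := fun i => ∫⁻ t, h i t ∂ν with hA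
  rcases eq_or_ne R ∞ with hRt | hRt
  · rw [hRt]; exact le_top
  have hAR : ∀ i ∈ S, A i ≤ R := fun i hi => lintegral_mono fun t => by
    calc h i t = (h i t ^ r) ^ (1 / r) := by
          rw [← ENNReal.rpow_mul, mul_one_div_cancel hr0.ne', ENNReal.rpow_one]
      _ ≤ _ := by
          gcongr
          exact Finset.single_le_sum (f := fun i => h i t ^ r) (fun i _ => zero_le) hi
  set N := ∑ i ∈ S, A i ^ r with hN
  have hNt : N ≠ ∞ := ENNReal.sum_ne_top.2 fun i hi =>
    ENNReal.rpow_ne_top_of_nonneg hr0.le (ne_top_of_le_ne_top hRt (hAR i hi))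
  rcases eq_or_ne N 0 with hN0 | hN0
  · rw [hN0, ENNReal.zero_rpow_of_pos (by positivity)]; exact zero_le
  set r' := r.conjExponent
  have hrr : r.HolderConjugate r' := Real.HolderConjugate.conjExponent hr
  have hr'0 : 0 < r' := hrr.symm.pos
  have hkey : N ≤ N ^ (1 / r') * R := by
    calc N = ∑ i ∈ S, A i ^ (r - 1) * ∫⁻ t, h i t ∂ν := by
          refine Finset.sum_congr rfl fun i hi => ?_
          change A i ^ r = A i ^ (r - 1) * A i
          nth_rewrite 3 [← ENNReal.rpow_one (A i)]
          rw [← ENNReal.rpow_add_of_nonneg _ _ (by linarith) one_pos.le, sub_add_cancel]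
      _ = ∫⁻ t, ∑ i ∈ S, A i ^ (r - 1) * h i t ∂ν := by
          rw [lintegral_finsetSum' S fun i _ => (hh i).const_mul _]
          refine Finset.sum_congr rfl fun i _ => ?_
          rw [lintegral_const_mul'' _ (hh i)]
      _ ≤ ∫⁻ t, N ^ (1 / r') * (∑ i ∈ S, h i t ^ r) ^ (1 / r) ∂ν := by
          refine lintegral_mono fun t => ?_
          refine (ENNReal.inner_le_Lp_mul_Lq S _ _ hrr.symm).trans (le_of_eq ?_)
          congr 2
          refine Finset.sum_congr rfl fun i _ => ?_
          rw [← ENNReal.rpow_mul, hrr.sub_one_mul_conj]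
      _ = _ := lintegral_const_mul' _ _ (ENNReal.rpow_ne_top_of_nonneg (by positivity) hNt)
  have hsplit : N = N ^ (1 / r') * N ^ (1 / r) := by
    rw [← ENNReal.rpow_add _ _ hN0 hNt, one_div, one_div, hrr.symm.inv_add_inv_eq_one,
      ENNReal.rpow_one]
  have h0 : N ^ (1 / r') ≠ 0 := by simp [ENNReal.rpow_eq_zero_iff, hN0, hNt]
  have h1 : N ^ (1 / r') ≠ ∞ := ENNReal.rpow_ne_top_of_nonneg (by positivity) hNt
  nth_rewrite 1 [hsplit] at hkey
  exact (ENNReal.mul_le_mul_iff_right h0 h1).1 hkey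

theorem sqComb_lpSize_le {Ω ι : Type*} [MeasurableSpace Ω] {ν : Measure Ω} (S : Finset ι)
    {x : ℝ} (hx : 0 < x) (hx2 : x < 2) {w : ι → ℝ≥0∞} (hw : ∀ i, w i ≠ ∞) {f : ι → Ω → ℝ≥0∞}
    (hf : ∀ i, AEMeasurable (f i) ν) :
    sqComb S w (fun i => lpSize x ν (f i)) ≤ lpSize x ν fun t => sqComb S w fun i => f i t := by
  have h := rpow_sum_lintegral_le (ν := ν) S (r := 2 / x) (by rw [lt_div_iff₀ hx]; linarith)
    (fun i t => (w i * f i t) ^ x) (fun i => ((hf i).const_mul _).pow_const x)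
  have e1 : ∀ y : ℝ≥0∞, (y ^ x) ^ (2 / x) = y ^ 2 := fun y => by
    rw [← ENNReal.rpow_mul, mul_div_cancel₀ _ hx.ne', ENNReal.rpow_two]
  have e2 : ∀ i, (∫⁻ t, (w i * f i t) ^ x ∂ν) ^ (2 / x) = (w i * lpSize x ν (f i)) ^ 2 := by
    intro i
    rw [← e1, ← lpSize_const_mul hx (hw i), lpSize_rpow hx]
  simp_rw [e1, e2] at h
  unfold sqComb
  have h2 := ENNReal.rpow_le_rpow h (z := 1 / x) (by positivity)
  rw [← ENNReal.rpow_mul, show 1 / (2 / x) * (1 / x) = 1 / 2 by field_simp] at h2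
  refine h2.trans (le_of_eq ?_)
  unfold lpSize
  simp_rw [← ENNReal.rpow_mul]
  rw [show 1 / (2 / x) = 1 / 2 * x by field_simp]

theorem sum_mul_le_sqComb {ι : Type*} (S : Finset ι) (w a b : ι → ℝ≥0∞) :
    ∑ i ∈ S, w i ^ 2 * (a i * b i) ≤ sqComb S w a * sqComb S w b := by
  have h := ENNReal.inner_le_Lp_mul_Lq S (fun i => w i * a i) (fun i => w i * b i)
    (p := 2) (q := 2) (by constructor <;> norm_num)
  simp only [ENNReal.rpow_two] at h
  refine le_trans (le_of_eq ?_) h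
  exact Finset.sum_congr rfl fun i _ => by ring

section Local

variable {X : Type*} [MeasurableSpace X] {μ : Measure X}
  {H : Type*} [NormedAddCommGroup H] [InnerProductSpace ℂ H]

/-- The hypotheses on the frequency localized propagators `S j = P_{2ʲ} exp(i t Dᵃ)`, as operators
on `L²(μ; H)`: homogeneous Strichartz estimates, and the dispersive estimate in its dual form on
the boxes of the Whitney decomposition, rescaled to intervals of length `2ᵏ`. -/
structure IsDispersive (S : ℤ → ℝ → Lp H 2 μ →L[ℂ] Lp H 2 μ) (n a σ σ' : ℝ) : Prop where
  isFlow : ∀ j, IsFlow (S j)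
  factor : ∀ j t τ f, S j (t - τ) f = S j t ((S (j - 1) (-τ) + S j (-τ) + S (j + 1) (-τ)) f)
  strichartz : ∀ p τ ω : ℝ, 2 ≤ p → τ ∈ Set.Ioo σ σ' → ω = τ * (1 / 2 - 1 / p) → ω ≤ 1 / 2 →
    ∃ C : ℝ≥0, ∀ j f, eLpNorm (fun t => spSize p (S j t f)) (ENNReal.ofReal ω)⁻¹ volume ≤
      C * 2 ^ (j * (n / 2 - n / p - a * ω)) * ‖f‖ₑ
  dispersive : ∃ C : ℝ≥0, ∀ (j k m : ℤ) (b : Bool) (F G : StepFn μ H),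
    ‖flowForm (S j) (whitneyBox (k, m, b)) F.val G.val‖ₑ ≤
      C * 2 ^ (j * (n - a * σ) - k * σ) *
        (lpSize 1 (volume.restrict (dyInt k (whitneyPast m b))) (fun t => spSize 1 (F.val t)) *
          lpSize 1 (volume.restrict (dyInt k (whitneyFuture m b))) fun t => spSize 1 (G.val t))

variable {S : ℤ → ℝ → Lp H 2 μ →L[ℂ] Lp H 2 μ} {n a σ σ' : ℝ}

theorem IsDispersive.isFlow_adjacent (hS : IsDispersive S n a σ σ') (j : ℤ) :
    IsFlow fun t => S (j - 1) t + S j t + S (j + 1) t :=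
  ((hS.isFlow _).add (hS.isFlow _)).add (hS.isFlow _)

theorem IsDispersive.strichartz_adjacent (hS : IsDispersive S n a σ σ') {p τ ω : ℝ} (hp : 2 ≤ p)
    (hτ : τ ∈ Set.Ioo σ σ') (hω : ω = τ * (1 / 2 - 1 / p)) (hω2 : ω ≤ 1 / 2) :
    ∃ C : ℝ≥0, ∀ j f,
      eLpNorm (fun t => spSize p ((S (j - 1) t + S j t + S (j + 1) t) f)) (ENNReal.ofReal ω)⁻¹
        volume ≤ C * 2 ^ (j * (n / 2 - n / p - a * ω)) * ‖f‖ₑ := by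
  obtain ⟨C, hC⟩ := hS.strichartz p τ ω hp hτ hω hω2
  set e := n / 2 - n / p - a * ω with he
  have hK : (C * (2 ^ (-e) + 1 + 2 ^ e) : ℝ≥0∞) ≠ ∞ :=
    ENNReal.mul_ne_top ENNReal.coe_ne_top (ENNReal.add_ne_top.2 ⟨ENNReal.add_ne_top.2
      ⟨two_rpow_ne_top _, ENNReal.one_ne_top⟩, two_rpow_ne_top _⟩)
  refine ⟨(C * (2 ^ (-e) + 1 + 2 ^ e) : ℝ≥0∞).toNNReal, fun j f => ?_⟩
  rw [ENNReal.coe_toNNReal hK]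
  have hp0 : 0 < p := by linarith
  have hq1 : 1 ≤ (ENNReal.ofReal ω)⁻¹ := by
    rw [ENNReal.one_le_inv, ENNReal.ofReal_le_one]; linarith
  have hm : ∀ i, AEStronglyMeasurable (fun t => spSize p (S i t f)) volume := fun i =>
    (aemeasurable_spSize hp0 ((hS.isFlow i).stronglyMeasurable measurable_id
      aestronglyMeasurable_const)).aestronglyMeasurable
  calc _ ≤ eLpNorm ((fun t => spSize p (S (j - 1) t f)) + (fun t => spSize p (S j t f)) +
        fun t => spSize p (S (j + 1) t f)) (ENNReal.ofReal ω)⁻¹ volume := by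
        refine eLpNorm_mono_enorm fun t => ?_
        simp only [enorm_eq_self, Pi.add_apply]
        exact (spSize_add_le (by linarith) _ _).trans
          (add_le_add_left (spSize_add_le (by linarith) _ _) _)
    _ ≤ C * 2 ^ (((j - 1 : ℤ) : ℝ) * e) * ‖f‖ₑ + C * 2 ^ (j * e) * ‖f‖ₑ +
        C * 2 ^ (((j + 1 : ℤ) : ℝ) * e) * ‖f‖ₑ :=
        (eLpNorm_add_le ((hm _).add (hm _)) (hm _) hq1).trans (add_le_add
          ((eLpNorm_add_le (hm _) (hm _) hq1).trans (add_le_add (hC _ f) (hC _ f))) (hC _ f))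
    _ = _ := by
        have e1 : (((j - 1 : ℤ) : ℝ) * e) = j * e + -e := by push_cast; ring
        have e2 : (((j + 1 : ℤ) : ℝ) * e) = j * e + e := by push_cast; ring
        rw [e1, e2, two_rpow_add, two_rpow_add]
        ring

/-- The local estimate: interpolation, with weight `θ`, between the dispersive estimate and the
product of two Strichartz estimates with the Lebesgue exponents `(1 - θ) / α` and
`(1 - θ) / αt`. -/
theorem IsDispersive.exists_local [CompleteSpace H] (hS : IsDispersive S n a σ σ')
    {σ₁ σ₂ θ α αt ω ωt x y u v : ℝ} (h₁ : σ₁ ∈ Set.Ioo σ σ') (h₂ : σ₂ ∈ Set.Ioo σ σ')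
    (hσ : 0 ≤ σ) (hθ0 : 0 < θ) (hθ1 : θ < 1) (hα : 0 < α) (hα2 : α ≤ (1 - θ) / 2)
    (hω : ω = σ₁ * ((1 - θ) / 2 - α)) (hω2 : ω ≤ (1 - θ) / 2)
    (hαt : 0 < αt) (hαt2 : αt ≤ (1 - θ) / 2)
    (hωt : ωt = σ₂ * ((1 - θ) / 2 - αt)) (hωt2 : ωt ≤ (1 - θ) / 2)
    (hx : 1 / x = 1 - ωt) (hy : 1 / y = 1 - αt) (hu : 1 / u = 1 - ω) (hv : 1 / v = 1 - α) :
    ∃ C : ℝ≥0, ∀ (j k m : ℤ) (b : Bool) (F G : StepFn μ H),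
      ‖flowForm (S j) (whitneyBox (k, m, b)) F.val G.val‖ₑ ≤
        C * 2 ^ (j * (n - n * (α + αt) - a * (ω + ωt) - a * (σ * θ)) - k * (σ * θ)) *
        (lpSize x (volume.restrict (dyInt k (whitneyPast m b))) (fun t => spSize y (F.val t)) *
          lpSize u (volume.restrict (dyInt k (whitneyFuture m b))) fun t =>
            spSize v (G.val t)) := by
  have hc : 0 < 1 - θ := by linarith
  have hω0 : 0 ≤ ω := by rw [hω]; exact mul_nonneg (hσ.trans h₁.1.le) (by linarith)
  have hωt0 : 0 ≤ ωt := by rw [hωt]; exact mul_nonneg (hσ.trans h₂.1.le) (by linarith)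
  have hp : 2 ≤ (1 - θ) / α := by rw [le_div_iff₀ hα]; linarith
  have hpt : 2 ≤ (1 - θ) / αt := by rw [le_div_iff₀ hαt]; linarith
  have hω' : ω / (1 - θ) = σ₁ * (1 / 2 - 1 / ((1 - θ) / α)) := by rw [hω]; field_simp
  have hωt' : ωt / (1 - θ) = σ₂ * (1 / 2 - 1 / ((1 - θ) / αt)) := by rw [hωt]; field_simp
  have hω'2 : ω / (1 - θ) ≤ 1 / 2 := by rw [div_le_iff₀ hc]; linarith
  have hωt'2 : ωt / (1 - θ) ≤ 1 / 2 := by rw [div_le_iff₀ hc]; linarith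
  have hω'0 : 0 ≤ ω / (1 - θ) := by positivity
  have hωt'0 : 0 ≤ ωt / (1 - θ) := by positivity
  have hα'2 : α / (1 - θ) ≤ 1 / 2 := by rw [div_le_iff₀ hc]; linarith
  have hαt'2 : αt / (1 - θ) ≤ 1 / 2 := by rw [div_le_iff₀ hc]; linarith
  have hα'0 : 0 < α / (1 - θ) := by positivity
  have hαt'0 : 0 < αt / (1 - θ) := by positivity
  obtain ⟨C1, hC1⟩ := hS.strichartz _ σ₁ _ hp h₁ hω' hω'2
  obtain ⟨C2, hC2⟩ := hS.strichartz_adjacent hpt h₂ hωt' hωt'2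
  obtain ⟨C3, hC3⟩ := hS.dispersive
  have hq1 : ∀ w : ℝ, w ≤ 1 / 2 → 1 ≤ (ENNReal.ofReal w)⁻¹ := fun w hw => by
    rw [ENNReal.one_le_inv, ENNReal.ofReal_le_one]; linarith
  have hqr : ∀ w : ℝ, 0 ≤ w → w ≤ 1 / 2 →
      ((ENNReal.ofReal w)⁻¹⁻¹).toReal + 1 / (1 - w)⁻¹ = 1 := fun w hw0 hw => by
    rw [inv_inv, ENNReal.toReal_ofReal hw0]; simp
  have hone : ∀ w : ℝ, 0 ≤ w → w ≤ 1 / 2 → 1 ≤ (1 - w)⁻¹ := fun w hw0 hw =>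
    (one_le_inv₀ (by linarith)).2 (by linarith)
  have hconj : ∀ w : ℝ, 0 < w → w ≤ (1 - θ) / 2 →
      ((1 - θ) / w).HolderConjugate (1 - w / (1 - θ))⁻¹ := fun w hw0 hw => by
    have h1 : 2 ≤ (1 - θ) / w := by rw [le_div_iff₀ hw0]; linarith
    refine Real.holderConjugate_iff.2 ⟨by linarith, ?_⟩
    rw [inv_inv, inv_div]; ring
  have hinterp : ∀ w z : ℝ, 1 / z = 1 - w → 1 / z = (1 - θ) / (1 - w / (1 - θ))⁻¹ + θ := by
    intro w z hz
    rw [hz, div_inv_eq_mul, mul_sub, mul_div_cancel₀ _ hc.ne']; ring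
  have hpos : ∀ w z : ℝ, w ≤ (1 - θ) / 2 → 1 / z = 1 - w → 0 < z := fun w z hw hz => by
    have h0 : 0 < 1 / z := by rw [hz]; linarith
    exact one_div_pos.1 h0
  have hpos' : ∀ w : ℝ, w ≤ 1 / 2 → 0 < (1 - w)⁻¹ := fun w hw => inv_pos.2 (by linarith)
  set e := n / 2 - n / ((1 - θ) / α) - a * (ω / (1 - θ)) with he
  set et := n / 2 - n / ((1 - θ) / αt) - a * (ωt / (1 - θ)) with het
  refine ⟨(C1 * C2) ^ (1 - θ) * C3 ^ θ, fun j k m b F G => ?_⟩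
  have hmain := (hS.isFlow j).enorm_flowForm_le_interp (whitneyBox (k, m, b))
    (ν₁ := volume.restrict (dyInt k (whitneyPast m b)))
    (ν₂ := volume.restrict (dyInt k (whitneyFuture m b)))
    Measure.restrict_le_self Measure.restrict_le_self hθ0.le hθ1.le
    (hpos' _ hωt'2) (hpos' _ hαt'2) (hpos' _ hω'2) (hpos' _ hα'2)
    (hpos _ _ hωt2 hx) (hpos _ _ hαt2 hy) (hpos _ _ hω2 hu) (hpos _ _ hα2 hv)
    (hinterp _ _ hx) (hinterp _ _ hy) (hinterp _ _ hu) (hinterp _ _ hv)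
    (A := (C1 * 2 ^ (j * e)) * (C2 * 2 ^ (j * et))) (B := C3 * 2 ^ (j * (n - a * σ) - k * σ))
    (ENNReal.mul_ne_top (ENNReal.mul_ne_top ENNReal.coe_ne_top (two_rpow_ne_top _))
      (ENNReal.mul_ne_top ENNReal.coe_ne_top (two_rpow_ne_top _)))
    (ENNReal.mul_ne_top ENNReal.coe_ne_top (two_rpow_ne_top _))
    -- the product of two Strichartz estimates, with exponents `(1 - θ) / α` and `(1 - θ) / αt`
    (fun F G => (hS.isFlow j).enorm_flowForm_prod_le (hS.isFlow_adjacent j) (hS.factor j)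
      (hone _ hω'0 hω'2) (hqr _ hω'0 hω'2) (hq1 _ hω'2) (hconj _ hα hα2)
      (hone _ hωt'0 hωt'2) (hqr _ hωt'0 hωt'2) (hq1 _ hωt'2) (hconj _ hαt hαt2)
      (hC1 j) (hC2 j) F.integrable_val G.integrable_val
      (measurableSet_dyInt _ _) (measurableSet_dyInt _ _))
    (fun F G => hC3 j k m b F G) F G
  refine hmain.trans (le_of_eq ?_)
  congr 1
  have hexp : j * (n - n * (α + αt) - a * (ω + ωt) - a * (σ * θ)) - k * (σ * θ) =
      (j * e + j * et) * (1 - θ) + (j * (n - a * σ) - k * σ) * θ := by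
    rw [he, het]; field_simp; ring
  have t1 : ((C1 : ℝ≥0∞) * 2 ^ (j * e)) * (C2 * 2 ^ (j * et)) =
      ((C1 * C2 : ℝ≥0) : ℝ≥0∞) * 2 ^ (j * e + j * et) := by
    rw [two_rpow_add, ENNReal.coe_mul]; ring
  rw [t1, ENNReal.mul_rpow_of_nonneg _ _ hc.le, ENNReal.mul_rpow_of_nonneg _ _ hθ0.le,
    ← ENNReal.rpow_mul, ← ENNReal.rpow_mul, hexp, two_rpow_add, ENNReal.coe_mul (_ ^ _),
    ENNReal.coe_rpow_of_nonneg _ hc.le, ENNReal.coe_rpow_of_nonneg _ hθ0.le]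
  ring

/-- The retarded form is controlled by the boxes of the Whitney decomposition of `τ < t`. -/
theorem IsFlow.enorm_flowForm_lt_le {S : ℝ → Lp H 2 μ →L[ℂ] Lp H 2 μ} (hS : IsFlow S)
    {F G : ℝ → Lp H 2 μ} (hF : Integrable F) (hG : Integrable G) :
    ‖flowForm S {z | z.1 < z.2} F G‖ₑ ≤
      ∑' (k : ℤ) (m : ℤ) (b : Bool), ‖flowForm S (whitneyBox (k, m, b)) F G‖ₑ := by
  have h1 : flowForm S {z | z.1 < z.2} F G = ∑' i, flowForm S (whitneyBox i) F G := by
    unfold flowForm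
    rw [← iUnion_whitneyBox]
    exact integral_iUnion measurableSet_whitneyBox pairwise_disjoint_whitneyBox
      (hS.integrable_inner hF hG).integrableOn
  rw [h1]
  refine enorm_tsum_le_tsum_enorm.trans (le_of_eq ?_)
  rw [ENNReal.tsum_prod']
  congr 1; ext k
  rw [ENNReal.tsum_prod']

theorem sqComb_le_sum {ι : Type*} (T : Finset ι) (w a : ι → ℝ≥0∞) :
    sqComb T w a ≤ ∑ i ∈ T, w i * a i := by
  unfold sqComb
  have h : ∑ i ∈ T, (w i * a i) ^ 2 ≤ (∑ i ∈ T, w i * a i) ^ 2 := by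
    rw [sq (∑ i ∈ T, w i * a i), Finset.sum_mul]
    refine Finset.sum_le_sum fun i hi => ?_
    rw [sq]
    gcongr
    exact Finset.single_le_sum (f := fun i => w i * a i) (fun _ _ => zero_le) hi
  refine (ENNReal.rpow_le_rpow h (by norm_num)).trans (le_of_eq ?_)
  rw [← ENNReal.rpow_two, ← ENNReal.rpow_mul]; norm_num

theorem sqComb_ne_top {ι : Type*} (T : Finset ι) {w a : ι → ℝ≥0∞} (hw : ∀ i, w i ≠ ∞)
    (ha : ∀ i, a i ≠ ∞) : sqComb T w a ≠ ∞ :=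
  ne_top_of_le_ne_top (ENNReal.sum_ne_top.2 fun i _ => ENNReal.mul_ne_top (hw i) (ha i))
    (sqComb_le_sum T w a)

theorem lpSize_sqComb_ne_top {Ω ι : Type*} [MeasurableSpace Ω] {ν : Measure Ω} (T : Finset ι)
    {x : ℝ} (hx : 1 ≤ x) {w : ι → ℝ≥0∞} (hw : ∀ i, w i ≠ ∞) {f : ι → Ω → ℝ≥0∞}
    (hf : ∀ i, Measurable (f i)) (hfin : ∀ i, lpSize x ν (f i) ≠ ∞) :
    lpSize x ν (fun t => sqComb T w fun i => f i t) ≠ ∞ := by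
  classical
  have hx0 : 0 < x := by linarith
  refine ne_top_of_le_ne_top ?_ (lpSize_mono hx0 ν fun t => sqComb_le_sum T w fun i => f i t)
  induction T using Finset.induction_on with
  | empty => simp [lpSize, hx0]
  | insert i T hi ih =>
    simp_rw [Finset.sum_insert hi]
    refine ne_top_of_le_ne_top (ENNReal.add_ne_top.2 ⟨?_, ih⟩)
      (lpSize_add_le hx ((hf i).const_mul _).aemeasurable
        (Finset.measurable_fun_sum T fun i _ => (hf i).const_mul _).aemeasurable)
    rw [lpSize_const_mul hx0 (hw i)]
    exact ENNReal.mul_ne_top (hw i) (hfin i)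

theorem measurable_sqComb {Ω ι : Type*} [MeasurableSpace Ω] (T : Finset ι) (w : ι → ℝ≥0∞)
    {f : ι → Ω → ℝ≥0∞} (hf : ∀ i, Measurable (f i)) :
    Measurable fun t => sqComb T w fun i => f i t :=
  (Finset.measurable_fun_sum T fun i _ => ((hf i).const_mul _).pow_const 2).pow_const _

theorem StepFn.measurable_spSize_val (F : StepFn μ H) (y : ℝ) :
    Measurable fun t => spSize y (F.val t) := by
  simp_rw [StepFn.spSize_val]
  exact F.measurable_comp_toFun fun e => lpSize y μ fun r => ‖e r‖ₑ

/-- The retarded estimate on step functions when `1/q + 1/qt < 1`, for finitely many frequencies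
at once. The numbers `Q`, `Qt` stand for `1/q`, `1/qt`. -/
theorem IsDispersive.exists_nonsharp [CompleteSpace H] (hS : IsDispersive S n a σ σ')
    {σ₁ σ₂ θ α αt ω ωt y v Q Qt X₀ Y₀ s : ℝ} (h₁ : σ₁ ∈ Set.Ioo σ σ') (h₂ : σ₂ ∈ Set.Ioo σ σ')
    (hσ : 0 ≤ σ) (hθ0 : 0 < θ) (hθ1 : θ < 1) (hα : 0 < α) (hα2 : α ≤ (1 - θ) / 2)
    (hω : ω = σ₁ * ((1 - θ) / 2 - α)) (hω2 : ω ≤ (1 - θ) / 2)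
    (hαt : 0 < αt) (hαt2 : αt ≤ (1 - θ) / 2)
    (hωt : ωt = σ₂ * ((1 - θ) / 2 - αt)) (hωt2 : ωt ≤ (1 - θ) / 2)
    (hy : 1 / y = 1 - αt) (hv : 1 / v = 1 - α) (hX : 1 / X₀ = 1 - Qt) (hY : 1 / Y₀ = 1 - Q)
    (hQ : ω < Q) (hQt : ωt < Qt) (hQ1 : Q < 1) (hQt1 : Qt < 1) (hQQ : Q + Qt < 1)
    (hβ : Q + Qt = σ * θ + ω + ωt)
    (hs : n - n * (α + αt) - a * (ω + ωt) - a * (σ * θ) = -2 * s) :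
    ∃ C : ℝ≥0, ∀ (T : Finset ℤ) (F G : ℤ → StepFn μ H),
      ‖∑ j ∈ T, flowForm (S j) {z | z.1 < z.2} (F j).val (G j).val‖ₑ ≤
        C * ((lpSize X₀ volume fun t => sqComb T (fun j => 2 ^ (-(j * s)))
            fun j => spSize y ((F j).val t)) *
          lpSize Y₀ volume fun t => sqComb T (fun j => 2 ^ (-(j * s)))
            fun j => spSize v ((G j).val t)) := by
  have hω0 : 0 ≤ ω := by
    rw [hω]; exact mul_nonneg (hσ.trans h₁.1.le) (by linarith)
  have hωt0 : 0 ≤ ωt := by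
    rw [hωt]; exact mul_nonneg (hσ.trans h₂.1.le) (by linarith)
  obtain ⟨x, hx⟩ : ∃ x, x = 1 / (1 - ωt) := ⟨_, rfl⟩
  obtain ⟨u, hu⟩ : ∃ u, u = 1 / (1 - ω) := ⟨_, rfl⟩
  have hx' : 1 / x = 1 - ωt := by rw [hx, one_div_one_div]
  have hu' : 1 / u = 1 - ω := by rw [hu, one_div_one_div]
  have hlt : ∀ {w W z Z : ℝ}, 1 / z = 1 - w → 1 / Z = 1 - W → w < W → W < 1 → z < Z := by
    intro w W z Z hz hZ hw hW
    have h2 : 0 < 1 / Z := by rw [hZ]; linarith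
    exact lt_of_one_div_lt_one_div (one_div_pos.1 h2) (by rw [hz, hZ]; linarith)
  have hle1 : ∀ {w z : ℝ}, 1 / z = 1 - w → 0 ≤ w → w < 1 → 1 ≤ z := by
    intro w z hz hw hw1
    rw [← one_div_one_div z, hz, le_div_iff₀ (by linarith)]; linarith
  have hx1 : 1 ≤ x := hle1 hx' hωt0 (by linarith)
  have hu1 : 1 ≤ u := hle1 hu' hω0 (by linarith)
  have hxX := hlt hx' hX hQt hQt1
  have huY := hlt hu' hY hQ hQ1
  have hx2 : x < 2 := hlt hx' (by norm_num : (1 : ℝ) / 2 = 1 - 1 / 2) (by linarith) (by norm_num)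
  have hu2 : u < 2 := hlt hu' (by norm_num : (1 : ℝ) / 2 = 1 - 1 / 2) (by linarith) (by norm_num)
  have hy0 : 0 < y := one_div_pos.1 (by rw [hy]; linarith)
  have hv0 : 0 < v := one_div_pos.1 (by rw [hv]; linarith)
  obtain ⟨C1, hC1⟩ := hS.exists_local h₁ h₂ hσ hθ0 hθ1 hα hα2 hω hω2 hαt hαt2 hωt hωt2 hx' hy
    hu' hv
  obtain ⟨C2, hC2⟩ := exists_whitney_sum_le hx1 hu1 hxX huY (by rw [hX, hY]; linarith)
  refine ⟨C1 * C2, fun T F G => ?_⟩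
  set w : ℤ → ℝ≥0∞ := fun j => 2 ^ (-(j * s)) with hw
  have hwt : ∀ j, w j ≠ ∞ := fun j => two_rpow_ne_top _
  set f : ℝ → ℝ≥0∞ := fun t => sqComb T w fun j => spSize y ((F j).val t) with hf
  set g : ℝ → ℝ≥0∞ := fun t => sqComb T w fun j => spSize v ((G j).val t) with hg
  -- `x, u < 2` lets Minkowski's inequality move the `ℓ²` sum over the frequencies inside
  have hbox : ∀ (k m : ℤ) (b : Bool),
      ∑ j ∈ T, ‖flowForm (S j) (whitneyBox (k, m, b)) (F j).val (G j).val‖ₑ ≤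
      C1 * (2 ^ (k * (1 / X₀ + 1 / Y₀ - 1 / x - 1 / u)) *
        (lpSize x (volume.restrict (dyInt k (whitneyPast m b))) f *
          lpSize u (volume.restrict (dyInt k (whitneyFuture m b))) g)) := by
    intro k m b
    set ν₁ : Measure ℝ := volume.restrict (dyInt k (whitneyPast m b))
    set ν₂ : Measure ℝ := volume.restrict (dyInt k (whitneyFuture m b))
    calc _ ≤ ∑ j ∈ T, C1 * 2 ^ (k * (1 / X₀ + 1 / Y₀ - 1 / x - 1 / u)) *
          (w j ^ 2 * (lpSize x ν₁ (fun t => spSize y ((F j).val t)) *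
            lpSize u ν₂ fun t => spSize v ((G j).val t))) := by
          refine Finset.sum_le_sum fun j _ => (hC1 j k m b (F j) (G j)).trans (le_of_eq ?_)
          have e1 : j * (n - n * (α + αt) - a * (ω + ωt) - a * (σ * θ)) - k * (σ * θ) =
              k * (1 / X₀ + 1 / Y₀ - 1 / x - 1 / u) + (-(j * s) + -(j * s)) := by
            rw [hs, hX, hY, hx', hu']
            linear_combination (k : ℝ) * hβ
          rw [e1, two_rpow_add, two_rpow_add, hw, sq]
          ring
      _ = C1 * 2 ^ (k * (1 / X₀ + 1 / Y₀ - 1 / x - 1 / u)) * ∑ j ∈ T,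
          (w j ^ 2 * (lpSize x ν₁ (fun t => spSize y ((F j).val t)) *
            lpSize u ν₂ fun t => spSize v ((G j).val t))) := by rw [Finset.mul_sum]
      _ ≤ C1 * 2 ^ (k * (1 / X₀ + 1 / Y₀ - 1 / x - 1 / u)) *
          (lpSize x ν₁ f * lpSize u ν₂ g) := by
          gcongr
          refine (sum_mul_le_sqComb T w _ _).trans ?_
          gcongr
          · exact sqComb_lpSize_le T (by linarith) hx2 hwt
              fun j => ((F j).measurable_spSize_val y).aemeasurable
          · exact sqComb_lpSize_le T (by linarith) hu2 hwt
              fun j => ((G j).measurable_spSize_val v).aemeasurable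
      _ = _ := by ring
  calc _ ≤ ∑ j ∈ T, ∑' (k : ℤ) (m : ℤ) (b : Bool),
        ‖flowForm (S j) (whitneyBox (k, m, b)) (F j).val (G j).val‖ₑ :=
        (enorm_sum_le _ _).trans (Finset.sum_le_sum fun j _ =>
          (hS.isFlow j).enorm_flowForm_lt_le (F j).integrable_val (G j).integrable_val)
    _ = ∑' (k : ℤ) (m : ℤ) (b : Bool), ∑ j ∈ T,
        ‖flowForm (S j) (whitneyBox (k, m, b)) (F j).val (G j).val‖ₑ := by
        rw [← Summable.tsum_finsetSum fun j _ => ENNReal.summable]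
        congr 1; ext k
        rw [← Summable.tsum_finsetSum fun j _ => ENNReal.summable]
        congr 1; ext m
        rw [← Summable.tsum_finsetSum fun j _ => ENNReal.summable]
    _ ≤ ∑' (k : ℤ) (m : ℤ) (b : Bool), C1 *
        (2 ^ (k * (1 / X₀ + 1 / Y₀ - 1 / x - 1 / u)) *
        (lpSize x (volume.restrict (dyInt k (whitneyPast m b))) f *
          lpSize u (volume.restrict (dyInt k (whitneyFuture m b))) g)) :=
        ENNReal.tsum_le_tsum fun k => ENNReal.tsum_le_tsum fun m => ENNReal.tsum_le_tsum fun b =>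
          hbox k m b
    _ ≤ C1 * (C2 * (lpSize X₀ volume f * lpSize Y₀ volume g)) := by
        simp_rw [ENNReal.tsum_mul_left]
        gcongr
        simp_rw [← ENNReal.tsum_mul_left]
        refine hC2 f g
          (measurable_sqComb T w fun j => (F j).measurable_spSize_val y)
          (measurable_sqComb T w fun j => (G j).measurable_spSize_val v)
          (fun t => sqComb_ne_top T hwt fun j => (F j).spSize_val_ne_top hy0 t)
          (fun t => sqComb_ne_top T hwt fun j => (G j).spSize_val_ne_top hv0 t)
          (lpSize_sqComb_ne_top T (by linarith) hwt (fun j => (F j).measurable_spSize_val y)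
            fun j => (F j).lpSize_spSize_val_ne_top (by linarith) hy0 le_rfl)
          (lpSize_sqComb_ne_top T (by linarith) hwt (fun j => (G j).measurable_spSize_val v)
            fun j => (G j).lpSize_spSize_val_ne_top (by linarith) hv0 le_rfl)
    _ = _ := by rw [ENNReal.coe_mul]; ring

end Local

/-! ### The sum on the line of duality -/

section Sharp

variable {X : Type*} [MeasurableSpace X] {μ : Measure X}
  {H : Type*} [NormedAddCommGroup H] [InnerProductSpace ℂ H]

open Classical in
/-- The `m`-th spatial atom of a step function, taken at each time. -/
def StepFn.atom (F : StepFn μ H) (m : ℤ) : StepFn μ H :=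
  F.twist fun e h => if ‖h‖ₑ ∈ atomValues μ (fun r => ‖e r‖ₑ) m then 1 else 0

theorem StepFn.measurable_enorm_toFun (F : StepFn μ H) (t : ℝ) :
    Measurable fun r => ‖F.toFun t r‖ₑ :=
  ((F.toFun t).map fun h => ‖h‖ₑ).measurable

theorem StepFn.spSize_atom (F : StepFn μ H) (m : ℤ) (z t : ℝ) :
    spSize z ((F.atom m).val t) = lpSize z μ (atomPart μ (fun r => ‖F.toFun t r‖ₑ) m) := by
  rw [StepFn.spSize_val]
  congr 1; ext r
  rw [atom, twist_apply]
  by_cases h : ‖F.toFun t r‖ₑ ∈ atomValues μ (fun r => ‖F.toFun t r‖ₑ) m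
  · rw [if_pos h, one_smul, atomPart, Set.indicator_of_mem (by exact h)]
  · rw [if_neg h, zero_smul, enorm_zero, atomPart, Set.indicator_of_notMem (by exact h)]

/-- A step function is the sum of finitely many of its spatial atoms. -/
theorem StepFn.exists_sum_atom (F : StepFn μ H) :
    ∃ M : Finset ℤ, ∀ t, F.val t = ∑ m ∈ M, (F.atom m).val t := by
  classical
  set lev : SimpleFunc X H × H → ℤ := fun i =>
    dyadicLevel (μ (levelSet (fun r => ‖i.1 r‖ₑ) (dyadicLevel ‖i.2‖ₑ))) with hlev
  refine ⟨F.index.image lev, fun t => Lp.ext ?_⟩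
  have h1 : ∀ᵐ r ∂μ, ∀ m ∈ F.index.image lev, (F.atom m).val t r = (F.atom m).toFun t r :=
    (Finset.eventually_all _).2 fun m _ => (F.atom m).coeFn_val t
  filter_upwards [F.coeFn_val t, Lp.coeFn_finsetSum (F.index.image lev)
    (fun m => (F.atom m).val t), h1] with r h2 h3 h4
  rw [h2, h3, Finset.sum_apply, Finset.sum_congr rfl h4]
  simp_rw [atom, twist_apply]
  by_cases h0 : F.toFun t r = 0
  · simp [h0]
  have hmem : ∀ m, ‖F.toFun t r‖ₑ ∈ atomValues μ (fun r => ‖F.toFun t r‖ₑ) m ↔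
      lev (F.toFun t, F.toFun t r) = m := by
    intro m
    simp [atomValues, hlev, h0]
  rw [Finset.sum_eq_single (lev (F.toFun t, F.toFun t r))]
  · rw [if_pos ((hmem _).2 rfl), one_smul]
  · intro m _ hne
    rw [if_neg (fun h => hne ((hmem m).1 h).symm), zero_smul]
  · intro h
    exact absurd (Finset.mem_image_of_mem lev (F.mem_index t r)) h

theorem IsFlow.flowForm_sum {S : ℝ → Lp H 2 μ →L[ℂ] Lp H 2 μ} (hS : IsFlow S)
    (D : Set (ℝ × ℝ)) {ι κ : Type*} (P : Finset ι) (Q : Finset κ) {F G : ℝ → Lp H 2 μ}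
    {f : ι → ℝ → Lp H 2 μ} {g : κ → ℝ → Lp H 2 μ} (hf : ∀ i, Integrable (f i))
    (hg : ∀ k, Integrable (g k)) (hF : ∀ t, F t = ∑ i ∈ P, f i t)
    (hG : ∀ t, G t = ∑ k ∈ Q, g k t) :
    flowForm S D F G = ∑ i ∈ P, ∑ k ∈ Q, flowForm S D (f i) (g k) := by
  unfold flowForm
  have hint : ∀ i k, Integrable (fun z : ℝ × ℝ => inner ℂ (g k z.2) (S (z.2 - z.1) (f i z.1)))
      (volume.restrict D) := fun i k => (hS.integrable_inner (hf i) (hg k)).integrableOn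
  simp_rw [hF, hG, map_sum, inner_sum, sum_inner]
  rw [integral_finsetSum _ fun i _ => integrable_finsetSum _ fun k _ => hint i k]
  exact Finset.sum_congr rfl fun i _ => integral_finsetSum _ fun k _ => hint i k

/-- In `L^X_t` the sum over the spatial atoms is controlled when `X` is at least the spatial
exponent. -/
theorem StepFn.tsum_lpSize_atom_le (F : StepFn μ H) {y x : ℝ} (hy : 0 < y) (hyx : y ≤ x) :
    (∑' m, lpSize x volume (fun t => spSize y ((F.atom m).val t)) ^ x) ^ (1 / x) ≤
      lpSize x volume fun t => spSize y (F.val t) := by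
  have hx : 0 < x := by linarith
  simp_rw [lpSize_rpow hx]
  rw [← lintegral_tsum fun m => (((F.atom m).measurable_spSize_val y).pow_const x).aemeasurable]
  rw [lpSize]
  gcongr with t
  have h1 := ENNReal.tsum_rpow_le_of_le hy hyx fun m => spSize y ((F.atom m).val t)
  have h2 := tsum_lpSize_atomPart_le μ (F.measurable_enorm_toFun t) hy
  simp_rw [← F.spSize_atom, ← F.spSize_val] at h2
  have h3 := ENNReal.rpow_le_rpow (h1.trans h2) hx.le
  rwa [← ENNReal.rpow_mul, one_div_mul_cancel hx.ne', ENNReal.rpow_one] at h3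

theorem StepFn.exists_spSize_atom_le {z y : ℝ} (hz : 0 < z) (hy : 0 < y) :
    ∃ C : ℝ≥0, ∀ (F : StepFn μ H) (m : ℤ) (t : ℝ),
      spSize z ((F.atom m).val t) ≤ C * 2 ^ (m * (1 / z - 1 / y)) * spSize y ((F.atom m).val t) := by
  obtain ⟨C, hC⟩ := exists_lpSize_atomPart_le hz hy
  refine ⟨C, fun F m t => ?_⟩
  rw [F.spSize_atom, F.spSize_atom]
  refine hC μ _ (F.measurable_enorm_toFun t) (fun i => ?_) m
  refine levelSet_measure_ne_top μ (F.measurable_enorm_toFun t) hy ?_ i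
  rw [← lpSize_rpow hy, ← F.spSize_val]
  exact ENNReal.rpow_ne_top_of_nonneg hy.le (F.spSize_val_ne_top hy t)

/-- The sum over one scale of the Whitney decomposition of the interactions of two spatial atoms,
estimated with the spatial exponents `1/p - δ`, `1/pt - δt` in place of `1/p`, `1/pt`. -/
theorem IsDispersive.exists_atom_scale_le [CompleteSpace H]
    {S : ℤ → ℝ → Lp H 2 μ →L[ℂ] Lp H 2 μ} {n a σ σ' : ℝ} (hS : IsDispersive S n a σ σ')
    {σ₁ σ₂ θ α αt ω ωt y v Q Qt X₀ Y₀ s : ℝ} (h₁ : σ₁ ∈ Set.Ioo σ σ') (h₂ : σ₂ ∈ Set.Ioo σ σ')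
    (hσ : 0 ≤ σ) (hθ0 : 0 < θ) (hθ1 : θ < 1)
    (hω : ω = σ₁ * ((1 - θ) / 2 - α)) (hωt : ωt = σ₂ * ((1 - θ) / 2 - αt))
    (hy0 : 0 < y) (hv0 : 0 < v) (hy : 1 / y = 1 - αt) (hv : 1 / v = 1 - α)
    (hX : 1 / X₀ = 1 - Qt) (hY : 1 / Y₀ = 1 - Q) (hQ1 : Q < 1) (hQt1 : Qt < 1)
    (hQQ : Q + Qt ≤ 1) (hβ : Q + Qt = σ * θ + ω + ωt)
    (hs : n - n * (α + αt) - a * (ω + ωt) - a * (σ * θ) = -2 * s)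
    {δ δt : ℝ} (hα : 0 < α - δ) (hα2 : α - δ ≤ (1 - θ) / 2) (hω2 : ω + σ₁ * δ ≤ (1 - θ) / 2)
    (hαt : 0 < αt - δt) (hαt2 : αt - δt ≤ (1 - θ) / 2) (hωt2 : ωt + σ₂ * δt ≤ (1 - θ) / 2)
    (hQ : ω + σ₁ * δ ≤ Q) (hQt : ωt + σ₂ * δt ≤ Qt) :
    ∃ C : ℝ≥0, ∀ (j k m l : ℤ) (F G : StepFn μ H),
      ∑' (i : ℤ) (b : Bool),
        ‖flowForm (S j) (whitneyBox (k, i, b)) (F.atom m).val (G.atom l).val‖ₑ ≤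
      C * 2 ^ (-2 * s * j) *
        ((2 ^ (δt * (m - σ₂ * k - (a * σ₂ - n) * j)) *
          lpSize X₀ volume fun t => spSize y ((F.atom m).val t)) *
        (2 ^ (δ * (l - σ₁ * k - (a * σ₁ - n) * j)) *
          lpSize Y₀ volume fun t => spSize v ((G.atom l).val t))) := by
  have hω'0 : 0 ≤ ω + σ₁ * δ := by
    have : ω + σ₁ * δ = σ₁ * ((1 - θ) / 2 - (α - δ)) := by rw [hω]; ring
    rw [this]; exact mul_nonneg (hσ.trans h₁.1.le) (by linarith)
  have hωt'0 : 0 ≤ ωt + σ₂ * δt := by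
    have : ωt + σ₂ * δt = σ₂ * ((1 - θ) / 2 - (αt - δt)) := by rw [hωt]; ring
    rw [this]; exact mul_nonneg (hσ.trans h₂.1.le) (by linarith)
  obtain ⟨x', hx'⟩ : ∃ x, 1 / x = 1 - (ωt + σ₂ * δt) := ⟨(1 - (ωt + σ₂ * δt))⁻¹, by simp⟩
  obtain ⟨u', hu'⟩ : ∃ x, 1 / x = 1 - (ω + σ₁ * δ) := ⟨(1 - (ω + σ₁ * δ))⁻¹, by simp⟩
  obtain ⟨y', hy'⟩ : ∃ x, 1 / x = 1 - (αt - δt) := ⟨(1 - (αt - δt))⁻¹, by simp⟩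
  obtain ⟨v', hv'⟩ : ∃ x, 1 / x = 1 - (α - δ) := ⟨(1 - (α - δ))⁻¹, by simp⟩
  have hle : ∀ {w W z Z : ℝ}, 1 / z = 1 - w → 1 / Z = 1 - W → w ≤ W → W < 1 → z ≤ Z := by
    intro w W z Z hz hZ hw hW
    have h2 : 0 < 1 / Z := by rw [hZ]; linarith
    exact le_of_one_div_le_one_div (one_div_pos.1 h2) (by rw [hz, hZ]; linarith)
  have h11 : (1 : ℝ) / 1 = 1 - 0 := by norm_num
  have hx'1 : 1 ≤ x' := hle h11 hx' hωt'0 (by linarith)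
  have hu'1 : 1 ≤ u' := hle h11 hu' hω'0 (by linarith)
  have hxX : x' ≤ X₀ := hle hx' hX hQt hQt1
  have huY : u' ≤ Y₀ := hle hu' hY hQ hQ1
  have hy'0 : 0 < y' := one_div_pos.1 (by rw [hy']; linarith)
  have hv'0 : 0 < v' := one_div_pos.1 (by rw [hv']; linarith)
  obtain ⟨C1, hC1⟩ := hS.exists_local (ω := ω + σ₁ * δ) (ωt := ωt + σ₂ * δt) h₁ h₂ hσ hθ0 hθ1 hα
    hα2 (by rw [hω]; ring) hω2 hαt hαt2 (by rw [hωt]; ring) hωt2 hx' hy' hu' hv'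
  obtain ⟨C2, hC2⟩ := StepFn.exists_spSize_atom_le (μ := μ) (H := H) hy'0 hy0
  obtain ⟨C3, hC3⟩ := StepFn.exists_spSize_atom_le (μ := μ) (H := H) hv'0 hv0
  refine ⟨C1 * C2 * C3 * 2, fun j k m l F G => ?_⟩
  set E : ℝ := j * (n - n * ((α - δ) + (αt - δt)) - a * ((ω + σ₁ * δ) + (ωt + σ₂ * δt)) -
    a * (σ * θ)) - k * (σ * θ) with hE
  set f : ℝ → ℝ≥0∞ := fun t => spSize y ((F.atom m).val t) with hf
  set g : ℝ → ℝ≥0∞ := fun t => spSize v ((G.atom l).val t) with hg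
  set cf : ℝ≥0∞ := C2 * 2 ^ (m * (1 / y' - 1 / y)) with hcf
  set cg : ℝ≥0∞ := C3 * 2 ^ (l * (1 / v' - 1 / v)) with hcg
  have hcft : cf ≠ ∞ := ENNReal.mul_ne_top ENNReal.coe_ne_top (two_rpow_ne_top _)
  have hcgt : cg ≠ ∞ := ENNReal.mul_ne_top ENNReal.coe_ne_top (two_rpow_ne_top _)
  have hx'0 : 0 < x' := by linarith
  have hu'0 : 0 < u' := by linarith
  have hbox : ∀ (i : ℤ) (b : Bool),
      ‖flowForm (S j) (whitneyBox (k, i, b)) (F.atom m).val (G.atom l).val‖ₑ ≤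
      C1 * 2 ^ E * (cf * cg) * (lpSize x' (volume.restrict (dyInt k (whitneyPast i b))) f *
        lpSize u' (volume.restrict (dyInt k (whitneyFuture i b))) g) := by
    intro i b
    refine (hC1 j k i b (F.atom m) (G.atom l)).trans ?_
    rw [mul_assoc (C1 * 2 ^ E : ℝ≥0∞)]
    refine mul_le_mul' le_rfl ?_
    calc _ ≤ (cf * lpSize x' (volume.restrict (dyInt k (whitneyPast i b))) f) *
          (cg * lpSize u' (volume.restrict (dyInt k (whitneyFuture i b))) g) := by
          rw [← lpSize_const_mul hx'0 hcft, ← lpSize_const_mul hu'0 hcgt]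
          exact mul_le_mul' (lpSize_mono hx'0 _ fun t => hC2 F m t)
            (lpSize_mono hu'0 _ fun t => hC3 G l t)
      _ = _ := by ring
  calc _ ≤ ∑' (i : ℤ) (b : Bool), C1 * 2 ^ E * (cf * cg) *
        (lpSize x' (volume.restrict (dyInt k (whitneyPast i b))) f *
        lpSize u' (volume.restrict (dyInt k (whitneyFuture i b))) g) :=
        ENNReal.tsum_le_tsum fun i => ENNReal.tsum_le_tsum fun b => hbox i b
    _ ≤ C1 * 2 ^ E * (cf * cg) * (2 * 2 ^ (k * ((1 / x' - 1 / X₀) + (1 / u' - 1 / Y₀))) *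
        (lpSize X₀ volume f * lpSize Y₀ volume g)) := by
        simp_rw [ENNReal.tsum_mul_left]
        gcongr
        exact tsum_whitney_scale_le hx'1 hu'1 hxX huY (by rw [hX, hY]; linarith)
          ((F.atom m).measurable_spSize_val y) ((G.atom l).measurable_spSize_val v) k
    _ = _ := by
        have hexp : E + (m * (1 / y' - 1 / y) + (l * (1 / v' - 1 / v) +
            k * ((1 / x' - 1 / X₀) + (1 / u' - 1 / Y₀)))) =
            -2 * s * j + (δt * (m - σ₂ * k - (a * σ₂ - n) * j) +
              δ * (l - σ₁ * k - (a * σ₁ - n) * j)) := by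
          rw [hE, hx', hX, hu', hY, hy', hy, hv', hv]
          linear_combination (j : ℝ) * hs + (k : ℝ) * hβ
        have h2 := congrArg (fun w : ℝ => (2 : ℝ≥0∞) ^ w) hexp
        simp only [two_rpow_add] at h2
        rw [hcf, hcg]
        calc _ = (C1 * C2 * C3 * 2 : ℝ≥0∞) * (2 ^ E * (2 ^ (m * (1 / y' - 1 / y)) *
              (2 ^ (l * (1 / v' - 1 / v)) *
                2 ^ (k * ((1 / x' - 1 / X₀) + (1 / u' - 1 / Y₀)))))) *
              (lpSize X₀ volume f * lpSize Y₀ volume g) := by ring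
          _ = _ := by
            rw [h2]; push_cast; ring

/-- The retarded estimate on step functions when `1/q + 1/qt = 1`, for one frequency. -/
theorem IsDispersive.exists_sharp [CompleteSpace H]
    {S : ℤ → ℝ → Lp H 2 μ →L[ℂ] Lp H 2 μ} {n a σ σ' : ℝ} (hS : IsDispersive S n a σ σ')
    {σ₁ σ₂ θ α αt ω ωt y v Q Qt X₀ Y₀ s : ℝ} (h₁ : σ₁ ∈ Set.Ioo σ σ') (h₂ : σ₂ ∈ Set.Ioo σ σ')
    (hσ : 0 ≤ σ) (hθ0 : 0 < θ) (hθ1 : θ < 1) (hα : 0 < α) (hα2 : α < (1 - θ) / 2)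
    (hω : ω = σ₁ * ((1 - θ) / 2 - α)) (hω2 : ω < (1 - θ) / 2)
    (hαt : 0 < αt) (hαt2 : αt < (1 - θ) / 2)
    (hωt : ωt = σ₂ * ((1 - θ) / 2 - αt)) (hωt2 : ωt < (1 - θ) / 2)
    (hy : 1 / y = 1 - αt) (hv : 1 / v = 1 - α) (hX : 1 / X₀ = 1 - Qt) (hY : 1 / Y₀ = 1 - Q)
    (hQ : ω < Q) (hQt : ωt < Qt) (hQ1 : Q < 1) (hQt1 : Qt < 1) (hQQ : Q + Qt = 1)
    (hαQ : α ≤ Q) (hαQt : αt ≤ Qt) (hβ : Q + Qt = σ * θ + ω + ωt)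
    (hs : n - n * (α + αt) - a * (ω + ωt) - a * (σ * θ) = -2 * s) :
    ∃ C : ℝ≥0, ∀ (j : ℤ) (F G : StepFn μ H),
      ‖flowForm (S j) {z | z.1 < z.2} F.val G.val‖ₑ ≤ C * 2 ^ (-2 * s * j) *
        ((lpSize X₀ volume fun t => spSize y (F.val t)) *
          lpSize Y₀ volume fun t => spSize v (G.val t)) := by
  have hσ₁ : 0 < σ₁ := hσ.trans_lt h₁.1
  have hσ₂ : 0 < σ₂ := hσ.trans_lt h₂.1
  have hy0 : 0 < y := one_div_pos.1 (by rw [hy]; linarith)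
  have hv0 : 0 < v := one_div_pos.1 (by rw [hv]; linarith)
  -- room for a perturbation of the exponents in both directions
  obtain ⟨ε, hε, e1, e2, e3, e4, e5⟩ : ∃ ε : ℝ, 0 < ε ∧ (ε < α ∧ ε < αt) ∧
      (ε ≤ (1 - θ) / 2 - α ∧ ε ≤ (1 - θ) / 2 - αt) ∧
      (σ₁ * ε ≤ (1 - θ) / 2 - ω ∧ σ₂ * ε ≤ (1 - θ) / 2 - ωt) ∧ σ₁ * ε ≤ Q - ω ∧
        σ₂ * ε ≤ Qt - ωt := by
    have hcont : ∀ c d : ℝ, 0 < d → ∀ᶠ ε in nhdsWithin (0 : ℝ) (Set.Ioi 0), c * ε < d := by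
      intro c d hd
      have : Filter.Tendsto (fun ε : ℝ => c * ε) (nhdsWithin 0 (Set.Ioi 0)) (nhds (c * 0)) :=
        ((continuous_const_mul c).tendsto 0).mono_left nhdsWithin_le_nhds
      exact this.eventually_lt_const (by simpa using hd)
    have hall := (((((((((hcont 1 α hα).and (hcont 1 αt hαt)).and
      (hcont 1 ((1 - θ) / 2 - α) (by linarith))).and
      (hcont 1 ((1 - θ) / 2 - αt) (by linarith))).and
      (hcont σ₁ ((1 - θ) / 2 - ω) (by linarith))).and
      (hcont σ₂ ((1 - θ) / 2 - ωt) (by linarith))).and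
      (hcont σ₁ (Q - ω) (by linarith))).and (hcont σ₂ (Qt - ωt) (by linarith))).and
      self_mem_nhdsWithin).exists
    obtain ⟨ε, ⟨⟨⟨⟨⟨⟨⟨g1, g2⟩, g3⟩, g4⟩, g5⟩, g6⟩, g7⟩, g8⟩, g9⟩ := hall
    rw [one_mul] at g1 g2 g3 g4
    exact ⟨ε, g9, ⟨g1, g2⟩, ⟨g3.le, g4.le⟩, ⟨g5.le, g6.le⟩, g7.le, g8.le⟩
  have hpm : ∀ s₁ ∈ ({1, -1} : Set ℝ), |s₁| = 1 := by
    rintro s₁ (rfl | rfl) <;> simp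
  have habs : ∀ {c s₁ B : ℝ}, |s₁| = 1 → 0 ≤ c → c * ε ≤ B → c * (s₁ * ε) ≤ B := by
    intro c s₁ B h hc hB
    have : s₁ ≤ 1 := h ▸ le_abs_self s₁
    have h2 := mul_le_mul_of_nonneg_right this (mul_nonneg hc hε.le)
    calc c * (s₁ * ε) = s₁ * (c * ε) := by ring
      _ ≤ 1 * (c * ε) := h2
      _ ≤ B := by rwa [one_mul]
  have habs' : ∀ {s₁ : ℝ}, |s₁| = 1 → s₁ * ε ≤ ε ∧ -ε ≤ s₁ * ε := by
    intro s₁ h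
    have h1 := abs_le.1 h.le
    have h2 := mul_le_mul_of_nonneg_right h1.1 hε.le
    have h3 := mul_le_mul_of_nonneg_right h1.2 hε.le
    exact ⟨by rwa [one_mul] at h3, by rwa [neg_one_mul] at h2⟩
  have hsign : ∀ s₁ ∈ ({1, -1} : Set ℝ), ∀ s₂ ∈ ({1, -1} : Set ℝ), ∃ C : ℝ≥0,
      ∀ (j k m l : ℤ) (F G : StepFn μ H), ∑' (i : ℤ) (b : Bool),
        ‖flowForm (S j) (whitneyBox (k, i, b)) (F.atom m).val (G.atom l).val‖ₑ ≤
      C * 2 ^ (-2 * s * j) *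
        ((2 ^ (s₁ * ε * (m - σ₂ * k - (a * σ₂ - n) * j)) *
          lpSize X₀ volume fun t => spSize y ((F.atom m).val t)) *
        (2 ^ (s₂ * ε * (l - σ₁ * k - (a * σ₁ - n) * j)) *
          lpSize Y₀ volume fun t => spSize v ((G.atom l).val t))) := by
    intro s₁ hs₁ s₂ hs₂
    have a1 := habs' (hpm s₁ hs₁)
    have a2 := habs' (hpm s₂ hs₂)
    have b1 := habs (hpm s₂ hs₂) hσ₁.le e3.1
    have b2 := habs (hpm s₁ hs₁) hσ₂.le e3.2
    have b3 := habs (hpm s₂ hs₂) hσ₁.le e4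
    have b4 := habs (hpm s₁ hs₁) hσ₂.le e5
    exact hS.exists_atom_scale_le h₁ h₂ hσ hθ0 hθ1 hω hωt hy0 hv0 hy hv hX hY hQ1 hQt1 hQQ.le hβ hs
      (δ := s₂ * ε) (δt := s₁ * ε) (by linarith) (by linarith) (by linarith) (by linarith)
      (by linarith) (by linarith) (by linarith) (by linarith)
  obtain ⟨C1, h11⟩ := hsign 1 (by simp) 1 (by simp)
  obtain ⟨C2, h12⟩ := hsign 1 (by simp) (-1) (by simp)
  obtain ⟨C3, h21⟩ := hsign (-1) (by simp) 1 (by simp)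
  obtain ⟨C4, h22⟩ := hsign (-1) (by simp) (-1) (by simp)
  -- by `1/p ≤ 1/q` and `1/pt ≤ 1/qt` the norms of the atoms are summable
  have hyX : y ≤ X₀ := by
    have : 0 < X₀ := one_div_pos.1 (by rw [hX]; linarith)
    exact le_of_one_div_le_one_div this (by rw [hX, hy]; linarith)
  have hvY : v ≤ Y₀ := by
    have : 0 < Y₀ := one_div_pos.1 (by rw [hY]; linarith)
    exact le_of_one_div_le_one_div this (by rw [hY, hv]; linarith)
  have hX1 : 1 ≤ X₀ := by
    have : 0 < X₀ := one_div_pos.1 (by rw [hX]; linarith)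
    exact le_of_one_div_le_one_div this (by rw [hX]; linarith)
  have hY1 : 1 ≤ Y₀ := by
    have : 0 < Y₀ := one_div_pos.1 (by rw [hY]; linarith)
    exact le_of_one_div_le_one_div this (by rw [hY]; linarith)
  obtain ⟨C, hC⟩ := exists_tsum_le_of_signs hε hσ₂.ne' hσ₁.ne' hX1 hY1
    (by rw [hX, hY]; linarith)
  set C0 : ℝ≥0 := C1 + C2 + C3 + C4 with hC0
  refine ⟨C * C0, fun j F G => ?_⟩
  set β : ℤ → ℤ → ℤ → ℝ≥0∞ := fun k m l => ∑' (i : ℤ) (b : Bool),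
    ‖flowForm (S j) (whitneyBox (k, i, b)) (F.atom m).val (G.atom l).val‖ₑ with hβ'
  have hmain := hC ((a * σ₂ - n) * j) ((a * σ₁ - n) * j) (C0 * 2 ^ (-2 * s * j)) β
    (fun m => lpSize X₀ volume fun t => spSize y ((F.atom m).val t))
    (fun l => lpSize Y₀ volume fun t => spSize v ((G.atom l).val t)) (by
      intro k m l s₁ hs₁ s₂ hs₂
      have hmono : ∀ {c : ℝ≥0} {A : ℝ≥0∞}, c ≤ C0 → β k m l ≤ c * 2 ^ (-2 * s * j) * A →
          β k m l ≤ C0 * 2 ^ (-2 * s * j) * A := by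
        intro c A hc h
        refine h.trans ?_
        gcongr
      rcases hs₁ with rfl | rfl <;> rcases hs₂ with rfl | rfl
      · exact hmono (le_self_add.trans (le_self_add.trans le_self_add)) (h11 j k m l F G)
      · exact hmono (le_add_self.trans (le_self_add.trans le_self_add)) (h12 j k m l F G)
      · exact hmono (le_add_self.trans le_self_add) (h21 j k m l F G)
      · exact hmono le_add_self (h22 j k m l F G))
  obtain ⟨M, hM⟩ := F.exists_sum_atom
  obtain ⟨L, hL⟩ := G.exists_sum_atom
  calc ‖flowForm (S j) {z | z.1 < z.2} F.val G.val‖ₑ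
      ≤ ∑ m ∈ M, ∑ l ∈ L, ‖flowForm (S j) {z | z.1 < z.2} (F.atom m).val (G.atom l).val‖ₑ := by
        rw [(hS.isFlow j).flowForm_sum _ M L (fun m => (F.atom m).integrable_val)
          (fun l => (G.atom l).integrable_val) hM hL]
        exact (enorm_sum_le _ _).trans (Finset.sum_le_sum fun m _ => enorm_sum_le _ _)
    _ ≤ ∑ m ∈ M, ∑ l ∈ L, ∑' k, β k m l :=
        Finset.sum_le_sum fun m _ => Finset.sum_le_sum fun l _ =>
          (hS.isFlow j).enorm_flowForm_lt_le (F.atom m).integrable_val (G.atom l).integrable_val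
    _ ≤ ∑' m, ∑' l, ∑' k, β k m l :=
        (Finset.sum_le_sum fun m _ => ENNReal.sum_le_tsum L).trans (ENNReal.sum_le_tsum M)
    _ = ∑' k, ∑' m, ∑' l, β k m l := by
        rw [ENNReal.tsum_comm (f := fun k m => ∑' l, β k m l)]
        congr 1; ext m
        exact ENNReal.tsum_comm
    _ ≤ _ := hmain
    _ ≤ C * (C0 * 2 ^ (-2 * s * j)) * ((lpSize X₀ volume fun t => spSize y (F.val t)) *
          lpSize Y₀ volume fun t => spSize v (G.val t)) := by
        gcongr
        · exact F.tsum_lpSize_atom_le hy0 hyX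
        · exact G.tsum_lpSize_atom_le hv0 hvY
    _ = _ := by rw [ENNReal.coe_mul]; ring

end Sharp

/-! ### From step functions to norm estimates of the retarded integral -/

theorem sqComb_add_le {ι : Type*} (T : Finset ι) (w a b : ι → ℝ≥0∞) :
    sqComb T w (fun i => a i + b i) ≤ sqComb T w a + sqComb T w b := by
  have h := ENNReal.Lp_add_le T (fun i => w i * a i) (fun i => w i * b i) (p := 2) (by norm_num)
  simp only [ENNReal.rpow_two] at h
  unfold sqComb
  simp_rw [mul_add]
  exact h

section Transfer

variable {X : Type*} [MeasurableSpace X] {μ : Measure X}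
  {H : Type*} [NormedAddCommGroup H] [InnerProductSpace ℂ H]

/-- The retarded integral `∫_{τ ≤ t} S(t - τ) F(τ) dτ`. -/
def retarded (S : ℝ → Lp H 2 μ →L[ℂ] Lp H 2 μ) (F : ℝ → Lp H 2 μ) (t : ℝ) : Lp H 2 μ :=
  ∫ τ in Set.Iic t, S (t - τ) (F τ)

theorem IsFlow.exists_norm_retarded_le {S : ℝ → Lp H 2 μ →L[ℂ] Lp H 2 μ} (hS : IsFlow S)
    {F : ℝ → Lp H 2 μ} (hF : Integrable F) : ∃ M : ℝ, ∀ t, ‖retarded S F t‖ ≤ M := by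
  obtain ⟨M, hM⟩ := hS.bounded
  refine ⟨M * ∫ τ, ‖F τ‖, fun t => ?_⟩
  calc ‖retarded S F t‖ ≤ ∫ τ in Set.Iic t, M * ‖F τ‖ :=
        norm_integral_le_of_norm_le (hF.norm.const_mul _).integrableOn
          (Filter.Eventually.of_forall fun τ => hM _ _)
    _ ≤ ∫ τ, M * ‖F τ‖ := setIntegral_le_integral (hF.norm.const_mul _)
        (Filter.Eventually.of_forall fun τ => by positivity)
    _ = _ := integral_const_mul _ _

theorem IsFlow.stronglyMeasurable_retarded {S : ℝ → Lp H 2 μ →L[ℂ] Lp H 2 μ} (hS : IsFlow S)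
    {F : ℝ → Lp H 2 μ} (hF : StronglyMeasurable F) : StronglyMeasurable (retarded S F) := by
  have h1 : retarded S F = fun t => ∫ τ, (Set.indicator {z : ℝ × ℝ | z.2 ≤ z.1}
      fun z => S (z.1 - z.2) (F z.2)) (t, τ) := by
    ext1 t
    rw [retarded, ← integral_indicator measurableSet_Iic]
    congr 1
  rw [h1]
  refine StronglyMeasurable.integral_prod_right' (f := Set.indicator {z : ℝ × ℝ | z.2 ≤ z.1}
      fun z => S (z.1 - z.2) (F z.2)) ?_
  refine StronglyMeasurable.indicator ?_ (measurableSet_le measurable_snd measurable_fst)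
  exact hS.continuous_uncurry.comp_stronglyMeasurable
    ((by fun_prop : Measurable fun z : ℝ × ℝ => z.1 - z.2).stronglyMeasurable.prodMk
      (hF.comp_measurable measurable_snd))

/-- The form pairs the retarded integral with a test function. -/
theorem IsFlow.flowForm_lt_eq [CompleteSpace H] {S : ℝ → Lp H 2 μ →L[ℂ] Lp H 2 μ}
    (hS : IsFlow S) {F G : ℝ → Lp H 2 μ} (hF : Integrable F) (hG : Integrable G) :
    flowForm S {z | z.1 < z.2} F G = ∫ t, inner ℂ (G t) (retarded S F t) := by
  have hm : MeasurableSet {z : ℝ × ℝ | z.1 < z.2} := measurableSet_lt measurable_fst measurable_snd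
  have hint := (hS.integrable_inner hF hG).indicator hm
  rw [flowForm, ← integral_indicator hm]
  rw [Measure.volume_eq_prod] at hint ⊢
  rw [integral_prod_symm _ hint]
  congr 1; ext t
  rw [retarded, integral_Iic_eq_integral_Iio, ← integral_inner, ← integral_indicator measurableSet_Iio]
  · congr 1
  · exact (hS.integrable (by fun_prop) hF).integrableOn

theorem lpSize_finsetSum_le {Ω ι : Type*} [MeasurableSpace Ω] {ν : Measure Ω} (T : Finset ι)
    {x : ℝ} (hx : 1 ≤ x) {f : ι → Ω → ℝ≥0∞} (hf : ∀ i, AEMeasurable (f i) ν) :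
    lpSize x ν (fun t => ∑ i ∈ T, f i t) ≤ ∑ i ∈ T, lpSize x ν (f i) := by
  classical
  have hx0 : 0 < x := by linarith
  induction T using Finset.induction_on with
  | empty => simp [lpSize, hx0]
  | insert i T hi ih =>
    simp_rw [Finset.sum_insert hi]
    exact (lpSize_add_le hx (hf i) (Finset.aemeasurable_fun_sum T fun i _ => hf i)).trans
      (by gcongr)

/-- Approximation of a finite family of curves by step functions. -/
theorem exists_stepFn_family [SigmaFinite μ] {ι : Type*} (T : Finset ι)
    {w : ι → ℝ≥0∞} (hw0 : ∀ i, w i ≠ 0) (hw : ∀ i, w i ≠ ∞) {x y : ℝ} (hx : 1 ≤ x) (hy : 1 ≤ y)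
    (hy2 : y ≤ 2) {F : ι → ℝ → Lp H 2 μ} (hF : ∀ i, Integrable (F i))
    (hfin : lpSize x volume (fun t => sqComb T w fun i => spSize y (F i t)) ≠ ∞) :
    ∃ s : ℕ → ι → StepFn μ H,
      (∀ i ∈ T, Filter.Tendsto (fun N => ∫⁻ t, ‖F i t - (s N i).val t‖ₑ) Filter.atTop (nhds 0)) ∧
      ∃ e : ℕ → ℝ≥0∞, Filter.Tendsto e Filter.atTop (nhds 0) ∧ ∀ N,
        lpSize x volume (fun t => sqComb T w fun i => spSize y ((s N i).val t)) ≤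
          lpSize x volume (fun t => sqComb T w fun i => spSize y (F i t)) + e N := by
  have hx0 : 0 < x := by linarith
  have hy0 : 0 < y := by linarith
  have hm : ∀ i, AEMeasurable (fun t => spSize y (F i t)) volume := fun i =>
    aemeasurable_spSize hy0 (hF i).1
  have hfin' : ∀ i ∈ T, lpSize x volume (fun t => spSize y (F i t)) ≠ ∞ := by
    intro i hi htop
    have h1 : w i * lpSize x volume (fun t => spSize y (F i t)) ≤
        lpSize x volume (fun t => sqComb T w fun i => spSize y (F i t)) := by
      rw [← lpSize_const_mul hx0 (hw i)]
      refine lpSize_mono hx0 _ fun t => ?_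
      calc w i * spSize y (F i t) = ((w i * spSize y (F i t)) ^ 2) ^ (1 / 2 : ℝ) := by
            rw [← ENNReal.rpow_two, ← ENNReal.rpow_mul]; norm_num
        _ ≤ _ := by
            unfold sqComb
            gcongr
            exact Finset.single_le_sum (f := fun i => (w i * spSize y (F i t)) ^ 2)
              (fun _ _ => zero_le) hi
    rw [htop, ENNReal.mul_top (hw0 i)] at h1
    exact hfin (top_le_iff.1 h1)
  set ε : ℕ → ℝ≥0∞ := fun N => ((N : ℝ≥0∞) + 1)⁻¹ with hε
  have hε0 : ∀ N, ε N ≠ 0 := fun N => by simp [hε]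
  have hεt : Filter.Tendsto ε Filter.atTop (nhds 0) := by
    have := ENNReal.tendsto_inv_nat_nhds_zero.comp (Filter.tendsto_add_atTop_nat 1)
    refine this.congr fun N => ?_
    simp [hε]
  have hstep : ∀ N i, ∃ s : StepFn μ H, i ∈ T → ∫⁻ t, ‖F i t - s.val t‖ₑ ≤ ε N ∧
      lpSize x volume (fun t => spSize y (F i t - s.val t)) ≤ ε N := by
    intro N i
    by_cases hi : i ∈ T
    · obtain ⟨s, hs⟩ := exists_stepFn_approx (hF i) hx hy hy2 (hfin' i hi) (hε0 N)
      exact ⟨s, fun _ => hs⟩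
    · obtain ⟨s, hs⟩ := exists_stepFn_approx (μ := μ) (H := H) (F := fun _ => 0)
        (integrable_zero _ _ _) hx hy hy2
        (by simp [spSize_zero hy0, lpSize, hx0]) (hε0 N)
      exact ⟨s, fun h => absurd h hi⟩
  choose s hs using hstep
  refine ⟨s, fun i hi => ?_, fun N => ∑ i ∈ T, w i * ε N, ?_, fun N => ?_⟩
  · exact tendsto_of_tendsto_of_tendsto_of_le_of_le tendsto_const_nhds hεt (fun _ => zero_le)
      fun N => (hs N i hi).1
  · have : Filter.Tendsto (fun N => ∑ i ∈ T, w i * ε N) Filter.atTop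
        (nhds (∑ i ∈ T, w i * 0)) :=
      tendsto_finsetSum T fun i _ => ENNReal.Tendsto.const_mul hεt (Or.inr (hw i))
    simpa using this
  · have hm' : ∀ i, AEMeasurable (fun t => spSize y (F i t - (s N i).val t)) volume := fun i =>
      aemeasurable_spSize hy0 ((hF i).1.sub (s N i).stronglyMeasurable_val.aestronglyMeasurable)
    have hmS : AEMeasurable (fun t => ∑ i ∈ T, w i * spSize y (F i t - (s N i).val t)) volume :=
      Finset.aemeasurable_fun_sum T fun i _ => (hm' i).const_mul _
    have hmQ : AEMeasurable (fun t => sqComb T w fun i => spSize y (F i t)) volume :=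
      (Finset.aemeasurable_fun_sum T fun i _ => ((hm i).const_mul _).pow_const 2).pow_const _
    calc _ ≤ lpSize x volume (fun t => (sqComb T w fun i => spSize y (F i t)) +
          ∑ i ∈ T, w i * spSize y (F i t - (s N i).val t)) := by
          refine lpSize_mono hx0 _ fun t => ?_
          have h1 : (sqComb T w fun i => spSize y ((s N i).val t)) ≤
              sqComb T w fun i => spSize y (F i t) + spSize y (F i t - (s N i).val t) := by
            refine sqComb_mono T w fun i _ => ?_
            calc spSize y ((s N i).val t) = spSize y (F i t + -(F i t - (s N i).val t)) := by
                  congr 1; abel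
              _ ≤ _ := (spSize_add_le hy _ _).trans (by rw [spSize_neg])
          exact h1.trans ((sqComb_add_le T w _ _).trans (by gcongr; exact sqComb_le_sum T w _))
      _ ≤ _ := (lpSize_add_le hx hmQ hmS).trans (by
          gcongr
          refine (lpSize_finsetSum_le T hx fun i => (hm' i).const_mul _).trans ?_
          refine Finset.sum_le_sum fun i hi => ?_
          rw [lpSize_const_mul hx0 (hw i)]
          gcongr
          exact (hs N i hi).2)

/-- An estimate of the retarded form extends from step functions to integrable curves. -/
theorem enorm_sum_flowForm_le_of_stepFn [SigmaFinite μ] {ι : Type*} (T : Finset ι)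
    {S : ι → ℝ → Lp H 2 μ →L[ℂ] Lp H 2 μ} (hS : ∀ i, IsFlow (S i)) (D : Set (ℝ × ℝ))
    {w : ι → ℝ≥0∞} (hw0 : ∀ i, w i ≠ 0) (hw : ∀ i, w i ≠ ∞) {x y u v : ℝ}
    (hx : 1 ≤ x) (hy : 1 ≤ y) (hy2 : y ≤ 2) (hu : 1 ≤ u) (hv : 1 ≤ v) (hv2 : v ≤ 2)
    {K : ℝ≥0∞} (hK : K ≠ ∞)
    (hstep : ∀ F G : ι → StepFn μ H, ‖∑ i ∈ T, flowForm (S i) D (F i).val (G i).val‖ₑ ≤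
      K * ((lpSize x volume fun t => sqComb T w fun i => spSize y ((F i).val t)) *
        lpSize u volume fun t => sqComb T w fun i => spSize v ((G i).val t)))
    {F G : ι → ℝ → Lp H 2 μ} (hF : ∀ i, Integrable (F i)) (hG : ∀ i, Integrable (G i))
    (hFfin : lpSize x volume (fun t => sqComb T w fun i => spSize y (F i t)) ≠ ∞)
    (hGfin : lpSize u volume (fun t => sqComb T w fun i => spSize v (G i t)) ≠ ∞) :
    ‖∑ i ∈ T, flowForm (S i) D (F i) (G i)‖ₑ ≤
      K * ((lpSize x volume fun t => sqComb T w fun i => spSize y (F i t)) *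
        lpSize u volume fun t => sqComb T w fun i => spSize v (G i t)) := by
  obtain ⟨sF, hsF, eF, heF, hFle⟩ := exists_stepFn_family T hw0 hw hx hy hy2 hF hFfin
  obtain ⟨sG, hsG, eG, heG, hGle⟩ := exists_stepFn_family T hw0 hw hu hv hv2 hG hGfin
  have hform : ∀ i ∈ T, Filter.Tendsto (fun N => flowForm (S i) D (sF N i).val (sG N i).val)
      Filter.atTop (nhds (flowForm (S i) D (F i) (G i))) := by
    intro i hi
    obtain ⟨M, hM⟩ := (hS i).exists_enorm_flowForm_le
    rw [tendsto_iff_edist_tendsto_0]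
    set a := ∫⁻ t, ‖F i t‖ₑ
    set b := ∫⁻ t, ‖G i t‖ₑ
    set α : ℕ → ℝ≥0∞ := fun N => ∫⁻ t, ‖F i t - (sF N i).val t‖ₑ with hα
    set β : ℕ → ℝ≥0∞ := fun N => ∫⁻ t, ‖G i t - (sG N i).val t‖ₑ with hβ
    have ha : a ≠ ∞ := (hF i).2.ne
    have hb : b ≠ ∞ := (hG i).2.ne
    have hle : ∀ N, edist (flowForm (S i) D (sF N i).val (sG N i).val)
        (flowForm (S i) D (F i) (G i)) ≤ M * (α N * b) + M * ((a + α N) * β N) := by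
      intro N
      rw [edist_comm, edist_eq_enorm_sub, (hS i).flowForm_sub_sub D (hF i)
        (sF N i).integrable_val (hG i) (sG N i).integrable_val]
      refine (enorm_add_le _ _).trans (add_le_add ?_ ?_)
      · exact hM D _ _ ((hF i).sub (sF N i).integrable_val) (hG i)
      · refine (hM D _ _ (sF N i).integrable_val ((hG i).sub (sG N i).integrable_val)).trans ?_
        gcongr
        · calc ∫⁻ t, ‖(sF N i).val t‖ₑ ≤ ∫⁻ t, (‖F i t‖ₑ + ‖F i t - (sF N i).val t‖ₑ) := by
                refine lintegral_mono fun t => ?_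
                calc ‖(sF N i).val t‖ₑ = ‖F i t - (F i t - (sF N i).val t)‖ₑ := by
                      congr 1; abel
                  _ ≤ _ := enorm_sub_le
            _ = _ := lintegral_add_left' (hF i).1.enorm _
        · exact le_rfl
    have hlim : Filter.Tendsto (fun N => M * (α N * b) + M * ((a + α N) * β N)) Filter.atTop
        (nhds (M * (0 * b) + M * ((a + 0) * 0))) := by
      refine Filter.Tendsto.add ?_ ?_
      · exact ENNReal.Tendsto.const_mul (ENNReal.Tendsto.mul_const (hsF i hi) (Or.inr hb))
          (Or.inr ENNReal.coe_ne_top)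
      · refine ENNReal.Tendsto.const_mul (ENNReal.Tendsto.mul
          (tendsto_const_nhds.add (hsF i hi)) (Or.inr (by simp)) (hsG i hi) (Or.inr ?_))
          (Or.inr ENNReal.coe_ne_top)
        simpa using ha
    simp only [zero_mul, mul_zero, add_zero] at hlim
    exact tendsto_of_tendsto_of_tendsto_of_le_of_le tendsto_const_nhds hlim (fun _ => zero_le) hle
  have hL : Filter.Tendsto (fun N => ‖∑ i ∈ T, flowForm (S i) D (sF N i).val (sG N i).val‖ₑ)
      Filter.atTop (nhds ‖∑ i ∈ T, flowForm (S i) D (F i) (G i)‖ₑ) :=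
    (continuous_enorm.tendsto _).comp (tendsto_finsetSum T hform)
  set NF := lpSize x volume fun t => sqComb T w fun i => spSize y (F i t)
  set NG := lpSize u volume fun t => sqComb T w fun i => spSize v (G i t)
  have hR : Filter.Tendsto (fun N => K * ((NF + eF N) * (NG + eG N))) Filter.atTop
      (nhds (K * ((NF + 0) * (NG + 0)))) := by
    refine ENNReal.Tendsto.const_mul (ENNReal.Tendsto.mul (tendsto_const_nhds.add heF)
      (Or.inr ?_) (tendsto_const_nhds.add heG) (Or.inr ?_)) (Or.inr hK)
    · simpa using hGfin
    · simpa using hFfin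
  simp only [add_zero] at hR
  exact le_of_tendsto_of_tendsto' hL hR fun N => (hstep (sF N) (sG N)).trans
    (by gcongr; exacts [hFle N, hGle N])

/-- A bound of the retarded form on step functions gives a bound of the retarded integral. -/
theorem lpSize_retarded_le_of_stepFn [SigmaFinite μ] [CompleteSpace H]
    [TopologicalSpace.SeparableSpace (Lp H 2 μ)] {ι : Type*} (T : Finset ι)
    {S : ι → ℝ → Lp H 2 μ →L[ℂ] Lp H 2 μ} (hS : ∀ i, IsFlow (S i))
    {w : ι → ℝ≥0∞} (hw0 : ∀ i, w i ≠ 0) (hw : ∀ i, w i ≠ ∞) {x y p q p' q' : ℝ}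
    (hx : 1 ≤ x) (hy : 1 ≤ y) (hy2 : y ≤ 2) (hp : 2 < p) (hpp : p.HolderConjugate p')
    (hqq : q.HolderConjugate q') {K : ℝ≥0∞} (hK : K ≠ ∞) (hK0 : K ≠ 0)
    (hstep : ∀ F G : ι → StepFn μ H,
      ‖∑ i ∈ T, flowForm (S i) {z | z.1 < z.2} (F i).val (G i).val‖ₑ ≤
      K * ((lpSize x volume fun t => sqComb T (fun i => (w i)⁻¹) fun i => spSize y ((F i).val t)) *
        lpSize q' volume fun t => sqComb T (fun i => (w i)⁻¹) fun i => spSize p' ((G i).val t)))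
    {F : ι → ℝ → Lp H 2 μ} (hF : ∀ i, Integrable (F i)) (hFm : ∀ i, StronglyMeasurable (F i)) :
    (lpSize q volume fun t => sqComb T w fun i => spSize p (retarded (S i) (F i) t)) ≤
      K * lpSize x volume fun t => sqComb T (fun i => (w i)⁻¹) fun i => spSize y (F i t) := by
  set NF := lpSize x volume fun t => sqComb T (fun i => (w i)⁻¹) fun i => spSize y (F i t)
    with hNF
  rcases eq_or_ne NF ∞ with htop | hFfin
  · rw [htop, ENNReal.mul_top hK0]; exact le_top
  have hp'1 : 1 < p' := hpp.symm.lt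
  have hp'2 : p' ≤ 2 := by
    have h1 := hpp.inv_add_inv_eq_one
    have h2 : p⁻¹ < 2⁻¹ := inv_strictAnti₀ (by norm_num) hp
    have h3 : (2 : ℝ)⁻¹ < p'⁻¹ := by linarith
    exact ((inv_lt_inv₀ (by norm_num) (by linarith)).1 h3).le
  have hM : ∃ M : ℝ, ∀ i ∈ T, ∀ t, ‖retarded (S i) (F i) t‖ ≤ M := by
    choose M hM using fun i => (hS i).exists_norm_retarded_le (hF i)
    refine ⟨∑ i ∈ T, |M i|, fun i hi t => (hM i t).trans ((le_abs_self _).trans ?_)⟩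
    exact Finset.single_le_sum (f := fun i => |M i|) (fun _ _ => abs_nonneg _) hi
  obtain ⟨M, hM⟩ := hM
  classical
  -- off the finite set the curves are irrelevant
  set V : ι → ℝ → Lp H 2 μ := fun i t => if i ∈ T then retarded (S i) (F i) t else 0 with hV
  have hVT : ∀ t, (sqComb T w fun i => spSize p (retarded (S i) (F i) t)) =
      sqComb T w fun i => spSize p (V i t) := by
    intro t
    unfold sqComb
    congr 1
    exact Finset.sum_congr rfl fun i hi => by simp only [hV, if_pos hi]
  simp_rw [hVT]
  refine ENNReal.le_of_forall_pos_le_add fun ε hε _ => ?_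
  refine lpSize_sqComb_le_of_forall_test T hp hpp hqq w hw0 hw V (fun i => ?_) (max M 0)
    (fun i t => ?_) (K * NF + ε) fun G hG => ?_
  · by_cases hi : i ∈ T
    · simp only [hV, if_pos hi]; exact (hS i).stronglyMeasurable_retarded (hFm i)
    · simp only [hV, if_neg hi]; exact stronglyMeasurable_const
  · by_cases hi : i ∈ T
    · simp only [hV, if_pos hi]; exact (hM i hi t).trans (le_max_left _ _)
    · simp only [hV, if_neg hi, norm_zero]; exact le_max_right _ _
  · set NG := lpSize q' volume fun t => sqComb T (fun i => (w i)⁻¹) fun i => spSize p' (G i t)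
    rcases eq_or_ne NG ∞ with hGt | hGfin
    · have : K * NF + (ε : ℝ≥0∞) ≠ 0 := by simp [hε.ne']
      rw [hGt, ENNReal.mul_top this]; exact le_top
    have heq : ∑ i ∈ T, ∫ t, inner ℂ (G i t) (V i t) =
        ∑ i ∈ T, flowForm (S i) {z | z.1 < z.2} (F i) (G i) := by
      refine Finset.sum_congr rfl fun i hi => ?_
      rw [(hS i).flowForm_lt_eq (hF i) (hG i)]
      simp only [hV, if_pos hi]
    rw [heq]
    refine (enorm_sum_flowForm_le_of_stepFn T hS _ (fun i => ENNReal.inv_ne_zero.2 (hw i))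
      (fun i => ENNReal.inv_ne_top.2 (hw0 i)) hx hy hy2 hqq.symm.lt.le hp'1.le hp'2 hK hstep hF hG
      hFfin hGfin).trans ?_
    rw [← mul_assoc]
    gcongr
    exact le_self_add

end Transfer

/-! ### Fourier multipliers on `L²(ℝⁿ)` -/

section Multiplier

variable {n : ℕ}

/-- The operator on `L²(ℝⁿ)` which multiplies the Fourier transform by the bounded symbol `g`. -/
def multiplier (g : Sp n → ℂ) (hg : MemLp g ∞ volume) : L2 n →L[ℂ] L2 n :=
  LinearMap.mkContinuous
    { toFun := fun f => 𝓕⁻ (hg.toLp g • 𝓕 f : L2 n)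
      map_add' := fun f f' => by
        rw [FourierTransform.fourier_add, Lp.add_smul, FourierTransform.fourierInv_add]
      map_smul' := fun c f => by
        rw [FourierTransform.fourier_smul, ← Lp.smul_comm, FourierTransform.fourierInv_smul,
          RingHom.id_apply] }
    ‖hg.toLp g‖ fun f => by
      have h := Lp.norm_fourier_eq (𝓕⁻ (hg.toLp g • 𝓕 f : L2 n))
      rw [FourierTransform.fourier_fourierInv_eq] at h
      refine h.symm.le.trans ((Lp.norm_smul_le _ _).trans ?_)
      rw [Lp.norm_fourier_eq]

theorem fourier_multiplier (g : Sp n → ℂ) (hg : MemLp g ∞ volume) (f : L2 n) :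
    (𝓕 (multiplier g hg f) : L2 n) = hg.toLp g • 𝓕 f :=
  FourierTransform.fourier_fourierInv_eq _

theorem coeFn_fourier_multiplier (g : Sp n → ℂ) (hg : MemLp g ∞ volume) (f : L2 n) :
    (𝓕 (multiplier g hg f) : L2 n) =ᵐ[volume] fun ξ => g ξ * (𝓕 f : L2 n) ξ := by
  rw [fourier_multiplier]
  filter_upwards [Lp.coeFn_lpSMul (r := 2) (hg.toLp g) (𝓕 f : L2 n), hg.coeFn_toLp] with ξ h1 h2
  rw [h1, Pi.smul_apply', h2, smul_eq_mul]

theorem fourier_injective : Function.Injective (fun f : L2 n => (𝓕 f : L2 n)) :=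
  (Lp.fourierTransformₗᵢ (Sp n) ℂ).injective

theorem eq_of_fourier_ae_eq {f g : L2 n}
    (h : (𝓕 f : L2 n) =ᵐ[volume] (𝓕 g : L2 n)) : f = g :=
  fourier_injective (Lp.ext h)

theorem multiplier_comp {g h k : Sp n → ℂ} (hg : MemLp g ∞ volume) (hh : MemLp h ∞ volume)
    (hk : MemLp k ∞ volume) (e : ∀ ξ, k ξ = g ξ * h ξ) (f : L2 n) :
    multiplier k hk f = multiplier g hg (multiplier h hh f) := by
  apply eq_of_fourier_ae_eq
  filter_upwards [coeFn_fourier_multiplier k hk f, coeFn_fourier_multiplier h hh f,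
    coeFn_fourier_multiplier g hg (multiplier h hh f)] with ξ h1 h2 h3
  rw [h1, h3, h2, e, mul_assoc]

theorem inner_multiplier_left {g h : Sp n → ℂ} (hg : MemLp g ∞ volume) (hh : MemLp h ∞ volume)
    (e : ∀ ξ, h ξ = starRingEnd ℂ (g ξ)) (f f' : L2 n) :
    inner ℂ (multiplier g hg f) f' = inner ℂ f (multiplier h hh f') := by
  rw [← Lp.inner_fourier_eq, ← Lp.inner_fourier_eq f, L2.inner_def, L2.inner_def]
  refine integral_congr_ae ?_
  filter_upwards [coeFn_fourier_multiplier g hg f, coeFn_fourier_multiplier h hh f'] with ξ h1 h2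
  rw [h1, h2, e]
  simp only [RCLike.inner_apply, map_mul]
  ring

theorem norm_multiplier_le {g : Sp n → ℂ} (hg : MemLp g ∞ volume) {M : ℝ≥0}
    (hM : ∀ ξ, ‖g ξ‖ ≤ M) (f : L2 n) : ‖multiplier g hg f‖ ≤ M * ‖f‖ := by
  rw [← Lp.norm_fourier_eq, ← Lp.norm_fourier_eq f]
  refine Lp.norm_le_mul_norm_of_ae_le_mul ?_
  filter_upwards [coeFn_fourier_multiplier g hg f] with ξ h1
  rw [h1, norm_mul]
  gcongr
  exact hM ξ

/-- Multipliers depend strongly continuously on a symbol which varies continuously and stays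
bounded. -/
theorem continuous_multiplier {g : ℝ → Sp n → ℂ} (hg : ∀ t, MemLp (g t) ∞ volume) {M : ℝ≥0}
    (hM : ∀ t ξ, ‖g t ξ‖ ≤ M) (hc : ∀ ξ, Continuous fun t => g t ξ) (f : L2 n) :
    Continuous fun t => multiplier (g t) (hg t) f := by
  have key : Continuous fun t => (hg t).toLp (g t) • (𝓕 f : L2 n) := by
    rw [continuous_iff_continuousAt]
    intro t₀
    rw [ContinuousAt, Lp.tendsto_Lp_iff_tendsto_eLpNorm']
    set h : L2 n := 𝓕 f with hh
    have h1 : ∀ t, eLpNorm (⇑((hg t).toLp (g t) • h : L2 n) - ⇑((hg t₀).toLp (g t₀) • h : L2 n)) 2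
        volume = (∫⁻ ξ, ‖(g t ξ - g t₀ ξ) * h ξ‖ₑ ^ (2 : ℝ)) ^ (1 / 2 : ℝ) := by
      intro t
      rw [eLpNorm_eq_lintegral_rpow_enorm_toReal (by norm_num) (by norm_num)]
      simp only [ENNReal.toReal_ofNat]
      congr 1
      refine lintegral_congr_ae ?_
      filter_upwards [Lp.coeFn_lpSMul (r := 2) ((hg t).toLp (g t)) h, (hg t).coeFn_toLp,
        Lp.coeFn_lpSMul (r := 2) ((hg t₀).toLp (g t₀)) h, (hg t₀).coeFn_toLp] with ξ e1 e2 e3 e4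
      rw [Pi.sub_apply, e1, e3, Pi.smul_apply', Pi.smul_apply', e2, e4, smul_eq_mul, smul_eq_mul,
        sub_mul]
    simp_rw [h1]
    have h2 : Filter.Tendsto (fun t => ∫⁻ ξ, ‖(g t ξ - g t₀ ξ) * h ξ‖ₑ ^ (2 : ℝ)) (nhds t₀)
        (nhds (∫⁻ ξ : Sp n, 0)) := by
      refine tendsto_lintegral_filter_of_dominated_convergence'
        (fun ξ => (2 * M * ‖h ξ‖ₑ) ^ (2 : ℝ)) ?_ ?_ ?_ ?_
      · refine Filter.Eventually.of_forall fun t => ?_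
        exact ((((hg t).1.sub (hg t₀).1).mul (Lp.aestronglyMeasurable h)).enorm).pow_const _
      · refine Filter.Eventually.of_forall fun t => Filter.Eventually.of_forall fun ξ => ?_
        refine ENNReal.rpow_le_rpow ?_ (by norm_num)
        rw [enorm_mul]
        gcongr
        refine enorm_sub_le.trans ?_
        have hM' : ∀ t, ‖g t ξ‖ₑ ≤ M := fun t => by
          rw [← ofReal_norm, ← ENNReal.ofReal_coe_nnreal]
          exact ENNReal.ofReal_le_ofReal (hM t ξ)
        rw [two_mul]
        exact add_le_add (hM' t) (hM' t₀)
      · have e : ∀ ξ, (2 * M * ‖h ξ‖ₑ) ^ (2 : ℝ) = (2 * M : ℝ≥0∞) ^ (2 : ℝ) * ‖h ξ‖ₑ ^ (2 : ℝ) :=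
          fun ξ => ENNReal.mul_rpow_of_nonneg _ _ (by norm_num)
        simp_rw [e]
        rw [lintegral_const_mul' _ _
          (ENNReal.rpow_ne_top_of_nonneg (by norm_num) (ENNReal.mul_ne_top (by simp) (by simp)))]
        refine ENNReal.mul_ne_top
          (ENNReal.rpow_ne_top_of_nonneg (by norm_num) (ENNReal.mul_ne_top (by simp) (by simp))) ?_
        have := lintegral_rpow_enorm_lt_top_of_eLpNorm_lt_top (by norm_num) (by norm_num)
          (Lp.memLp h).2
        simpa using this.ne
      · refine Filter.Eventually.of_forall fun ξ => ?_
        have hc' : Continuous fun t => ‖(g t ξ - g t₀ ξ) * h ξ‖ₑ ^ (2 : ℝ) :=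
          ENNReal.continuous_rpow_const.comp
            (((hc ξ).sub continuous_const).mul continuous_const).enorm
        have := hc'.tendsto t₀
        simpa using this
    have h3 := (ENNReal.continuous_rpow_const (y := (1 / 2 : ℝ))).continuousAt.tendsto.comp h2
    simpa [Function.comp_def] using h3
  exact (Lp.fourierTransformₗᵢ (Sp n) ℂ).symm.continuous.comp key

/-- The symbol `g(ξ) exp(i t |ξ| ^ a)`. -/
def flowSymbol (g : Sp n → ℝ) (a t : ℝ) (ξ : Sp n) : ℂ := (g ξ : ℂ) * propagatorSymbol n a t ξ

theorem norm_propagatorSymbol (a t : ℝ) (ξ : Sp n) : ‖propagatorSymbol n a t ξ‖ = 1 := by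
  rw [propagatorSymbol, mul_comm, Complex.norm_exp_ofReal_mul_I]

theorem propagatorSymbol_add (a t τ : ℝ) (ξ : Sp n) :
    propagatorSymbol n a (t + τ) ξ = propagatorSymbol n a t ξ * propagatorSymbol n a τ ξ := by
  rw [propagatorSymbol, propagatorSymbol, propagatorSymbol, ← Complex.exp_add]
  congr 1
  push_cast
  ring

theorem propagatorSymbol_zero (a : ℝ) (ξ : Sp n) : propagatorSymbol n a 0 ξ = 1 := by
  simp [propagatorSymbol]

theorem propagatorSymbol_neg (a t : ℝ) (ξ : Sp n) :
    propagatorSymbol n a (-t) ξ = starRingEnd ℂ (propagatorSymbol n a t ξ) := by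
  rw [propagatorSymbol, propagatorSymbol, ← Complex.exp_conj]
  congr 1
  simp

theorem flowSymbol_memLp {g : Sp n → ℝ} (hg : Measurable g) {M : ℝ≥0} (hM : ∀ ξ, |g ξ| ≤ M)
    (a t : ℝ) : MemLp (flowSymbol g a t) ∞ volume := by
  refine memLp_top_of_bound ?_ M (Filter.Eventually.of_forall fun ξ => ?_)
  · apply Measurable.aestronglyMeasurable
    unfold flowSymbol propagatorSymbol
    fun_prop
  · rw [flowSymbol, norm_mul, norm_propagatorSymbol, mul_one, Complex.norm_real]
    exact hM ξ

/-- A frequency-localized unitary group is a flow. -/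
theorem isFlow_multiplier {g : Sp n → ℝ} (hg : Measurable g) {M : ℝ≥0} (hM : ∀ ξ, |g ξ| ≤ M)
    (a : ℝ) : IsFlow fun t => multiplier (flowSymbol g a t) (flowSymbol_memLp hg hM a t) := by
  have hn : ∀ t ξ, ‖flowSymbol g a t ξ‖ ≤ M := by
    intro t ξ
    rw [flowSymbol, norm_mul, norm_propagatorSymbol, mul_one, Complex.norm_real]
    exact hM ξ
  refine ⟨?_, ⟨M, fun t f => norm_multiplier_le _ (hn t) f⟩, fun t f f' => ?_⟩
  · refine continuous_prod_of_continuous_lipschitzWith' _ M (fun t => ?_) fun f => ?_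
    · exact LipschitzWith.of_dist_le_mul fun f f' => by
        rw [dist_eq_norm, dist_eq_norm, ← map_sub]
        exact norm_multiplier_le _ (hn t) _
    · refine continuous_multiplier _ hn (fun ξ => ?_) f
      unfold flowSymbol propagatorSymbol
      fun_prop
  · refine inner_multiplier_left _ _ (fun ξ => ?_) f f'
    rw [flowSymbol, flowSymbol, map_mul, propagatorSymbol_neg, Complex.conj_ofReal]

theorem propagator_eq_multiplier (a t : ℝ) (f : L2 n) :
    propagator a t f = multiplier (propagatorSymbol n a t) (propagatorSymbol_memLp n a t) f := rfl

end Multiplier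

/-! ### Dyadic frequency localization of the propagator -/

section Localization

variable {n : ℕ} (ψ : Cutoff n)

theorem Cutoff.le_one (x : Sp n) : ψ.toFun x ≤ 1 := by
  rw [← ψ.eq_one 0 (by simp)]
  exact ψ.radial_anti _ _ (by simp)

theorem Cutoff.nonneg (x : Sp n) : 0 ≤ ψ.toFun x := by
  rcases le_or_gt ‖x‖ 1 with h | h
  · rw [ψ.eq_one x h]; norm_num
  · rw [← ψ.eq_zero ((2 : ℝ) • x) (by rw [norm_smul]; norm_num; linarith)]
    refine ψ.radial_anti _ _ ?_
    rw [norm_smul]; norm_num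
    linarith

theorem Cutoff.abs_bump_le (x : Sp n) : |ψ.bump x| ≤ 1 := by
  have h1 := ψ.le_one x
  have h2 := ψ.le_one ((2 : ℝ) • x)
  have h3 := ψ.nonneg x
  have h4 := ψ.nonneg ((2 : ℝ) • x)
  rw [Cutoff.bump, abs_le]
  constructor <;> linarith

theorem Cutoff.bump_mul_sum (x : Sp n) :
    ψ.bump x * (ψ.bump ((2 : ℝ) • x) + ψ.bump x + ψ.bump ((1 / 2 : ℝ) • x)) = ψ.bump x := by
  simp only [Cutoff.bump, smul_smul]
  norm_num
  rcases le_or_gt ‖x‖ (1 / 2) with h | h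
  · rw [ψ.eq_one x (by linarith), ψ.eq_one ((2 : ℝ) • x) (by rw [norm_smul]; norm_num; linarith)]
    ring
  · rcases le_or_gt 2 ‖x‖ with h' | h'
    · rw [ψ.eq_zero x h', ψ.eq_zero ((2 : ℝ) • x) (by rw [norm_smul]; norm_num; linarith)]
      ring
    · rw [ψ.eq_one ((1 / 2 : ℝ) • x) (by rw [norm_smul]; norm_num; linarith),
        ψ.eq_zero ((4 : ℝ) • x) (by rw [norm_smul]; norm_num; linarith)]
      ring

theorem Cutoff.hasTemperateGrowth : ψ.toFun.HasTemperateGrowth := by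
  have hs : HasCompactSupport ψ.toFun := by
    refine HasCompactSupport.of_support_subset_isCompact (isCompact_closedBall (0 : Sp n) 2)
      fun x hx => ?_
    by_contra h
    rw [Metric.mem_closedBall, dist_zero_right, not_le] at h
    exact hx (ψ.eq_zero x h.le)
  exact (hs.toSchwartzMap ψ.smooth).hasTemperateGrowth

/-- The symbol `χ(ξ / 2ʲ)` of the frequency localization, in the frequency variable of
`∫ f(x) exp(-2πi x·ξ) dx`. -/
def dyadicBump (j : ℤ) (ξ : Sp n) : ℝ := ψ.bump ((2 * Real.pi / dyadic j) • ξ)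

theorem dyadic_pos (j : ℤ) : 0 < dyadic j := zpow_pos (by norm_num) j

theorem dyadic_add (i j : ℤ) : dyadic (i + j) = dyadic i * dyadic j := zpow_add₀ (by norm_num) i j

theorem abs_dyadicBump_le (j : ℤ) (ξ : Sp n) : |dyadicBump ψ j ξ| ≤ (1 : ℝ≥0) :=
  ψ.abs_bump_le _

theorem hasTemperateGrowth_dyadicBump (j : ℤ) :
    (fun ξ => (dyadicBump ψ j ξ : ℂ)).HasTemperateGrowth := by
  have h := ψ.hasTemperateGrowth
  unfold dyadicBump Cutoff.bump
  have hl : ∀ c : ℝ, (fun ξ : Sp n => ψ.toFun (c • ξ)).HasTemperateGrowth := fun c =>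
    h.comp (c • ContinuousLinearMap.id ℝ (Sp n)).hasTemperateGrowth
  have h2 := (hl (2 * Real.pi / dyadic j)).sub (hl (2 * (2 * Real.pi / dyadic j)))
  simp_rw [smul_smul]
  exact Complex.ofRealCLM.hasTemperateGrowth.comp h2

theorem measurable_dyadicBump (j : ℤ) : Measurable (dyadicBump ψ j) := by
  have h := ψ.smooth.continuous.measurable
  unfold dyadicBump Cutoff.bump
  fun_prop

/-- On the support of `P_N` the symbol of `P_{N/2} + P_N + P_{2N}` equals `1`. -/
theorem dyadicBump_mul_sum (j : ℤ) (ξ : Sp n) : dyadicBump ψ j ξ *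
    (dyadicBump ψ (j - 1) ξ + dyadicBump ψ j ξ + dyadicBump ψ (j + 1) ξ) = dyadicBump ψ j ξ := by
  have h := ψ.bump_mul_sum ((2 * Real.pi / dyadic j) • ξ)
  have hj := (dyadic_pos j).ne'
  have e1 : dyadic (j - 1) = dyadic j / 2 := zpow_sub_one₀ (by norm_num) j
  have e2 : dyadic (j + 1) = dyadic j * 2 := zpow_add_one₀ (by norm_num) j
  simp only [dyadicBump]
  rw [smul_smul, smul_smul] at h
  rw [e1, e2]
  convert h using 6
  · field_simp
  · field_simp

/-- The frequency-localized unitary group `P_N exp(i t D ^ a)` on `L²(ℝⁿ)`, with `N = 2ʲ`. -/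
def locFlow (a : ℝ) (j : ℤ) (t : ℝ) : L2 n →L[ℂ] L2 n :=
  multiplier (flowSymbol (dyadicBump ψ j) a t)
    (flowSymbol_memLp (measurable_dyadicBump ψ j) (abs_dyadicBump_le ψ j) a t)

theorem isFlow_locFlow (a : ℝ) (j : ℤ) : IsFlow (locFlow ψ a j) :=
  isFlow_multiplier (measurable_dyadicBump ψ j) (abs_dyadicBump_le ψ j) a

/-- The factorization of the localized group into two localized groups, on which the `TT*` argument
rests. -/
theorem locFlow_factor (a : ℝ) (j : ℤ) (t τ : ℝ) (f : L2 n) : locFlow ψ a j (t - τ) f =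
    locFlow ψ a j t
      ((locFlow ψ a (j - 1) (-τ) + locFlow ψ a j (-τ) + locFlow ψ a (j + 1) (-τ)) f) := by
  apply eq_of_fourier_ae_eq
  rw [add_apply, add_apply]
  set u₁ := locFlow ψ a (j - 1) (-τ) f with h₁
  set u₂ := locFlow ψ a j (-τ) f with h₂
  set u₃ := locFlow ψ a (j + 1) (-τ) f with h₃
  have e1 := coeFn_fourier_multiplier _
    (flowSymbol_memLp (measurable_dyadicBump ψ (j - 1)) (abs_dyadicBump_le ψ _) a (-τ)) f
  have e2 := coeFn_fourier_multiplier _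
    (flowSymbol_memLp (measurable_dyadicBump ψ j) (abs_dyadicBump_le ψ _) a (-τ)) f
  have e3 := coeFn_fourier_multiplier _
    (flowSymbol_memLp (measurable_dyadicBump ψ (j + 1)) (abs_dyadicBump_le ψ _) a (-τ)) f
  have e4 := coeFn_fourier_multiplier _
    (flowSymbol_memLp (measurable_dyadicBump ψ j) (abs_dyadicBump_le ψ _) a (t - τ)) f
  have e5 := coeFn_fourier_multiplier _
    (flowSymbol_memLp (measurable_dyadicBump ψ j) (abs_dyadicBump_le ψ _) a t) (u₁ + u₂ + u₃)
  have e6 : (𝓕 (u₁ + u₂ + u₃) : L2 n) = 𝓕 u₁ + 𝓕 u₂ + 𝓕 u₃ := by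
    rw [FourierTransform.fourier_add, FourierTransform.fourier_add]
  rw [e6] at e5
  filter_upwards [e1, e2, e3, e4, e5, Lp.coeFn_add (𝓕 u₁ + 𝓕 u₂ : L2 n) (𝓕 u₃),
    Lp.coeFn_add (𝓕 u₁ : L2 n) (𝓕 u₂)] with ξ e1 e2 e3 e4 e5 e7 e8
  refine e4.trans (Eq.trans ?_ e5.symm)
  rw [e7, Pi.add_apply, e8, Pi.add_apply]
  have e1' : (𝓕 u₁ : L2 n) ξ = _ := e1
  have e2' : (𝓕 u₂ : L2 n) ξ = _ := e2
  have e3' : (𝓕 u₃ : L2 n) ξ = _ := e3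
  rw [e1', e2', e3']
  simp only [flowSymbol]
  have h := congrArg (fun x : ℝ => (x : ℂ)) (dyadicBump_mul_sum ψ j ξ)
  simp only [Complex.ofReal_mul, Complex.ofReal_add] at h
  rw [sub_eq_add_neg, propagatorSymbol_add]
  linear_combination (-(propagatorSymbol n a t ξ * propagatorSymbol n a (-τ) ξ *
    (𝓕 f : L2 n) ξ)) * h

theorem locFlow_apply_propagator (a : ℝ) (j : ℤ) (t : ℝ) (f : L2 n) :
    locFlow ψ a j 0 (propagator a t f) = locFlow ψ a j t f := by
  rw [propagator_eq_multiplier]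
  refine (multiplier_comp _ _ _ (fun ξ => ?_) f).symm
  rw [flowSymbol, flowSymbol, propagatorSymbol_zero, mul_one]

theorem freqLoc_toDist (a : ℝ) (j : ℤ) (u : L2 n) :
    freqLoc ψ (dyadic j) (toDist u) = toDist (locFlow ψ a j 0 u) := by
  have hm : MemLp (fun ξ => (dyadicBump ψ j ξ : ℂ)) ∞ (volume : Measure (Sp n)) := by
    convert flowSymbol_memLp (measurable_dyadicBump ψ j) (abs_dyadicBump_le ψ j) a 0 using 2
    rw [flowSymbol, propagatorSymbol_zero, mul_one]
  have h1 : locFlow ψ a j 0 u = multiplier _ hm u := by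
    unfold locFlow
    congr 1
    congr 1
    ext ξ
    rw [flowSymbol, propagatorSymbol_zero, mul_one]
  rw [h1, freqLoc, TemperedDistribution.fourierMultiplierCLM_apply]
  unfold toDist
  rw [Lp.fourier_toTemperedDistribution_eq]
  have h2 := Lp.toTemperedDistribution_smul_eq (r := 2) (hasTemperateGrowth_dyadicBump ψ j) hm
    (𝓕 u : L2 n)
  have h3 := Lp.fourierInv_toTemperedDistribution_eq
    (hm.toLp _ • (𝓕 u : L2 n) : L2 n)
  rw [h2] at h3
  exact h3

theorem toDist_injective : Function.Injective (toDist (n := n)) := by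
  have h := Lp.ker_toTemperedDistributionCLM_eq_bot (F := ℂ) (μ := (volume : Measure (Sp n))) (p := 2)
  exact LinearMap.ker_eq_bot.mp h

theorem isFlow_propagator (a : ℝ) :
    IsFlow fun t => multiplier (propagatorSymbol n a t) (propagatorSymbol_memLp n a t) := by
  have hM : ∀ _ : Sp n, |(1 : ℝ)| ≤ ((1 : ℝ≥0) : ℝ) := fun _ => by simp
  convert isFlow_multiplier (g := fun _ : Sp n => (1 : ℝ)) measurable_const hM a using 3 with t
  ext ξ
  simp [flowSymbol]

/-- The frequency localization of the Duhamel integral is a retarded integral. -/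
theorem freqLoc_duhamel (a : ℝ) (j : ℤ) {F : ℝ → L2 n} (hF : Integrable F) (t : ℝ) :
    freqLoc ψ (dyadic j) (toDist (duhamel a F t)) = toDist (retarded (locFlow ψ a j) F t) := by
  rw [freqLoc_toDist ψ a]
  congr 1
  have hi : Integrable (fun τ => propagator a (t - τ) (F τ)) (volume.restrict (Set.Iic t)) :=
    (isFlow_propagator (n := n) a).integrable (τ := fun τ => t - τ) (by fun_prop)
      (hF.restrict (s := Set.Iic t))
  rw [duhamel, retarded, ← ContinuousLinearMap.integral_comp_comm _ hi]
  simp_rw [locFlow_apply_propagator]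

end Localization

/-! ### The range spaces inside `L²(ℝⁿ)` -/

section RangeSpaces

variable {n : ℕ} {ψ : Cutoff n} {H : Type*} [NormedAddCommGroup H] [InnerProductSpace ℂ H]

theorem eLpNorm_const_mul_ennreal {Ω : Type*} [MeasurableSpace Ω] {ν : Measure Ω} {c : ℝ≥0∞}
    (hc : c ≠ ∞) (q : ℝ≥0∞) (f : Ω → ℝ≥0∞) :
    eLpNorm (fun t => c * f t) q ν = c * eLpNorm f q ν := by
  rcases eq_or_ne q 0 with rfl | hq0
  · simp
  rcases eq_or_ne q ∞ with rfl | hq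
  · simp only [eLpNorm_exponent_top, eLpNormEssSup, enorm_eq_self]
    exact ENNReal.essSup_const_mul
  · have hq' := ENNReal.toReal_pos hq0 hq
    rw [eLpNorm_eq_lintegral_rpow_enorm_toReal hq0 hq, eLpNorm_eq_lintegral_rpow_enorm_toReal hq0 hq]
    exact lpSize_const_mul hq' hc f

theorem toDist_add (u v : L2 n) : toDist (u + v) = toDist u + toDist v :=
  map_add (Lp.toTemperedDistributionCLM ℂ (volume : Measure (Sp n)) 2) u v

theorem toDist_smul (c : ℂ) (u : L2 n) : toDist (c • u) = c • toDist u :=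
  map_smul (Lp.toTemperedDistributionCLM ℂ (volume : Measure (Sp n)) 2) c u

theorem RangeSpaces.exists_isometry (Z : RangeSpaces n ψ H) :
    ∃ (c : ℝ) (U : Lp H 2 (radialMeasure n) →ₗᵢ[ℂ] L2 n), 0 < c ∧
      ∀ f, Z.emb 2 f = toDist ((c : ℂ) • U f) := by
  obtain ⟨c, hc, h⟩ := Z.emb_two
  choose u hu hun using h
  have hc' : (c : ℂ) ≠ 0 := by exact_mod_cast hc.ne'
  refine ⟨c, ⟨{ toFun := fun f => (c : ℂ)⁻¹ • u f, map_add' := ?_, map_smul' := ?_ }, ?_⟩, hc, ?_⟩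
  · intro f g
    rw [← smul_add]
    congr 1
    apply toDist_injective
    rw [toDist_add, ← hu, ← hu, ← hu, map_add]
  · intro d f
    rw [RingHom.id_apply, smul_comm d]
    congr 1
    apply toDist_injective
    rw [toDist_smul, ← hu, ← hu, map_smul]
  · intro f
    change ‖(c : ℂ)⁻¹ • u f‖ = ‖f‖
    rw [norm_smul, norm_inv, Complex.norm_real, Real.norm_of_nonneg hc.le, hun,
      inv_mul_cancel_left₀ hc.ne']
  · intro f
    change _ = toDist ((c : ℂ) • (c : ℂ)⁻¹ • u f)
    rw [smul_inv_smul₀ hc', hu]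

/-- The factor between the norms of `L²(ℝⁿ)` and `Z_2`. -/
def RangeSpaces.normFactor (Z : RangeSpaces n ψ H) : ℝ := Z.exists_isometry.choose

/-- The embedding of `Z_2` into `L²(ℝⁿ)`, normalized to an isometry. -/
def RangeSpaces.isom (Z : RangeSpaces n ψ H) : Lp H 2 (radialMeasure n) →ₗᵢ[ℂ] L2 n :=
  Z.exists_isometry.choose_spec.choose

variable (Z : RangeSpaces n ψ H)

theorem RangeSpaces.normFactor_pos : 0 < Z.normFactor :=
  Z.exists_isometry.choose_spec.choose_spec.1

theorem RangeSpaces.emb_two_eq (f : Lp H 2 (radialMeasure n)) :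
    Z.emb 2 f = toDist ((Z.normFactor : ℂ) • Z.isom f) :=
  Z.exists_isometry.choose_spec.choose_spec.2 f

theorem RangeSpaces.toDist_isom (f : Lp H 2 (radialMeasure n)) :
    toDist (Z.isom f) = Z.emb 2 ((Z.normFactor : ℂ)⁻¹ • f) := by
  have hc : (Z.normFactor : ℂ) ≠ 0 := by exact_mod_cast Z.normFactor_pos.ne'
  rw [Z.emb_two_eq, map_smul, smul_inv_smul₀ hc]

theorem RangeSpaces.memTwo_iff (u : L2 n) : Z.MemTwo u ↔ u ∈ Set.range Z.isom := by
  constructor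
  · rintro ⟨g, hg⟩
    rw [Z.emb_two_eq] at hg
    exact ⟨(Z.normFactor : ℂ) • g, by rw [map_smul]; exact toDist_injective hg⟩
  · rintro ⟨f, rfl⟩
    exact ⟨_, (Z.toDist_isom f).symm⟩

/-- The norm of `Z_p` on `L²` functions which belong to `Z_2`. -/
theorem RangeSpaces.zNorm_isom (p : ℝ≥0∞) [Fact (1 ≤ p)] (f : Lp H 2 (radialMeasure n)) :
    Z.zNorm p (toDist (Z.isom f)) =
      ENNReal.ofReal Z.normFactor⁻¹ * eLpNorm f p (radialMeasure n) := by
  have hc := Z.normFactor_pos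
  have he : eLpNorm ((Z.normFactor : ℂ)⁻¹ • f : Lp H 2 (radialMeasure n)) p (radialMeasure n) =
      ENNReal.ofReal Z.normFactor⁻¹ * eLpNorm f p (radialMeasure n) := by
    rw [eLpNorm_congr_ae (Lp.coeFn_smul _ _), eLpNorm_const_smul, ← ofReal_norm, norm_inv,
      Complex.norm_real, Real.norm_of_nonneg hc.le]
  rw [← he, Z.toDist_isom, RangeSpaces.zNorm]
  set g : Lp H 2 (radialMeasure n) := (Z.normFactor : ℂ)⁻¹ • f
  by_cases hg : MemLp g p (radialMeasure n)
  · refine le_antisymm (iInf₂_le_of_le (hg.toLp g) ?_ ?_) (le_iInf₂ fun h hh => ?_)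
    · rw [Z.emb_eq_iff]
      exact AEEqFun.ext ((AEEqFun.coeFn_mk _ _).trans (Filter.EventuallyEq.refl _ _))
    · rw [Lp.enorm_toLp]
    · rw [Z.emb_eq_iff] at hh
      rw [Lp.enorm_def]
      exact (eLpNorm_congr_ae (by
        have : ((h : Set.Ioi (0 : ℝ) →ₘ[radialMeasure n] H) : Set.Ioi (0 : ℝ) → H) =
          (g : Set.Ioi (0 : ℝ) →ₘ[radialMeasure n] H) := by rw [hh]
        exact Filter.EventuallyEq.of_eq this.symm)).le
  · have h1 : eLpNorm g p (radialMeasure n) = ∞ := by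
      by_contra h
      exact hg ⟨Lp.aestronglyMeasurable g, lt_top_iff_ne_top.2 h⟩
    rw [h1, iInf₂_eq_top]
    intro h hh
    rw [Z.emb_eq_iff] at hh
    have h2 := Lp.memLp h
    have : ((h : Set.Ioi (0 : ℝ) →ₘ[radialMeasure n] H) : Set.Ioi (0 : ℝ) → H) =
      (g : Set.Ioi (0 : ℝ) →ₘ[radialMeasure n] H) := by rw [hh]
    rw [show (h : Set.Ioi (0 : ℝ) → H) = g from this] at h2
    exact absurd h2 hg

theorem RangeSpaces.zNorm_isom_ofReal {p : ℝ} [Fact (1 ≤ ENNReal.ofReal p)] (hp : 0 < p)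
    (f : Lp H 2 (radialMeasure n)) :
    Z.zNorm (ENNReal.ofReal p) (toDist (Z.isom f)) =
      ENNReal.ofReal Z.normFactor⁻¹ * spSize p f := by
  rw [Z.zNorm_isom, spSize_eq_eLpNorm hp]

variable [CompleteSpace H]

/-- The compression to `Z_2` of an operator on `L²(ℝⁿ)`. -/
def RangeSpaces.compress (T : L2 n →L[ℂ] L2 n) :
    Lp H 2 (radialMeasure n) →L[ℂ] Lp H 2 (radialMeasure n) :=
  Z.isom.toContinuousLinearMap.adjoint ∘L T ∘L Z.isom.toContinuousLinearMap

theorem RangeSpaces.adjoint_isom (f : Lp H 2 (radialMeasure n)) :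
    Z.isom.toContinuousLinearMap.adjoint (Z.isom f) = f := by
  refine ext_inner_right ℂ fun g => ?_
  rw [ContinuousLinearMap.adjoint_inner_left]
  exact Z.isom.inner_map_map f g

theorem RangeSpaces.isom_adjoint {u : L2 n} (hu : u ∈ Set.range Z.isom) :
    Z.isom (Z.isom.toContinuousLinearMap.adjoint u) = u := by
  obtain ⟨f, rfl⟩ := hu
  rw [Z.adjoint_isom]

theorem RangeSpaces.isom_compress {T : L2 n →L[ℂ] L2 n} {f : Lp H 2 (radialMeasure n)}
    (h : T (Z.isom f) ∈ Set.range Z.isom) : Z.isom (Z.compress T f) = T (Z.isom f) :=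
  Z.isom_adjoint h

/-- Compression to a subspace preserves the flow properties: no group law is required. -/
theorem RangeSpaces.isFlow_compress {S : ℝ → L2 n →L[ℂ] L2 n} (hS : IsFlow S) :
    IsFlow fun t => Z.compress (S t) := by
  refine ⟨?_, ?_, fun t f g => ?_⟩
  · exact Z.isom.toContinuousLinearMap.adjoint.continuous.comp (hS.continuous_uncurry.comp
      (continuous_fst.prodMk (Z.isom.continuous.comp continuous_snd)))
  · obtain ⟨M, hM⟩ := hS.bounded
    refine ⟨‖Z.isom.toContinuousLinearMap.adjoint‖₊ * M, fun t f => ?_⟩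
    have h1 := Z.isom.toContinuousLinearMap.adjoint.le_opNorm (S t (Z.isom f))
    have h2 := hM t (Z.isom f)
    rw [Z.isom.norm_map] at h2
    calc _ ≤ _ := h1
      _ ≤ ‖Z.isom.toContinuousLinearMap.adjoint‖ * (M * ‖f‖) :=
        mul_le_mul_of_nonneg_left h2 (norm_nonneg _)
      _ = _ := by rw [NNReal.coe_mul, mul_assoc, coe_nnnorm]
  · change inner ℂ (Z.isom.toContinuousLinearMap.adjoint (S t (Z.isom f))) g =
      inner ℂ f (Z.isom.toContinuousLinearMap.adjoint (S (-t) (Z.isom g)))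
    rw [ContinuousLinearMap.adjoint_inner_left, ContinuousLinearMap.adjoint_inner_right]
    exact hS.inner_left t _ _

theorem RangeSpaces.isClosed_range_isom : IsClosed (Set.range Z.isom) :=
  Z.isom.isometry.isClosedEmbedding.isClosed_range

/-- The frequency-localized unitary group on `Z_2`. -/
def RangeSpaces.flow (a : ℝ) (j : ℤ) (t : ℝ) :
    Lp H 2 (radialMeasure n) →L[ℂ] Lp H 2 (radialMeasure n) :=
  Z.compress (locFlow ψ a j t)

theorem RangeSpaces.isFlow_flow (a : ℝ) (j : ℤ) : IsFlow (Z.flow a j) :=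
  Z.isFlow_compress (isFlow_locFlow ψ a j)

theorem ofReal_dyadic_rpow (j : ℤ) (x : ℝ) :
    ENNReal.ofReal (dyadic j ^ x) = (2 : ℝ≥0∞) ^ (j * x) := by
  rw [two_rpow_eq_ofReal, dyadic, ← Real.rpow_intCast, ← Real.rpow_mul (by norm_num)]

variable {Z} {a σ' : ℝ}

/-- The spaces `Z_2` are invariant under the localized unitary group: by the endpoint
`(q, p) = (∞, 2)` of the Strichartz estimates this holds for almost all times. -/
theorem AdmitsStrichartz.locFlow_mem_range (hS : AdmitsStrichartz Z a σ') (j : ℤ) (t : ℝ)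
    (f : Lp H 2 (radialMeasure n)) : locFlow ψ a j t (Z.isom f) ∈ Set.range Z.isom := by
  obtain ⟨h1, h2, h3⟩ := hS
  obtain ⟨C, hC⟩ := h3 2 ∞ le_rfl le_top ((decayParameter a n + σ') / 2)
    ⟨by linarith, by linarith⟩ (by simp [recip])
  have h4 := hC j (Z.isom f) ((Z.memTwo_iff _).2 ⟨f, rfl⟩)
  have h5 : ∀ᵐ t : ℝ, locFlow ψ a j t (Z.isom f) ∈ Set.range Z.isom := by
    have h6 := h4.trans_lt (ENNReal.mul_lt_top (ENNReal.mul_lt_top (by simp) (by simp))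
      enorm_lt_top)
    rw [RangeSpaces.tzNorm, eLpNorm_exponent_top, eLpNormEssSup] at h6
    filter_upwards [ae_lt_of_essSup_lt h6] with t ht
    rw [freqLoc_toDist ψ a, locFlow_apply_propagator, RangeSpaces.zNorm] at ht
    simp only [enorm_eq_self, iInf_lt_iff] at ht
    obtain ⟨g, hg, -⟩ := ht
    exact (Z.memTwo_iff _).1 ⟨g, hg⟩
  have h6 : IsClosed {t : ℝ | locFlow ψ a j t (Z.isom f) ∈ Set.range Z.isom} :=
    Z.isClosed_range_isom.preimage
      ((isFlow_locFlow ψ a j).continuous_uncurry.comp (continuous_id.prodMk continuous_const))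
  have h7 : Dense {t : ℝ | locFlow ψ a j t (Z.isom f) ∈ Set.range Z.isom} :=
    Measure.dense_of_ae h5
  have h8 := h6.closure_eq ▸ h7 t
  exact h8

theorem AdmitsStrichartz.isom_flow (hS : AdmitsStrichartz Z a σ') (j : ℤ) (t : ℝ)
    (f : Lp H 2 (radialMeasure n)) : Z.isom (Z.flow a j t f) = locFlow ψ a j t (Z.isom f) :=
  Z.isom_compress (hS.locFlow_mem_range j t f)

theorem AdmitsStrichartz.flow_factor (hS : AdmitsStrichartz Z a σ') (j : ℤ) (t τ : ℝ)
    (f : Lp H 2 (radialMeasure n)) : Z.flow a j (t - τ) f =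
      Z.flow a j t ((Z.flow a (j - 1) (-τ) + Z.flow a j (-τ) + Z.flow a (j + 1) (-τ)) f) := by
  apply Z.isom.injective
  rw [hS.isom_flow, hS.isom_flow, locFlow_factor]
  simp only [add_apply, map_add, hS.isom_flow]

/-- The Strichartz estimates on the model of `Z_2`. The number `ω` stands for `1/q`; for `ω = 0` the
exponent `(ENNReal.ofReal ω)⁻¹` is `∞`. -/
theorem AdmitsStrichartz.exists_flow_le (hS : AdmitsStrichartz Z a σ') {p τ ω : ℝ} (hp : 2 ≤ p)
    (hτ : τ ∈ Set.Ioo (decayParameter a n) σ') (hω : ω = τ * (1 / 2 - 1 / p)) (hω2 : ω ≤ 1 / 2) :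
    ∃ C : ℝ≥0, ∀ j f, eLpNorm (fun t => spSize p (Z.flow a j t f)) (ENNReal.ofReal ω)⁻¹ volume ≤
      C * 2 ^ (j * (n / 2 - n / p - a * ω)) * ‖f‖ₑ := by
  obtain ⟨h1, -, h3⟩ := id hS
  have hp0 : 0 < p := by linarith
  have hω0 : 0 ≤ ω := by
    rw [hω]
    refine mul_nonneg (by linarith [hτ.1]) ?_
    rw [sub_nonneg]
    exact one_div_le_one_div_of_le (by norm_num) hp
  have hp2 : (2 : ℝ≥0∞) ≤ ENNReal.ofReal p := by
    rw [← ENNReal.ofReal_ofNat]; exact ENNReal.ofReal_le_ofReal hp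
  have : Fact (1 ≤ ENNReal.ofReal p) := ⟨le_trans (by norm_num) hp2⟩
  have hrp : recip (ENNReal.ofReal p) = 1 / p := by
    rw [recip, ENNReal.toReal_inv, ENNReal.toReal_ofReal hp0.le, one_div]
  have hrq : recip (ENNReal.ofReal ω)⁻¹ = ω := by
    rw [recip, inv_inv, ENNReal.toReal_ofReal hω0]
  obtain ⟨C, hC⟩ := h3 (ENNReal.ofReal p) (ENNReal.ofReal ω)⁻¹ hp2 (by
    rw [ENNReal.le_inv_iff_le_inv]
    refine (ENNReal.ofReal_le_ofReal hω2).trans (le_of_eq ?_)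
    rw [one_div, ENNReal.ofReal_inv_of_pos (by norm_num)]; norm_num) τ hτ (by rw [hrp, hrq, hω])
  set c := ENNReal.ofReal Z.normFactor⁻¹ with hc
  have hc0 : c ≠ 0 := by
    rw [hc, ne_eq, ENNReal.ofReal_eq_zero, not_le]
    exact inv_pos.2 Z.normFactor_pos
  have hct : c ≠ ∞ := ENNReal.ofReal_ne_top
  refine ⟨(c⁻¹ * C).toNNReal, fun j f => ?_⟩
  rw [ENNReal.coe_toNNReal (ENNReal.mul_ne_top (ENNReal.inv_ne_top.2 hc0) (by simp))]
  have h4 := hC j (Z.isom f) ((Z.memTwo_iff _).2 ⟨f, rfl⟩)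
  rw [RangeSpaces.tzNorm] at h4
  simp_rw [freqLoc_toDist ψ a, locFlow_apply_propagator, ← hS.isom_flow,
    Z.zNorm_isom_ofReal hp0] at h4
  rw [← hc, hrp, hrq, ofReal_dyadic_rpow] at h4
  have h5 : eLpNorm (fun t => c * spSize p (Z.flow a j t f)) (ENNReal.ofReal ω)⁻¹ volume =
      c * eLpNorm (fun t => spSize p (Z.flow a j t f)) (ENNReal.ofReal ω)⁻¹ volume :=
    eLpNorm_const_mul_ennreal hct _ _
  rw [h5] at h4
  have h6 : ‖Z.isom f‖ₑ = ‖f‖ₑ := Z.isom.enorm_map f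
  rw [h6] at h4
  calc eLpNorm (fun t => spSize p (Z.flow a j t f)) (ENNReal.ofReal ω)⁻¹ volume
      = c⁻¹ * (c * eLpNorm (fun t => spSize p (Z.flow a j t f)) (ENNReal.ofReal ω)⁻¹ volume) := by
        rw [← mul_assoc, ENNReal.inv_mul_cancel hc0 hct, one_mul]
    _ ≤ c⁻¹ * _ := mul_le_mul_right h4 _
    _ = _ := by
      rw [← mul_assoc, ← mul_assoc]
      congr 4
      ring

end RangeSpaces

/-! ### Dilations -/

section Dilation

variable {n : ℕ}

theorem smulLeft_inv_apply {lam : ℝ} (hlam : 0 < lam) (x : Sp n) :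
    ContinuousLinearEquiv.smulLeft (R₁ := ℝ) (M₁ := Sp n) (Units.mk0 lam hlam.ne')⁻¹ x = lam⁻¹ • x := by
  change ((Units.mk0 lam hlam.ne')⁻¹ : ℝˣ) • x = _
  rw [Units.smul_def, Units.val_inv_eq_inv_val, Units.val_mk0]

theorem fourier_comp_smul_apply {lam : ℝ} (hlam : 0 < lam) (φ φ' : 𝓢(Sp n, ℂ))
    (h : ∀ x, φ' x = φ (lam • x)) (ξ : Sp n) :
    (𝓕 φ) (lam⁻¹ • ξ) = (lam : ℂ) ^ n * (𝓕 φ') ξ := by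
  rw [SchwartzMap.fourier_coe, SchwartzMap.fourier_coe, Real.fourier_eq, Real.fourier_eq]
  have h1 := Measure.integral_comp_smul (volume : Measure (Sp n))
    (fun v : Sp n => Real.fourierChar (-inner ℝ v (lam⁻¹ • ξ)) • φ v) lam
  have h2 : ∀ v : Sp n, Real.fourierChar (-inner ℝ (lam • v) (lam⁻¹ • ξ)) • φ (lam • v) =
      Real.fourierChar (-inner ℝ v ξ) • φ' v := by
    intro v
    rw [h, inner_smul_left, inner_smul_right]
    simp [hlam.ne']
  simp_rw [h2] at h1
  rw [h1, finrank_euclideanSpace, Fintype.card_fin, abs_of_pos (by positivity), Complex.real_smul]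
  have : (lam : ℂ) ≠ 0 := by exact_mod_cast hlam.ne'
  push_cast
  field_simp

/-- The Fourier transform of a dilated `L²` function. -/
theorem fourier_of_toDist_eq_dilate {u v : L2 n} {lam : ℝ} (hlam : 0 < lam)
    (h : toDist v = dilate lam hlam (toDist u)) :
    (𝓕 v : L2 n) =ᵐ[volume] fun ξ => ((lam : ℂ) ^ n)⁻¹ * (𝓕 u : L2 n) (lam⁻¹ • ξ) := by
  have hc : ((lam : ℂ) ^ n) ≠ 0 := pow_ne_zero _ (by exact_mod_cast hlam.ne')
  have hW : MemLp (fun ξ : Sp n => ((lam : ℂ) ^ n)⁻¹ * (𝓕 u : L2 n) (lam⁻¹ • ξ)) 2 volume := by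
    refine MemLp.const_mul ?_ _
    have hmap := Measure.map_addHaar_smul (volume : Measure (Sp n)) (inv_ne_zero hlam.ne')
    have h1 : MemLp (𝓕 u : L2 n) 2 (Measure.map (fun x : Sp n => lam⁻¹ • x) volume) := by
      have h2 : (Measure.map (fun x : Sp n => lam⁻¹ • x) volume) = _ := hmap
      rw [h2]
      exact (Lp.memLp (𝓕 u : L2 n)).smul_measure ENNReal.ofReal_ne_top
    exact h1.comp_of_map (by fun_prop)
  have key : (𝓕 v : L2 n) = hW.toLp _ := by
    apply toDist_injective
    ext φ
    set e := ContinuousLinearEquiv.smulLeft (R₁ := ℝ) (M₁ := Sp n) (Units.mk0 lam hlam.ne')⁻¹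
    set φ' : 𝓢(Sp n, ℂ) := SchwartzMap.compCLMOfContinuousLinearEquiv ℂ e.symm φ with hφ'
    have hφ'x : ∀ x, φ' x = φ (lam • x) := by
      intro x
      change φ (e.symm x) = _
      congr 1
    have h1 : toDist (𝓕 v : L2 n) φ = toDist v (𝓕 φ) := by
      unfold toDist
      rw [← Lp.fourier_toTemperedDistribution_eq, TemperedDistribution.fourier_apply]
    have h2 : toDist (𝓕 u : L2 n) φ' = toDist u (𝓕 φ') := by
      unfold toDist
      rw [← Lp.fourier_toTemperedDistribution_eq, TemperedDistribution.fourier_apply]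
    have h3 : SchwartzMap.compCLMOfContinuousLinearEquiv ℂ e (𝓕 φ) = (lam : ℂ) ^ n • 𝓕 φ' := by
      ext ξ
      change (𝓕 φ) (e ξ) = _
      rw [smulLeft_inv_apply hlam, fourier_comp_smul_apply hlam φ φ' hφ'x]
      rfl
    have h4 : toDist v (𝓕 φ) = toDist u (𝓕 φ') := by
      rw [h]
      change ((lam : ℂ) ^ n)⁻¹ • toDist u (SchwartzMap.compCLMOfContinuousLinearEquiv ℂ e (𝓕 φ)) = _
      rw [h3, map_smul, inv_smul_smul₀ hc]
    rw [h1, h4, ← h2]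
    unfold toDist
    rw [Lp.toTemperedDistribution_apply, Lp.toTemperedDistribution_apply]
    have h5 : ∫ ξ, φ ξ • (hW.toLp _ : L2 n) ξ =
        ∫ ξ, φ ξ • (((lam : ℂ) ^ n)⁻¹ * (𝓕 u : L2 n) (lam⁻¹ • ξ)) := by
      refine integral_congr_ae ?_
      filter_upwards [hW.coeFn_toLp] with ξ hξ
      rw [hξ]
    rw [h5]
    have h6 := Measure.integral_comp_smul (volume : Measure (Sp n))
      (fun ξ => φ ξ • (((lam : ℂ) ^ n)⁻¹ * (𝓕 u : L2 n) (lam⁻¹ • ξ))) lam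
    rw [finrank_euclideanSpace, Fintype.card_fin, abs_of_pos (by positivity)] at h6
    have h7 : ∀ x : Sp n, φ (lam • x) • (((lam : ℂ) ^ n)⁻¹ * (𝓕 u : L2 n) (lam⁻¹ • lam • x)) =
        ((lam ^ n)⁻¹ : ℝ) • (φ' x • (𝓕 u : L2 n) x) := by
      intro x
      rw [inv_smul_smul₀ hlam.ne', hφ'x, Complex.real_smul, smul_eq_mul, smul_eq_mul]
      push_cast
      ring
    simp_rw [h7] at h6
    rw [integral_smul] at h6
    exact smul_right_injective _ (by positivity : ((lam ^ n)⁻¹ : ℝ) ≠ 0) h6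
  rw [key]
  exact hW.coeFn_toLp

/-- The dilation `r ↦ lam r` of `(0, ∞)`. -/
def scaleIoi (lam : ℝ) (hlam : 0 < lam) (r : Set.Ioi (0 : ℝ)) : Set.Ioi (0 : ℝ) :=
  ⟨lam * r.1, mul_pos hlam r.2⟩

theorem measurable_scaleIoi {lam : ℝ} (hlam : 0 < lam) : Measurable (scaleIoi lam hlam) :=
  (measurable_subtype_coe.const_mul lam).subtype_mk

theorem map_scaleIoi (hn : 1 ≤ n) {lam : ℝ} (hlam : 0 < lam) :
    (radialMeasure n).map (scaleIoi lam hlam) = ENNReal.ofReal (lam ^ n)⁻¹ • radialMeasure n := by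
  symm
  have hle : ENNReal.ofReal (lam ^ n)⁻¹ ≠ ∞ := ENNReal.ofReal_ne_top
  have hfs : (ENNReal.ofReal (lam ^ n)⁻¹ • radialMeasure n).FiniteSpanningSetsIn
      (Set.range Set.Iio) :=
    { set := (Measure.finiteSpanningSetsIn_volumeIoiPow_range_Iio (n - 1)).set
      set_mem := (Measure.finiteSpanningSetsIn_volumeIoiPow_range_Iio (n - 1)).set_mem
      finite := fun k => by
        rw [Measure.smul_apply, smul_eq_mul]
        exact ENNReal.mul_lt_top hle.lt_top
          ((Measure.finiteSpanningSetsIn_volumeIoiPow_range_Iio (n - 1)).finite k)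
      spanning := (Measure.finiteSpanningSetsIn_volumeIoiPow_range_Iio (n - 1)).spanning }
  refine hfs.ext ((borel_eq_generateFrom_Iio _).symm.trans BorelSpace.measurable_eq.symm).symm
    isPiSystem_Iio ?_
  rintro _ ⟨x, rfl⟩
  have hpre : scaleIoi lam hlam ⁻¹' Set.Iio x = Set.Iio (scaleIoi lam⁻¹ (inv_pos.2 hlam) x) := by
    ext r
    simp only [Set.mem_preimage, Set.mem_Iio, scaleIoi, ← Subtype.coe_lt_coe]
    rw [inv_mul_eq_div, lt_div_iff₀ hlam, mul_comm]
  rw [Measure.map_apply (measurable_scaleIoi hlam) measurableSet_Iio, hpre, Measure.smul_apply,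
    smul_eq_mul, Measure.volumeIoiPow_apply_Iio, Measure.volumeIoiPow_apply_Iio,
    ← ENNReal.ofReal_mul (by positivity), Nat.sub_add_cancel hn]
  congr 1
  simp only [scaleIoi]
  rw [mul_pow, inv_pow]
  ring

variable {H : Type*} [NormedAddCommGroup H]

theorem eLpNorm_comp_scaleIoi (hn : 1 ≤ n) {lam : ℝ} (hlam : 0 < lam) (p : ℝ≥0∞)
    {f : Set.Ioi (0 : ℝ) → H} (hf : AEStronglyMeasurable f (radialMeasure n)) :
    eLpNorm (f ∘ scaleIoi lam hlam) p (radialMeasure n) =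
      ENNReal.ofReal (lam ^ n)⁻¹ ^ (1 / p).toReal * eLpNorm f p (radialMeasure n) := by
  have hc : ENNReal.ofReal (lam ^ n)⁻¹ ≠ 0 := by
    rw [ne_eq, ENNReal.ofReal_eq_zero, not_le]; positivity
  rw [← eLpNorm_map_measure _ (measurable_scaleIoi hlam).aemeasurable, map_scaleIoi hn,
    eLpNorm_smul_measure_of_ne_zero hc, smul_eq_mul]
  rw [map_scaleIoi hn]
  exact hf.smul_measure _

theorem quasiMeasurePreserving_scaleIoi (hn : 1 ≤ n) {lam : ℝ} (hlam : 0 < lam) :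
    Measure.QuasiMeasurePreserving (scaleIoi lam hlam) (radialMeasure n) (radialMeasure n) := by
  refine ⟨measurable_scaleIoi hlam, ?_⟩
  rw [map_scaleIoi hn]
  exact Measure.smul_absolutelyContinuous

theorem memLp_comp_scaleIoi (hn : 1 ≤ n) {lam : ℝ} (hlam : 0 < lam)
    (f : Lp H 2 (radialMeasure n)) :
    MemLp (f ∘ scaleIoi lam hlam) 2 (radialMeasure n) := by
  refine ⟨(Lp.aestronglyMeasurable f).comp_quasiMeasurePreserving
    (quasiMeasurePreserving_scaleIoi hn hlam), ?_⟩
  rw [eLpNorm_comp_scaleIoi hn hlam _ (Lp.aestronglyMeasurable f)]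
  exact ENNReal.mul_lt_top (ENNReal.rpow_lt_top_of_nonneg (by simp) ENNReal.ofReal_ne_top)
    (Lp.memLp f).2

variable [InnerProductSpace ℂ H]

/-- The dilation `f ↦ f(lam ·)` of `L²((0, ∞), r ^ (n - 1) dr; H)` as a map. -/
def dilateFun (hn : 1 ≤ n) (lam : ℝ) (hlam : 0 < lam) (f : Lp H 2 (radialMeasure n)) :
    Lp H 2 (radialMeasure n) := (memLp_comp_scaleIoi hn hlam f).toLp _

theorem coeFn_dilateFun (hn : 1 ≤ n) {lam : ℝ} (hlam : 0 < lam) (f : Lp H 2 (radialMeasure n)) :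
    dilateFun hn lam hlam f =ᵐ[radialMeasure n] f ∘ scaleIoi lam hlam := MemLp.coeFn_toLp _

theorem dilateFun_add (hn : 1 ≤ n) {lam : ℝ} (hlam : 0 < lam) (f g : Lp H 2 (radialMeasure n)) :
    dilateFun hn lam hlam (f + g) = dilateFun hn lam hlam f + dilateFun hn lam hlam g := by
  apply Lp.ext
  filter_upwards [coeFn_dilateFun hn hlam (f + g), coeFn_dilateFun hn hlam f,
    coeFn_dilateFun hn hlam g, Lp.coeFn_add (dilateFun hn lam hlam f) (dilateFun hn lam hlam g),
    (quasiMeasurePreserving_scaleIoi hn hlam).ae (Lp.coeFn_add f g)] with r h1 h2 h3 h4 h5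
  rw [h1, h4, Pi.add_apply, h2, h3, Function.comp_apply, h5, Pi.add_apply]
  rfl

theorem dilateFun_smul (hn : 1 ≤ n) {lam : ℝ} (hlam : 0 < lam) (c : ℂ)
    (f : Lp H 2 (radialMeasure n)) :
    dilateFun hn lam hlam (c • f) = c • dilateFun hn lam hlam f := by
  apply Lp.ext
  filter_upwards [coeFn_dilateFun hn hlam (c • f), coeFn_dilateFun hn hlam f,
    Lp.coeFn_smul c (dilateFun hn lam hlam f),
    (quasiMeasurePreserving_scaleIoi hn hlam).ae (Lp.coeFn_smul c f)] with r h1 h2 h3 h4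
  rw [h1, h3, Pi.smul_apply, h2, Function.comp_apply, h4, Pi.smul_apply]
  rfl

theorem norm_dilateFun (hn : 1 ≤ n) {lam : ℝ} (hlam : 0 < lam) (f : Lp H 2 (radialMeasure n)) :
    ‖dilateFun hn lam hlam f‖ =
      (ENNReal.ofReal (lam ^ n)⁻¹ ^ (1 / 2 : ℝ≥0∞).toReal).toReal * ‖f‖ := by
  rw [dilateFun, Lp.norm_toLp, eLpNorm_comp_scaleIoi hn hlam _ (Lp.aestronglyMeasurable f),
    ENNReal.toReal_mul, Lp.norm_def]

/-- The dilation `f ↦ f(lam ·)` of `L²((0, ∞), r ^ (n - 1) dr; H)` as an operator. -/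
def dilateL2 (hn : 1 ≤ n) (lam : ℝ) (hlam : 0 < lam) :
    Lp H 2 (radialMeasure n) →L[ℂ] Lp H 2 (radialMeasure n) :=
  LinearMap.mkContinuous
    { toFun := dilateFun hn lam hlam
      map_add' := dilateFun_add hn hlam
      map_smul' := dilateFun_smul hn hlam } _ fun f => (norm_dilateFun hn hlam f).le

theorem coeFn_dilateL2 (hn : 1 ≤ n) {lam : ℝ} (hlam : 0 < lam) (f : Lp H 2 (radialMeasure n)) :
    dilateL2 hn lam hlam f =ᵐ[radialMeasure n] f ∘ scaleIoi lam hlam := coeFn_dilateFun hn hlam f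

theorem spSize_one_dilateL2 (hn : 1 ≤ n) {lam : ℝ} (hlam : 0 < lam)
    (f : Lp H 2 (radialMeasure n)) :
    spSize 1 (dilateL2 hn lam hlam f) = ENNReal.ofReal (lam ^ n)⁻¹ * spSize 1 f := by
  rw [spSize_eq_eLpNorm one_pos, spSize_eq_eLpNorm one_pos, ENNReal.ofReal_one,
    eLpNorm_congr_ae (coeFn_dilateL2 hn hlam f),
    eLpNorm_comp_scaleIoi hn hlam _ (Lp.aestronglyMeasurable f)]
  simp

theorem eLpNorm_top_dilateL2 (hn : 1 ≤ n) {lam : ℝ} (hlam : 0 < lam)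
    (f : Lp H 2 (radialMeasure n)) :
    eLpNorm (dilateL2 hn lam hlam f) ∞ (radialMeasure n) = eLpNorm f ∞ (radialMeasure n) := by
  rw [eLpNorm_congr_ae (coeFn_dilateL2 hn hlam f),
    eLpNorm_comp_scaleIoi hn hlam _ (Lp.aestronglyMeasurable f)]
  simp

variable {ψ : Cutoff n} {Z : RangeSpaces n ψ H}

theorem RangeSpaces.toDist_isom_dilateL2 (hn : 1 ≤ n) {lam : ℝ} (hlam : 0 < lam)
    (f : Lp H 2 (radialMeasure n)) :
    toDist (Z.isom (dilateL2 hn lam hlam f)) = dilate lam hlam (toDist (Z.isom f)) := by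
  rw [Z.toDist_isom, Z.toDist_isom]
  refine Z.emb_dilate 2 lam hlam _ _ ?_
  rw [← map_smul]
  exact coeFn_dilateL2 hn hlam _

theorem dyadicBump_add (ψ : Cutoff n) (j m : ℤ) (ξ : Sp n) :
    dyadicBump ψ (j + m) ξ = dyadicBump ψ j ((dyadic m)⁻¹ • ξ) := by
  have h1 := (dyadic_pos j).ne'
  have h2 := (dyadic_pos m).ne'
  rw [dyadicBump, dyadicBump, smul_smul, dyadic_add]
  congr 2
  field_simp

theorem propagatorSymbol_smul (a t : ℝ) {lam : ℝ} (hlam : 0 < lam) (ξ : Sp n) :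
    propagatorSymbol n a t ξ = propagatorSymbol n a (lam ^ a * t) (lam⁻¹ • ξ) := by
  rw [propagatorSymbol, propagatorSymbol, norm_smul, norm_inv, Real.norm_of_nonneg hlam.le]
  congr 3
  rw [show 2 * Real.pi * (lam⁻¹ * ‖ξ‖) = lam⁻¹ * (2 * Real.pi * ‖ξ‖) by ring,
    Real.mul_rpow (x := lam⁻¹) (by positivity) (by positivity), Real.inv_rpow hlam.le]
  have := (Real.rpow_pos_of_pos hlam a).ne'
  field_simp

/-- The scaling law of the localized unitary group: dilating by `2ᵐ` shifts the frequency by `m`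
and speeds up time by the factor `2^(m a)`. -/
theorem AdmitsStrichartz.flow_dilateL2 [CompleteSpace H] {a σ' : ℝ} (hS : AdmitsStrichartz Z a σ')
    (hn : 1 ≤ n) (j m : ℤ) (t : ℝ) (f : Lp H 2 (radialMeasure n)) :
    Z.flow a (j + m) t (dilateL2 hn (dyadic m) (dyadic_pos m) f) =
      dilateL2 hn (dyadic m) (dyadic_pos m) (Z.flow a j (dyadic m ^ a * t) f) := by
  have hm := dyadic_pos m
  apply Z.isom.injective
  apply eq_of_fourier_ae_eq
  rw [hS.isom_flow]
  have e1 := coeFn_fourier_multiplier _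
    (flowSymbol_memLp (measurable_dyadicBump ψ (j + m)) (abs_dyadicBump_le ψ _) a t)
    (Z.isom (dilateL2 hn (dyadic m) (dyadic_pos m) f))
  have e2 := fourier_of_toDist_eq_dilate hm (Z.toDist_isom_dilateL2 hn hm f)
  have e3 := fourier_of_toDist_eq_dilate hm
    (Z.toDist_isom_dilateL2 hn hm (Z.flow a j (dyadic m ^ a * t) f))
  have e4 := coeFn_fourier_multiplier _
    (flowSymbol_memLp (measurable_dyadicBump ψ j) (abs_dyadicBump_le ψ _) a (dyadic m ^ a * t))
    (Z.isom f)
  rw [hS.isom_flow] at e3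
  have hq : Measure.QuasiMeasurePreserving (fun ξ : Sp n => (dyadic m)⁻¹ • ξ) volume volume := by
    refine ⟨by fun_prop, ?_⟩
    have := Measure.map_addHaar_smul (volume : Measure (Sp n)) (inv_ne_zero hm.ne')
    have h2 : (Measure.map (fun x : Sp n => (dyadic m)⁻¹ • x) volume) = _ := this
    rw [h2]
    exact Measure.smul_absolutelyContinuous
  filter_upwards [e1, e2, e3, hq.ae e4] with ξ e1 e2 e3 e4
  refine e1.trans ?_
  rw [e2, e3]
  have e4' : (𝓕 (locFlow ψ a j (dyadic m ^ a * t) (Z.isom f)) : L2 n) ((dyadic m)⁻¹ • ξ) = _ := e4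
  rw [e4', flowSymbol, flowSymbol, dyadicBump_add, propagatorSymbol_smul a t hm]
  ring

end Dilation

/-! ### The dispersive estimate at all time scales -/

section DispersiveScales

variable {n : ℕ} {ψ : Cutoff n} {H : Type*} [NormedAddCommGroup H] [InnerProductSpace ℂ H]
  [CompleteSpace H] {Z : RangeSpaces n ψ H} {a σ' : ℝ}

/-- In dimension `0` the decay parameter is at most `0`, against `1 ≤ σ`. -/
theorem AdmitsStrichartz.one_le_dim (hS : AdmitsStrichartz Z a σ') : 1 ≤ n := by
  have h := hS.1
  by_contra hn
  obtain rfl : n = 0 := by omega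
  unfold decayParameter at h
  split_ifs at h <;> norm_num at h

theorem AdmitsStrichartz.retarded_isom (hS : AdmitsStrichartz Z a σ') (j : ℤ)
    {F : ℝ → Lp H 2 (radialMeasure n)} (hF : Integrable F) (t : ℝ) :
    retarded (locFlow ψ a j) (fun τ => Z.isom (F τ)) t = Z.isom (retarded (Z.flow a j) F t) := by
  unfold retarded
  have h := Z.isom.toContinuousLinearMap.integral_comp_comm
    (((Z.isFlow_flow a j).integrable (τ := fun τ => t - τ) (by fun_prop) hF).integrableOn
      (s := Set.Iic t))
  refine Eq.trans ?_ h
  congr 1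
  ext1 τ
  exact (hS.isom_flow j _ _).symm

theorem AdmitsStrichartz.freqLoc_duhamel_isom (hS : AdmitsStrichartz Z a σ') (j : ℤ)
    {F : ℝ → Lp H 2 (radialMeasure n)} (hF : Integrable F) (t : ℝ) :
    freqLoc ψ (dyadic j) (toDist (duhamel a (fun τ => Z.isom (F τ)) t)) =
      toDist (Z.isom (retarded (Z.flow a j) F t)) := by
  have h : Integrable fun τ => Z.isom (F τ) := Z.isom.toContinuousLinearMap.integrable_comp hF
  rw [freqLoc_duhamel ψ a j h, hS.retarded_isom j hF]

theorem RangeSpaces.ofReal_normFactor_inv_ne_zero : ENNReal.ofReal Z.normFactor⁻¹ ≠ 0 := by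
  rw [ne_eq, ENNReal.ofReal_eq_zero, not_le]
  exact inv_pos.2 Z.normFactor_pos

/-- The dispersive estimate on the model of `Z_2`, for intervals of unit length at any position. -/
theorem AdmitsDispersive.exists_retarded_le (hD : AdmitsDispersive Z a)
    (hS : AdmitsStrichartz Z a σ') {κ : ℝ} (hκ : 1 ≤ κ) : ∃ C : ℝ≥0, ∀ b c : ℝ,
      κ⁻¹ ≤ |b - c| - 1 → |b - c| - 1 ≤ κ → ∀ (j : ℤ) (F : ℝ → Lp H 2 (radialMeasure n)),
      Integrable F → (∀ t ∉ Set.Icc b (b + 1), F t = 0) →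
      ∀ᵐ t, t ∈ Set.Icc c (c + 1) →
        eLpNorm (retarded (Z.flow a j) F t) ∞ (radialMeasure n) ≤
          C * 2 ^ (j * (n - a * decayParameter a n)) * ∫⁻ t, spSize 1 (F t) := by
  obtain ⟨C, hC⟩ := hD κ hκ
  refine ⟨C, fun b c h1 h2 j F hF hF0 => ?_⟩
  have h3 := hC b c h1 h2 j (fun t => Z.isom (F t))
    ⟨Z.isom.toContinuousLinearMap.integrable_comp hF,
      Filter.Eventually.of_forall fun t => (Z.memTwo_iff _).2 ⟨F t, rfl⟩⟩
    fun t ht => by rw [hF0 t ht, map_zero]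
  set K := ENNReal.ofReal Z.normFactor⁻¹ with hK
  have hK0 : K ≠ 0 := Z.ofReal_normFactor_inv_ne_zero
  have hKt : K ≠ ∞ := ENNReal.ofReal_ne_top
  have h4 : ∀ t, Z.zNorm 1 (toDist (Z.isom (F t))) = K * spSize 1 (F t) := by
    intro t
    rw [Z.zNorm_isom, spSize_eq_eLpNorm one_pos, ENNReal.ofReal_one]
  simp_rw [hS.freqLoc_duhamel_isom j hF, Z.zNorm_isom ∞, h4] at h3
  rw [← hK, eLpNorm_const_mul_ennreal hKt, eLpNorm_const_mul_ennreal hKt, ofReal_dyadic_rpow,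
    eLpNorm_one_eq_lintegral_enorm, eLpNorm_exponent_top] at h3
  simp only [enorm_eq_self] at h3
  have h5 : eLpNormEssSup (fun t => eLpNorm (retarded (Z.flow a j) F t) ∞ (radialMeasure n))
      (volume.restrict (Set.Icc c (c + 1))) ≤
      C * 2 ^ (j * (n - a * decayParameter a n)) * ∫⁻ t, spSize 1 (F t) := by
    rw [← ENNReal.mul_le_mul_iff_right hK0 hKt]
    refine h3.trans ?_
    rw [mul_left_comm]
    gcongr
    exact Measure.restrict_le_self
  rw [← ae_restrict_iff' measurableSet_Icc]
  filter_upwards [ae_le_eLpNormEssSup (μ := volume.restrict (Set.Icc c (c + 1)))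
    (f := fun t => eLpNorm (retarded (Z.flow a j) F t) ∞ (radialMeasure n))] with t ht
  simp only [enorm_eq_self] at ht
  exact ht.trans h5

/-- The retarded integral of a dilated source. -/
theorem AdmitsStrichartz.retarded_dilateL2 (hS : AdmitsStrichartz Z a σ') (hn : 1 ≤ n) (j m : ℤ)
    {F : ℝ → Lp H 2 (radialMeasure n)} (hF : Integrable F) {I : Set ℝ} (hI : MeasurableSet I)
    {t : ℝ} (ht : ∀ τ ∈ I, τ ≤ dyadic m ^ a * t) :
    retarded (Z.flow a (j + m)) (fun τ => dilateL2 hn (dyadic m) (dyadic_pos m)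
      (I.indicator F (dyadic m ^ a * τ))) t = ((dyadic m ^ a)⁻¹ : ℝ) •
        dilateL2 hn (dyadic m) (dyadic_pos m)
          (∫ τ in I, Z.flow a j (dyadic m ^ a * t - τ) (F τ)) := by
  set L := dyadic m ^ a with hL
  have hL0 : 0 < L := Real.rpow_pos_of_pos (dyadic_pos m) a
  set D : Lp H 2 (radialMeasure n) →L[ℂ] Lp H 2 (radialMeasure n) :=
    dilateL2 hn (dyadic m) (dyadic_pos m) with hDdef
  set h : ℝ → Lp H 2 (radialMeasure n) := fun τ => Z.flow a j (L * t - τ) (I.indicator F τ)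
  have hi : Integrable h :=
    (Z.isFlow_flow a j).integrable (τ := fun τ => L * t - τ) (by fun_prop) (hF.indicator hI)
  have e1 : ∀ τ, Z.flow a (j + m) (t - τ) (D (I.indicator F (L * τ))) = D (h (L * τ)) := by
    intro τ
    rw [hS.flow_dilateL2 hn, ← hL, mul_sub]
  have e2 : ∫ τ in Set.Iic t, D (h (L * τ)) = ∫ τ, D (h (L * τ)) := by
    refine setIntegral_eq_integral_of_forall_compl_eq_zero fun τ hτ => ?_
    have hτ' : L * τ ∉ I := by
      intro hmem
      have := le_of_mul_le_mul_left (ht _ hmem) hL0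
      exact hτ this
    simp only [h]
    rw [Set.indicator_of_notMem hτ', map_zero, map_zero]
  have e3 : ∫ τ, D (h (L * τ)) = D (∫ τ, h (L * τ)) :=
    D.integral_comp_comm (hi.comp_mul_left' hL0.ne')
  have e4 : ∫ τ, h τ = ∫ τ in I, Z.flow a j (L * t - τ) (F τ) := by
    rw [← integral_indicator hI]
    congr 1
    ext1 τ
    by_cases hτ : τ ∈ I
    · simp only [h, Set.indicator_of_mem hτ]
    · simp only [h, Set.indicator_of_notMem hτ, map_zero]
  unfold retarded
  simp_rw [e1]
  rw [e2, e3, Measure.integral_comp_mul_left, e4, abs_of_pos (inv_pos.2 hL0)]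
  exact D.map_smul_of_tower _ _

theorem lintegral_comp_mul_left' {L : ℝ} (hL : 0 < L) (f : ℝ → ℝ≥0∞) :
    ∫⁻ t, f (L * t) = ENNReal.ofReal L⁻¹ * ∫⁻ t, f t := by
  have h := (Homeomorph.mulLeft₀ L hL.ne').measurableEmbedding.lintegral_map (μ := volume) f
  have h2 : Measure.map (Homeomorph.mulLeft₀ L hL.ne') volume =
    ENNReal.ofReal |L⁻¹| • (volume : Measure ℝ) := Real.map_volume_mul_left hL.ne'
  rw [h2, lintegral_smul_measure, abs_of_pos (inv_pos.2 hL), smul_eq_mul] at h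
  exact h.symm

/-- The dispersive estimate on dyadic intervals of length `2ᵏ` at distance comparable to `2ᵏ`,
obtained from intervals of unit length by scaling. -/
theorem AdmitsDispersive.exists_dyadic_le (hD : AdmitsDispersive Z a)
    (hS : AdmitsStrichartz Z a σ') (ha : 1 ≤ a) : ∃ C : ℝ≥0, ∀ (j k i d : ℤ), 2 ≤ d → d ≤ 3 →
      ∀ F : ℝ → Lp H 2 (radialMeasure n), Integrable F → ∀ᵐ t, t ∈ dyInt k (i + d) →
        eLpNorm (∫ τ in dyInt k i, Z.flow a j (t - τ) (F τ) : Lp H 2 (radialMeasure n)) ∞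
            (radialMeasure n) ≤
          C * 2 ^ (j * (n - a * decayParameter a n) - k * decayParameter a n) *
            ∫⁻ t in dyInt k i, spSize 1 (F t) := by
  have hn := hS.one_le_dim
  have ha0 : 0 < a := by linarith
  have hκ : (2 : ℝ) ≤ 2 ^ a := by
    calc (2 : ℝ) = 2 ^ (1 : ℝ) := (Real.rpow_one 2).symm
      _ ≤ _ := Real.rpow_le_rpow_of_exponent_le (by norm_num) ha
  obtain ⟨C, hC⟩ := hD.exists_retarded_le hS (κ := 2 ^ a) (by linarith)
  refine ⟨C, fun j k i d hd2 hd3 F hF => ?_⟩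
  -- the dilation factor `2ᵐ` for which `2ᵏ ≤ 2^(m a) < 2^(k + a)`
  set m : ℤ := ⌈(k : ℝ) / a⌉ with hm
  have hm1 : (k : ℝ) ≤ m * a := by
    have := Int.le_ceil ((k : ℝ) / a)
    rwa [div_le_iff₀ ha0] at this
  have hm2 : (m : ℝ) * a ≤ k + a := by
    have := (Int.ceil_lt_add_one ((k : ℝ) / a)).le
    calc (m : ℝ) * a ≤ ((k : ℝ) / a + 1) * a := by gcongr
      _ = _ := by field_simp
  set L := dyadic m ^ a with hL
  have hLe : L = 2 ^ (m * a) := by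
    rw [hL, dyadic, ← Real.rpow_intCast, ← Real.rpow_mul (by norm_num)]
  have hL0 : 0 < L := Real.rpow_pos_of_pos (dyadic_pos m) a
  set ℓ := (2 : ℝ) ^ k / L with hℓ
  have hℓe : ℓ = 2 ^ ((k : ℝ) - m * a) := by
    rw [hℓ, hLe, ← Real.rpow_intCast, Real.rpow_sub (by norm_num)]
  have hℓ0 : 0 < ℓ := by rw [hℓe]; positivity
  have hℓ1 : ℓ ≤ 1 := by
    rw [hℓe]
    exact Real.rpow_le_one_of_one_le_of_nonpos (by norm_num) (by linarith)
  have hℓ2 : ((2 : ℝ) ^ a)⁻¹ ≤ ℓ := by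
    rw [hℓe, ← Real.rpow_neg (by norm_num)]
    exact Real.rpow_le_rpow_of_exponent_le (by norm_num) (by linarith)
  have h2k : (2 : ℝ) ^ k = L * ℓ := by rw [hℓ]; field_simp
  have hd2' : (2 : ℝ) ≤ d := by exact_mod_cast hd2
  have hd3' : (d : ℝ) ≤ 3 := by exact_mod_cast hd3
  set b := i * ℓ + ℓ - 1 with hb
  set c := (i + d) * ℓ with hc
  have hbc : |b - c| - 1 = (d - 1) * ℓ := by
    have : b - c = -((d - 1) * ℓ + 1) := by rw [hb, hc]; ring
    rw [this, abs_neg, abs_of_nonneg (by nlinarith)]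
    ring
  have hDint : ∀ τ : ℝ, L * τ ∈ dyInt k i → τ ∈ Set.Icc b (b + 1) := by
    rintro τ ⟨h1, h2⟩
    rw [h2k] at h1 h2
    have h1' : i * ℓ ≤ τ := le_of_mul_le_mul_left (by linarith) hL0
    have h2' : τ < (i + 1) * ℓ := lt_of_mul_lt_mul_left (by linarith) hL0.le
    constructor
    · rw [hb]; linarith
    · rw [hb]; linarith
  set D : Lp H 2 (radialMeasure n) →L[ℂ] Lp H 2 (radialMeasure n) :=
    dilateL2 hn (dyadic m) (dyadic_pos m) with hDdef
  have hI := measurableSet_dyInt k i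
  set F' : ℝ → Lp H 2 (radialMeasure n) := fun τ => D ((dyInt k i).indicator F (L * τ)) with hF'
  have hF'i : Integrable F' := D.integrable_comp ((hF.indicator hI).comp_mul_left' hL0.ne')
  have hmain := hC b c (by rw [hbc]; nlinarith) (by rw [hbc]; nlinarith) (j + m) F' hF'i
    (fun t ht => by
      simp only [hF']
      rw [Set.indicator_of_notMem (fun h => ht (hDint t h)), map_zero])
  have hq : Measure.QuasiMeasurePreserving (fun t : ℝ => L⁻¹ * t) volume volume := by
    refine ⟨by fun_prop, ?_⟩
    rw [Real.map_volume_mul_left (inv_ne_zero hL0.ne')]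
    exact Measure.smul_absolutelyContinuous
  have hint : ∫⁻ t, spSize 1 (F' t) = ENNReal.ofReal (dyadic m ^ n)⁻¹ * (ENNReal.ofReal L⁻¹ *
      ∫⁻ t in dyInt k i, spSize 1 (F t)) := by
    simp only [hF', hDdef, spSize_one_dilateL2]
    rw [lintegral_const_mul' _ _ ENNReal.ofReal_ne_top,
      lintegral_comp_mul_left' hL0 fun t => spSize 1 ((dyInt k i).indicator F t),
      ← lintegral_indicator hI]
    congr 3
    ext1 t
    by_cases ht : t ∈ dyInt k i
    · simp only [Set.indicator_of_mem ht]
    · simp only [Set.indicator_of_notMem ht]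
      exact spSize_zero one_pos
  filter_upwards [hq.ae hmain] with t ht htJ
  have htL : L * (L⁻¹ * t) = t := mul_inv_cancel_left₀ hL0.ne' t
  have htc : L⁻¹ * t ∈ Set.Icc c (c + 1) := by
    obtain ⟨h1, h2⟩ := htJ
    rw [h2k, ← htL] at h1 h2
    push_cast at h1 h2
    have h1' : (i + d) * ℓ ≤ L⁻¹ * t := le_of_mul_le_mul_left (by linarith) hL0
    have h2' : L⁻¹ * t < (i + d + 1) * ℓ := lt_of_mul_lt_mul_left (by linarith) hL0.le
    constructor
    · rw [hc]; exact h1'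
    · rw [hc]; linarith
  have h1 := ht htc
  rw [hint] at h1
  have hle : ∀ τ ∈ dyInt k i, τ ≤ dyadic m ^ a * (L⁻¹ * t) := by
    rintro τ ⟨-, hτ⟩
    rw [← hL, htL]
    refine hτ.le.trans (le_trans ?_ htJ.1)
    have : (0 : ℝ) < 2 ^ k := by positivity
    push_cast
    nlinarith
  have h2 := hS.retarded_dilateL2 hn j m hF hI hle
  rw [← hL, htL] at h2
  simp only [hF', hDdef] at h1
  rw [h2] at h1
  set v : Lp H 2 (radialMeasure n) := ∫ τ in dyInt k i, Z.flow a j (t - τ) (F τ)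
  have h3 : eLpNorm (L⁻¹ • dilateL2 hn (dyadic m) (dyadic_pos m) v : Lp H 2 (radialMeasure n)) ∞
      (radialMeasure n) = ENNReal.ofReal L⁻¹ * eLpNorm v ∞ (radialMeasure n) := by
    rw [eLpNorm_congr_ae (Lp.coeFn_smul _ _), eLpNorm_const_smul, eLpNorm_top_dilateL2,
      Real.enorm_of_nonneg (inv_pos.2 hL0).le]
  rw [h3] at h1
  have hLi0 : ENNReal.ofReal L⁻¹ ≠ 0 := by
    rw [ne_eq, ENNReal.ofReal_eq_zero, not_le]; exact inv_pos.2 hL0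
  rw [← ENNReal.mul_le_mul_iff_right hLi0 ENNReal.ofReal_ne_top]
  refine h1.trans ?_
  have h4 : ENNReal.ofReal (dyadic m ^ n)⁻¹ = 2 ^ (-(m * n) : ℝ) := by
    rw [two_rpow_eq_ofReal, dyadic, Real.rpow_neg (by norm_num), ← Real.rpow_intCast,
      ← Real.rpow_natCast, ← Real.rpow_mul (by norm_num)]
  have h5 : (2 : ℝ≥0∞) ^ (((j + m : ℤ) : ℝ) * (n - a * decayParameter a n)) * 2 ^ (-(m * n) : ℝ) ≤
      2 ^ (j * (n - a * decayParameter a n) - k * decayParameter a n) := by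
    rw [← two_rpow_add]
    refine ENNReal.rpow_le_rpow_of_exponent_le (by norm_num) ?_
    push_cast
    have hσ : 0 ≤ decayParameter a n := by linarith [hS.1]
    nlinarith
  rw [h4]
  calc _ = C * (2 ^ (((j + m : ℤ) : ℝ) * (n - a * decayParameter a n)) * 2 ^ (-(m * n) : ℝ)) *
        (ENNReal.ofReal L⁻¹ * ∫⁻ t in dyInt k i, spSize 1 (F t)) := by ring
    _ ≤ C * 2 ^ (j * (n - a * decayParameter a n) - k * decayParameter a n) *
        (ENNReal.ofReal L⁻¹ * ∫⁻ t in dyInt k i, spSize 1 (F t)) := by gcongr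
    _ = _ := by ring

/-- The dispersive estimate for the form on the boxes of the Whitney decomposition. -/
theorem AdmitsDispersive.exists_flowForm_le (hD : AdmitsDispersive Z a)
    (hS : AdmitsStrichartz Z a σ') (ha : 1 ≤ a) :
    ∃ C : ℝ≥0, ∀ (j k m : ℤ) (b : Bool) (F G : StepFn (radialMeasure n) H),
      ‖flowForm (Z.flow a j) (whitneyBox (k, m, b)) F.val G.val‖ₑ ≤
        C * 2 ^ (j * (n - a * decayParameter a n) - k * decayParameter a n) *
          (lpSize 1 (volume.restrict (dyInt k (whitneyPast m b))) (fun t => spSize 1 (F.val t)) *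
            lpSize 1 (volume.restrict (dyInt k (whitneyFuture m b)))
              fun t => spSize 1 (G.val t)) := by
  obtain ⟨C, hC⟩ := hD.exists_dyadic_le hS ha
  refine ⟨C, fun j k m b F G => ?_⟩
  obtain ⟨d, hd2, hd3, hd⟩ : ∃ d : ℤ, 2 ≤ d ∧ d ≤ 3 ∧ whitneyFuture m b = whitneyPast m b + d := by
    cases b
    · exact ⟨2, le_rfl, by norm_num, by simp [whitneyFuture, whitneyPast]⟩
    · exact ⟨3, by norm_num, le_rfl, by simp [whitneyFuture, whitneyPast]⟩
  set i := whitneyPast m b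
  have hI := measurableSet_dyInt k i
  have hJ := measurableSet_dyInt k (i + d)
  have hFl := Z.isFlow_flow a j
  have h1 := hC j k i d hd2 hd3 F.val F.integrable_val
  have h2 : flowForm (Z.flow a j) (whitneyBox (k, m, b)) F.val G.val =
      ∫ t in dyInt k (i + d), inner ℂ (G.val t)
        (∫ τ in dyInt k i, Z.flow a j (t - τ) (F.val τ)) := by
    have hint := (hFl.integrable_inner F.integrable_val G.integrable_val).integrableOn
      (s := dyInt k i ×ˢ dyInt k (i + d))
    rw [flowForm, whitneyBox, hd]
    rw [IntegrableOn, Measure.volume_eq_prod, ← Measure.prod_restrict] at hint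
    rw [Measure.volume_eq_prod, ← Measure.prod_restrict, integral_prod_symm _ hint]
    congr 1
    ext1 t
    have hi : Integrable (fun τ => Z.flow a j (t - τ) (F.val τ))
        (volume.restrict (dyInt k i)) :=
      (hFl.integrable (τ := fun τ => t - τ) (by fun_prop) F.integrable_val).integrableOn
    exact integral_inner hi (G.val t)
  have hl : ∀ (ν : Measure ℝ) (f : ℝ → ℝ≥0∞), lpSize 1 ν f = ∫⁻ t, f t ∂ν := by
    intro ν f
    simp [lpSize]
  rw [h2, hd, hl, hl]
  set B := C * 2 ^ (j * (n - a * decayParameter a n) - k * decayParameter a n) *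
    ∫⁻ t in dyInt k i, spSize 1 (F.val t) with hB
  calc _ ≤ ∫⁻ t in dyInt k (i + d), ‖inner ℂ (G.val t)
        (∫ τ in dyInt k i, Z.flow a j (t - τ) (F.val τ))‖ₑ := enorm_integral_le_lintegral_enorm _
    _ ≤ ∫⁻ t in dyInt k (i + d), spSize 1 (G.val t) * B := by
        refine setLIntegral_mono_ae' hJ ?_
        filter_upwards [h1] with t ht htJ
        refine (enorm_inner_le_spSize_one _ _).trans ?_
        exact mul_le_mul_right (ht htJ) _
    _ = (∫⁻ t in dyInt k (i + d), spSize 1 (G.val t)) * B :=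
        lintegral_mul_const _ (G.measurable_spSize_val 1)
    _ = _ := by rw [hB]; ring

/-- The localized unitary groups on `Z_2` satisfy the hypotheses of the abstract estimates. -/
theorem AdmitsDispersive.isDispersive (hD : AdmitsDispersive Z a) (hS : AdmitsStrichartz Z a σ')
    (ha : 1 ≤ a) : IsDispersive (Z.flow a) n a (decayParameter a n) σ' where
  isFlow := Z.isFlow_flow a
  factor := hS.flow_factor
  strichartz := fun _ _ _ hp hτ hω hω2 => hS.exists_flow_le hp hτ hω hω2
  dispersive := hD.exists_flowForm_le hS ha

end DispersiveScales

/-! ### Summation over the frequencies -/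

/-- The weighted `ℓ²` norm `(∑ i, (w i * a i) ^ 2) ^ (1 / 2)`. -/
def sqSum {ι : Type*} (w a : ι → ℝ≥0∞) : ℝ≥0∞ := (∑' i, (w i * a i) ^ 2) ^ (1 / 2 : ℝ)

section SqSum

variable {ι : Type*}

theorem sqComb_singleton (i : ι) (w a : ι → ℝ≥0∞) : sqComb {i} w a = w i * a i := by
  rw [sqComb, Finset.sum_singleton, ← ENNReal.rpow_two, ← ENNReal.rpow_mul,
    mul_one_div_cancel two_ne_zero, ENNReal.rpow_one]

theorem sqComb_le_sqSum (T : Finset ι) (w a : ι → ℝ≥0∞) : sqComb T w a ≤ sqSum w a :=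
  ENNReal.rpow_le_rpow (ENNReal.sum_le_tsum T) (by norm_num)

theorem sqSum_le_of_forall {w a : ι → ℝ≥0∞} {B : ℝ≥0∞} (h : ∀ T, sqComb T w a ≤ B) :
    sqSum w a ≤ B := by
  have h2 : ∀ T : Finset ι, ∑ i ∈ T, (w i * a i) ^ 2 ≤ B ^ (2 : ℝ) := by
    intro T
    have := ENNReal.rpow_le_rpow (h T) (by norm_num : (0 : ℝ) ≤ 2)
    rwa [sqComb, ← ENNReal.rpow_mul, one_div_mul_cancel two_ne_zero, ENNReal.rpow_one] at this
  have h3 : ∑' i, (w i * a i) ^ 2 ≤ B ^ (2 : ℝ) := by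
    rw [ENNReal.tsum_eq_iSup_sum]
    exact iSup_le h2
  refine (ENNReal.rpow_le_rpow h3 (by norm_num : (0 : ℝ) ≤ 1 / 2)).trans (le_of_eq ?_)
  rw [← ENNReal.rpow_mul, mul_one_div_cancel two_ne_zero, ENNReal.rpow_one]

theorem sqSum_mono (w : ι → ℝ≥0∞) {a b : ι → ℝ≥0∞} (h : ∀ i, a i ≤ b i) :
    sqSum w a ≤ sqSum w b :=
  sqSum_le_of_forall fun T => (sqComb_mono T w fun i _ => h i).trans (sqComb_le_sqSum T w b)

theorem sqSum_add_le (w a b : ι → ℝ≥0∞) :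
    sqSum w (fun i => a i + b i) ≤ sqSum w a + sqSum w b :=
  sqSum_le_of_forall fun T => (sqComb_add_le T w a b).trans
    (add_le_add (sqComb_le_sqSum T w a) (sqComb_le_sqSum T w b))

theorem sqSum_const_mul (c : ℝ≥0∞) (w a : ι → ℝ≥0∞) :
    sqSum w (fun i => c * a i) = c * sqSum w a := by
  unfold sqSum
  have h : ∀ i, (w i * (c * a i)) ^ 2 = c ^ 2 * (w i * a i) ^ 2 := fun i => by ring
  simp_rw [h]
  rw [ENNReal.tsum_mul_left, ENNReal.mul_rpow_of_nonneg _ _ (by norm_num), ← ENNReal.rpow_two,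
    ← ENNReal.rpow_mul, mul_one_div_cancel two_ne_zero, ENNReal.rpow_one]

theorem sqSum_shift (s : ℝ) (i : ℤ) (b : ℤ → ℝ≥0∞) :
    sqSum (fun j : ℤ => (2 : ℝ≥0∞) ^ (-(j * s))) (fun j => b (j + i)) =
      2 ^ (i * s) * sqSum (fun j : ℤ => (2 : ℝ≥0∞) ^ (-(j * s))) b := by
  rw [← sqSum_const_mul]
  unfold sqSum
  rw [← (Equiv.addRight i).tsum_eq fun j : ℤ => ((2 : ℝ≥0∞) ^ (-(j * s)) * (2 ^ (i * s) * b j)) ^ 2]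
  congr 1
  refine tsum_congr fun j => ?_
  rw [Equiv.coe_addRight, ← mul_assoc, ← two_rpow_add]
  congr 3
  push_cast
  ring_nf

/-- Neighboring frequencies are controlled in a weighted `ℓ²` norm. -/
theorem sqSum_neighbors_le (s : ℝ) (b : ℤ → ℝ≥0∞) :
    sqSum (fun j : ℤ => (2 : ℝ≥0∞) ^ (-(j * s))) (fun j => b (j - 1) + b j + b (j + 1)) ≤
      (2 ^ (-s) + 1 + 2 ^ s) * sqSum (fun j : ℤ => (2 : ℝ≥0∞) ^ (-(j * s))) b := by
  refine (sqSum_add_le _ _ _).trans ?_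
  refine (add_le_add_left (sqSum_add_le _ _ _) _).trans (le_of_eq ?_)
  have h1 := sqSum_shift s (-1) b
  have h2 := sqSum_shift s 1 b
  simp only [← sub_eq_add_neg, Int.cast_neg, Int.cast_one, neg_mul, one_mul] at h1 h2
  rw [h1, h2]
  ring

theorem lpSize_sqSum_le {Ω : Type*} [MeasurableSpace Ω] {ν : Measure Ω} {q : ℝ} (hq : 0 < q)
    {w : ℤ → ℝ≥0∞} {f : ℤ → Ω → ℝ≥0∞} (hf : ∀ j, Measurable (f j)) {B : ℝ≥0∞}
    (h : ∀ T, lpSize q ν (fun t => sqComb T w fun j => f j t) ≤ B) :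
    lpSize q ν (fun t => sqSum w fun j => f j t) ≤ B := by
  set T : ℕ → Finset ℤ := fun k => Finset.Icc (-(k : ℤ)) k
  have hT : Filter.Tendsto T Filter.atTop Filter.atTop := Finset.tendsto_Icc_neg
  have hTm : Monotone T := fun k l hkl => Finset.Icc_subset_Icc (by omega) (by omega)
  have h1 : ∀ t, Filter.Tendsto (fun k => (sqComb (T k) w fun j => f j t) ^ q) Filter.atTop
      (nhds ((sqSum w fun j => f j t) ^ q)) := by
    intro t
    refine (ENNReal.continuous_rpow_const.tendsto _).comp
      ((ENNReal.continuous_rpow_const.tendsto _).comp ?_)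
    exact (ENNReal.summable.hasSum).comp hT
  have h2 := lintegral_tendsto_of_tendsto_of_monotone (μ := ν)
    (fun k => ((measurable_sqComb (T k) w hf).pow_const q).aemeasurable)
    (Filter.Eventually.of_forall fun t k l hkl => ENNReal.rpow_le_rpow
      (ENNReal.rpow_le_rpow (Finset.sum_le_sum_of_subset (hTm hkl)) (by norm_num)) hq.le)
    (Filter.Eventually.of_forall h1)
  refine le_of_tendsto' ((ENNReal.continuous_rpow_const (y := 1 / q)).continuousAt.tendsto.comp h2)
    fun k => ?_
  exact h (T k)

end SqSum

section Assembly

variable {X : Type*} [MeasurableSpace X] {μ : Measure X} [SigmaFinite μ]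
  {H : Type*} [NormedAddCommGroup H] [InnerProductSpace ℂ H] [CompleteSpace H]
  [TopologicalSpace.SeparableSpace (Lp H 2 μ)]
  {S : ℤ → ℝ → Lp H 2 μ →L[ℂ] Lp H 2 μ} {n a σ σ' : ℝ}

/-- The source may be replaced by its localization to the frequency and its neighbors. -/
theorem IsDispersive.retarded_eq (hS : IsDispersive S n a σ σ') (j : ℤ) (f : ℝ → Lp H 2 μ) :
    retarded (S j) f = retarded (S j)
      fun τ => S (j - 1) 0 (f τ) + S j 0 (f τ) + S (j + 1) 0 (f τ) := by
  ext1 t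
  unfold retarded
  congr 1
  ext1 τ
  have h := hS.factor j (t - τ) 0 (f τ)
  rw [sub_zero, neg_zero, add_apply, add_apply] at h
  exact h

theorem measurable_spSize_comp {y : ℝ} (hy : 0 < y) {F : ℝ → Lp H 2 μ}
    (hF : StronglyMeasurable F) : Measurable fun t => spSize y (F t) := by
  let _ : MeasurableSpace (Lp H 2 μ) := borel _
  have : BorelSpace (Lp H 2 μ) := ⟨rfl⟩
  exact (measurable_spSize hy).comp hF.measurable

theorem IsFlow.stronglyMeasurable_apply {S : ℝ → Lp H 2 μ →L[ℂ] Lp H 2 μ} (t : ℝ)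
    {f : ℝ → Lp H 2 μ} (hf : StronglyMeasurable f) : StronglyMeasurable fun τ => S t (f τ) :=
  (S t).continuous.comp_stronglyMeasurable hf

/-- The bound on step functions, for finitely many frequencies, as an estimate of the retarded
integral in terms of the localized source. -/
theorem IsDispersive.retarded_step (hS : IsDispersive S n a σ σ') {x y p q p' q' s : ℝ}
    (hx : 1 ≤ x) (hy : 1 ≤ y) (hy2 : y ≤ 2) (hp : 2 < p) (hpp : p.HolderConjugate p')
    (hqq : q.HolderConjugate q') {C : ℝ≥0} {T : Finset ℤ}
    (hstep : ∀ F G : ℤ → StepFn μ H,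
      ‖∑ j ∈ T, flowForm (S j) {z | z.1 < z.2} (F j).val (G j).val‖ₑ ≤
        C * ((lpSize x volume fun t => sqComb T (fun j => 2 ^ (-(j * s)))
            fun j => spSize y ((F j).val t)) *
          lpSize q' volume fun t => sqComb T (fun j => 2 ^ (-(j * s)))
            fun j => spSize p' ((G j).val t)))
    {f : ℝ → Lp H 2 μ} (hf : Integrable f) (hfm : StronglyMeasurable f) :
    (lpSize q volume fun t => sqComb T (fun j => 2 ^ (j * s))
        fun j => spSize p (retarded (S j) f t)) ≤
      (C + 1) * lpSize x volume fun t => sqComb T (fun j => 2 ^ (-(j * s)))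
        fun j => spSize y (S (j - 1) 0 (f t) + S j 0 (f t) + S (j + 1) 0 (f t)) := by
  have hinv : (fun j : ℤ => ((2 : ℝ≥0∞) ^ (j * s))⁻¹) = fun j : ℤ => (2 : ℝ≥0∞) ^ (-(j * s)) := by
    ext1 j
    rw [ENNReal.rpow_neg]
  set g : ℤ → ℝ → Lp H 2 μ := fun j τ => S (j - 1) 0 (f τ) + S j 0 (f τ) + S (j + 1) 0 (f τ)
  have hg : ∀ j, Integrable (g j) := fun j =>
    (((S (j - 1) 0).integrable_comp hf).add ((S j 0).integrable_comp hf)).add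
      ((S (j + 1) 0).integrable_comp hf)
  have hgm : ∀ j, StronglyMeasurable (g j) := fun j =>
    ((IsFlow.stronglyMeasurable_apply 0 hfm).add (IsFlow.stronglyMeasurable_apply 0 hfm)).add
      (IsFlow.stronglyMeasurable_apply 0 hfm)
  have h := lpSize_retarded_le_of_stepFn T hS.isFlow (w := fun j : ℤ => 2 ^ (j * s))
    (fun j => two_rpow_ne_zero _) (fun j => two_rpow_ne_top _) hx hy hy2 hp hpp hqq
    (K := C + 1) (by finiteness) (by simp) (fun F G => by
      rw [hinv]
      refine (hstep F G).trans ?_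
      gcongr
      exact le_self_add) hg hgm
  rw [hinv] at h
  refine le_trans (le_of_eq ?_) h
  congr 1
  ext1 t
  congr 1
  ext1 j
  rw [hS.retarded_eq j f]

/-- The estimate in `L_t^q` of the `ℓ²` combination over all frequencies. -/
theorem IsDispersive.lpSize_sqSum_retarded_le (hS : IsDispersive S n a σ σ') {x y p q p' q' s : ℝ}
    (hx : 1 ≤ x) (hy : 1 ≤ y) (hy2 : y ≤ 2) (hp : 2 < p) (hpp : p.HolderConjugate p')
    (hqq : q.HolderConjugate q') {C : ℝ≥0}
    (hstep : ∀ (T : Finset ℤ) (F G : ℤ → StepFn μ H),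
      ‖∑ j ∈ T, flowForm (S j) {z | z.1 < z.2} (F j).val (G j).val‖ₑ ≤
        C * ((lpSize x volume fun t => sqComb T (fun j => 2 ^ (-(j * s)))
            fun j => spSize y ((F j).val t)) *
          lpSize q' volume fun t => sqComb T (fun j => 2 ^ (-(j * s)))
            fun j => spSize p' ((G j).val t)))
    {f : ℝ → Lp H 2 μ} (hf : Integrable f) (hfm : StronglyMeasurable f) :
    (lpSize q volume fun t => sqSum (fun j : ℤ => 2 ^ (j * s))
        fun j => spSize p (retarded (S j) f t)) ≤
      (C + 1) * (2 ^ (-s) + 1 + 2 ^ s) * lpSize x volume fun t =>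
        sqSum (fun j : ℤ => 2 ^ (-(j * s))) fun j => spSize y (S j 0 (f t)) := by
  have hm : ∀ j, Measurable fun t => spSize p (retarded (S j) f t) := fun j =>
    measurable_spSize_comp (by linarith) ((hS.isFlow j).stronglyMeasurable_retarded hfm)
  refine lpSize_sqSum_le hqq.pos hm fun T => ?_
  refine (hS.retarded_step hx hy hy2 hp hpp hqq (hstep T) hf hfm).trans ?_
  have hx0 : 0 < x := by linarith
  have hc : (2 : ℝ≥0∞) ^ (-s) + 1 + 2 ^ s ≠ ∞ := by
    have h1 := two_rpow_ne_top (-s)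
    have h2 := two_rpow_ne_top s
    finiteness
  rw [mul_assoc, ← lpSize_const_mul hx0 hc]
  gcongr
  refine lpSize_mono hx0 _ fun t => ?_
  refine (sqComb_le_sqSum T _ _).trans (le_trans (sqSum_mono _ fun j => ?_)
    (sqSum_neighbors_le s fun j => spSize y (S j 0 (f t))))
  exact (spSize_add_le hy _ _).trans (add_le_add_left (spSize_add_le hy _ _) _)

/-- The estimate of the `ℓ²` combination over all frequencies of the `L_t^q` norms. It only needs
the estimate for single frequencies. -/
theorem IsDispersive.sqSum_lpSize_retarded_le (hS : IsDispersive S n a σ σ') {x y p q p' q' s : ℝ}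
    (hx : 1 ≤ x) (hy : 1 ≤ y) (hy2 : y ≤ 2) (hp : 2 < p) (hpp : p.HolderConjugate p')
    (hqq : q.HolderConjugate q') {C : ℝ≥0}
    (hstep : ∀ (j : ℤ) (F G : StepFn μ H),
      ‖flowForm (S j) {z | z.1 < z.2} F.val G.val‖ₑ ≤ C * 2 ^ (-2 * s * j) *
        ((lpSize x volume fun t => spSize y (F.val t)) *
          lpSize q' volume fun t => spSize p' (G.val t)))
    {f : ℝ → Lp H 2 μ} (hf : Integrable f) (hfm : StronglyMeasurable f) :
    (sqSum (fun j : ℤ => 2 ^ (j * s)) fun j => lpSize q volume fun t =>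
        spSize p (retarded (S j) f t)) ≤
      (C + 1) * (2 ^ (-s) + 1 + 2 ^ s) * sqSum (fun j : ℤ => 2 ^ (-(j * s)))
        fun j => lpSize x volume fun t => spSize y (S j 0 (f t)) := by
  set b : ℤ → ℝ≥0∞ := fun j => lpSize x volume fun t => spSize y (S j 0 (f t)) with hb
  have hx0 : 0 < x := by linarith
  have hm : ∀ j, Measurable fun t => spSize y (S j 0 (f t)) := fun j =>
    measurable_spSize_comp (by linarith) (IsFlow.stronglyMeasurable_apply 0 hfm)
  have hsingle : ∀ j : ℤ, 2 ^ (j * s) * lpSize q volume (fun t => spSize p (retarded (S j) f t)) ≤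
      2 ^ (-(j * s)) * ((C + 1) * (b (j - 1) + b j + b (j + 1))) := by
    intro j
    have h := hS.retarded_step (T := {j}) (C := C) (s := s) hx hy hy2 hp hpp hqq (fun F G => by
      simp only [sqComb_singleton, Finset.sum_singleton]
      rw [lpSize_const_mul hx0 (two_rpow_ne_top _),
        lpSize_const_mul hqq.symm.pos (two_rpow_ne_top _)]
      refine (hstep j (F j) (G j)).trans (le_of_eq ?_)
      rw [show -2 * s * j = -(j * s) + -(j * s) by ring, two_rpow_add]
      ring) hf hfm
    simp only [sqComb_singleton] at h
    rw [lpSize_const_mul hqq.pos (two_rpow_ne_top _), lpSize_const_mul hx0 (two_rpow_ne_top _)] at h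
    refine h.trans ?_
    rw [mul_left_comm]
    gcongr
    refine (lpSize_mono hx0 _ fun t => (spSize_add_le hy _ _).trans
      (add_le_add_left (spSize_add_le hy _ _) _)).trans ?_
    refine (lpSize_add_le hx ((hm (j - 1)).add (hm j)).aemeasurable (hm (j + 1)).aemeasurable).trans ?_
    exact add_le_add_left (lpSize_add_le hx (hm (j - 1)).aemeasurable (hm j).aemeasurable) _
  calc _ ≤ sqSum (fun j : ℤ => (2 : ℝ≥0∞) ^ (-(j * s)))
        (fun j => (C + 1) * (b (j - 1) + b j + b (j + 1))) := by
        refine ENNReal.rpow_le_rpow (ENNReal.tsum_le_tsum fun j => ?_) (by norm_num)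
        exact pow_le_pow_left' (hsingle j) 2
    _ ≤ _ := by
        rw [sqSum_const_mul, mul_assoc]
        exact mul_le_mul_right (sqSum_neighbors_le s b) _

end Assembly

/-! ### The estimates for forcing terms -/

section Norms

variable {n : ℕ} {ψ : Cutoff n} {H : Type*} [NormedAddCommGroup H] [InnerProductSpace ℂ H]
  (Z : RangeSpaces n ψ H)

theorem eLpNorm_ofReal_eq_lpSize {Ω : Type*} [MeasurableSpace Ω] {ν : Measure Ω} {q : ℝ}
    (hq : 0 < q) (f : Ω → ℝ≥0∞) : eLpNorm f (ENNReal.ofReal q) ν = lpSize q ν f := by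
  rw [eLpNorm_eq_lintegral_rpow_enorm_toReal (by simpa using hq) ENNReal.ofReal_ne_top,
    ENNReal.toReal_ofReal hq.le]
  rfl

theorem tsum_dyadic_eq_sqSum (s : ℝ) (c : ℝ≥0∞) (b : ℤ → ℝ≥0∞) :
    (∑' j : ℤ, ENNReal.ofReal (dyadic j ^ (2 * s)) * (c * b j) ^ 2) ^ (1 / 2 : ℝ) =
      c * sqSum (fun j : ℤ => 2 ^ (j * s)) b := by
  rw [← sqSum_const_mul, sqSum]
  congr 1
  refine tsum_congr fun j => ?_
  rw [ofReal_dyadic_rpow, mul_pow (2 ^ (j * s) : ℝ≥0∞), sq ((2 : ℝ≥0∞) ^ (j * s)), ← two_rpow_add]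
  congr 2
  ring

theorem RangeSpaces.zsNorm_eq (s : ℝ) {p : ℝ} [Fact (1 ≤ ENNReal.ofReal p)] (hp : 0 < p)
    {T : 𝓢'(Sp n, ℂ)} {g : ℤ → Lp H 2 (radialMeasure n)}
    (h : ∀ j, freqLoc ψ (dyadic j) T = toDist (Z.isom (g j))) :
    Z.zsNorm s (ENNReal.ofReal p) T = ENNReal.ofReal Z.normFactor⁻¹ *
      sqSum (fun j : ℤ => 2 ^ (j * s)) fun j => spSize p (g j) := by
  rw [RangeSpaces.zsNorm]
  simp_rw [h, Z.zNorm_isom_ofReal hp]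
  exact tsum_dyadic_eq_sqSum s _ _

theorem RangeSpaces.tzsNorm_eq (s : ℝ) {p q : ℝ} [Fact (1 ≤ ENNReal.ofReal p)] (hp : 0 < p)
    (hq : 0 < q) {F : ℝ → L2 n} {g : ℤ → ℝ → Lp H 2 (radialMeasure n)}
    (h : ∀ᵐ t, ∀ j, freqLoc ψ (dyadic j) (toDist (F t)) = toDist (Z.isom (g j t))) :
    Z.tzsNorm s (ENNReal.ofReal q) (ENNReal.ofReal p) F = ENNReal.ofReal Z.normFactor⁻¹ *
      lpSize q volume fun t => sqSum (fun j : ℤ => 2 ^ (j * s)) fun j => spSize p (g j t) := by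
  rw [RangeSpaces.tzsNorm, ← lpSize_const_mul hq ENNReal.ofReal_ne_top, ← eLpNorm_ofReal_eq_lpSize hq]
  refine eLpNorm_congr_ae ?_
  filter_upwards [h] with t ht
  exact Z.zsNorm_eq s hp ht

theorem RangeSpaces.zspqNorm_eq (s : ℝ) {p q : ℝ} [Fact (1 ≤ ENNReal.ofReal p)] (hp : 0 < p)
    (hq : 0 < q) {F : ℝ → L2 n} {g : ℤ → ℝ → Lp H 2 (radialMeasure n)}
    (h : ∀ᵐ t, ∀ j, freqLoc ψ (dyadic j) (toDist (F t)) = toDist (Z.isom (g j t))) :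
    Z.zspqNorm s (ENNReal.ofReal p) (ENNReal.ofReal q) F = ENNReal.ofReal Z.normFactor⁻¹ *
      sqSum (fun j : ℤ => 2 ^ (j * s)) fun j => lpSize q volume fun t => spSize p (g j t) := by
  rw [RangeSpaces.zspqNorm, ← tsum_dyadic_eq_sqSum]
  congr 1
  refine tsum_congr fun j => ?_
  congr 2
  rw [RangeSpaces.tzNorm, ← lpSize_const_mul hq ENNReal.ofReal_ne_top,
    ← eLpNorm_ofReal_eq_lpSize hq]
  refine eLpNorm_congr_ae ?_
  filter_upwards [h] with t ht
  rw [ht j, Z.zNorm_isom_ofReal hp]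

variable [CompleteSpace H] {Z} {a σ' : ℝ}

/-- A forcing term comes from an integrable function with values in the model of `Z_2`. -/
theorem RangeSpaces.IsSource.exists_lift {F : ℝ → L2 n} (hF : Z.IsSource F) :
    ∃ f : ℝ → Lp H 2 (radialMeasure n), Integrable f ∧ StronglyMeasurable f ∧
      ∀ᵐ t, Z.isom (f t) = F t := by
  have h1 : Integrable fun t => Z.isom.toContinuousLinearMap.adjoint (F t) :=
    Z.isom.toContinuousLinearMap.adjoint.integrable_comp hF.1
  refine ⟨h1.1.mk _, h1.congr h1.1.ae_eq_mk, h1.1.stronglyMeasurable_mk, ?_⟩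
  filter_upwards [h1.1.ae_eq_mk, hF.2] with t h2 h3
  rw [← h2]
  exact Z.isom_adjoint ((Z.memTwo_iff _).1 h3)

theorem duhamel_congr {F G : ℝ → L2 n} (h : ∀ᵐ t, F t = G t) (t : ℝ) :
    duhamel a F t = duhamel a G t := by
  refine integral_congr_ae (ae_restrict_of_ae ?_)
  filter_upwards [h] with τ hτ
  rw [hτ]

/-- The localizations of the Duhamel integral and of the forcing term on the model of `Z_2`. -/
theorem AdmitsStrichartz.freqLoc_source (hS : AdmitsStrichartz Z a σ') {F : ℝ → L2 n}
    {f : ℝ → Lp H 2 (radialMeasure n)} (hf : Integrable f) (h : ∀ᵐ t, Z.isom (f t) = F t) :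
    (∀ᵐ t, ∀ j, freqLoc ψ (dyadic j) (toDist (duhamel a F t)) =
        toDist (Z.isom (retarded (Z.flow a j) f t))) ∧
      ∀ᵐ t, ∀ j, freqLoc ψ (dyadic j) (toDist (F t)) =
        toDist (Z.isom (Z.flow a j 0 (f t))) := by
  constructor
  · refine Filter.Eventually.of_forall fun t j => ?_
    rw [← duhamel_congr h t, hS.freqLoc_duhamel_isom j hf]
  · filter_upwards [h] with t ht j
    rw [← ht, freqLoc_toDist ψ a, hS.isom_flow]

variable [TopologicalSpace.SeparableSpace H]

instance separableSpace_radial : TopologicalSpace.SeparableSpace (Lp H 2 (radialMeasure n)) := by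
  have : Fact ((2 : ℝ≥0∞) ≠ ∞) := ⟨by norm_num⟩
  have h : SecondCountableTopology (Lp H 2 (radialMeasure n)) := inferInstance
  infer_instance

theorem IsDispersive.timeEstimate {σ : ℝ} (hI : IsDispersive (Z.flow a) n a σ σ')
    (hS : AdmitsStrichartz Z a σ') {x y p q p' q' s : ℝ} [Fact (1 ≤ ENNReal.ofReal p)]
    [Fact (1 ≤ ENNReal.ofReal y)]
    (hx : 1 ≤ x) (hy : 1 ≤ y) (hy2 : y ≤ 2) (hp : 2 < p) (hpp : p.HolderConjugate p')
    (hqq : q.HolderConjugate q') {C : ℝ≥0}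
    (hstep : ∀ (T : Finset ℤ) (F G : ℤ → StepFn (radialMeasure n) H),
      ‖∑ j ∈ T, flowForm (Z.flow a j) {z | z.1 < z.2} (F j).val (G j).val‖ₑ ≤
        C * ((lpSize x volume fun t => sqComb T (fun j => 2 ^ (-(j * s)))
            fun j => spSize y ((F j).val t)) *
          lpSize q' volume fun t => sqComb T (fun j => 2 ^ (-(j * s)))
            fun j => spSize p' ((G j).val t))) :
    TimeEstimate Z a s (ENNReal.ofReal q) (ENNReal.ofReal p) (ENNReal.ofReal x)
      (ENNReal.ofReal y) := by
  have hc : ((C : ℝ≥0∞) + 1) * (2 ^ (-s) + 1 + 2 ^ s) ≠ ∞ := by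
    have h1 := two_rpow_ne_top (-s)
    have h2 := two_rpow_ne_top s
    finiteness
  refine ⟨(((C : ℝ≥0∞) + 1) * (2 ^ (-s) + 1 + 2 ^ s)).toNNReal, fun F hF => ?_⟩
  obtain ⟨f, hf, hfm, hfF⟩ := hF.exists_lift
  obtain ⟨h1, h2⟩ := hS.freqLoc_source hf hfF
  rw [Z.tzsNorm_eq s (by linarith) hqq.pos h1, Z.tzsNorm_eq (-s) (by linarith) (by linarith) h2,
    ENNReal.coe_toNNReal hc, mul_left_comm]
  simp_rw [mul_neg]
  gcongr
  exact hI.lpSize_sqSum_retarded_le hx hy hy2 hp hpp hqq hstep hf hfm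

theorem IsDispersive.freqEstimate {σ : ℝ} (hI : IsDispersive (Z.flow a) n a σ σ')
    (hS : AdmitsStrichartz Z a σ') {x y p q p' q' s : ℝ} [Fact (1 ≤ ENNReal.ofReal p)]
    [Fact (1 ≤ ENNReal.ofReal y)]
    (hx : 1 ≤ x) (hy : 1 ≤ y) (hy2 : y ≤ 2) (hp : 2 < p) (hpp : p.HolderConjugate p')
    (hqq : q.HolderConjugate q') {C : ℝ≥0}
    (hstep : ∀ (j : ℤ) (F G : StepFn (radialMeasure n) H),
      ‖flowForm (Z.flow a j) {z | z.1 < z.2} F.val G.val‖ₑ ≤ C * 2 ^ (-2 * s * j) *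
        ((lpSize x volume fun t => spSize y (F.val t)) *
          lpSize q' volume fun t => spSize p' (G.val t))) :
    FreqEstimate Z a s (ENNReal.ofReal q) (ENNReal.ofReal p) (ENNReal.ofReal x)
      (ENNReal.ofReal y) := by
  have hc : ((C : ℝ≥0∞) + 1) * (2 ^ (-s) + 1 + 2 ^ s) ≠ ∞ := by
    have h1 := two_rpow_ne_top (-s)
    have h2 := two_rpow_ne_top s
    finiteness
  refine ⟨(((C : ℝ≥0∞) + 1) * (2 ^ (-s) + 1 + 2 ^ s)).toNNReal, fun F hF => ?_⟩
  obtain ⟨f, hf, hfm, hfF⟩ := hF.exists_lift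
  obtain ⟨h1, h2⟩ := hS.freqLoc_source hf hfF
  rw [Z.zspqNorm_eq s (by linarith) hqq.pos h1, Z.zspqNorm_eq (-s) (by linarith) (by linarith) h2,
    ENNReal.coe_toNNReal hc, mul_left_comm]
  simp_rw [mul_neg]
  gcongr
  exact hI.sqSum_lpSize_retarded_le hx hy hy2 hp hpp hqq hstep hf hfm

end Norms

/-! ### Exponents -/

theorem recip_ofReal {p : ℝ} (hp : 0 ≤ p) : recip (ENNReal.ofReal p) = 1 / p := by
  rw [recip, ENNReal.toReal_inv, ENNReal.toReal_ofReal hp, one_div]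

theorem exists_ofReal_of_ne_top {p : ℝ≥0∞} (hp : 1 ≤ p) (hp' : p ≠ ∞) :
    ∃ P : ℝ, 1 ≤ P ∧ p = ENNReal.ofReal P := by
  refine ⟨p.toReal, ?_, (ENNReal.ofReal_toReal hp').symm⟩
  rw [← ENNReal.toReal_one]
  exact ENNReal.toReal_mono hp' hp

theorem eq_ofReal_of_holderConjugate {p p' : ℝ≥0∞} [h : p.HolderConjugate p'] {P : ℝ} (hP : 1 < P)
    (hp : p = ENNReal.ofReal P) : p' = ENNReal.ofReal (1 - 1 / P)⁻¹ := by
  have h1 := ENNReal.HolderConjugate.inv_add_inv_eq_one p p'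
  have hP0 : 0 < P := by linarith
  have hlt : 0 < 1 - 1 / P := by
    rw [sub_pos, div_lt_one hP0]; exact hP
  rw [hp, ← ENNReal.ofReal_inv_of_pos hP0] at h1
  have h2 : p'⁻¹ = ENNReal.ofReal (1 - 1 / P) := by
    refine (ENNReal.add_right_inj (ENNReal.ofReal_ne_top (r := P⁻¹))).1 ?_
    rw [h1, ← ENNReal.ofReal_add (by positivity) hlt.le, one_div]
    simp
  rw [ENNReal.ofReal_inv_of_pos hlt, ← h2, inv_inv]

/-- The definition of `μ` and the scaling condition determine the time exponents. -/
theorem add_eq_of_muParam {n a σ σ₁ σ₂ α αt Q Qt s μ : ℝ} (ha : 0 < a)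
    (hμ : μ = (a / 2 * (σ₁ / 2 + σ₂ / 2 - σ)) /
      (s - (a * σ - n) / 2 + ((a * σ₁ - n) * α + (a * σ₂ - n) * αt) / 2))
    (hμ0 : 0 < μ) (hβ : Q + Qt - n / a * (1 - α - αt) - 2 * s / a = 0) :
    Q + Qt = σ * (1 - 1 / μ) + σ₁ * (1 / μ / 2 - α) + σ₂ * (1 / μ / 2 - αt) := by
  have hs : 2 * s = a * (Q + Qt) - n * (1 - α - αt) := by
    field_simp at hβ
    linarith
  set d := s - (a * σ - n) / 2 + ((a * σ₁ - n) * α + (a * σ₂ - n) * αt) / 2 with hd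
  have hd' : d = a / 2 * (Q + Qt - σ + σ₁ * α + σ₂ * αt) := by
    rw [hd]; linear_combination hs / 2
  have hd0 : d ≠ 0 := by
    intro h
    rw [h, div_zero] at hμ
    exact hμ0.ne' hμ
  have h3 : μ * d = a / 2 * (σ₁ / 2 + σ₂ / 2 - σ) := by
    rw [hμ, div_mul_cancel₀ _ hd0]
  rw [hd'] at h3
  have h4 : μ * (Q + Qt - σ + σ₁ * α + σ₂ * αt) = σ₁ / 2 + σ₂ / 2 - σ := by
    have : a / 2 * (μ * (Q + Qt - σ + σ₁ * α + σ₂ * αt) - (σ₁ / 2 + σ₂ / 2 - σ)) = 0 := by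
      linear_combination h3
    rcases mul_eq_zero.1 this with h | h
    · linarith
    · linarith
  have h5 : Q + Qt - σ + σ₁ * α + σ₂ * αt = (σ₁ / 2 + σ₂ / 2 - σ) * (1 / μ) := by
    rw [← h4]; field_simp
  linear_combination h5

/-- The total power of the frequency in the estimates, which is `-2 s` by the scaling condition. -/
theorem scaling_eq_of_add_eq {n a σ θ Q Qt α αt ω ωt s : ℝ} (ha : 0 < a)
    (h : Q + Qt = σ * θ + ω + ωt) (hβ : Q + Qt - n / a * (1 - α - αt) - 2 * s / a = 0) :
    n - n * (α + αt) - a * (ω + ωt) - a * (σ * θ) = -2 * s := by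
  have h' : a * (Q + Qt) - n * (1 - α - αt) - 2 * s = 0 := by
    rw [← mul_zero a, ← hβ]; field_simp
  linear_combination a * h - h'

theorem ofReal_mul_half {c p : ℝ} (hc : 0 ≤ c) :
    ENNReal.ofReal c * (ENNReal.ofReal p / 2) = ENNReal.ofReal (c * (p / 2)) := by
  rw [ENNReal.ofReal_mul hc, ENNReal.ofReal_div_of_pos two_pos, ENNReal.ofReal_ofNat]

theorem ofReal_half_div {σ q p : ℝ} (hσ : 0 < σ) (hq : 0 < q) (hp : 0 < p) :
    ENNReal.ofReal (σ / 2) / (1 / ENNReal.ofReal q + ENNReal.ofReal σ / ENNReal.ofReal p) =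
      ENNReal.ofReal (σ / 2 / (1 / q + σ / p)) := by
  have h : 0 < 1 / q + σ / p := by positivity
  rw [ENNReal.ofReal_div_of_pos h, ENNReal.ofReal_add (by positivity) (by positivity),
    ENNReal.ofReal_div_of_pos hq, ENNReal.ofReal_div_of_pos hp, ENNReal.ofReal_one]

/-- The lower bounds of `μ` say that `ω ≤ 1 / (2 μ)` for `ω = σ (1 / (2 μ) - 1 / p)`. -/
theorem decay_le_iff {σ p μ : ℝ} (hσ : 0 < σ) (hp : 0 < p) (hμ : 0 < μ) :
    (σ - 1) / σ * (p / 2) ≤ μ ↔ σ * (1 / μ / 2 - 1 / p) ≤ 1 / μ / 2 := by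
  rw [← sub_nonneg, ← sub_nonneg (b := σ * (1 / μ / 2 - 1 / p))]
  have h : 1 / μ / 2 - σ * (1 / μ / 2 - 1 / p) = (μ - (σ - 1) / σ * (p / 2)) * (σ / (μ * p)) := by
    field_simp
    ring
  rw [h, mul_nonneg_iff_of_pos_right (by positivity)]

theorem decay_lt_iff {σ p μ : ℝ} (hσ : 0 < σ) (hp : 0 < p) (hμ : 0 < μ) :
    (σ - 1) / σ * (p / 2) < μ ↔ σ * (1 / μ / 2 - 1 / p) < 1 / μ / 2 := by
  rw [← sub_pos, ← sub_pos (b := σ * (1 / μ / 2 - 1 / p))]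
  have h : 1 / μ / 2 - σ * (1 / μ / 2 - 1 / p) = (μ - (σ - 1) / σ * (p / 2)) * (σ / (μ * p)) := by
    field_simp
    ring
  rw [h, mul_pos_iff_of_pos_right (by positivity)]

/-- The last lower bounds of `μ` say that `σ (1 / (2 μ) - 1 / p) < 1 / q`. -/
theorem time_lt_iff {σ p q μ : ℝ} (hσ : 0 < σ) (hp : 0 < p) (hq : 0 < q) (hμ : 0 < μ) :
    σ / 2 / (1 / q + σ / p) < μ ↔ σ * (1 / μ / 2 - 1 / p) < 1 / q := by
  have h0 : 0 < 1 / q + σ / p := by positivity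
  rw [div_lt_iff₀ h0, ← sub_pos, ← sub_pos (b := σ * (1 / μ / 2 - 1 / p))]
  have h : 1 / q - σ * (1 / μ / 2 - 1 / p) = (μ * (1 / q + σ / p) - σ / 2) * (1 / μ) := by
    field_simp
    ring
  rw [h, mul_pos_iff_of_pos_right (by positivity)]

/-! ### The non-sharp and the sharp case -/

theorem holderConjugate_inv {p : ℝ} (hp : 1 < p) : p.HolderConjugate (1 - 1 / p)⁻¹ := by
  rw [Real.holderConjugate_iff]
  refine ⟨hp, ?_⟩
  rw [inv_inv, one_div]
  ring

theorem one_le_inv_sub {p : ℝ} (hp : 1 < p) : 1 ≤ (1 - 1 / p)⁻¹ :=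
  (holderConjugate_inv hp).symm.lt.le

theorem inv_sub_le_two {p : ℝ} (hp : 2 ≤ p) : (1 - 1 / p)⁻¹ ≤ 2 := by
  have h : 1 / p ≤ 1 / 2 := one_div_le_one_div_of_le (by norm_num) hp
  rw [show (2 : ℝ) = (1 / 2)⁻¹ by norm_num]
  exact inv_anti₀ (by norm_num) (by linarith)

/-- The lower bounds of `μ` force `p` to be finite. -/
theorem ne_top_of_mul_half_le {σ μ : ℝ} (hσ : 1 < σ) {p : ℝ≥0∞}
    (h : ENNReal.ofReal ((σ - 1) / σ) * (p / 2) ≤ ENNReal.ofReal μ) : p ≠ ∞ := by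
  rintro rfl
  rw [ENNReal.top_div_of_ne_top (by norm_num), ENNReal.mul_top] at h
  · exact ENNReal.ofReal_ne_top (top_le_iff.1 h)
  · rw [ne_eq, ENNReal.ofReal_eq_zero, not_le]
    exact div_pos (by linarith) (by linarith)

theorem one_div_ofReal_add {q qt : ℝ} (hq : 0 < q) (hqt : 0 < qt) :
    1 / ENNReal.ofReal q + 1 / ENNReal.ofReal qt = ENNReal.ofReal (1 / q + 1 / qt) := by
  rw [ENNReal.ofReal_add (by positivity) (by positivity), ENNReal.ofReal_div_of_pos hq,
    ENNReal.ofReal_div_of_pos hqt, ENNReal.ofReal_one]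

theorem ofReal_le_half_iff {μ p : ℝ} (hp : 0 < p) :
    ENNReal.ofReal μ ≤ ENNReal.ofReal p / 2 ↔ μ ≤ p / 2 := by
  rw [← ENNReal.ofReal_ofNat 2, ← ENNReal.ofReal_div_of_pos two_pos,
    ENNReal.ofReal_le_ofReal_iff (by positivity)]

theorem ofReal_lt_half_iff {μ p : ℝ} (hp : 0 < p) :
    ENNReal.ofReal μ < ENNReal.ofReal p / 2 ↔ μ < p / 2 := by
  rw [← ENNReal.ofReal_ofNat 2, ← ENNReal.ofReal_div_of_pos two_pos,
    ENNReal.ofReal_lt_ofReal_iff (by positivity)]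

theorem one_div_le_of_le_half {μ p : ℝ} (hμ : 0 < μ) (h : μ ≤ p / 2) : 1 / p ≤ 1 / μ / 2 := by
  rw [div_div]
  exact one_div_le_one_div_of_le (by positivity) (by linarith)

theorem one_div_lt_of_lt_half {μ p : ℝ} (hμ : 0 < μ) (h : μ < p / 2) : 1 / p < 1 / μ / 2 := by
  rw [div_div]
  exact one_div_lt_one_div_of_lt (by positivity) (by linarith)

section Cases

variable {n : ℕ} {ψ : Cutoff n} {H : Type*} [NormedAddCommGroup H] [InnerProductSpace ℂ H]
  [CompleteSpace H] [TopologicalSpace.SeparableSpace H] {Z : RangeSpaces n ψ H} {a σ' : ℝ}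

theorem AdmitsStrichartz.nonsharp_estimates (hS : AdmitsStrichartz Z a σ')
    (hD : AdmitsDispersive Z a) (ha : 1 ≤ a) (p q pt qt pt' qt' : ℝ≥0∞) [h1p : Fact (1 ≤ p)]
    [h1q : Fact (1 ≤ q)] [h1pt : Fact (1 ≤ pt)] [h1qt : Fact (1 ≤ qt)] [Fact (1 ≤ pt')]
    [pt.HolderConjugate pt'] [qt.HolderConjugate qt'] {s : ℝ}
    (hβ : scalingBeta n a q qt p pt s = 0) (hqq : 1 / q + 1 / qt < 1) (hq : q ≠ ∞) (hqt : qt ≠ ∞)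
    {σ₁ σ₂ : ℝ} (h₁ : σ₁ ∈ Set.Ioo (decayParameter a n) σ')
    (h₂ : σ₂ ∈ Set.Ioo (decayParameter a n) σ') (hc : NonsharpCondition n a q qt p pt s σ₁ σ₂) :
    TimeEstimate Z a s q p qt' pt' ∧ FreqEstimate Z a s q p qt' pt' := by
  obtain ⟨c1, c2, c3, c4, c5, c6, c7⟩ := hc
  have hσ := hS.1
  have ha0 : 0 < a := by linarith
  have hσ₁ : 1 < σ₁ := hσ.trans_lt h₁.1
  have hσ₂ : 1 < σ₂ := hσ.trans_lt h₂.1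
  obtain ⟨P, hP1, hP⟩ := exists_ofReal_of_ne_top h1p.out (ne_top_of_mul_half_le hσ₁ c2)
  obtain ⟨Pt, hPt1, hPt⟩ := exists_ofReal_of_ne_top h1pt.out (ne_top_of_mul_half_le hσ₂ c4)
  obtain ⟨Q, hQ1, hQ⟩ := exists_ofReal_of_ne_top h1q.out hq
  obtain ⟨Qt, hQt1, hQt⟩ := exists_ofReal_of_ne_top h1qt.out hqt
  have hP0 : 0 < P := by linarith
  have hPt0 : 0 < Pt := by linarith
  have hQ0 : 0 < Q := by linarith
  have hQt0 : 0 < Qt := by linarith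
  obtain ⟨μ, hμ⟩ : ∃ μ, μ = muParam n a p pt s σ₁ σ₂ := ⟨_, rfl⟩
  rw [← hμ] at c1 c2 c3 c4 c5 c6 c7
  have hμ0 : 0 < μ := by linarith
  rw [muParam, hP, hPt, recip_ofReal hP0.le, recip_ofReal hPt0.le] at hμ
  rw [scalingBeta, hP, hPt, hQ, hQt, recip_ofReal hP0.le, recip_ofReal hPt0.le,
    recip_ofReal hQ0.le, recip_ofReal hQt0.le] at hβ
  rw [hP, ofReal_mul_half (div_nonneg (by linarith) (by linarith)),
    ENNReal.ofReal_le_ofReal_iff hμ0.le, decay_le_iff (by linarith) hP0 hμ0] at c2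
  rw [hPt, ofReal_mul_half (div_nonneg (by linarith) (by linarith)),
    ENNReal.ofReal_le_ofReal_iff hμ0.le, decay_le_iff (by linarith) hPt0 hμ0] at c4
  rw [hP, ofReal_le_half_iff hP0] at c3
  rw [hPt, ofReal_le_half_iff hPt0] at c5
  rw [hP, hQ, ofReal_half_div (by linarith) hQ0 hP0, ENNReal.ofReal_lt_ofReal_iff hμ0,
    time_lt_iff (by linarith) hP0 hQ0 hμ0] at c6
  rw [hPt, hQt, ofReal_half_div (by linarith) hQt0 hPt0, ENNReal.ofReal_lt_ofReal_iff hμ0,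
    time_lt_iff (by linarith) hPt0 hQt0 hμ0] at c7
  rw [hQ, hQt, one_div_ofReal_add hQ0 hQt0, ENNReal.ofReal_lt_one] at hqq
  have hadd := add_eq_of_muParam ha0 hμ hμ0 hβ
  have iQ : 0 < 1 / Q := by positivity
  have iQt : 0 < 1 / Qt := by positivity
  have hQ1' : 1 < Q := by
    rw [← div_lt_one hQ0]; linarith
  have hQt1' : 1 < Qt := by
    rw [← div_lt_one hQt0]; linarith
  -- for `μ = 1` the conditions contradict the scaling condition
  have hμ1 : 1 < μ := by
    rcases c1.lt_or_eq with h | h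
    · exact h
    · rw [← h] at hadd c6 c7
      norm_num at hadd c6 c7
      linarith
  have hθ : 1 / μ < 1 := by rw [div_lt_one hμ0]; exact hμ1
  have hθ' : 0 < 1 / μ := by positivity
  have c3' := one_div_le_of_le_half hμ0 c3
  have c5' := one_div_le_of_le_half hμ0 c5
  have e : ((1 : ℝ) - (1 - 1 / μ)) / 2 = 1 / μ / 2 := by ring
  have hP2 : 2 < P := by linarith
  have hPt2 : 2 < Pt := by linarith
  have hI := hD.isDispersive hS ha
  have hs := scaling_eq_of_add_eq ha0 hadd hβ
  -- the interpolation weight is `θ = 1 - 1 / μ`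
  obtain ⟨C, hC⟩ := hI.exists_nonsharp (θ := 1 - 1 / μ) (α := 1 / P) (αt := 1 / Pt)
    (Q := 1 / Q) (Qt := 1 / Qt) (y := (1 - 1 / Pt)⁻¹) (v := (1 - 1 / P)⁻¹)
    (X₀ := (1 - 1 / Qt)⁻¹) (Y₀ := (1 - 1 / Q)⁻¹) (s := s) h₁ h₂ (by linarith) (by linarith)
    (by linarith) (by positivity) (by rw [e]; exact c3') (by rw [e]) (by rw [e]; exact c2)
    (by positivity) (by rw [e]; exact c5') (by rw [e]) (by rw [e]; exact c4)
    (by rw [one_div, inv_inv]) (by rw [one_div, inv_inv]) (by rw [one_div, inv_inv])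
    (by rw [one_div, inv_inv]) c6 c7 (by rw [div_lt_one hQ0]; exact hQ1')
    (by rw [div_lt_one hQt0]; exact hQt1') hqq hadd hs
  have hpt' := eq_ofReal_of_holderConjugate (p' := pt') (by linarith) hPt
  have hqt' := eq_ofReal_of_holderConjugate (p' := qt') hQt1' hQt
  subst hP hQ hpt' hqt'
  refine ⟨hI.timeEstimate hS (one_le_inv_sub hQt1') (one_le_inv_sub (by linarith))
    (inv_sub_le_two hPt2.le) hP2 (holderConjugate_inv (by linarith))
    (holderConjugate_inv hQ1') hC, ?_⟩
  refine hI.freqEstimate hS (one_le_inv_sub hQt1') (one_le_inv_sub (by linarith))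
    (inv_sub_le_two hPt2.le) hP2 (holderConjugate_inv (by linarith))
    (holderConjugate_inv hQ1') (C := C) fun j F G => ?_
  have h := hC {j} (fun _ => F) fun _ => G
  simp only [sqComb_singleton, Finset.sum_singleton] at h
  rw [lpSize_const_mul (holderConjugate_inv hQt1').symm.pos (two_rpow_ne_top _),
    lpSize_const_mul (holderConjugate_inv hQ1').symm.pos (two_rpow_ne_top _)] at h
  refine h.trans (le_of_eq ?_)
  rw [show -2 * s * j = -(j * s) + -(j * s) by ring, two_rpow_add]
  ring

theorem AdmitsStrichartz.sharp_estimate (hS : AdmitsStrichartz Z a σ')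
    (hD : AdmitsDispersive Z a) (ha : 1 ≤ a) (p q pt qt pt' qt' : ℝ≥0∞) [h1p : Fact (1 ≤ p)]
    [h1q : Fact (1 ≤ q)] [h1pt : Fact (1 ≤ pt)] [h1qt : Fact (1 ≤ qt)] [Fact (1 ≤ pt')]
    [pt.HolderConjugate pt'] [qt.HolderConjugate qt'] {s : ℝ}
    (hβ : scalingBeta n a q qt p pt s = 0) (hqq : 1 / q + 1 / qt = 1) (hp : p ≠ ∞) (hpt : pt ≠ ∞)
    {σ₁ σ₂ : ℝ} (h₁ : σ₁ ∈ Set.Ioo (decayParameter a n) σ')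
    (h₂ : σ₂ ∈ Set.Ioo (decayParameter a n) σ') (hc : SharpCondition n a q qt p pt s σ₁ σ₂) :
    FreqEstimate Z a s q p qt' pt' := by
  obtain ⟨c1, c2, c3, c4, c5, c6, c7, c8, c9⟩ := hc
  have hσ := hS.1
  have ha0 : 0 < a := by linarith
  have hσ₁ : 1 < σ₁ := hσ.trans_lt h₁.1
  have hσ₂ : 1 < σ₂ := hσ.trans_lt h₂.1
  obtain ⟨P, hP1, hP⟩ := exists_ofReal_of_ne_top h1p.out hp
  obtain ⟨Pt, hPt1, hPt⟩ := exists_ofReal_of_ne_top h1pt.out hpt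
  have hne : ∀ {p q : ℝ≥0∞}, p ≠ ∞ → 1 / p ≤ 1 / q → q ≠ ∞ := by
    rintro p q hp h rfl
    rw [ENNReal.div_top, le_zero_iff, ENNReal.div_eq_zero_iff] at h
    rcases h with h | h
    · exact one_ne_zero h
    · exact hp h
  obtain ⟨Q, hQ1, hQ⟩ := exists_ofReal_of_ne_top h1q.out (hne hp c8)
  obtain ⟨Qt, hQt1, hQt⟩ := exists_ofReal_of_ne_top h1qt.out (hne hpt c9)
  have hP0 : 0 < P := by linarith
  have hPt0 : 0 < Pt := by linarith
  have hQ0 : 0 < Q := by linarith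
  have hQt0 : 0 < Qt := by linarith
  obtain ⟨μ, hμ⟩ : ∃ μ, μ = muParam n a p pt s σ₁ σ₂ := ⟨_, rfl⟩
  rw [← hμ] at c1 c2 c3 c4 c5 c6 c7
  have hμ0 : 0 < μ := by linarith
  rw [muParam, hP, hPt, recip_ofReal hP0.le, recip_ofReal hPt0.le] at hμ
  rw [scalingBeta, hP, hPt, hQ, hQt, recip_ofReal hP0.le, recip_ofReal hPt0.le,
    recip_ofReal hQ0.le, recip_ofReal hQt0.le] at hβ
  rw [hP, ofReal_mul_half (div_nonneg (by linarith) (by linarith)),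
    ENNReal.ofReal_lt_ofReal_iff hμ0, decay_lt_iff (by linarith) hP0 hμ0] at c2
  rw [hPt, ofReal_mul_half (div_nonneg (by linarith) (by linarith)),
    ENNReal.ofReal_lt_ofReal_iff hμ0, decay_lt_iff (by linarith) hPt0 hμ0] at c4
  rw [hP, ofReal_lt_half_iff hP0] at c3
  rw [hPt, ofReal_lt_half_iff hPt0] at c5
  rw [hP, hQ, ofReal_half_div (by linarith) hQ0 hP0, ENNReal.ofReal_lt_ofReal_iff hμ0,
    time_lt_iff (by linarith) hP0 hQ0 hμ0] at c6
  rw [hPt, hQt, ofReal_half_div (by linarith) hQt0 hPt0, ENNReal.ofReal_lt_ofReal_iff hμ0,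
    time_lt_iff (by linarith) hPt0 hQt0 hμ0] at c7
  rw [hQ, hQt, one_div_ofReal_add hQ0 hQt0, ENNReal.ofReal_eq_one] at hqq
  have hle : ∀ {p q : ℝ}, 0 < p → 0 < q → 1 / ENNReal.ofReal p ≤ 1 / ENNReal.ofReal q →
      1 / p ≤ 1 / q := by
    intro p q hp hq h
    rw [one_div, one_div, ENNReal.inv_le_inv, ENNReal.ofReal_le_ofReal_iff hp.le] at h
    exact one_div_le_one_div_of_le hq h
  rw [hP, hQ] at c8
  rw [hPt, hQt] at c9
  have hadd := add_eq_of_muParam ha0 hμ hμ0 hβ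
  have iQ : 0 < 1 / Q := by positivity
  have iQt : 0 < 1 / Qt := by positivity
  have hQ1' : 1 < Q := by
    rw [← div_lt_one hQ0]; linarith
  have hQt1' : 1 < Qt := by
    rw [← div_lt_one hQt0]; linarith
  have hθ : 1 / μ < 1 := by rw [div_lt_one hμ0]; exact c1
  have hθ' : 0 < 1 / μ := by positivity
  have c3' := one_div_lt_of_lt_half hμ0 c3
  have c5' := one_div_lt_of_lt_half hμ0 c5
  have e : ((1 : ℝ) - (1 - 1 / μ)) / 2 = 1 / μ / 2 := by ring
  have hP2 : 2 < P := by linarith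
  have hPt2 : 2 < Pt := by linarith
  have hI := hD.isDispersive hS ha
  have hs := scaling_eq_of_add_eq ha0 hadd hβ
  -- the interpolation weight is `θ = 1 - 1 / μ`
  obtain ⟨C, hC⟩ := hI.exists_sharp (θ := 1 - 1 / μ) (α := 1 / P) (αt := 1 / Pt)
    (Q := 1 / Q) (Qt := 1 / Qt) (y := (1 - 1 / Pt)⁻¹) (v := (1 - 1 / P)⁻¹)
    (X₀ := (1 - 1 / Qt)⁻¹) (Y₀ := (1 - 1 / Q)⁻¹) (s := s) h₁ h₂ (by linarith) (by linarith)
    (by linarith) (by positivity) (by rw [e]; exact c3') (by rw [e]) (by rw [e]; exact c2)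
    (by positivity) (by rw [e]; exact c5') (by rw [e]) (by rw [e]; exact c4)
    (by rw [one_div, inv_inv]) (by rw [one_div, inv_inv]) (by rw [one_div, inv_inv])
    (by rw [one_div, inv_inv]) c6 c7 (by rw [div_lt_one hQ0]; exact hQ1')
    (by rw [div_lt_one hQt0]; exact hQt1') hqq (hle hP0 hQ0 c8) (hle hPt0 hQt0 c9) hadd hs
  have hpt' := eq_ofReal_of_holderConjugate (p' := pt') (by linarith) hPt
  have hqt' := eq_ofReal_of_holderConjugate (p' := qt') hQt1' hQt
  subst hP hQ hpt' hqt'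
  exact hI.freqEstimate hS (one_le_inv_sub hQt1') (one_le_inv_sub (by linarith))
    (inv_sub_le_two hPt2.le) hP2 (holderConjugate_inv (by linarith))
    (holderConjugate_inv hQ1') (C := C) hC

end Cases

end

theorem theorem1 {n : ℕ} (ψ : Cutoff n)
    {H : Type*} [NormedAddCommGroup H] [InnerProductSpace ℂ H] [CompleteSpace H]
    [TopologicalSpace.SeparableSpace H]
    (Z : RangeSpaces n ψ H) (a σ' : ℝ) (ha : 1 ≤ a)
    (hS : AdmitsStrichartz Z a σ') (hD : AdmitsDispersive Z a)
    (p q pt qt pt' qt' : ℝ≥0∞) [Fact (1 ≤ p)] [Fact (1 ≤ q)] [Fact (1 ≤ pt)] [Fact (1 ≤ qt)]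
    [Fact (1 ≤ pt')] [pt.HolderConjugate pt'] [qt.HolderConjugate qt']
    (s : ℝ) (hβ : scalingBeta n a q qt p pt s = 0) :
    (1 / q + 1 / qt < 1 → q < ∞ → qt < ∞ →
      (∃ σ₁ ∈ Set.Ioo (decayParameter a n) σ', ∃ σ₂ ∈ Set.Ioo (decayParameter a n) σ',
        NonsharpCondition n a q qt p pt s σ₁ σ₂) →
      TimeEstimate Z a s q p qt' pt' ∧ FreqEstimate Z a s q p qt' pt') ∧
    (1 / q + 1 / qt = 1 → 2 < p → p < ∞ → 2 < pt → pt < ∞ →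
      (∃ σ₁ ∈ Set.Ioo (decayParameter a n) σ', ∃ σ₂ ∈ Set.Ioo (decayParameter a n) σ',
        SharpCondition n a q qt p pt s σ₁ σ₂) →
      FreqEstimate Z a s q p qt' pt') := by
  constructor
  · rintro h1 hq hqt ⟨σ₁, h₁, σ₂, h₂, hc⟩
    exact hS.nonsharp_estimates hD ha p q pt qt pt' qt' hβ h1 hq.ne hqt.ne h₁ h₂ hc
  · rintro h1 - hp - hpt ⟨σ₁, h₁, σ₂, h₂, hc⟩
    exact hS.sharp_estimate hD ha p q pt qt pt' qt' hβ h1 hp.ne hpt.ne h₁ h₂ hc
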